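/- **Setting.** For every value $\lambda\in\mathbb N$ of the security parameter let $(p,\mathbb G,\hat{\mathbb G},\mathbb G_T,e)$ be an asymmetric bilinear group: $\mathbb G,\hat{\mathbb G},\mathbb G_T$ are (multiplicative, cyclic) groups of prime order $p=p(\lambda)$ of bit size $\Theta(\lambda)$, their elements have injective binary encodings of length polynomial in $\lambda$, and $e:\mathbb G\times\hat{\mathbb G}\to\mathbb G_T$ satisfies $e(u^a,\hat v^b)=e(u,\hat v)^{ab}$ and is non-degenerate. Let the maximum depth $l=l(\lambda)$ be polynomially bounded. *PPT* means non-uniform probabilistic polynomial time: a family, indexed by $\lambda$, of straight-line programs (randomized circuits) of length polynomial in $\lambda$ over bits, elements of $\mathbb Z_p$ and elements of the three groups, where the following take one step: Boolean gates, coin flips, arithmetic and uniform sampling in $\mathbb Z_p$, the group operations, exponentiations and the pairing, equality tests, selection, and conversion between elements and their encodings. **Scheme.** A hierarchical identity of depth $m\le l$ is a vector $ID=(I_1,\dots,I_m)\in(\mathbb Z_p^*)^m$; messages are elements of $\mathbb G_T$. *Setup*: choose uniformly random $g\in\mathbb G$, $\hat g\in\hat{\mathbb G}$, $\nu,\phi_1,\phi_2,y_h,y_{u_1},\dots,y_{u_l},y_w,\alpha\in\mathbb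 Z_p$; put $\tau=\phi_1+\nu\phi_2$, $h=g^{y_h}$, $\hat h=\hat g^{y_h}$, $u_i=g^{y_{u_i}}$, $\hat u_i=\hat g^{y_{u_i}}$, $\hat w=\hat g^{y_w}$. The master key is $(\hat g,\hat g^\alpha,\hat h,\{\hat u_i\})$, and $$PP=\bigl(g,g^\nu,g^{-\tau},\;h,h^\nu,h^{-\tau},\;\{u_i,u_i^\nu,u_i^{-\tau}\}_{i=1}^l,\;W_1=\hat w^{\phi_1},W_2=\hat w^{\phi_2},W_3=\hat w,\;\Omega=e(g,\hat g)^\alpha\bigr).$$ *KeyGen* for $ID=(I_1,\dots,I_m)$: with $\hat F=\hat h\prod_{i=1}^m\hat u_i^{I_i}$ and independent uniform exponents $r_1,r_2,c_1,c_2,c_{3,i},c_4,c_5,c_{6,i}\in\mathbb Z_p$, output the triples $K_1=(\hat g^\alpha\hat F^{r_1}W_1^{c_1},W_2^{c_1},W_3^{c_1})$, $K_2=(\hat g^{r_1}W_1^{c_2},W_2^{c_2},W_3^{c_2})$, $L_i=(\hat u_i^{r_1}W_1^{c_{3,i}},W_2^{c_{3,i}},W_3^{c_{3,i}})$ for $m<i\le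 l$, $R_1=(\hat F^{r_2}W_1^{c_4},W_2^{c_4},W_3^{c_4})$, $R_2=(\hat g^{r_2}W_1^{c_5},W_2^{c_5},W_3^{c_5})$, $R_{3,i}=(\hat u_i^{r_2}W_1^{c_{6,i}},W_2^{c_{6,i}},W_3^{c_{6,i}})$ for $m<i\le l$. *Delegate* from $(I_1,\dots,I_m)$ to $(I_1,\dots,I_{m+1})$: with independent uniform $\gamma_1,\gamma_2,\delta_1,\delta_2,\delta_{3,i},\delta_4,\delta_5,\delta_{6,i}\in\mathbb Z_p$, output, for $k=1,2,3$ and $m+1<i\le l$, $K_{1,k}'=K_{1,k}L_{m+1,k}^{I_{m+1}}(R_{1,k}R_{3,m+1,k}^{I_{m+1}})^{\gamma_1}W_k^{\delta_1}$, $K_{2,k}'=K_{2,k}R_{2,k}^{\gamma_1}W_k^{\delta_2}$, $L_{i,k}'=L_{i,k}R_{3,i,k}^{\gamma_1}W_k^{\delta_{3,i}}$, $R_{1,k}'=(R_{1,k}R_{3,m+1,k}^{I_{m+1}})^{\gamma_2}W_k^{\delta_4}$, $R_{2,k}'=R_{2,k}^{\gamma_2}W_k^{\delta_5}$, $R_{3,i,k}'=R_{3,i,k}^{\gamma_2}W_k^{\delta_{6,i}}$.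 *Encrypt* $M$ for $ID=(I_1,\dots,I_n)$: choose a uniform $t\in\mathbb Z_p$ and output $C=\Omega^tM$, $C_1=(g^t,(g^\nu)^t,(g^{-\tau})^t)$ and $$C_2=\Bigl(\bigl(h\prod_{i=1}^n u_i^{I_i}\bigr)^t,\bigl(h^\nu\prod_{i=1}^n (u_i^\nu)^{I_i}\bigr)^t,\bigl(h^{-\tau}\prod_{i=1}^n (u_i^{-\tau})^{I_i}\bigr)^t\Bigr).$$ *Decrypt*: output $C\cdot\prod_{i=1}^3e(C_{1,i},K_{1,i})^{-1}\cdot\prod_{i=1}^3e(C_{2,i},K_{2,i})$. **Security experiment (chosen plaintext attack).** The adversary $\mathcal A$ gets $PP$. It may adaptively ask for private keys of identities $ID$ of arbitrary depths, generated by KeyGen. Once, it submits identities $ID_0^*,ID_1^*$ of equal depth and messages $M_0^*,M_1^*$, and gets an encryption of $M_\gamma^*$ for $ID_\gamma^*$, where $\gamma\in\{0,1\}$ is a uniform bit; after that it may ask for more keys. No $ID$ of a key query, before or after the challenge, may be a prefix of $ID_0^*$ or of $ID_1^*$; requests against the rules are ignored. Finally $\mathcal A$ outputs a guess $\gamma'$,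 and $\mathrm{Adv}^{AHIBE}_{\mathcal A}(\lambda)=|\Pr[\gamma=\gamma']-\tfrac12|$. The scheme is *fully secure* (anonymous and message hiding) under a chosen plaintext attack if $\mathrm{Adv}^{AHIBE}_{\mathcal A}$ is negligible for every PPT adversary $\mathcal A$. **Assumptions.** Let $g,\hat g$ be uniformly random generators of $\mathbb G,\hat{\mathbb G}$ and $a,b,c,d,x$ uniformly random in $\mathbb Z_p$. Each assumption gives data $D$ and a challenge $T\in\{T_0,T_1\}$; the advantage of an algorithm is $\mathrm{Adv}^{Ai}_{\mathcal B}(\lambda)=|\Pr[\mathcal B(D,T_0)=0]-\Pr[\mathcal B(D,T_1)=0]|$, and the assumption holds if it is negligible for every PPT $\mathcal B$. 1. (LW1) $D=(g,g^a,g^b,g^{ab^2},g^{b^2},g^{b^3},g^c,g^{ac},g^{bc},g^{b^2c},g^{b^3c},\hat g,\hat g^b)$, $T_0=g^{ab^2c}$, $T_1=g^d$. 2. (LW2) $D=(g,g^a,g^{a^2},g^{bx},g^{abx},g^{a^2x},\hat g,\hat g^a,\hat g^b,\hat g^c)$, $T_0=\hat g^{bc}$, $T_1=\hat g^d$. 3.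 (SXDH) $D=(g,\hat g,\hat g^a,\hat g^b)$, $T_0=\hat g^{ab}$, $T_1=\hat g^c$. 4. (DBDH) $D=(g,g^a,g^b,g^c,\hat g,\hat g^a,\hat g^b,\hat g^c)$, $T_0=e(g,\hat g)^{abc}$, $T_1=e(g,\hat g)^d$. 5. (Asymmetric 3-party DH) $D=(g,g^a,g^b,g^c,g^{ab},g^{a^2b},\hat g,\hat g^a,\hat g^b)$, $T_0=g^{abc}$, $T_1=g^d$. **Theorem.** For every PPT adversary $\mathcal A$ that gets at most $q=q(\lambda)$ private keys in every execution of the experiment there are PPT algorithms $\mathcal B_1,\dots,\mathcal B_5$ such that for all $\lambda$ $$\mathrm{Adv}^{AHIBE}_{\mathcal A}(\lambda)\le\mathrm{Adv}^{A1}_{\mathcal B_1}(\lambda)+q\bigl(\mathrm{Adv}^{A2}_{\mathcal B_2}(\lambda)+\mathrm{Adv}^{A3}_{\mathcal B_3}(\lambda)\bigr)+\mathrm{Adv}^{A4}_{\mathcal B_4}(\lambda)+\mathrm{Adv}^{A5}_{\mathcal B_5}(\lambda).$$ Consequently, if Assumptions 1-5 hold, the scheme is fully secure under a chosen plaintext attack.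 -/

import Mathlib

namespace AHIBE

/-! ## Asymmetric bilinear groups of prime order -/

/-- The three groups of a bilinear group: `left` is `𝔾`, `right` is `𝔾̂`, `target` is `𝔾_T`. -/
inductive GrpIdx
  | left
  | right
  | target
  deriving DecidableEq

/-- The description `(p, 𝔾, 𝔾̂, 𝔾_T, e)` of an asymmetric bilinear group of prime order `p`
(groups of prime order are cyclic), together with an injective binary encoding of the elements
of the three groups, which is what a machine can see of a group element. -/
structure BilinearGroup where
  p : ℕ
  prime : Fact p.Prime
  El : GrpIdx → Type
  group : ∀ k, CommGroup (El k)
  fintype : ∀ k, Fintype (El k)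
  card_el : ∀ k, Fintype.card (El k) = p
  e : El .left → El .right → El .target
  bilinear : ∀ (u : El .left) (v : El .right) (a b : ZMod p),
    e (u ^ a.val) (v ^ b.val) = e u v ^ (a * b).val
  nondegenerate : ∃ (g : El .left) (ĝ : El .right), orderOf (e g ĝ) = p
  encLen : ℕ
  enc : ∀ k, El k → Fin encLen → Bool
  enc_injective : ∀ k, Function.Injective (enc k)

attribute [instance] BilinearGroup.prime BilinearGroup.group BilinearGroup.fintype

abbrev BilinearGroup.G (B : BilinearGroup) : Type := B.El .left
abbrev BilinearGroup.Ghat (B : BilinearGroup) : Type := B.El .right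
abbrev BilinearGroup.GT (B : BilinearGroup) : Type := B.El .target

/-- Exponentiation of a group element by an exponent in `ℤ_p`. -/
instance (B : BilinearGroup) (k : GrpIdx) : Pow (B.El k) (ZMod B.p) := ⟨fun x a => x ^ a.val⟩

/-- `f` is bounded by a polynomial. -/
def PolyBounded (f : ℕ → ℕ) : Prop := ∃ P : Polynomial ℕ, ∀ n, f n ≤ P.eval n

/-- A family of bilinear groups indexed by the security parameter: the order has bit size
`Θ(n)` and group elements have encodings of polynomial length. -/
structure BilinearGroupFamily where
  grp : ℕ → BilinearGroup
  size_order : (fun n => (Nat.size (grp n).p : ℝ)) =Θ[Filter.atTop] (fun n => (n : ℝ))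
  encLen_poly : PolyBounded fun n => (grp n).encLen

/-! ## Sampling -/

/-- The uniform distribution on a finite type. -/
noncomputable abbrev unif (α : Type) [Fintype α] [Nonempty α] : PMF α := PMF.uniformOfFintype α

/-- The generators of one of the three groups. -/
abbrev BilinearGroup.Generator (B : BilinearGroup) (k : GrpIdx) : Type :=
  {x : B.El k // orderOf x = B.p}

noncomputable instance (B : BilinearGroup) (k : GrpIdx) : Fintype (B.Generator k) :=
  Fintype.ofFinite _

instance (B : BilinearGroup) (k : GrpIdx) : Nonempty (B.Generator k) := by
  obtain ⟨x, hx⟩ := exists_prime_orderOf_dvd_card (G := B.El k) B.p (by rw [B.card_el])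
  exact ⟨⟨x, hx⟩⟩

/-! ## The machine model

A (non-uniform) probabilistic polynomial-time algorithm is a family of straight-line programs of
polynomial length, one for each value of the security parameter, that is, a family of
randomized circuits of polynomial size. A program works on registers that hold bits, exponents in
`ℤ_p`, and elements of the three groups. Besides Boolean gates and coin flips, the
instructions are the efficient operations of the bilinear group: arithmetic and
uniform sampling in `ℤ_p`, the group operations, exponentiation, the pairing, equality tests,
selection, and the passage between group elements and their binary encodings in both directions
(so programs are not restricted to generic ones). Every instruction is executed exactly once, so
the length of a program is its number of steps. -/

/-- Instructions. The first argument `d` is the destination register; for group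
instructions, `k` says in which of the three groups they work. -/
inductive Instr
  /-- `bit d := b` -/
  | bitConst (d : ℕ) (b : Bool)
  /-- `bit d := ¬ (bit a ∧ bit b)` -/
  | bitNand (d a b : ℕ)
  /-- `bit d :=` a fair coin -/
  | bitFlip (d : ℕ)
  /-- `bit d := if bit c then bit a else bit b` -/
  | bitMux (d c a b : ℕ)
  /-- `scal d := n mod p` -/
  | scalConst (d n : ℕ)
  /-- `scal d := scal a + scal b` -/
  | scalAdd (d a b : ℕ)
  /-- `scal d := scal a * scal b` -/
  | scalMul (d a b : ℕ)
  /-- `scal d := (scal a)⁻¹` (with `0⁻¹ = 0`) -/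
  | scalInv (d a : ℕ)
  /-- `scal d :=` a uniformly random element of `ℤ_p` -/
  | scalSample (d : ℕ)
  /-- `scal d := if bit c then scal a else scal b` -/
  | scalMux (d c a b : ℕ)
  /-- `bit d := (scal a = scal b)` -/
  | scalEq (d a b : ℕ)
  /-- `bit d :=` the `i`-th binary digit of `scal a` -/
  | scalBit (d a i : ℕ)
  /-- `el d := 1` -/
  | elOne (k : GrpIdx) (d : ℕ)
  /-- `el d := el a * el b` -/
  | elMul (k : GrpIdx) (d a b : ℕ)
  /-- `el d := (el a)⁻¹` -/
  | elInv (k : GrpIdx) (d a : ℕ)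
  /-- `el d := (el a) ^ (scal s)` -/
  | elPow (k : GrpIdx) (d a s : ℕ)
  /-- `el d := if bit c then el a else el b` -/
  | elMux (k : GrpIdx) (d c a b : ℕ)
  /-- `bit d := (el a = el b)` -/
  | elEq (k : GrpIdx) (d a b : ℕ)
  /-- `bit d :=` the `i`-th bit of the encoding of `el a` (`false` beyond its length) -/
  | elBit (k : GrpIdx) (d a i : ℕ)
  /-- `el d :=` the element encoded by the bits `bit s, bit (s + 1), …` (`1` if there is none) -/
  | elDecode (k : GrpIdx) (d s : ℕ)
  /-- `el d := e (el a) (el b)`, a pairing -/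
  | pairing (d a b : ℕ)

/-- The contents of the registers. -/
structure State (B : BilinearGroup) where
  bit : ℕ → Bool
  scal : ℕ → ZMod B.p
  el : (k : GrpIdx) → ℕ → B.El k

namespace State

variable {B : BilinearGroup}

def setBit (σ : State B) (d : ℕ) (b : Bool) : State B :=
  { σ with bit := Function.update σ.bit d b }

def setScal (σ : State B) (d : ℕ) (a : ZMod B.p) : State B :=
  { σ with scal := Function.update σ.scal d a }

def setEl (σ : State B) (k : GrpIdx) (d : ℕ) (x : B.El k) : State B :=
  { σ with el := Function.update σ.el k (Function.update (σ.el k) d x) }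

/-- Write the list `xs` into the registers `d, d + 1, …` of the group `k`. -/
def writeEl (σ : State B) (k : GrpIdx) (d : ℕ) (xs : List (B.El k)) : State B :=
  let f : ℕ → B.El k := fun i => if d ≤ i then xs.getD (i - d) (σ.el k i) else σ.el k i
  { σ with el := Function.update σ.el k f }

/-- The registers of a program that gets the lists `xs`, `ys`, `zs` of elements of `𝔾`, `𝔾̂`, `𝔾_T`
as its input. -/
def input (xs : List B.G) (ys : List B.Ghat) (zs : List B.GT) : State B :=
  (((({ bit := fun _ => false, scal := fun _ => 0, el := fun _ _ => 1 } : State B).writeEl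
    .left 0 xs).writeEl .right 0 ys).writeEl .target 0 zs)

end State

open Classical in
/-- The element with a given encoding, and `1` if there is none. -/
noncomputable def BilinearGroup.decode (B : BilinearGroup) (k : GrpIdx)
    (w : Fin B.encLen → Bool) : B.El k :=
  if h : ∃ x, B.enc k x = w then h.choose else 1

open Classical in
/-- The effect of one instruction. -/
noncomputable def step {B : BilinearGroup} : Instr → State B → PMF (State B)
  | .bitConst d b, σ => pure (σ.setBit d b)
  | .bitNand d a b, σ => pure (σ.setBit d (!(σ.bit a && σ.bit b)))
  | .bitFlip d, σ => do let b ← unif Bool; pure (σ.setBit d b)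
  | .bitMux d c a b, σ => pure (σ.setBit d (if σ.bit c then σ.bit a else σ.bit b))
  | .scalConst d n, σ => pure (σ.setScal d (n : ZMod B.p))
  | .scalAdd d a b, σ => pure (σ.setScal d (σ.scal a + σ.scal b))
  | .scalMul d a b, σ => pure (σ.setScal d (σ.scal a * σ.scal b))
  | .scalInv d a, σ => pure (σ.setScal d (σ.scal a)⁻¹)
  | .scalSample d, σ => do let x ← unif (ZMod B.p); pure (σ.setScal d x)
  | .scalMux d c a b, σ => pure (σ.setScal d (if σ.bit c then σ.scal a else σ.scal b))
  | .scalEq d a b, σ => pure (σ.setBit d (decide (σ.scal a = σ.scal b)))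
  | .scalBit d a i, σ => pure (σ.setBit d ((σ.scal a).val.testBit i))
  | .elOne k d, σ => pure (σ.setEl k d 1)
  | .elMul k d a b, σ => pure (σ.setEl k d (σ.el k a * σ.el k b))
  | .elInv k d a, σ => pure (σ.setEl k d (σ.el k a)⁻¹)
  | .elPow k d a s, σ => pure (σ.setEl k d (σ.el k a ^ σ.scal s))
  | .elMux k d c a b, σ => pure (σ.setEl k d (if σ.bit c then σ.el k a else σ.el k b))
  | .elEq k d a b, σ => pure (σ.setBit d (decide (σ.el k a = σ.el k b)))
  | .elBit k d a i, σ =>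
      pure (σ.setBit d (if h : i < B.encLen then B.enc k (σ.el k a) ⟨i, h⟩ else false))
  | .elDecode k d s, σ => pure (σ.setEl k d (B.decode k fun i => σ.bit (s + i)))
  | .pairing d a b, σ => pure (σ.setEl .target d (B.e (σ.el .left a) (σ.el .right b)))

/-- Run a program. -/
noncomputable def run {B : BilinearGroup} : List Instr → State B → PMF (State B)
  | [], σ => pure σ
  | i :: is, σ => do let σ' ← step i σ; run is σ'

/-- A PPT algorithm without interaction (such as an algorithm that attacks an assumption). -/
def IsPPT (𝓑 : ℕ → List Instr) : Prop := PolyBounded fun n => (𝓑 n).length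

/-! ## The five assumptions

Each of them is a pair of distributions of the input `(D, T)`, where `T = T₀` for `β = false` and
`T = T₁` for `β = true`. The element `T` is the last entry of the list of its group. -/

/-- A random generator. -/
noncomputable def randGen (B : BilinearGroup) (k : GrpIdx) : PMF (B.El k) := do
  let x ← unif (B.Generator k)
  pure x.val

/-- Assumption LW1. -/
noncomputable def LW1 (B : BilinearGroup) (β : Bool) : PMF (State B) := do
  let g ← randGen B .left
  let ĝ ← randGen B .right
  let a ← unif (ZMod B.p)
  let b ← unif (ZMod B.p)
  let c ← unif (ZMod B.p)
  let d ← unif (ZMod B.p)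
  pure (State.input
    [g, g ^ a, g ^ b, g ^ (a * b ^ 2), g ^ (b ^ 2), g ^ (b ^ 3),
      g ^ c, g ^ (a * c), g ^ (b * c), g ^ (b ^ 2 * c), g ^ (b ^ 3 * c),
      if β then g ^ d else g ^ (a * b ^ 2 * c)]
    [ĝ, ĝ ^ b]
    [])

/-- Assumption LW2. -/
noncomputable def LW2 (B : BilinearGroup) (β : Bool) : PMF (State B) := do
  let g ← randGen B .left
  let ĝ ← randGen B .right
  let a ← unif (ZMod B.p)
  let b ← unif (ZMod B.p)
  let c ← unif (ZMod B.p)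
  let x ← unif (ZMod B.p)
  let d ← unif (ZMod B.p)
  pure (State.input
    [g, g ^ a, g ^ (a ^ 2), g ^ (b * x), g ^ (a * b * x), g ^ (a ^ 2 * x)]
    [ĝ, ĝ ^ a, ĝ ^ b, ĝ ^ c, if β then ĝ ^ d else ĝ ^ (b * c)]
    [])

/-- Assumption SXDH (the decisional Diffie-Hellman problem in `𝔾̂`). -/
noncomputable def SXDH (B : BilinearGroup) (β : Bool) : PMF (State B) := do
  let g ← randGen B .left
  let ĝ ← randGen B .right
  let a ← unif (ZMod B.p)
  let b ← unif (ZMod B.p)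
  let c ← unif (ZMod B.p)
  pure (State.input
    [g]
    [ĝ, ĝ ^ a, ĝ ^ b, if β then ĝ ^ c else ĝ ^ (a * b)]
    [])

/-- Assumption DBDH. -/
noncomputable def DBDH (B : BilinearGroup) (β : Bool) : PMF (State B) := do
  let g ← randGen B .left
  let ĝ ← randGen B .right
  let a ← unif (ZMod B.p)
  let b ← unif (ZMod B.p)
  let c ← unif (ZMod B.p)
  let d ← unif (ZMod B.p)
  pure (State.input
    [g, g ^ a, g ^ b, g ^ c]
    [ĝ, ĝ ^ a, ĝ ^ b, ĝ ^ c]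
    [if β then B.e g ĝ ^ d else B.e g ĝ ^ (a * b * c)])

/-- The asymmetric 3-party Diffie-Hellman assumption. -/
noncomputable def A3DH (B : BilinearGroup) (β : Bool) : PMF (State B) := do
  let g ← randGen B .left
  let ĝ ← randGen B .right
  let a ← unif (ZMod B.p)
  let b ← unif (ZMod B.p)
  let c ← unif (ZMod B.p)
  let d ← unif (ZMod B.p)
  pure (State.input
    [g, g ^ a, g ^ b, g ^ c, g ^ (a * b), g ^ (a ^ 2 * b),
      if β then g ^ d else g ^ (a * b * c)]
    [ĝ, ĝ ^ a, ĝ ^ b]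
    [])

/-- The probability that the program `P`, run on an input from `μ`, outputs `0`. The output is the
content of the bit register `0`. -/
noncomputable def probZero {B : BilinearGroup} (μ : PMF (State B)) (P : List Instr) : ℝ :=
  (((μ.bind (run P)).map fun σ => σ.bit 0) false).toReal

/-- The advantage `|Pr[𝓑(D, T₀) = 0] - Pr[𝓑(D, T₁) = 0]|` of `𝓑` against an assumption, for the
security parameter `n`. -/
noncomputable def assumptionAdv (Γ : BilinearGroupFamily)
    (X : (B : BilinearGroup) → Bool → PMF (State B)) (𝓑 : ℕ → List Instr) (n : ℕ) : ℝ :=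
  |probZero (X (Γ.grp n) false) (𝓑 n) - probZero (X (Γ.grp n) true) (𝓑 n)|

/-- A function is negligible if it decays faster than the inverse of every polynomial. -/
def Negligible (f : ℕ → ℝ) : Prop :=
  Asymptotics.SuperpolynomialDecay Filter.atTop (fun n : ℕ => (n : ℝ)) f

/-- An assumption holds if every PPT algorithm has a negligible advantage. -/
def Holds (Γ : BilinearGroupFamily) (X : (B : BilinearGroup) → Bool → PMF (State B)) : Prop :=
  ∀ 𝓑 : ℕ → List Instr, IsPPT 𝓑 → Negligible (assumptionAdv Γ X 𝓑)

/-! ## The scheme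

Indices that run through `1, …, l` in the usual description run through `Fin l` here. A triple
such as `(g, g^ν, g^{-τ})` is a function on `Fin 3`. -/

/-- A hierarchical identity is a vector of identities; the genuine ones are singled out by
`ValidID`. -/
abbrev ID (B : BilinearGroup) : Type := List (ZMod B.p)

/-- The hierarchical identities of depth at most `l` over the identity space `ℤ_p^*`. -/
def ValidID {B : BilinearGroup} (l : ℕ) (I : ID B) : Prop :=
  I.length ≤ l ∧ ∀ x ∈ I, x ≠ 0

structure MasterKey (B : BilinearGroup) (l : ℕ) where
  ĝ : B.Ghat
  ĝα : B.Ghat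
  ĥ : B.Ghat
  û : Fin l → B.Ghat

/-- Public parameters: `g = (g, g^ν, g^{-τ})`, `h = (h, h^ν, h^{-τ})`,
`u i = (u_i, u_i^ν, u_i^{-τ})`, `W = (ŵ^{φ₁}, ŵ^{φ₂}, ŵ)` and `Ω = e(g, ĝ)^α`. -/
structure PublicParams (B : BilinearGroup) (l : ℕ) where
  g : Fin 3 → B.G
  h : Fin 3 → B.G
  u : Fin l → Fin 3 → B.G
  W : Fin 3 → B.Ghat
  Ω : B.GT

/-- Private keys. For an identity of depth `m`, the components `L i` and `R₃ i` exist only for the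
levels after the first `m` ones; for the first `m` levels they are set to `1`. -/
structure PrivateKey (B : BilinearGroup) (l : ℕ) where
  K₁ : Fin 3 → B.Ghat
  K₂ : Fin 3 → B.Ghat
  L : Fin l → Fin 3 → B.Ghat
  R₁ : Fin 3 → B.Ghat
  R₂ : Fin 3 → B.Ghat
  R₃ : Fin l → Fin 3 → B.Ghat

structure Ciphertext (B : BilinearGroup) where
  C : B.GT
  C₁ : Fin 3 → B.G
  C₂ : Fin 3 → B.G

section Scheme

variable {B : BilinearGroup} {l : ℕ}

/-- `h ∏_{i=1}^m u_i^{I_i}` for an identity `(I_1, …, I_m)` with `m ≤ l`. -/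
def idProd {k : GrpIdx} (h : B.El k) (u : Fin l → B.El k) (I : ID B) : B.El k :=
  h * ∏ i : Fin l, u i ^ (I.getD i 0)

/-- Keep the components of the levels after the first `m` ones. -/
def levelsAfter (m : ℕ) (f : Fin l → Fin 3 → B.Ghat) : Fin l → Fin 3 → B.Ghat :=
  fun i => if m ≤ i then f i else 1

variable (B l) in
noncomputable def setup : PMF (MasterKey B l × PublicParams B l) := do
  let g ← unif B.G
  let ĝ ← unif B.Ghat
  let ν ← unif (ZMod B.p)
  let φ₁ ← unif (ZMod B.p)
  let φ₂ ← unif (ZMod B.p)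
  let y_h ← unif (ZMod B.p)
  let y_u ← unif (Fin l → ZMod B.p)
  let y_w ← unif (ZMod B.p)
  let α ← unif (ZMod B.p)
  let τ := φ₁ + ν * φ₂
  let h := g ^ y_h
  let ĥ := ĝ ^ y_h
  let u := fun i => g ^ y_u i
  let û := fun i => ĝ ^ y_u i
  let ŵ := ĝ ^ y_w
  pure
    ({ ĝ := ĝ, ĝα := ĝ ^ α, ĥ := ĥ, û := û },
     { g := ![g, g ^ ν, g ^ (-τ)]
       h := ![h, h ^ ν, h ^ (-τ)]
       u := fun i => ![u i, u i ^ ν, u i ^ (-τ)]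
       W := ![ŵ ^ φ₁, ŵ ^ φ₂, ŵ]
       Ω := B.e g ĝ ^ α })

noncomputable def keyGen (I : ID B) (mk : MasterKey B l) (pp : PublicParams B l) :
    PMF (PrivateKey B l) := do
  let r₁ ← unif (ZMod B.p)
  let c₁ ← unif (ZMod B.p)
  let c₂ ← unif (ZMod B.p)
  let c₃ ← unif (Fin l → ZMod B.p)
  let r₂ ← unif (ZMod B.p)
  let c₄ ← unif (ZMod B.p)
  let c₅ ← unif (ZMod B.p)
  let c₆ ← unif (Fin l → ZMod B.p)
  let W := pp.W
  let F := idProd mk.ĥ mk.û I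
  pure
    { K₁ := ![mk.ĝα * F ^ r₁ * W 0 ^ c₁, W 1 ^ c₁, W 2 ^ c₁]
      K₂ := ![mk.ĝ ^ r₁ * W 0 ^ c₂, W 1 ^ c₂, W 2 ^ c₂]
      L := levelsAfter I.length fun i =>
        ![mk.û i ^ r₁ * W 0 ^ c₃ i, W 1 ^ c₃ i, W 2 ^ c₃ i]
      R₁ := ![F ^ r₂ * W 0 ^ c₄, W 1 ^ c₄, W 2 ^ c₄]
      R₂ := ![mk.ĝ ^ r₂ * W 0 ^ c₅, W 1 ^ c₅, W 2 ^ c₅]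
      R₃ := levelsAfter I.length fun i =>
        ![mk.û i ^ r₂ * W 0 ^ c₆ i, W 1 ^ c₆ i, W 2 ^ c₆ i] }

/-- Delegation from an identity of depth `m < l` to its extension by `x` (the experiment below,
like every experiment that does not trace the path of delegation, has no use for it). -/
noncomputable def delegate (m : Fin l) (x : ZMod B.p) (sk : PrivateKey B l)
    (pp : PublicParams B l) : PMF (PrivateKey B l) := do
  let γ₁ ← unif (ZMod B.p)
  let δ₁ ← unif (ZMod B.p)
  let δ₂ ← unif (ZMod B.p)
  let δ₃ ← unif (Fin l → ZMod B.p)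
  let γ₂ ← unif (ZMod B.p)
  let δ₄ ← unif (ZMod B.p)
  let δ₅ ← unif (ZMod B.p)
  let δ₆ ← unif (Fin l → ZMod B.p)
  let W := pp.W
  pure
    { K₁ := fun k => sk.K₁ k * sk.L m k ^ x * (sk.R₁ k * sk.R₃ m k ^ x) ^ γ₁ * W k ^ δ₁
      K₂ := fun k => sk.K₂ k * sk.R₂ k ^ γ₁ * W k ^ δ₂
      L := levelsAfter (m + 1) fun i k => sk.L i k * sk.R₃ i k ^ γ₁ * W k ^ δ₃ i
      R₁ := fun k => (sk.R₁ k * sk.R₃ m k ^ x) ^ γ₂ * W k ^ δ₄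
      R₂ := fun k => sk.R₂ k ^ γ₂ * W k ^ δ₅
      R₃ := levelsAfter (m + 1) fun i k => sk.R₃ i k ^ γ₂ * W k ^ δ₆ i }

noncomputable def encrypt (I : ID B) (M : B.GT) (pp : PublicParams B l) :
    PMF (Ciphertext B) := do
  let t ← unif (ZMod B.p)
  pure
    { C := pp.Ω ^ t * M
      C₁ := fun k => pp.g k ^ t
      C₂ := fun k => idProd (pp.h k) (fun i => pp.u i k) I ^ t }

def decrypt (ct : Ciphertext B) (sk : PrivateKey B l) : B.GT :=
  ct.C * (∏ i, (B.e (ct.C₁ i) (sk.K₁ i))⁻¹) * ∏ i, B.e (ct.C₂ i) (sk.K₂ i)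

end Scheme

/-! ## The security experiment -/

/-- Instructions of an adversary. `key c I d`: if `bit c` is set, request a private key for the
hierarchical identity in the exponent registers `I`, to be written into the registers of `𝔾̂`
from `d` on. `chal c I₀ I₁ M₀ M₁ d d'`: if `bit c` is set, submit the challenge identities in the
exponent registers `I₀` and `I₁` and the messages in the registers `M₀` and `M₁` of `𝔾_T`; the
challenge ciphertext is written into the registers of `𝔾` from `d` on, and into the
register `d'` of `𝔾_T`. As the instructions are conditional, all choices of the adversary,
including those of the depths and of the moment of the challenge, can be adaptive. -/
inductive AdvInstr
  | loc (i : Instr)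
  | key (c : ℕ) (I : List ℕ) (d : ℕ)
  | chal (c : ℕ) (I₀ I₁ : List ℕ) (M₀ M₁ : ℕ) (d d' : ℕ)

/-- The number of steps of an instruction (an identity is sent component by component). -/
def AdvInstr.cost : AdvInstr → ℕ
  | .loc _ => 1
  | .key _ I _ => 1 + I.length
  | .chal _ I₀ I₁ _ _ _ _ => 1 + I₀.length + I₁.length

/-- A PPT adversary. -/
def IsPPTAdversary (𝓐 : ℕ → List AdvInstr) : Prop :=
  PolyBounded fun n => ((𝓐 n).map AdvInstr.cost).sum

/-- A configuration of the experiment: the registers of the adversary, the identities whose private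
keys it has got, and the pair of challenge identities if there has been a challenge. -/
structure Config (B : BilinearGroup) where
  regs : State B
  queried : List (ID B)
  challenge : Option (ID B × ID B)

section Experiment

variable {B : BilinearGroup} {l : ℕ}

/-- The order in which the elements of the public parameters that lie in `𝔾` are handed over. -/
def PublicParams.toList (pp : PublicParams B l) : List B.G :=
  List.ofFn pp.g ++ List.ofFn pp.h ++ (List.ofFn fun i => List.ofFn (pp.u i)).flatten

/-- The order in which the elements of a private key are handed over. -/
def PrivateKey.toList (sk : PrivateKey B l) : List B.Ghat :=
  List.ofFn sk.K₁ ++ List.ofFn sk.K₂ ++ (List.ofFn fun i => List.ofFn (sk.L i)).flatten ++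
  List.ofFn sk.R₁ ++ List.ofFn sk.R₂ ++ (List.ofFn fun i => List.ofFn (sk.R₃ i)).flatten

/-- A private key for `I` may be given out: `I` is not a prefix of a challenge identity. -/
def KeyAllowed (l : ℕ) (s : Config B) (I : ID B) : Prop :=
  ValidID l I ∧ ∀ c ∈ s.challenge, ¬ I <+: c.1 ∧ ¬ I <+: c.2

/-- The pair `I₀, I₁` is admissible as the (only) challenge: the depths agree, and no identity of an
earlier key query is a prefix of one of them. -/
def ChalAllowed (l : ℕ) (s : Config B) (I₀ I₁ : ID B) : Prop :=
  s.challenge = none ∧ ValidID l I₀ ∧ ValidID l I₁ ∧ I₀.length = I₁.length ∧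
    ∀ I ∈ s.queried, ¬ I <+: I₀ ∧ ¬ I <+: I₁

open Classical in
/-- One step of the adversary against the challenger. Requests that violate the rules of the
experiment are ignored. -/
noncomputable def advStep (mk : MasterKey B l) (pp : PublicParams B l) (γ : Bool) :
    AdvInstr → Config B → PMF (Config B)
  | .loc i, s => do
      let σ ← step i s.regs
      pure { s with regs := σ }
  | .key c I d, s =>
      let J := I.map s.regs.scal
      if s.regs.bit c = true ∧ KeyAllowed l s J then do
        let sk ← keyGen J mk pp
        pure { s with
          regs := s.regs.writeEl .right d sk.toList
          queried := s.queried ++ [J] }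
      else pure s
  | .chal c I₀ I₁ M₀ M₁ d d', s =>
      let J₀ := I₀.map s.regs.scal
      let J₁ := I₁.map s.regs.scal
      if s.regs.bit c = true ∧ ChalAllowed l s J₀ J₁ then do
        let ct ← encrypt (if γ then J₁ else J₀)
          (s.regs.el .target (if γ then M₁ else M₀)) pp
        pure { s with
          regs := (s.regs.writeEl .left d (List.ofFn ct.C₁ ++ List.ofFn ct.C₂)).setEl
            .target d' ct.C
          challenge := some (J₀, J₁) }
      else pure s

noncomputable def advRun (mk : MasterKey B l) (pp : PublicParams B l) (γ : Bool) :
    List AdvInstr → Config B → PMF (Config B)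
  | [], s => pure s
  | i :: is, s => do let s' ← advStep mk pp γ i s; advRun mk pp γ is s'

variable (B l) in
/-- The experiment with the adversary `A`: the random bit `γ` and the final configuration. -/
noncomputable def experiment (A : List AdvInstr) : PMF (Bool × Config B) := do
  let (mk, pp) ← setup B l
  let γ ← unif Bool
  let s ← advRun mk pp γ A
    { regs := State.input pp.toList (List.ofFn pp.W) [pp.Ω]
      queried := []
      challenge := none }
  pure (γ, s)

end Experiment

/-- The advantage `|Pr[γ = γ'] - 1/2|`, where the guess `γ'` is the content of the bit
register `0` at the end. -/
noncomputable def schemeAdv (Γ : BilinearGroupFamily) (l : ℕ → ℕ) (𝓐 : ℕ → List AdvInstr)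
    (n : ℕ) : ℝ :=
  |(((experiment (Γ.grp n) (l n) (𝓐 n)).map fun x => decide (x.1 = x.2.regs.bit 0)) true).toReal
    - 1 / 2|

/-- `𝓐` gets at most `q n` private keys in every execution of the experiment. -/
def QueryBound (Γ : BilinearGroupFamily) (l : ℕ → ℕ) (𝓐 : ℕ → List AdvInstr) (q : ℕ → ℕ) : Prop :=
  ∀ n, ∀ x ∈ (experiment (Γ.grp n) (l n) (𝓐 n)).support, x.2.queried.length ≤ q n

/-- Full security (message hiding and anonymity) under a chosen plaintext attack. -/
def FullySecure (Γ : BilinearGroupFamily) (l : ℕ → ℕ) : Prop :=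
  ∀ 𝓐 : ℕ → List AdvInstr, IsPPTAdversary 𝓐 → Negligible (schemeAdv Γ l 𝓐)

end AHIBE

set_option linter.unusedSectionVars false

/-! The proof is a dual system argument, carried out on exponents. A key triple has the form (x - νκ
+ φ₁c, κ + φ₂c, c) and a ciphertext triple the form (t, νt + s, -(φ₁t + φ₂(νt + s))); pairing them
entrywise yields tx + sκ. Genuine keys have κ = 0 and genuine ciphertexts s = 0, so a
semi-functional part κ or s disturbs decryption only when both are present. The computational hops
introduce these parts, until the keys no longer help against the challenge ciphertext.

LW1 makes the challenge semi-functional (`lw1_equiv`). Then the keys are changed one at a time. LW2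
gives key number k a semi-functional part (`lw2_equiv`), but the simulator, which could build a
ciphertext for any identity, can only produce parts in which key and ciphertext share one affine
function of the identity, `auxExp`. This correlation is hidden because the key identity J is not a
prefix of the challenge identity I: they differ at some level of J, and the exponent of that level
makes the values at J and at I independent, even given the level exponents that the key reveals
(`expect_auxExp_mul`, `gameValue_hybrid_correlated`). After that the two halves of the key still
carry proportional parts; SXDH destroys the proportionality (`sxdh_equiv`), and key k becomes a key
with fresh semi-functional coins (`gameValue_hybrid_random`). When all keys are semi-functional, one
entry of the second ciphertext triple is uniform up to an error 1/p
(`abs_gameValue_uniform_sub_le`), DBDH masks the message (`dbdh_equiv`) and the 3-party assumption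
masks the identity (`a3dh_equiv`). The last ciphertext has a law that depends on neither, and the
coin is guessed with probability exactly 1/2 (`gameValue_random`).

The independence claims must survive adaptivity: the adversary picks identities after having seen
other answers. This is handled once, in `advRunE_lazy`: coins that enter only one key and the
challenge ciphertext can be resampled separately for each, if the two answers are independent
whenever the rules allow both to be asked.

The bound has no additive term in 1/p, although several hops lose one: the trapdoors need nonzero
exponents, the setup may pick trivial elements, and two statistical hops fail with probability 1/p.
The compensation comes from degenerate instances. If an exponent such as b in LW1 is 0, the solution
of the instance is the trivial element, and testing this already distinguishes it from a random
element. The reductions to LW1, SXDH and DBDH make this test and gain a surplus that pays for the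
losses. Non-uniformity lets each reduction hardwire the exponent of ŵ, the best hybrid index and the
sign of the guess, so the reductions really have to be programs of the machine model. They are
written as formulas for exponents (`Red`), and one compiler with one correctness proof
(`Red.runE_prog`) and one length bound serves all five. -/

namespace AHIBE

open Finset
open scoped BigOperators

/-! ## Averages -/

section Averages

variable {α β : Type} [Fintype α] [Nonempty α] [Fintype β] [Nonempty β]

theorem expect_mono_real {f g : α → ℝ} (h : ∀ a, f a ≤ g a) : 𝔼 a, f a ≤ 𝔼 a, g a :=
  Finset.expect_le_expect fun a _ => h a

theorem expect_swap (f : α → β → ℝ) : 𝔼 a, 𝔼 b, f a b = 𝔼 b, 𝔼 a, f a b :=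
  Finset.expect_comm _ _ _

theorem expect_prod_type (f : α × β → ℝ) : 𝔼 x, f x = 𝔼 a, 𝔼 b, f (a, b) := by
  rw [← Finset.univ_product_univ, Finset.expect_product]

/-- Averages are invariant under injective self-maps. -/
theorem expect_comp_injective {φ : α → α} (hφ : Function.Injective φ) (f : α → ℝ) :
    𝔼 a, f (φ a) = 𝔼 a, f a :=
  Fintype.expect_bijective φ (Finite.injective_iff_bijective.mp hφ) _ _ fun _ => rfl

theorem abs_expect_le (f : α → ℝ) : |𝔼 a, f a| ≤ 𝔼 a, |f a| :=
  Finset.abs_expect_le _ _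

theorem expect_le_of_le {f : α → ℝ} {c : ℝ} (h : ∀ a, f a ≤ c) : 𝔼 a, f a ≤ c :=
  (expect_mono_real h).trans_eq (Fintype.expect_const c)

theorem le_expect_of_le {f : α → ℝ} {c : ℝ} (h : ∀ a, c ≤ f a) : c ≤ 𝔼 a, f a :=
  (Fintype.expect_const c).symm.trans_le (expect_mono_real h)

theorem expect_mem_unit {f : α → ℝ} (h : ∀ a, f a ∈ Set.Icc (0 : ℝ) 1) :
    𝔼 a, f a ∈ Set.Icc (0 : ℝ) 1 :=
  ⟨le_expect_of_le fun a => (h a).1, expect_le_of_le fun a => (h a).2⟩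

variable {V R : Type} [Fintype V] [DecidableEq V] [Fintype R] [Nonempty R]

/-- Resampling a coordinate of a random vector does not change its law. -/
theorem expect_update (v : V) (f : (V → R) → ℝ) :
    𝔼 a : R, 𝔼 x : V → R, f (Function.update x v a) = 𝔼 x, f x := by
  have key : ∀ y : V → R, 𝔼 a : R, 𝔼 x : {w // w ≠ v} → R,
      f (fun w => if h : w = v then a else x ⟨w, h⟩) = 𝔼 x, f x := by
    intro _
    rw [← expect_prod_type fun q : R × ({w // w ≠ v} → R) =>
      f (fun w => if h : w = v then q.1 else q.2 ⟨w, h⟩)]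
    refine Fintype.expect_equiv (Equiv.funSplitAt v R).symm _ _ fun q => ?_
    congr 1
    funext w
    simp [Equiv.funSplitAt, Equiv.piSplitAt]
  have y : V → R := fun _ => Classical.arbitrary R
  rw [← key y]
  refine Finset.expect_congr rfl fun a _ => ?_
  have h2 : ∀ g : ({w // w ≠ v} → R) → ℝ, 𝔼 x : V → R, g (fun w => x w.1) = 𝔼 z, g z := by
    intro g
    rw [show 𝔼 x : V → R, g (fun w => x w.1)
        = 𝔼 q : R × ({w // w ≠ v} → R), g q.2 from
      Fintype.expect_equiv (Equiv.funSplitAt v R) _ _ fun x => rfl, expect_prod_type]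
    simp only [Fintype.expect_const]
  rw [← h2]
  refine Finset.expect_congr rfl fun x _ => ?_
  congr 1
  funext w
  by_cases h : w = v <;> simp [h, Function.update]

/-- Two independent random vectors, merged along a set of coordinates, form a random vector. -/
theorem expect_merge (S : V → Prop) [DecidablePred S] (f : (V → R) → ℝ) :
    𝔼 x : V → R, 𝔼 y : V → R, f (fun v => if S v then y v else x v) = 𝔼 x, f x := by
  have h1 : ∀ g : ({w // S w} → R) → ℝ, 𝔼 x : V → R, g (fun w => x w.1) = 𝔼 z, g z := by
    intro g
    rw [show 𝔼 x : V → R, g (fun w => x w.1)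
        = 𝔼 q : ({w // S w} → R) × ({w // ¬ S w} → R), g q.1 from
      Fintype.expect_equiv (Equiv.piEquivPiSubtypeProd S fun _ => R) _ _ fun x => rfl,
      expect_prod_type]
    simp only [Fintype.expect_const]
  have h2 : ∀ g : ({w // ¬ S w} → R) → ℝ, 𝔼 x : V → R, g (fun w => x w.1) = 𝔼 z, g z := by
    intro g
    rw [show 𝔼 x : V → R, g (fun w => x w.1)
        = 𝔼 q : ({w // S w} → R) × ({w // ¬ S w} → R), g q.2 from
      Fintype.expect_equiv (Equiv.piEquivPiSubtypeProd S fun _ => R) _ _ fun x => rfl,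
      expect_prod_type]
    simp only [Fintype.expect_const]
  have h3 : 𝔼 x, f x = 𝔼 a : {w // S w} → R, 𝔼 b : {w // ¬ S w} → R,
      f (fun v => if h : S v then a ⟨v, h⟩ else b ⟨v, h⟩) := by
    rw [← expect_prod_type fun q : ({w // S w} → R) × ({w // ¬ S w} → R) =>
      f (fun v => if h : S v then q.1 ⟨v, h⟩ else q.2 ⟨v, h⟩)]
    refine (Fintype.expect_equiv (Equiv.piEquivPiSubtypeProd S fun _ => R).symm _ _ fun q => ?_).symm
    rfl
  rw [h3, ← h1, expect_swap]
  refine Finset.expect_congr rfl fun y _ => ?_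
  rw [← h2]
  simp only [dite_eq_ite]

end Averages

/-! ## Distributions as averages -/

/-- The average functional `E` represents the distribution `μ`. -/
def Represents {α : Type} (μ : PMF α) (E : (α → ℝ) → ℝ) : Prop :=
  ∀ (β : Type) (F : α → PMF β) (b : β), ((μ.bind F) b).toReal = E fun a => (F a b).toReal

namespace Represents

theorem pure {α : Type} (a : α) : Represents (PMF.pure a) fun f => f a := by
  intro β F b; simp

theorem unif (α : Type) [Fintype α] [Nonempty α] :
    Represents (AHIBE.unif α) fun f => 𝔼 a, f a := by
  intro β F b
  rw [PMF.bind_apply, tsum_fintype, ENNReal.toReal_sum]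
  · simp only [Fintype.expect_eq_sum_div_card, Finset.sum_div]
    refine Finset.sum_congr rfl fun a _ => ?_
    simp [PMF.uniformOfFintype_apply, div_eq_inv_mul]
  · intro a _
    exact ENNReal.mul_ne_top (PMF.apply_ne_top _ _) (PMF.apply_ne_top _ _)

/-- The definition of `Represents` tests a distribution against all continuations into a `PMF`, and
a composite of continuations is again one. Hence associativity of `bind` suffices, and no
summability has to be discussed. -/
theorem bind {α γ : Type} {μ : PMF α} {E : (α → ℝ) → ℝ} {ν : α → PMF γ}
    {E' : α → (γ → ℝ) → ℝ} (h : Represents μ E) (h' : ∀ a, Represents (ν a) (E' a)) :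
    Represents (μ.bind ν) fun f => E fun a => E' a f := by
  intro β F b
  rw [PMF.bind_bind, h]
  exact congrArg E (funext fun a => h' a β F b)

theorem toReal_map {α : Type} {μ : PMF α} {E : (α → ℝ) → ℝ} (h : Represents μ E)
    (w : α → Bool) (b : Bool) :
    ((μ.map w) b).toReal = E fun a => if w a = b then 1 else 0 := by
  rw [PMF.map, h]
  refine congrArg E (funext fun a => ?_)
  by_cases hb : w a = b
  · simp [hb]
  · simp [hb, PMF.pure_apply, Ne.symm hb]

end Represents

/-! ## Programs as average transformers -/

variable {B : BilinearGroup}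

open Classical in
/-- The effect of an instruction that does not toss coins. -/
noncomputable def stepDet : Instr → State B → State B
  | .bitConst d b, σ => σ.setBit d b
  | .bitNand d a b, σ => σ.setBit d (!(σ.bit a && σ.bit b))
  | .bitFlip _, σ => σ
  | .bitMux d c a b, σ => σ.setBit d (if σ.bit c then σ.bit a else σ.bit b)
  | .scalConst d n, σ => σ.setScal d (n : ZMod B.p)
  | .scalAdd d a b, σ => σ.setScal d (σ.scal a + σ.scal b)
  | .scalMul d a b, σ => σ.setScal d (σ.scal a * σ.scal b)
  | .scalInv d a, σ => σ.setScal d (σ.scal a)⁻¹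
  | .scalSample _, σ => σ
  | .scalMux d c a b, σ => σ.setScal d (if σ.bit c then σ.scal a else σ.scal b)
  | .scalEq d a b, σ => σ.setBit d (decide (σ.scal a = σ.scal b))
  | .scalBit d a i, σ => σ.setBit d ((σ.scal a).val.testBit i)
  | .elOne k d, σ => σ.setEl k d 1
  | .elMul k d a b, σ => σ.setEl k d (σ.el k a * σ.el k b)
  | .elInv k d a, σ => σ.setEl k d (σ.el k a)⁻¹
  | .elPow k d a s, σ => σ.setEl k d (σ.el k a ^ σ.scal s)
  | .elMux k d c a b, σ => σ.setEl k d (if σ.bit c then σ.el k a else σ.el k b)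
  | .elEq k d a b, σ => σ.setBit d (decide (σ.el k a = σ.el k b))
  | .elBit k d a i, σ =>
      σ.setBit d (if h : i < B.encLen then B.enc k (σ.el k a) ⟨i, h⟩ else false)
  | .elDecode k d s, σ => σ.setEl k d (B.decode k fun i => σ.bit (s + i))
  | .pairing d a b, σ => σ.setEl .target d (B.e (σ.el .left a) (σ.el .right b))

/-- The average of `f` over the results of an instruction. -/
noncomputable def stepE (i : Instr) (f : State B → ℝ) (σ : State B) : ℝ :=
  match i with
  | .bitFlip d => 𝔼 b : Bool, f (σ.setBit d b)
  | .scalSample d => 𝔼 x : ZMod B.p, f (σ.setScal d x)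
  | i => f (stepDet i σ)

/-- The average of `f` over the results of a program. -/
noncomputable def runE : List Instr → (State B → ℝ) → State B → ℝ
  | [], f => f
  | i :: is, f => stepE i (runE is f)

theorem represents_step (i : Instr) (σ : State B) :
    Represents (step i σ) fun f => stepE i f σ := by
  cases i
  case bitFlip d => exact (Represents.unif Bool).bind fun b => Represents.pure _
  case scalSample d => exact (Represents.unif (ZMod B.p)).bind fun b => Represents.pure _
  all_goals exact Represents.pure _

theorem represents_run (P : List Instr) (σ : State B) :
    Represents (run P σ) fun f => runE P f σ := by
  induction P generalizing σ with
  | nil => exact Represents.pure _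
  | cons i is ih => exact (represents_step i σ).bind fun σ' => ih σ'

theorem runE_append (P Q : List Instr) (f : State B → ℝ) :
    runE (P ++ Q) f = runE P (runE Q f) := by
  induction P with
  | nil => rfl
  | cons i is ih => rw [List.cons_append, runE, ih, runE]

theorem probZero_eq {μ : PMF (State B)} {E : (State B → ℝ) → ℝ} (h : Represents μ E)
    (P : List Instr) :
    probZero μ P = E (runE P fun σ => if σ.bit 0 = false then 1 else 0) := by
  unfold probZero
  rw [(h.bind fun σ => represents_run P σ).toReal_map]

/-! ## Structured programs

Programs over named registers, and their translation into programs of the machine model. -/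

/-- The components of a private key: the one that carries the identity, the generator, and one for
each level. -/
abbrev CompIdx (l : ℕ) : Type := Option (Option (Fin l))

/-- The exponents that a reduction samples at the beginning. -/
inductive SetupVar (l : ℕ)
  | nu | phi1 | phi2 | yh | alpha | t | s | z | xi | zeta | ah | a0 | delta | rho
  | eta (b : Bool)
  | yu (i : Fin l)
  | au (i : Fin l)
  deriving DecidableEq, Fintype, Encodable

/-- The exponents that are sampled for every private key. -/
inductive KeyVar (l : ℕ)
  | delta | rho
  | r (b : Bool)
  | eta (b : Bool)
  | c (b : Bool) (j : CompIdx l)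
  | a (i : Fin l)
  deriving DecidableEq, Fintype, Encodable

/-- The variables of exponent expressions: sampled exponents, the components of the identity, and
the indicators of whether the current key comes before the distinguished one, or is it. -/
inductive ExpVar (l : ℕ)
  | setup (v : SetupVar l)
  | key (v : KeyVar l)
  | ident (i : Fin l)
  | lt | eq
  deriving DecidableEq, Encodable

inductive ScalVar (l : ℕ)
  | exp (v : ExpVar l)
  | adv (i : ℕ)
  | slot (pos : ℕ) (i : Fin l)
  | chal (b : Bool) (i : Fin l)
  | work (b : Bool) (i : Fin l)
  deriving DecidableEq, Encodable

inductive BitVar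
  | adv (i : ℕ)
  | coin
  | count (j : ℕ)
  | got (pos : ℕ)
  | done
  | ok
  deriving DecidableEq, Encodable

/-- The elements that a reduction starts with: its input, and pairings of elements of its input. -/
inductive BaseVar
  | inp (i : Fin 12)
  | pair (i j : Fin 12)
  deriving DecidableEq, Encodable

inductive ElVar
  | adv (i : ℕ)
  | base (v : BaseVar)
  deriving DecidableEq, Encodable

/-- The contents of the named registers. -/
@[ext]
structure Mem (B : BilinearGroup) (l : ℕ) where
  bit : BitVar → Bool
  scal : ScalVar l → ZMod B.p
  el : (k : GrpIdx) → ElVar → B.El k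

namespace Mem

variable {B : BilinearGroup} {l : ℕ}

def setBit (m : Mem B l) (v : BitVar) (b : Bool) : Mem B l :=
  { m with bit := Function.update m.bit v b }

def setScal (m : Mem B l) (v : ScalVar l) (a : ZMod B.p) : Mem B l :=
  { m with scal := Function.update m.scal v a }

def setEl (m : Mem B l) (k : GrpIdx) (v : ElVar) (x : B.El k) : Mem B l :=
  { m with el := Function.update m.el k (Function.update (m.el k) v x) }

/-- The registers of the adversary. -/
def advState (m : Mem B l) : State B where
  bit i := m.bit (.adv i)
  scal i := m.scal (.adv i)
  el k i := m.el k (.adv i)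

/-- Overwrite the registers of the adversary. -/
def setAdv (m : Mem B l) (ρ : State B) : Mem B l where
  bit v := match v with
    | .adv i => ρ.bit i
    | v => m.bit v
  scal v := match v with
    | .adv i => ρ.scal i
    | v => m.scal v
  el k v := match v with
    | .adv i => ρ.el k i
    | v => m.el k v

end Mem

/-! ### Addresses -/

/-- Temporaries have even offsets and named registers odd ones, so neither overwrites the other. Two
initial segments are kept apart: the bit registers below `L`, the length of encodings, serve as a
buffer for decoding, and the element registers below 12 hold the input of the reduction. -/
def expTemp (t : ℕ) : ℕ := 2 * t
def scalAddr {l : ℕ} (v : ScalVar l) : ℕ := 2 * Encodable.encode v + 1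
def bitTemp (L t : ℕ) : ℕ := L + 2 * t
def bitAddr (L : ℕ) (v : BitVar) : ℕ := L + (2 * Encodable.encode v + 1)
def elTemp (t : ℕ) : ℕ := 12 + 2 * t
def elAddr : ElVar → ℕ
  | .base (.inp i) => i
  | v => 12 + (2 * Encodable.encode v + 1)

theorem scalAddr_injective {l : ℕ} : Function.Injective (scalAddr (l := l)) := by
  intro v w h
  exact Encodable.encode_injective (by unfold scalAddr at h; omega)

theorem bitAddr_injective (L : ℕ) : Function.Injective (bitAddr L) := by
  intro v w h
  exact Encodable.encode_injective (by unfold bitAddr at h; omega)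

theorem elAddr_injective : Function.Injective elAddr := by
  intro v w h
  unfold elAddr at h
  split at h <;> split at h
  · congr 2; exact Fin.ext h
  · omega
  · omega
  · exact Encodable.encode_injective (by omega)

theorem scalAddr_ne_temp {l : ℕ} (v : ScalVar l) (t : ℕ) : scalAddr v ≠ expTemp t := by
  unfold scalAddr expTemp; omega

theorem bitAddr_ne_temp (L : ℕ) (v : BitVar) (t : ℕ) : bitAddr L v ≠ bitTemp L t := by
  unfold bitAddr bitTemp; omega

theorem elAddr_ne_temp (v : ElVar) (t : ℕ) : elAddr v ≠ elTemp t := by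
  unfold elAddr elTemp
  split <;> omega

section Machine

variable {B : BilinearGroup} {l : ℕ}

/-- The named registers of a state of the machine. -/
def view (l : ℕ) (σ : State B) : Mem B l where
  bit v := σ.bit (bitAddr B.encLen v)
  scal v := σ.scal (scalAddr v)
  el k v := σ.el k (elAddr v)

theorem view_setBit (σ : State B) (v : BitVar) (b : Bool) :
    view l (σ.setBit (bitAddr B.encLen v) b) = (view l σ).setBit v b := by
  ext1
  · exact Function.update_comp_eq_of_injective _ (bitAddr_injective _) _ _
  · rfl
  · rfl

theorem view_setScal (σ : State B) (v : ScalVar l) (a : ZMod B.p) :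
    view l (σ.setScal (scalAddr v) a) = (view l σ).setScal v a := by
  ext1
  · rfl
  · exact Function.update_comp_eq_of_injective _ scalAddr_injective _ _
  · rfl

theorem view_setEl (σ : State B) (k : GrpIdx) (v : ElVar) (x : B.El k) :
    view l (σ.setEl k (elAddr v) x) = (view l σ).setEl k v x := by
  ext1
  · rfl
  · rfl
  · funext k'
    by_cases h : k' = k
    · subst h
      simp only [view, State.setEl, Mem.setEl, Function.update_self]
      exact Function.update_comp_eq_of_injective _ elAddr_injective _ _
    · simp [view, State.setEl, Mem.setEl, Function.update_of_ne h]

theorem view_setBit_temp (σ : State B) {d : ℕ} (hd : ∀ v, bitAddr B.encLen v ≠ d) (b : Bool) :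
    view l (σ.setBit d b) = view l σ := by
  ext1
  · funext v; exact Function.update_of_ne (hd v) _ _
  · rfl
  · rfl

theorem view_setScal_temp (σ : State B) (t : ℕ) (a : ZMod B.p) :
    view l (σ.setScal (expTemp t) a) = view l σ := by
  ext1
  · rfl
  · funext v; exact Function.update_of_ne (scalAddr_ne_temp v t) _ _
  · rfl

theorem view_setEl_temp (σ : State B) (k : GrpIdx) (t : ℕ) (x : B.El k) :
    view l (σ.setEl k (elTemp t) x) = view l σ := by
  ext1
  · rfl
  · rfl
  · funext k' v
    by_cases h : k' = k
    · subst h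
      simp only [view, State.setEl, Function.update_self]
      exact Function.update_of_ne (elAddr_ne_temp v t) _ _
    · simp [view, State.setEl, Function.update_of_ne h]

/-- The program `P` leads from `σ` to `σ'` without coin tosses. -/
def Steps (P : List Instr) (σ σ' : State B) : Prop := ∀ f, runE P f σ = f σ'

theorem Steps.append {P Q : List Instr} {σ σ' σ'' : State B} (h : Steps P σ σ')
    (h' : Steps Q σ' σ'') : Steps (P ++ Q) σ σ'' := by
  intro f
  rw [runE_append, h, h']

/-! ### Expressions -/

/-- Expressions for exponents. -/
inductive ScalExp (l p : ℕ)
  | const (c : ZMod p)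
  | var (v : ExpVar l)
  | add (a b : ScalExp l p)
  | mul (a b : ScalExp l p)

namespace ScalExp

variable {p : ℕ}

def eval (x : ExpVar l → ZMod p) : ScalExp l p → ZMod p
  | const c => c
  | var v => x v
  | add a b => a.eval x + b.eval x
  | mul a b => a.eval x * b.eval x

def code : ScalExp l p → ℕ → List Instr
  | const c, t => [.scalConst (expTemp t) c.val]
  | var v, t => [.scalMux (expTemp t) 0 (scalAddr (.exp v : ScalVar l)) (scalAddr (.exp v : ScalVar l))]
  | add a b, t => a.code t ++ b.code (t + 1) ++
      [.scalAdd (expTemp t) (expTemp t) (expTemp (t + 1))]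
  | mul a b, t => a.code t ++ b.code (t + 1) ++
      [.scalMul (expTemp t) (expTemp t) (expTemp (t + 1))]

def size : ScalExp l p → ℕ
  | const _ => 1
  | var _ => 1
  | add a b => a.size + b.size + 1
  | mul a b => a.size + b.size + 1

theorem length_code (e : ScalExp l p) (t : ℕ) : (e.code t).length = e.size := by
  induction e generalizing t with
  | const | var => rfl
  | add a b ha hb => simp [code, size, ha, hb, add_assoc]
  | mul a b ha hb => simp [code, size, ha, hb, add_assoc]

/-- The temporaries are used as a stack. The code at depth `t` leaves everything below `t` alone;
this clause protects the value of the left operand while the right one is computed at depth `t + 1`.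
-/
theorem steps_code (e : ScalExp l B.p) (t : ℕ) (σ : State B) :
    ∃ σ', Steps (e.code t) σ σ' ∧ view l σ' = view l σ ∧
      σ'.scal (expTemp t) = e.eval (fun v => (view l σ).scal (.exp v)) ∧
      (∀ t' < t, σ'.scal (expTemp t') = σ.scal (expTemp t')) ∧ σ'.bit = σ.bit ∧ σ'.el = σ.el := by
  have hne : ∀ t' < t, expTemp t' ≠ expTemp t := fun t' h => by unfold expTemp; omega
  induction e generalizing t σ with
  | const c =>
    refine ⟨_, fun f => rfl, view_setScal_temp _ _ _, ?_, ?_, rfl, rfl⟩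
    · simp [stepDet, State.setScal, eval]
    · intro t' h
      simp [stepDet, State.setScal, hne t' h]
  | var v =>
    refine ⟨_, fun f => rfl, view_setScal_temp _ _ _, ?_, ?_, rfl, rfl⟩
    · simp [stepDet, State.setScal, eval, view]
    · intro t' h
      simp [stepDet, State.setScal, hne t' h]
  | add a b ha hb =>
    obtain ⟨σ₁, s₁, v₁, e₁, p₁, b₁, l₁⟩ := ha t σ hne
    obtain ⟨σ₂, s₂, v₂, e₂, p₂, b₂, l₂⟩ := hb (t + 1) σ₁ fun t' h => by unfold expTemp; omega
    refine ⟨_, (s₁.append s₂).append fun f => rfl, ?_, ?_, ?_, ?_, ?_⟩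
    · exact (view_setScal_temp _ _ _).trans (v₂.trans v₁)
    · simp [stepDet, State.setScal, eval, e₂, p₂ t (by omega), e₁, v₁]
    · intro t' h
      simp [stepDet, State.setScal, hne t' h, p₂ t' (by omega), p₁ t' h]
    · exact b₂.trans b₁
    · exact l₂.trans l₁
  | mul a b ha hb =>
    obtain ⟨σ₁, s₁, v₁, e₁, p₁, b₁, l₁⟩ := ha t σ hne
    obtain ⟨σ₂, s₂, v₂, e₂, p₂, b₂, l₂⟩ := hb (t + 1) σ₁ fun t' h => by unfold expTemp; omega
    refine ⟨_, (s₁.append s₂).append fun f => rfl, ?_, ?_, ?_, ?_, ?_⟩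
    · exact (view_setScal_temp _ _ _).trans (v₂.trans v₁)
    · simp [stepDet, State.setScal, eval, e₂, p₂ t (by omega), e₁, v₁]
    · intro t' h
      simp [stepDet, State.setScal, hne t' h, p₂ t' (by omega), p₁ t' h]
    · exact b₂.trans b₁
    · exact l₂.trans l₁

end ScalExp

/-- Products of powers of the elements that a reduction starts with. -/
abbrev GrpExp (l p : ℕ) : Type := List (BaseVar × ScalExp l p)

namespace GrpExp

variable {p : ℕ}

def eval {k : GrpIdx} (y : BaseVar → B.El k) (x : ExpVar l → ZMod B.p) (G : GrpExp l B.p) :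
    B.El k :=
  (G.map fun q => y q.1 ^ q.2.eval x).prod

def codeMul (k : GrpIdx) : GrpExp l p → List Instr
  | [] => []
  | q :: G => q.2.code 0 ++ [.elPow k (elTemp 1) (elAddr (.base q.1)) (expTemp 0),
      .elMul k (elTemp 0) (elTemp 0) (elTemp 1)] ++ codeMul k G

/-- Compute a product of powers. -/
def code (k : GrpIdx) (G : GrpExp l p) : List Instr := .elOne k (elTemp 0) :: codeMul k G

def size (G : GrpExp l p) : ℕ := 1 + (G.map fun q => q.2.size + 2).sum

theorem length_code (k : GrpIdx) (G : GrpExp l p) : (code k G).length = G.size := by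
  unfold code size
  have : (codeMul k G).length = (G.map fun q => q.2.size + 2).sum := by
    induction G with
    | nil => rfl
    | cons q G ih =>
      rw [codeMul, List.length_append, List.length_append, ih, ScalExp.length_code]
      simp
  simp [this, add_comm]

theorem steps_codeMul (k : GrpIdx) (G : GrpExp l B.p) (σ : State B) :
    ∃ σ', Steps (codeMul k G) σ σ' ∧ view l σ' = view l σ ∧
      σ'.el k (elTemp 0) = σ.el k (elTemp 0) *
        eval (fun v => (view l σ).el k (.base v)) (fun v => (view l σ).scal (.exp v)) G ∧
      σ'.bit = σ.bit := by
  induction G generalizing σ with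
  | nil => exact ⟨σ, fun f => rfl, rfl, by simp [eval], rfl⟩
  | cons q G ih =>
    obtain ⟨σ₁, s₁, v₁, e₁, -, b₁, l₁⟩ := q.2.steps_code 0 σ
    set σ₂ := (σ₁.setEl k (elTemp 1) (σ₁.el k (elAddr (.base q.1)) ^ σ₁.scal (expTemp 0)))
      with hσ₂
    set σ₃ := σ₂.setEl k (elTemp 0) (σ₂.el k (elTemp 0) * σ₂.el k (elTemp 1)) with hσ₃
    obtain ⟨σ₄, s₄, v₄, e₄, b₄⟩ := ih σ₃
    have v₃ : view l σ₃ = view l σ := by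
      rw [hσ₃, view_setEl_temp, hσ₂, view_setEl_temp, v₁]
    refine ⟨σ₄, ((s₁.append fun f => rfl).append s₄), v₄.trans v₃, ?_, ?_⟩
    · rw [e₄, v₃]
      have h01 : elTemp 0 ≠ elTemp 1 := by unfold elTemp; omega
      have h1 : σ₁.el k (elAddr (.base q.1)) = (view l σ).el k (.base q.1) := by
        rw [← v₁]; rfl
      simp [hσ₃, hσ₂, State.setEl, h01, eval, e₁, l₁, mul_assoc, ← h1]
    · rw [b₄, hσ₃, hσ₂]; exact b₁

theorem steps_code (k : GrpIdx) (G : GrpExp l B.p) (σ : State B) :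
    ∃ σ', Steps (code k G) σ σ' ∧ view l σ' = view l σ ∧
      σ'.el k (elTemp 0) =
        eval (fun v => (view l σ).el k (.base v)) (fun v => (view l σ).scal (.exp v)) G ∧
      σ'.bit = σ.bit := by
  obtain ⟨σ', s, v, e, b⟩ := steps_codeMul k G (σ.setEl k (elTemp 0) 1)
  rw [view_setEl_temp] at v e
  refine ⟨σ', fun f => s f, v, ?_, b⟩
  rw [e]
  simp [State.setEl]

end GrpExp

/-- Conditions. -/
inductive BitExp (l : ℕ)
  | const (b : Bool)
  | var (v : BitVar)
  | nand (a b : BitExp l)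
  | scalEq (v w : ScalVar l)
  | scalZero (v : ScalVar l)
  | isOne (k : GrpIdx) (v : BaseVar)

namespace BitExp

open Classical in
noncomputable def eval (m : Mem B l) : BitExp l → Bool
  | const b => b
  | var v => m.bit v
  | nand a b => !(a.eval m && b.eval m)
  | scalEq v w => decide (m.scal v = m.scal w)
  | scalZero v => decide (m.scal v = 0)
  | isOne k v => decide (m.el k (.base v) = 1)

def code (L : ℕ) : BitExp l → ℕ → List Instr
  | const b, t => [.bitConst (bitTemp L t) b]
  | var v, t => [.bitMux (bitTemp L t) 0 (bitAddr L v) (bitAddr L v)]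
  | nand a b, t => a.code L t ++ b.code L (t + 1) ++
      [.bitNand (bitTemp L t) (bitTemp L t) (bitTemp L (t + 1))]
  | scalEq v w, t => [.scalEq (bitTemp L t) (scalAddr v) (scalAddr w)]
  | scalZero v, t => [.scalConst (expTemp 0) 0, .scalEq (bitTemp L t) (scalAddr v) (expTemp 0)]
  | isOne k v, t => [.elOne k (elTemp 0), .elEq k (bitTemp L t) (elAddr (.base v)) (elTemp 0)]

def size : BitExp l → ℕ
  | const _ => 1
  | var _ => 1
  | nand a b => a.size + b.size + 1
  | scalEq _ _ => 1
  | scalZero _ => 2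
  | isOne _ _ => 2

theorem length_code (L : ℕ) (e : BitExp l) (t : ℕ) : (e.code L t).length = e.size := by
  induction e generalizing t with
  | nand a b ha hb => simp [code, size, ha, hb, add_assoc]
  | _ => rfl

theorem bitTemp_ne {L t' t : ℕ} (h : t' < t) : bitTemp L t' ≠ bitTemp L t := by
  unfold bitTemp; omega

theorem steps_code (e : BitExp l) (t : ℕ) (σ : State B) :
    ∃ σ', Steps (e.code B.encLen t) σ σ' ∧ view l σ' = view l σ ∧
      σ'.bit (bitTemp B.encLen t) = e.eval (view l σ) ∧
      (∀ t' < t, σ'.bit (bitTemp B.encLen t') = σ.bit (bitTemp B.encLen t')) := by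
  induction e generalizing t σ with
  | nand a b ha hb =>
    obtain ⟨σ₁, s₁, v₁, e₁, p₁⟩ := ha t σ
    obtain ⟨σ₂, s₂, v₂, e₂, p₂⟩ := hb (t + 1) σ₁
    refine ⟨_, (s₁.append s₂).append fun f => rfl, ?_, ?_, ?_⟩
    · exact (view_setBit_temp _ (fun v => bitAddr_ne_temp _ v _) _).trans (v₂.trans v₁)
    · simp [stepDet, State.setBit, eval, e₂, p₂ t (by omega), e₁, v₁]
    · intro t' h
      simp [stepDet, State.setBit, bitTemp_ne h, p₂ t' (by omega), p₁ t' h]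
  | scalZero v =>
    refine ⟨_, fun f => rfl, ?_, ?_, ?_⟩
    · exact (view_setBit_temp _ (fun v => bitAddr_ne_temp _ v _) _).trans (view_setScal_temp _ _ _)
    · have h1 := scalAddr_ne_temp v 0
      simp only [State.setBit, State.setScal, eval, stepDet, view, Function.update_self,
        Function.update_of_ne h1, Nat.cast_zero]
      congr
    · intro t' h
      simp [State.setBit, State.setScal, bitTemp_ne h, stepDet]
  | isOne k v =>
    refine ⟨_, fun f => rfl, ?_, ?_, ?_⟩
    · exact (view_setBit_temp _ (fun v => bitAddr_ne_temp _ v _) _).trans (view_setEl_temp _ _ _ _)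
    · have h1 := elAddr_ne_temp (.base v) 0
      simp only [State.setBit, State.setEl, eval, stepDet, view, Function.update_self,
        Function.update_of_ne h1]
      congr
      · rw [Function.update_self, Function.update_of_ne h1]
      · simp
    · intro t' h
      simp [State.setBit, State.setEl, bitTemp_ne h, stepDet]
  | _ =>
    refine ⟨_, fun f => rfl, view_setBit_temp _ (fun v => bitAddr_ne_temp _ v _) _, ?_, ?_⟩
    · simp [stepDet, State.setBit, eval, view] <;> congr
    · intro t' h
      simp [stepDet, State.setBit, bitTemp_ne h]

def not (a : BitExp l) : BitExp l := nand a (const true)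
def and (a b : BitExp l) : BitExp l := not (nand a b)
def or (a b : BitExp l) : BitExp l := nand (not a) (not b)
def all (L : List (BitExp l)) : BitExp l := L.foldr and (const true)
def any (L : List (BitExp l)) : BitExp l := L.foldr or (const false)

@[simp] theorem eval_not (m : Mem B l) (a : BitExp l) : (not a).eval m = !(a.eval m) := by
  simp [not, eval]
@[simp] theorem eval_and (m : Mem B l) (a b : BitExp l) :
    (and a b).eval m = (a.eval m && b.eval m) := by
  simp [and, eval]
@[simp] theorem eval_or (m : Mem B l) (a b : BitExp l) :
    (or a b).eval m = (a.eval m || b.eval m) := by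
  simp [or, eval]
@[simp] theorem eval_all (m : Mem B l) (L : List (BitExp l)) :
    (all L).eval m = L.all fun a => a.eval m := by
  induction L with
  | nil => rfl
  | cons a L ih => simpa [all] using congrArg (a.eval m && ·) ih
@[simp] theorem eval_any (m : Mem B l) (L : List (BitExp l)) :
    (any L).eval m = L.any fun a => a.eval m := by
  induction L with
  | nil => rfl
  | cons a L ih => simpa [any] using congrArg (a.eval m || ·) ih

end BitExp

end Machine

/-! ### Statements of structured programs and their compilation -/

section Statements

variable {B : BilinearGroup} {l : ℕ}

/-- Let an instruction work on the registers of the adversary. -/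
def Instr.relocate (l L : ℕ) : Instr → List Instr
  | .bitConst d b => [.bitConst (bitAddr L (.adv d)) b]
  | .bitNand d a b => [.bitNand (bitAddr L (.adv d)) (bitAddr L (.adv a)) (bitAddr L (.adv b))]
  | .bitFlip d => [.bitFlip (bitAddr L (.adv d))]
  | .bitMux d c a b => [.bitMux (bitAddr L (.adv d)) (bitAddr L (.adv c)) (bitAddr L (.adv a))
      (bitAddr L (.adv b))]
  | .scalConst d n => [.scalConst (scalAddr (.adv d : ScalVar l)) n]
  | .scalAdd d a b => [.scalAdd (scalAddr (.adv d : ScalVar l)) (scalAddr (.adv a : ScalVar l))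
      (scalAddr (.adv b : ScalVar l))]
  | .scalMul d a b => [.scalMul (scalAddr (.adv d : ScalVar l)) (scalAddr (.adv a : ScalVar l))
      (scalAddr (.adv b : ScalVar l))]
  | .scalInv d a => [.scalInv (scalAddr (.adv d : ScalVar l)) (scalAddr (.adv a : ScalVar l))]
  | .scalSample d => [.scalSample (scalAddr (.adv d : ScalVar l))]
  | .scalMux d c a b => [.scalMux (scalAddr (.adv d : ScalVar l)) (bitAddr L (.adv c))
      (scalAddr (.adv a : ScalVar l)) (scalAddr (.adv b : ScalVar l))]
  | .scalEq d a b => [.scalEq (bitAddr L (.adv d)) (scalAddr (.adv a : ScalVar l))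
      (scalAddr (.adv b : ScalVar l))]
  | .scalBit d a i => [.scalBit (bitAddr L (.adv d)) (scalAddr (.adv a : ScalVar l)) i]
  | .elOne k d => [.elOne k (elAddr (.adv d))]
  | .elMul k d a b => [.elMul k (elAddr (.adv d)) (elAddr (.adv a)) (elAddr (.adv b))]
  | .elInv k d a => [.elInv k (elAddr (.adv d)) (elAddr (.adv a))]
  | .elPow k d a s => [.elPow k (elAddr (.adv d)) (elAddr (.adv a)) (scalAddr (.adv s : ScalVar l))]
  | .elMux k d c a b => [.elMux k (elAddr (.adv d)) (bitAddr L (.adv c)) (elAddr (.adv a))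
      (elAddr (.adv b))]
  | .elEq k d a b => [.elEq k (bitAddr L (.adv d)) (elAddr (.adv a)) (elAddr (.adv b))]
  | .elBit k d a i => [.elBit k (bitAddr L (.adv d)) (elAddr (.adv a)) i]
  | .elDecode k d s => (List.range L).map (fun i =>
      .bitMux i 0 (bitAddr L (.adv (s + i))) (bitAddr L (.adv (s + i)))) ++
      [.elDecode k (elAddr (.adv d)) 0]
  | .pairing d a b => [.pairing (elAddr (.adv d)) (elAddr (.adv a)) (elAddr (.adv b))]

theorem Instr.length_relocate (l L : ℕ) (i : Instr) : (i.relocate l L).length ≤ L + 1 := by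
  cases i <;> simp [Instr.relocate]

theorem Mem.setAdv_setBit (m : Mem B l) (d : ℕ) (b : Bool) :
    m.setAdv (m.advState.setBit d b) = m.setBit (.adv d) b := by
  ext1
  · funext v
    cases v <;> simp [Mem.setAdv, Mem.setBit, State.setBit, Mem.advState, Function.update_apply]
  · funext v
    cases v <;> rfl
  · funext k v
    cases v <;> rfl

theorem Mem.setAdv_setScal (m : Mem B l) (d : ℕ) (a : ZMod B.p) :
    m.setAdv (m.advState.setScal d a) = m.setScal (.adv d) a := by
  ext1
  · funext v
    cases v <;> rfl
  · funext v
    cases v <;> simp [Mem.setAdv, Mem.setScal, State.setScal, Mem.advState, Function.update_apply]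
  · funext k v
    cases v <;> rfl

theorem Mem.setAdv_setEl (m : Mem B l) (k : GrpIdx) (d : ℕ) (x : B.El k) :
    m.setAdv (m.advState.setEl k d x) = m.setEl k (.adv d) x := by
  ext1
  · funext v
    cases v <;> rfl
  · funext v
    cases v <;> rfl
  · funext k' v
    by_cases h : k' = k
    · subst h
      cases v <;> simp [Mem.setAdv, Mem.setEl, State.setEl, Mem.advState, Function.update_apply]
    · cases v <;> simp [Mem.setAdv, Mem.setEl, State.setEl, Mem.advState, Function.update_of_ne h]

/-- Decoding reads consecutive bit registers, but the addresses of the adversary's bits are not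
consecutive. They are first moved into the buffer below `L`, where no named register lives. A
multiplexer with equal branches serves as the move instruction. -/
theorem steps_copyBits (L s : ℕ) (hL : L = B.encLen) (n : ℕ) (hn : n ≤ L) (σ : State B) :
    ∃ σ', Steps ((List.range n).map (fun i =>
      Instr.bitMux i 0 (bitAddr L (.adv (s + i))) (bitAddr L (.adv (s + i))))) σ σ' ∧
      view l σ' = view l σ ∧ ∀ i < n, σ'.bit i = σ.bit (bitAddr L (.adv (s + i))) := by
  induction n with
  | zero => exact ⟨σ, fun f => rfl, rfl, by simp⟩
  | succ n ih =>
    obtain ⟨σ₁, s₁, v₁, b₁⟩ := ih (by omega)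
    rw [List.range_succ, List.map_append]
    refine ⟨_, s₁.append fun f => rfl, ?_, ?_⟩
    · exact (view_setBit_temp _ (fun v => by unfold bitAddr; omega) _).trans v₁
    · intro i hi
      have h2 : σ₁.bit (bitAddr L (.adv (s + n))) = σ.bit (bitAddr L (.adv (s + n))) := by
        subst hL
        exact congrFun (congrArg (Mem.bit (l := l)) v₁) (.adv (s + n))
      rcases Nat.lt_succ_iff_lt_or_eq.mp hi with h | h
      · simp [stepDet, State.setBit, h.ne, b₁ i h]
      · subst h
        simp [stepDet, State.setBit, h2]

theorem runE_relocate (i : Instr) (F : Mem B l → ℝ) (σ : State B) :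
    runE (i.relocate l B.encLen) (fun ρ => F (view l ρ)) σ =
      stepE i (fun ρ => F ((view l σ).setAdv ρ)) (view l σ).advState := by
  cases i
  case elDecode k d s =>
    obtain ⟨σ₁, s₁, v₁, b₁⟩ := steps_copyBits (l := l) B.encLen s rfl B.encLen le_rfl σ
    rw [Instr.relocate, runE_append, s₁]
    simp only [runE, stepE, stepDet]
    rw [view_setEl, Mem.setAdv_setEl, v₁]
    congr 3
    funext i
    rw [zero_add, b₁ i i.2]
    rfl
  all_goals
    simp only [Instr.relocate, runE, stepE, stepDet, view_setBit, view_setScal, view_setEl,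
      Mem.setAdv_setBit, Mem.setAdv_setScal, Mem.setAdv_setEl]
    try rfl

/-- Statements of structured programs. -/
inductive Stmt (l p : ℕ)
  /-- assign a condition -/
  | bit (v : BitVar) (e : BitExp l)
  /-- assign one of two exponents -/
  | sel (v : ScalVar l) (c : BitVar) (a b : ScalVar l)
  /-- assign zero -/
  | zero (v : ScalVar l)
  /-- assign the indicator of a condition -/
  | ofBit (v : ScalVar l) (e : BitExp l)
  /-- if the condition `c` holds, write an element into a register of the adversary -/
  | el (k : GrpIdx) (i : ℕ) (c : BitExp l) (G : GrpExp l p)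
  /-- the same for the product of an element and the message `M₁` or `M₀` of the adversary -/
  | elMsg (i : ℕ) (c : BitExp l) (G : GrpExp l p) (M₁ M₀ : ℕ)
  | pair (i j : Fin 12)
  | sample (v : ExpVar l)
  | flip (v : BitVar)
  /-- an instruction of the adversary -/
  | loc (i : Instr)

noncomputable def GrpExp.evalMem {k : GrpIdx} (m : Mem B l) (G : GrpExp l B.p) : B.El k :=
  G.eval (fun v => m.el k (.base v)) fun v => m.scal (.exp v)

namespace Stmt

/-- The average of `F` over the results of a statement. -/
noncomputable def den (s : Stmt l B.p) (F : Mem B l → ℝ) (m : Mem B l) : ℝ :=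
  match s with
  | bit v e => F (m.setBit v (e.eval m))
  | sel v c a b => F (m.setScal v (if m.bit c then m.scal a else m.scal b))
  | zero v => F (m.setScal v 0)
  | ofBit v e => F (m.setScal v (if e.eval m then 1 else 0))
  | el k i c G => F (m.setEl k (.adv i) (if c.eval m then G.evalMem m else m.el k (.adv i)))
  | elMsg i c G M₁ M₀ => F (m.setEl .target (.adv i) (if c.eval m then
      G.evalMem m * m.el .target (.adv (if m.bit .coin then M₁ else M₀))
      else m.el .target (.adv i)))
  | pair i j => F (m.setEl .target (.base (.pair i j))
      (B.e (m.el .left (.base (.inp i))) (m.el .right (.base (.inp j)))))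
  | sample v => 𝔼 x : ZMod B.p, F (m.setScal (.exp v) x)
  | flip v => 𝔼 b : Bool, F (m.setBit v b)
  | loc i => stepE i (fun ρ => F (m.setAdv ρ)) m.advState

def code (L : ℕ) : Stmt l p → List Instr
  | bit v e => e.code L 0 ++ [.bitMux (bitAddr L v) 0 (bitTemp L 0) (bitTemp L 0)]
  | sel v c a b => [.scalMux (scalAddr v) (bitAddr L c) (scalAddr a) (scalAddr b)]
  | zero v => [.scalConst (scalAddr v) 0]
  | ofBit v e => e.code L 0 ++ [.scalConst (expTemp 1) 1, .scalConst (expTemp 0) 0,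
      .scalMux (scalAddr v) (bitTemp L 0) (expTemp 1) (expTemp 0)]
  | el k i c G => c.code L 0 ++ (G.code k ++
      [.elMux k (elAddr (.adv i)) (bitTemp L 0) (elTemp 0) (elAddr (.adv i))])
  | elMsg i c G M₁ M₀ => c.code L 0 ++ (G.code .target ++
      [.elMux .target (elTemp 1) (bitAddr L .coin) (elAddr (.adv M₁)) (elAddr (.adv M₀)),
        .elMul .target (elTemp 0) (elTemp 0) (elTemp 1),
        .elMux .target (elAddr (.adv i)) (bitTemp L 0) (elTemp 0) (elAddr (.adv i))])
  | pair i j => [.pairing (elAddr (.base (.pair i j))) (elAddr (.base (.inp i)))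
      (elAddr (.base (.inp j)))]
  | sample v => [.scalSample (scalAddr (.exp v : ScalVar l))]
  | flip v => [.bitFlip (bitAddr L v)]
  | loc i => i.relocate l L

def size (L : ℕ) : Stmt l p → ℕ
  | bit _ e => e.size + 1
  | ofBit _ e => e.size + 3
  | el _ _ c G => c.size + G.size + 1
  | elMsg _ c G _ _ => c.size + G.size + 3
  | loc _ => L + 1
  | _ => 1

theorem length_code (L : ℕ) (s : Stmt l p) : (s.code L).length ≤ s.size L := by
  cases s <;> simp [code, size, BitExp.length_code, GrpExp.length_code, Instr.length_relocate]
    <;> omega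

/-- Observables that factor through `view` are mapped to observables of the same kind, because the
code leaves its results in named registers only. All later reasoning can therefore take place in
`Mem` and forget temporaries and addresses. -/
theorem runE_code (s : Stmt l B.p) (F : Mem B l → ℝ) (σ : State B) :
    runE (s.code B.encLen) (fun ρ => F (view l ρ)) σ = s.den F (view l σ) := by
  cases s with
  | bit v e =>
    obtain ⟨σ₁, s₁, v₁, e₁, -⟩ := e.steps_code 0 σ
    rw [code, runE_append, s₁]
    simp [runE, stepE, stepDet, view_setBit, v₁, e₁, den]
  | sel v c a b =>
    simp [code, runE, stepE, stepDet, view_setScal, den]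
    rfl
  | zero v => simp [code, runE, stepE, stepDet, view_setScal, den]
  | ofBit v e =>
    obtain ⟨σ₁, s₁, v₁, e₁, -⟩ := e.steps_code 0 σ
    have h01 : expTemp 1 ≠ expTemp 0 := by unfold expTemp; omega
    rw [code, runE_append, s₁]
    simp only [runE, stepE, stepDet, view_setScal, view_setScal_temp, v₁, den]
    simp [State.setScal, e₁, h01]
  | el k i c G =>
    obtain ⟨σ₁, s₁, v₁, e₁, -⟩ := c.steps_code 0 σ
    obtain ⟨σ₂, s₂, v₂, e₂, b₂⟩ := GrpExp.steps_code k G σ₁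
    rw [code, runE_append, s₁, runE_append, s₂]
    simp only [runE, stepE, stepDet, view_setEl, den, GrpExp.evalMem, e₂, b₂, e₁]
    rw [v₂, v₁, ← v₁, ← v₂]
    rfl
  | elMsg i c G M₁ M₀ =>
    obtain ⟨σ₁, s₁, v₁, e₁, -⟩ := c.steps_code 0 σ
    obtain ⟨σ₂, s₂, v₂, e₂, b₂⟩ := GrpExp.steps_code .target G σ₁
    have h01 : elTemp 0 ≠ elTemp 1 := by unfold elTemp; omega
    rw [code, runE_append, s₁, runE_append, s₂]
    simp only [runE, stepE, stepDet, view_setEl, view_setEl_temp, den, GrpExp.evalMem]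
    rw [v₂, v₁]
    congr 2
    have h3 : ∀ v, σ₂.el .target (elAddr v) = (view l σ).el .target v := fun v => by
      rw [← v₁, ← v₂]; rfl
    have h4 : σ₂.bit (bitAddr B.encLen .coin) = (view l σ).bit .coin := by
      rw [← v₁, ← v₂]; rfl
    have h5 := elAddr_ne_temp (.adv i) 0
    have h6 := elAddr_ne_temp (.adv i) 1
    have h7 : σ₂.bit (bitTemp B.encLen 0) = c.eval (view l σ) := by rw [b₂, e₁]
    simp only [State.setEl, Function.update_self, h7, Function.update_of_ne h01,
      Function.update_of_ne h5, Function.update_of_ne h6, e₂, h3, h4, v₁]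
    cases c.eval (view l σ) <;> cases (view l σ).bit .coin <;> simp
  | pair i j =>
    simp [code, runE, stepE, stepDet, view_setEl, den]
    rfl
  | sample v => simp [code, runE, stepE, view_setScal, den]
  | flip v => simp [code, runE, stepE, view_setBit, den]
  | loc i => exact runE_relocate i F σ

/-- The average of `F` over the results of a list of statements. -/
noncomputable def denList : List (Stmt l B.p) → (Mem B l → ℝ) → Mem B l → ℝ
  | [], F => F
  | s :: S, F => s.den (denList S F)

theorem denList_append (S T : List (Stmt l B.p)) (F : Mem B l → ℝ) :
    denList (S ++ T) F = denList S (denList T F) := by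
  induction S with
  | nil => rfl
  | cons s S ih => rw [List.cons_append, denList, ih, denList]

theorem runE_codeList (S : List (Stmt l B.p)) (F : Mem B l → ℝ) (σ : State B) :
    runE (S.flatMap (code B.encLen)) (fun ρ => F (view l ρ)) σ = denList S F (view l σ) := by
  induction S generalizing σ with
  | nil => rfl
  | cons s S ih =>
    rw [List.flatMap_cons, runE_append, show runE (S.flatMap (code B.encLen))
      (fun ρ => F (view l ρ)) = fun ρ => denList S F (view l ρ) from funext ih, runE_code]
    rfl

end Stmt

end Statements

/-! ### Challengers and the adversary's probability of winning -/

section Games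

variable {B : BilinearGroup} {l : ℕ}

/-- A challenger: public parameters, private keys (which may depend on the number of
earlier key requests), and challenge ciphertexts, with the random coins in `K` and `C`. -/
structure Challenger (B : BilinearGroup) (l : ℕ) (K C : Type) where
  pp : PublicParams B l
  key : ℕ → ID B → K → PrivateKey B l
  ct : ID B → B.GT → C → Ciphertext B

def Config.addKey (s : Config B) (d : ℕ) (J : ID B) (sk : PrivateKey B l) : Config B :=
  { s with
    regs := s.regs.writeEl .right d sk.toList
    queried := s.queried ++ [J] }

def Config.addChal (s : Config B) (d d' : ℕ) (J₀ J₁ : ID B) (ct : Ciphertext B) : Config B :=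
  { s with
    regs := (s.regs.writeEl .left d (List.ofFn ct.C₁ ++ List.ofFn ct.C₂)).setEl .target d' ct.C
    challenge := some (J₀, J₁) }

variable {K C : Type} [Fintype K] [Nonempty K] [Fintype C] [Nonempty C]

open Classical in
/-- The average of `f` over the results of one step of an adversary that gets at most `q` keys. -/
noncomputable def advStepE (ch : Challenger B l K C) (q : ℕ) (γ : Bool) (i : AdvInstr)
    (f : Config B → ℝ) (s : Config B) : ℝ :=
  match i with
  | .loc i => stepE i (fun σ => f { s with regs := σ }) s.regs
  | .key c I d =>
      if s.regs.bit c = true ∧ KeyAllowed l s (I.map s.regs.scal) ∧ s.queried.length < q then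
        𝔼 r, f (s.addKey d (I.map s.regs.scal)
          (ch.key s.queried.length (I.map s.regs.scal) r))
      else f s
  | .chal c I₀ I₁ M₀ M₁ d d' =>
      if s.regs.bit c = true ∧ ChalAllowed l s (I₀.map s.regs.scal) (I₁.map s.regs.scal) then
        𝔼 r, f (s.addChal d d' (I₀.map s.regs.scal) (I₁.map s.regs.scal)
          (ch.ct (if γ then I₁.map s.regs.scal else I₀.map s.regs.scal)
            (s.regs.el .target (if γ then M₁ else M₀)) r))
      else f s

noncomputable def advRunE (ch : Challenger B l K C) (q : ℕ) (γ : Bool) :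
    List AdvInstr → (Config B → ℝ) → Config B → ℝ
  | [], f => f
  | i :: is, f => advStepE ch q γ i (advRunE ch q γ is f)

def PublicParams.init (pp : PublicParams B l) : Config B where
  regs := State.input pp.toList (List.ofFn pp.W) [pp.Ω]
  queried := []
  challenge := none

/-- The indicator of the event that the guess is correct. -/
def guessed (γ : Bool) (s : Config B) : ℝ := if γ = s.regs.bit 0 then 1 else 0

/-- The probability that the adversary guesses correctly. -/
noncomputable def Challenger.value (ch : Challenger B l K C) (q : ℕ) (A : List AdvInstr) : ℝ :=
  𝔼 γ : Bool, advRunE ch q γ A (guessed γ) ch.pp.init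

theorem stepE_mem_unit (i : Instr) {f : State B → ℝ} (h : ∀ σ, f σ ∈ Set.Icc (0 : ℝ) 1)
    (σ : State B) : stepE i f σ ∈ Set.Icc (0 : ℝ) 1 := by
  cases i <;> first | exact h _ | exact expect_mem_unit fun _ => h _

theorem ite_mem_unit {P : Prop} {_ : Decidable P} {a b : ℝ} (ha : a ∈ Set.Icc (0 : ℝ) 1)
    (hb : b ∈ Set.Icc (0 : ℝ) 1) : (if P then a else b) ∈ Set.Icc (0 : ℝ) 1 := by
  split_ifs <;> assumption

theorem advRunE_mem_unit (ch : Challenger B l K C) (q : ℕ) (γ : Bool) (A : List AdvInstr)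
    {f : Config B → ℝ} (h : ∀ s, f s ∈ Set.Icc (0 : ℝ) 1) (s : Config B) :
    advRunE ch q γ A f s ∈ Set.Icc (0 : ℝ) 1 := by
  induction A generalizing s with
  | nil => exact h s
  | cons i is ih =>
    unfold advRunE advStepE
    cases i with
    | loc i => exact stepE_mem_unit i (fun σ => ih _) _
    | key c I d =>
      refine ite_mem_unit ?_ (ih _)
      exact expect_mem_unit fun _ => ih _
    | chal =>
      refine ite_mem_unit ?_ (ih _)
      exact expect_mem_unit fun _ => ih _

theorem guessed_mem_unit (γ : Bool) (s : Config B) : guessed γ s ∈ Set.Icc (0 : ℝ) 1 := by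
  unfold guessed; split_ifs <;> simp

theorem Challenger.value_mem_unit (ch : Challenger B l K C) (q : ℕ) (A : List AdvInstr) :
    ch.value q A ∈ Set.Icc (0 : ℝ) 1 :=
  expect_mem_unit fun γ => advRunE_mem_unit ch q γ A (guessed_mem_unit γ) _

theorem stepE_congr (i : Instr) {f g : State B → ℝ} (h : ∀ σ, f σ = g σ) (σ : State B) :
    stepE i f σ = stepE i g σ := by rw [funext h]

theorem ite_congr_of {P : Prop} {_ : Decidable P} {a b a' b' : ℝ} (ha : P → a = a') (hb : b = b') :
    (if P then a else b) = if P then a' else b' := by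
  split_ifs with h
  exacts [ha h, hb]

/-- Challengers whose answers have the same laws are indistinguishable. -/
theorem Challenger.value_congr {K' C' : Type} [Fintype K'] [Nonempty K'] [Fintype C'] [Nonempty C']
    (ch : Challenger B l K C) (ch' : Challenger B l K' C') (hpp : ch.pp = ch'.pp) (q : ℕ)
    (hkey : ∀ (n : ℕ) (I : ID B), n < q → ValidID l I → ∀ F : PrivateKey B l → ℝ,
      𝔼 r, F (ch.key n I r) = 𝔼 r, F (ch'.key n I r))
    (hct : ∀ (I : ID B) (M : B.GT), ValidID l I → ∀ F : Ciphertext B → ℝ,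
      𝔼 r, F (ch.ct I M r) = 𝔼 r, F (ch'.ct I M r))
    (A : List AdvInstr) : ch.value q A = ch'.value q A := by
  unfold Challenger.value
  rw [hpp]
  refine Finset.expect_congr rfl fun γ _ => ?_
  generalize ch'.pp.init = s
  induction A generalizing s with
  | nil => rfl
  | cons i is ih =>
    unfold advRunE advStepE
    cases i with
    | loc i => exact stepE_congr i (fun σ => ih _) _
    | key c I d =>
      refine ite_congr_of (fun h => ?_) (ih s)
      simp only [ih]
      exact hkey _ _ h.2.2 h.2.1.1 fun sk => advRunE ch' q γ is (guessed γ) (s.addKey d _ sk)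
    | chal c I₀ I₁ M₀ M₁ d d' =>
      refine ite_congr_of (fun h => ?_) (ih s)
      simp only [ih]
      refine hct _ _ ?_ fun ct => advRunE ch' q γ is (guessed γ) (s.addChal d d' _ _ ct)
      cases γ
      exacts [h.2.2.1, h.2.2.2.1]

theorem stepE_add (i : Instr) (f g : State B → ℝ) (σ : State B) :
    stepE i (fun σ => f σ + g σ) σ = stepE i f σ + stepE i g σ := by
  cases i <;> first | rfl | exact Finset.expect_add_distrib _ _ _

theorem advRunE_add (ch : Challenger B l K C) (q : ℕ) (γ : Bool) (A : List AdvInstr)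
    (f g : Config B → ℝ) (s : Config B) : advRunE ch q γ A (fun s => f s + g s) s =
      advRunE ch q γ A f s + advRunE ch q γ A g s := by
  induction A generalizing s with
  | nil => rfl
  | cons i is ih =>
    unfold advRunE advStepE
    simp only [funext ih]
    cases i with
    | loc i => exact stepE_add _ _ _ _
    | key c I d =>
      dsimp only
      rw [Finset.expect_add_distrib, ite_add_ite]
    | chal c I₀ I₁ M₀ M₁ d d' =>
      dsimp only
      rw [Finset.expect_add_distrib, ite_add_ite]

theorem stepE_const (i : Instr) (a : ℝ) (σ : State B) : stepE i (fun _ => a) σ = a := by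
  cases i <;> first | rfl | exact Fintype.expect_const (M := ℝ) a

theorem advRunE_const (ch : Challenger B l K C) (q : ℕ) (γ : Bool) (A : List AdvInstr)
    (a : ℝ) (s : Config B) : advRunE ch q γ A (fun _ => a) s = a := by
  induction A generalizing s with
  | nil => rfl
  | cons i is ih =>
    unfold advRunE advStepE
    simp only [funext ih]
    cases i with
    | loc i => exact stepE_const _ _ _
    | key c I d => simp
    | chal c I₀ I₁ M₀ M₁ d d' => simp

/-- If the challenge ciphertext does not depend on the coin, it has to be guessed blindly. -/
theorem Challenger.value_eq_half (ch : Challenger B l K C)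
    (hct : ∀ I M I' M' r, ch.ct I M r = ch.ct I' M' r) (q : ℕ) (A : List AdvInstr) :
    ch.value q A = 1 / 2 := by
  have h1 : ∀ (f : Config B → ℝ) s, advRunE ch q true A f s = advRunE ch q false A f s := by
    intro f s
    induction A generalizing s with
    | nil => rfl
    | cons i is ih =>
      unfold advRunE advStepE
      cases i with
      | loc i => exact stepE_congr i (fun σ => ih _) _
      | key c I d => dsimp only; simp only [ih]
      | chal c I₀ I₁ M₀ M₁ d d' =>
        refine ite_congr_of (fun h => ?_) (ih s)
        exact Finset.expect_congr rfl fun r _ => by rw [ih]; congr 2; apply hct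
  -- Both values of the coin lead to the same run, and at its end exactly one of them is guessed
  -- correctly.
  have h2 : ∀ s : Config B, guessed true s + guessed false s = 1 := by
    intro s
    unfold guessed; cases s.regs.bit 0 <;> simp
  unfold Challenger.value
  rw [Fintype.expect_eq_sum_div_card, Fintype.sum_bool, h1, ← advRunE_add]
  simp [h2, advRunE_const]

/-! ### Lazy sampling -/

/-- The challenger that answers the key request number `k` and the challenge with independent
coins. -/
noncomputable def freshChallenger {X : Type} [Nonempty X] (ch : X → Challenger B l K C) :
    Challenger B l (X × K) (X × C) where
  pp := (ch (Classical.arbitrary X)).pp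
  key n I r := (ch r.1).key n I r.2
  ct I M r := (ch r.1).ct I M r.2

section Lazy

variable {X : Type} [Fintype X] [Nonempty X]

theorem sum_mul_stepE (w : X → ℝ) (i : Instr) (f : X → State B → ℝ) (σ : State B) :
    ∑ x, w x * stepE i (f x) σ = stepE i (fun σ => ∑ x, w x * f x σ) σ := by
  cases i <;> first | rfl | (simp only [stepE, Finset.mul_expect]; rw [Finset.expect_sum_comm])

theorem stepE_mul (a : ℝ) (i : Instr) (f : State B → ℝ) (σ : State B) :
    stepE i (fun σ => a * f σ) σ = a * stepE i f σ := by
  cases i <;> first | rfl | (simp only [stepE, Finset.mul_expect])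

/-- Grouping a weighted sum by the values of `g`. -/
theorem sum_mul_fiberwise {Y : Type} (w : X → ℝ) (g : X → Y) (R : X → Y → ℝ) (R' : Y → ℝ)
    (h : ∀ F : Y → ℝ, ∀ y, (∀ z, z ≠ y → F z = 0) →
      ∑ x, (w x * F (g x)) * R x y = (∑ x, w x * F (g x)) * R' y) :
    ∑ x, w x * R x (g x) = ∑ x, w x * R' (g x) := by
  classical
  have e : ∀ T : X → Y → ℝ, ∑ x, w x * T x (g x) =
      ∑ y ∈ Finset.univ.image g, ∑ x, (w x * (if g x = y then 1 else 0)) * T x y := by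
    intro T
    rw [Finset.sum_comm]
    refine Finset.sum_congr rfl fun x _ => ?_
    rw [Finset.sum_eq_single (g x)]
    · simp
    · intro y _ hy
      simp [Ne.symm hy]
    · intro hx
      exact absurd (Finset.mem_image_of_mem g (Finset.mem_univ x)) hx
  rw [e, e fun _ => R']
  refine Finset.sum_congr rfl fun y _ => ?_
  rw [h (fun z => if z = y then 1 else 0) y fun z hz => by simp [hz], Finset.sum_mul]

/-- The coins `x` are sampled eagerly on the left and anew for each answer on the right. The weight
`w` plays the role of the unnormalised posterior of `x` given the answers so far. The three
hypotheses say that under `w` the pending answers still have their prior laws, jointly if both are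
pending. They are guarded by what can still happen, so an answer that has been given drops out. The
induction must carry an arbitrary `w`, since answering reweights it. -/
theorem advRunE_lazy (ch : X → Challenger B l K C) (k q : ℕ) (γ : Bool)
    (hkey : ∀ x x' n I r, n ≠ k → (ch x).key n I r = (ch x').key n I r)
    (f : Config B → ℝ) (A : List AdvInstr) (s : Config B) (w : X → ℝ)
    (hk : s.queried.length ≤ k → ∀ I, ValidID l I → (∀ c ∈ s.challenge, ¬ I <+: c.1 ∧ ¬ I <+: c.2) →
      ∀ r (F : PrivateKey B l → ℝ), ∑ x, w x * F ((ch x).key k I r) =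
        (∑ x, w x) * 𝔼 x, F ((ch x).key k I r))
    (hc : s.challenge = none → ∀ I M, ValidID l I → (∀ J ∈ s.queried, ¬ J <+: I) →
      ∀ r (H : Ciphertext B → ℝ), ∑ x, w x * H ((ch x).ct I M r) =
        (∑ x, w x) * 𝔼 x, H ((ch x).ct I M r))
    (hj : s.queried.length ≤ k → s.challenge = none → ∀ J I M, ValidID l J → ValidID l I →
      ¬ J <+: I → ∀ r r' (F : PrivateKey B l → ℝ) (H : Ciphertext B → ℝ),
      ∑ x, w x * (F ((ch x).key k J r) * H ((ch x).ct I M r')) =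
        (∑ x, w x) * ((𝔼 x, F ((ch x).key k J r)) * 𝔼 x, H ((ch x).ct I M r'))) :
    ∑ x, w x * advRunE (ch x) q γ A f s =
      (∑ x, w x) * advRunE (freshChallenger ch) q γ A f s := by
  induction A generalizing s w with
  | nil => simp [advRunE, Finset.sum_mul]
  | cons i is ih =>
    simp only [advRunE]
    cases i with
    | loc i =>
      simp only [advStepE]
      rw [sum_mul_stepE, ← stepE_mul]
      exact stepE_congr i (fun σ => ih { s with regs := σ } w hk hc hj) _
    | key c I d =>
      simp only [advStepE]
      by_cases h : s.regs.bit c = true ∧ KeyAllowed l s (I.map s.regs.scal) ∧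
        s.queried.length < q
      swap
      · simp only [if_neg h]
        exact ih s w hk hc hj
      simp only [if_pos h]
      set J := I.map s.regs.scal
      have hJ := h.2.1
      by_cases hn : s.queried.length = k
      -- The distinguished key is given out. Conditioning on its value multiplies `w` by a function
      -- `F` of the key, and the induction hypothesis is applied to the new weight.
      · have step : ∀ r, ∑ x, w x * advRunE (ch x) q γ is f (s.addKey d J ((ch x).key k J r)) =
            (∑ x, w x) * 𝔼 x, advRunE (freshChallenger ch) q γ is f
              (s.addKey d J ((ch x).key k J r)) := by
          intro r
          rw [← hk hn.le J hJ.1 hJ.2 r fun sk =>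
            advRunE (freshChallenger ch) q γ is f (s.addKey d J sk)]
          refine sum_mul_fiberwise w (fun x => (ch x).key k J r)
            (fun x sk => advRunE (ch x) q γ is f (s.addKey d J sk))
            (fun sk => advRunE (freshChallenger ch) q γ is f (s.addKey d J sk)) ?_
          intro F sk _
          refine ih _ _ ?_ ?_ ?_
          · intro h1
            simp [Config.addKey, hn] at h1
          · intro h1 I' M hI' h2 r' H
            have h3 : ¬ J <+: I' := h2 J (by simp [Config.addKey])
            -- A later challenge must avoid `J`, which is now in the list of queries, so joint
            -- independence shows that the reweighting leaves the law of the ciphertext unchanged.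
            have := hj hn.le h1 J I' M hJ.1 hI' h3 r r' F H
            simp only [← mul_assoc] at this
            rw [this, hk hn.le J hJ.1 hJ.2 r F]
          · intro h1
            simp [Config.addKey, hn] at h1
        simp only [Finset.mul_expect]
        rw [← Finset.expect_sum_comm]
        simp only [hn, step]
        simp only [freshChallenger, expect_prod_type]
        rw [← Finset.mul_expect, expect_swap]
        simp only [Finset.mul_expect]
      · simp only [Finset.mul_expect]
        rw [← Finset.expect_sum_comm]
        have x₀ : X := Classical.arbitrary X
        have step : ∀ r, ∑ x, w x * advRunE (ch x) q γ is f
            (s.addKey d J ((ch x).key s.queried.length J r)) = (∑ x, w x) *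
              advRunE (freshChallenger ch) q γ is f
                (s.addKey d J ((ch x₀).key s.queried.length J r)) := by
          intro r
          -- The other keys do not involve `x`, so they reveal nothing about it and the weight stays
          -- the same.
          simp only [fun x => hkey x x₀ _ J r hn]
          refine ih _ w ?_ ?_ ?_
          · intro h1 I' hI' h2
            refine hk ?_ I' hI' h2
            simp [Config.addKey] at h1
            omega
          · intro h1 I' M hI' h2
            exact hc h1 I' M hI' fun J' hJ' => h2 J' (by simp [Config.addKey, hJ'])
          · intro h1 h2
            refine hj ?_ h2
            simp [Config.addKey] at h1
            omega
        simp only [step]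
        rw [← Finset.mul_expect, ← Finset.mul_expect]
        congr 1
        simp only [freshChallenger, expect_prod_type, fun x r => hkey x x₀ _ J r hn]
        rw [Fintype.expect_const]
    | chal c I₀ I₁ M₀ M₁ d d' =>
      simp only [advStepE]
      by_cases h : s.regs.bit c = true ∧
        ChalAllowed l s (I₀.map s.regs.scal) (I₁.map s.regs.scal)
      swap
      · simp only [if_neg h]
        exact ih s w hk hc hj
      simp only [if_pos h]
      set J₀ := I₀.map s.regs.scal
      set J₁ := I₁.map s.regs.scal
      set J := if γ then J₁ else J₀ with hJ
      set M := s.regs.el .target (if γ then M₁ else M₀)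
      obtain ⟨-, h1, h2, h3, -, h4⟩ := h
      have hv : ValidID l J := by rw [hJ]; cases γ <;> assumption
      have hq : ∀ I ∈ s.queried, ¬ I <+: J := by
        intro I hI
        rw [hJ]; cases γ
        exacts [(h4 I hI).1, (h4 I hI).2]
      -- The same conditioning for the challenge: the weight is multiplied by a function of the
      -- ciphertext, and a later request for key `k` is allowed only for an identity that is not a
      -- prefix of the challenge.
      have step : ∀ r, ∑ x, w x * advRunE (ch x) q γ is f
          (s.addChal d d' J₀ J₁ ((ch x).ct J M r)) =
            (∑ x, w x) * 𝔼 x, advRunE (freshChallenger ch) q γ is f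
              (s.addChal d d' J₀ J₁ ((ch x).ct J M r)) := by
        intro r
        rw [← hc h1 J M hv hq r fun ct =>
          advRunE (freshChallenger ch) q γ is f (s.addChal d d' J₀ J₁ ct)]
        refine sum_mul_fiberwise w (fun x => (ch x).ct J M r)
          (fun x ct => advRunE (ch x) q γ is f (s.addChal d d' J₀ J₁ ct))
          (fun ct => advRunE (freshChallenger ch) q γ is f (s.addChal d d' J₀ J₁ ct)) ?_
        intro F ct _
        refine ih _ _ ?_ ?_ ?_
        · intro hl I hI hno r' G
          have h3' : ¬ I <+: J := by
            have := hno (J₀, J₁) rfl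
            rw [hJ]; cases γ
            exacts [this.1, this.2]
          have := hj hl h1 I J M hI hv h3' r' r G F
          rw [mul_comm (𝔼 x, G _)] at this
          simp only [mul_comm (G _), ← mul_assoc] at this
          rw [this, hc h1 J M hv hq r F]
        · intro h1'
          simp [Config.addChal] at h1'
        · intro _ h1'
          simp [Config.addChal] at h1'
      simp only [Finset.mul_expect]
      rw [← Finset.expect_sum_comm]
      simp only [step]
      simp only [freshChallenger, expect_prod_type]
      rw [← Finset.mul_expect, expect_swap]
      simp only [Finset.mul_expect]

/-- Random coins that are used for one private key and for the challenge ciphertext only may be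
sampled anew for each of them, provided that the answers are independent of each other. -/
theorem Challenger.value_lazy (ch : X → Challenger B l K C) (k q : ℕ)
    (hpp : ∀ x x', (ch x).pp = (ch x').pp)
    (hkey : ∀ x x' n I r, n ≠ k → (ch x).key n I r = (ch x').key n I r)
    (hj : ∀ J I M, ValidID l J → ValidID l I →
      ¬ J <+: I → ∀ r r' (F : PrivateKey B l → ℝ) (H : Ciphertext B → ℝ),
      𝔼 x, (F ((ch x).key k J r) * H ((ch x).ct I M r')) =
        (𝔼 x, F ((ch x).key k J r)) * 𝔼 x, H ((ch x).ct I M r'))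
    (A : List AdvInstr) :
    𝔼 x, (ch x).value q A = (freshChallenger ch).value q A := by
  unfold Challenger.value
  rw [expect_swap]
  refine Finset.expect_congr rfl fun γ _ => ?_
  have hcard : (Fintype.card X : ℝ) ≠ 0 := by simp
  have key := advRunE_lazy ch k q γ hkey (guessed γ) A (freshChallenger ch).pp.init (fun _ => 1)
    ?_ ?_ ?_
  · rw [Fintype.expect_eq_sum_div_card, div_eq_iff hcard]
    simp only [one_mul] at key
    rw [show (∑ x : X, advRunE (ch x) q γ A (guessed γ) (ch x).pp.init) =
      ∑ x : X, advRunE (ch x) q γ A (guessed γ) (freshChallenger ch).pp.init from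
      Finset.sum_congr rfl fun x _ => by rw [hpp x (Classical.arbitrary X)]; rfl, key]
    simp [mul_comm]
  · intro _ I _ _ r F
    simp
  · intro _ I M _ _ r H
    simp
  · intro _ _ J I M hJ hI hp r r' F H
    rw [← hj J I M hJ hI hp]
    simp

end Lazy

end Games

/-! ### The experiment with a cap on the number of keys -/

section RealExperiment

variable {B : BilinearGroup} {l : ℕ}

/-- The coins of `keyGen`. -/
abbrev KeyCoins (B : BilinearGroup) (l : ℕ) : Type :=
  ZMod B.p × ZMod B.p × ZMod B.p × (Fin l → ZMod B.p) ×
    ZMod B.p × ZMod B.p × ZMod B.p × (Fin l → ZMod B.p)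

/-- The challenger of the security experiment. -/
def realChallenger (mk : MasterKey B l) (pp : PublicParams B l) :
    Challenger B l (KeyCoins B l) (ZMod B.p) where
  pp := pp
  key _ I := fun (r₁, c₁, c₂, c₃, r₂, c₄, c₅, c₆) =>
    { K₁ := ![mk.ĝα * idProd mk.ĥ mk.û I ^ r₁ * pp.W 0 ^ c₁, pp.W 1 ^ c₁, pp.W 2 ^ c₁]
      K₂ := ![mk.ĝ ^ r₁ * pp.W 0 ^ c₂, pp.W 1 ^ c₂, pp.W 2 ^ c₂]
      L := levelsAfter I.length fun i =>
        ![mk.û i ^ r₁ * pp.W 0 ^ c₃ i, pp.W 1 ^ c₃ i, pp.W 2 ^ c₃ i]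
      R₁ := ![idProd mk.ĥ mk.û I ^ r₂ * pp.W 0 ^ c₄, pp.W 1 ^ c₄, pp.W 2 ^ c₄]
      R₂ := ![mk.ĝ ^ r₂ * pp.W 0 ^ c₅, pp.W 1 ^ c₅, pp.W 2 ^ c₅]
      R₃ := levelsAfter I.length fun i =>
        ![mk.û i ^ r₂ * pp.W 0 ^ c₆ i, pp.W 1 ^ c₆ i, pp.W 2 ^ c₆ i] }
  ct I M t :=
    { C := pp.Ω ^ t * M
      C₁ := fun k => pp.g k ^ t
      C₂ := fun k => idProd (pp.h k) (fun i => pp.u i k) I ^ t }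

theorem represents_keyGen (n : ℕ) (I : ID B) (mk : MasterKey B l) (pp : PublicParams B l) :
    Represents (keyGen I mk pp) fun f => 𝔼 r, f ((realChallenger mk pp).key n I r) := by
  have h : Represents (keyGen I mk pp) fun f => 𝔼 r₁ : ZMod B.p, 𝔼 c₁ : ZMod B.p,
      𝔼 c₂ : ZMod B.p, 𝔼 c₃ : Fin l → ZMod B.p, 𝔼 r₂ : ZMod B.p, 𝔼 c₄ : ZMod B.p,
      𝔼 c₅ : ZMod B.p, 𝔼 c₆ : Fin l → ZMod B.p,
      f ((realChallenger mk pp).key n I (r₁, c₁, c₂, c₃, r₂, c₄, c₅, c₆)) :=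
    (Represents.unif _).bind fun _ => (Represents.unif _).bind fun _ =>
      (Represents.unif _).bind fun _ => (Represents.unif _).bind fun _ =>
      (Represents.unif _).bind fun _ => (Represents.unif _).bind fun _ =>
      (Represents.unif _).bind fun _ => (Represents.unif _).bind fun _ => Represents.pure _
  simpa only [expect_prod_type] using h

theorem represents_encrypt (I : ID B) (M : B.GT) (mk : MasterKey B l) (pp : PublicParams B l) :
    Represents (encrypt I M pp) fun f => 𝔼 r, f ((realChallenger mk pp).ct I M r) :=
  (Represents.unif _).bind fun _ => Represents.pure _

/-- The experiment has no quota on keys, while `advRunE` has one. A run that cannot make more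
requests than the quota leaves it inactive. -/
theorem represents_advRun (mk : MasterKey B l) (pp : PublicParams B l) (γ : Bool) (q : ℕ)
    (A : List AdvInstr) (s : Config B) (h : s.queried.length + A.length ≤ q) :
    Represents (advRun mk pp γ A s) fun f => advRunE (realChallenger mk pp) q γ A f s := by
  induction A generalizing s with
  | nil => exact Represents.pure _
  | cons i is ih =>
    simp only [List.length_cons] at h
    simp only [advRun, advRunE]
    cases i with
    | loc i =>
      have h1 := (represents_step i s.regs).bind fun σ =>
        ih { s with regs := σ } (by simpa using by omega)
      have e : (step i s.regs).bind (fun σ => advRun mk pp γ is { s with regs := σ }) =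
          advStep mk pp γ (.loc i) s >>= advRun mk pp γ is := by
        change _ = ((step i s.regs).bind fun σ => PMF.pure { s with regs := σ }).bind _
        simp only [PMF.bind_bind, PMF.pure_bind]
      rw [← e]
      exact h1
    | key c I d =>
      simp only [advStep, advStepE]
      by_cases hc : s.regs.bit c = true ∧ KeyAllowed l s (I.map s.regs.scal)
      · have hq : s.queried.length < q := by omega
        simp only [hc, hq, and_self, if_true]
        have h1 := (represents_keyGen s.queried.length (I.map s.regs.scal) mk pp).bind fun sk =>
          ih (s.addKey d (I.map s.regs.scal) sk) (by simp [Config.addKey]; omega)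
        have e : ((keyGen (I.map s.regs.scal) mk pp).bind fun sk =>
            PMF.pure (s.addKey d (I.map s.regs.scal) sk)).bind (advRun mk pp γ is) =
            (keyGen (I.map s.regs.scal) mk pp).bind fun sk =>
              advRun mk pp γ is (s.addKey d (I.map s.regs.scal) sk) := by
          simp only [PMF.bind_bind, PMF.pure_bind]
        rw [← e] at h1
        exact h1
      · have hc' : ¬ (s.regs.bit c = true ∧ KeyAllowed l s (I.map s.regs.scal) ∧
          s.queried.length < q) := fun h => hc ⟨h.1, h.2.1⟩
        rw [if_neg hc]
        simp only [if_neg hc']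
        have h1 := ih s (by omega)
        rw [← PMF.pure_bind s (advRun mk pp γ is)] at h1
        exact h1
    | chal c I₀ I₁ M₀ M₁ d d' =>
      simp only [advStep, advStepE]
      by_cases hc : s.regs.bit c = true ∧
        ChalAllowed l s (I₀.map s.regs.scal) (I₁.map s.regs.scal)
      · rw [if_pos hc]
        simp only [if_pos hc]
        have h1 := (represents_encrypt (if γ then I₁.map s.regs.scal else I₀.map s.regs.scal)
          (s.regs.el .target (if γ then M₁ else M₀)) mk pp).bind fun ct =>
          ih (s.addChal d d' (I₀.map s.regs.scal) (I₁.map s.regs.scal) ct)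
            (by simp [Config.addChal]; omega)
        have e : ((encrypt (if γ then I₁.map s.regs.scal else I₀.map s.regs.scal)
          (s.regs.el .target (if γ then M₁ else M₀)) pp).bind fun ct =>
            PMF.pure (s.addChal d d' (I₀.map s.regs.scal) (I₁.map s.regs.scal) ct)).bind
              (advRun mk pp γ is) =
            (encrypt (if γ then I₁.map s.regs.scal else I₀.map s.regs.scal)
          (s.regs.el .target (if γ then M₁ else M₀)) pp).bind fun ct =>
              advRun mk pp γ is (s.addChal d d' (I₀.map s.regs.scal) (I₁.map s.regs.scal) ct) := by
          simp only [PMF.bind_bind, PMF.pure_bind]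
        rw [← e] at h1
        exact h1
      · rw [if_neg hc]
        simp only [if_neg hc]
        have h1 := ih s (by omega)
        rw [← PMF.pure_bind s (advRun mk pp γ is)] at h1
        exact h1

variable {K C : Type} [Fintype K] [Nonempty K] [Fintype C] [Nonempty C]

open Classical in
/-- The indicator of the event that there have been more than `n` keys. -/
noncomputable def exceeds (n : ℕ) (s : Config B) : ℝ := if n < s.queried.length then 1 else 0

theorem ite_eq_of {P : Prop} {_ : Decidable P} {a b c : ℝ} (ha : P → a = c) (hb : b = c) :
    (if P then a else b) = c := by
  split_ifs with h
  exacts [ha h, hb]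

theorem stepE_mono (i : Instr) {f g : State B → ℝ} (h : ∀ σ, f σ ≤ g σ) (σ : State B) :
    stepE i f σ ≤ stepE i g σ := by
  cases i <;> first | exact h _ | exact expect_mono_real fun _ => h _

theorem abs_stepE_sub_le (i : Instr) (f g : State B → ℝ) (σ : State B) :
    |stepE i f σ - stepE i g σ| ≤ stepE i (fun σ => |f σ - g σ|) σ := by
  cases i <;> first | exact le_rfl |
    (simp only [stepE]; rw [← Finset.expect_sub_distrib]; exact abs_expect_le _)

/-- The list of queried identities never shrinks. -/
theorem advRunE_exceeds (ch : Challenger B l K C) (q n : ℕ) (γ : Bool) (A : List AdvInstr)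
    (s : Config B) (h : n < s.queried.length) : advRunE ch q γ A (exceeds n) s = 1 := by
  induction A generalizing s with
  | nil => simp [advRunE, exceeds, h]
  | cons i is ih =>
    unfold advRunE advStepE
    cases i with
    | loc i =>
      exact (stepE_congr i (fun σ => ih { s with regs := σ } h) _).trans (stepE_const _ _ _)
    | key c I d =>
      dsimp only
      refine ite_eq_of (fun _ => ?_) (ih s h)
      refine (Finset.expect_congr rfl fun r _ => ih _ ?_).trans (Fintype.expect_const _)
      simp [Config.addKey]; omega
    | chal c I₀ I₁ M₀ M₁ d d' =>
      dsimp only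
      refine ite_eq_of (fun _ => ?_) (ih s h)
      exact (Finset.expect_congr rfl fun r _ => ih (s.addChal d d' _ _ _) h).trans (Fintype.expect_const _)

theorem advRunE_exceeds_eq_zero (ch : Challenger B l K C) (q n : ℕ) (γ : Bool)
    (A : List AdvInstr) (s : Config B) (h : s.queried.length + A.length ≤ n) :
    advRunE ch q γ A (exceeds n) s = 0 := by
  induction A generalizing s with
  | nil => simp [advRunE, exceeds] at *; omega
  | cons i is ih =>
    simp only [List.length_cons] at h
    unfold advRunE advStepE
    cases i with
    | loc i =>
      exact (stepE_congr i (fun σ => ih { s with regs := σ } (by simpa using by omega)) _).trans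
        (stepE_const _ _ _)
    | key c I d =>
      dsimp only
      refine ite_eq_of (fun _ => ?_) (ih s (by omega))
      refine (Finset.expect_congr rfl fun r _ => ih _ ?_).trans (Fintype.expect_const _)
      simp [Config.addKey]; omega
    | chal c I₀ I₁ M₀ M₁ d d' =>
      dsimp only
      refine ite_eq_of (fun _ => ?_) (ih s (by omega))
      refine (Finset.expect_congr rfl fun r _ => ih _ ?_).trans (Fintype.expect_const _)
      simp [Config.addChal]; omega

/-- Refusing to give out more than `q` keys has an effect only if the adversary asks for more. -/
theorem abs_advRunE_sub_le (ch : Challenger B l K C) {q Q : ℕ} (hq : q ≤ Q) (γ : Bool)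
    {f : Config B → ℝ} (hf : ∀ s, f s ∈ Set.Icc (0 : ℝ) 1) (A : List AdvInstr)
    (s : Config B) (h : s.queried.length ≤ q) :
    |advRunE ch Q γ A f s - advRunE ch q γ A f s| ≤ advRunE ch Q γ A (exceeds q) s := by
  induction A generalizing s with
  | nil =>
    simp only [advRunE, exceeds, sub_self, abs_zero]
    split_ifs <;> simp
  | cons i is ih =>
    have ind := fun (Q : ℕ) s => advRunE_mem_unit ch Q γ is hf s
    simp only [advRunE]
    cases i with
    | loc i =>
      exact (abs_stepE_sub_le _ _ _ _).trans
        (stepE_mono i (fun σ => ih { s with regs := σ } h) _)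
    | key c I d =>
      simp only [advStepE]
      by_cases hc : s.regs.bit c = true ∧ KeyAllowed l s (I.map s.regs.scal)
      · by_cases h1 : s.queried.length < q
        · have h2 : s.queried.length < Q := by omega
          simp only [hc, h1, h2, and_self, if_true]
          rw [← Finset.expect_sub_distrib]
          refine (abs_expect_le _).trans (expect_mono_real fun r => ih _ ?_)
          simp [Config.addKey]; omega
        -- Only here can the two runs part: the smaller quota is exhausted and the larger one is
        -- not. The larger run then exceeds `q` for certain, so the right-hand side is 1, which
        -- bounds any difference of probabilities.
        · by_cases h2 : s.queried.length < Q
          · simp only [hc, h1, h2, and_self, and_false, if_true, if_false]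
            have h3 : 𝔼 r, advRunE ch Q γ is (exceeds q) (s.addKey d (I.map s.regs.scal)
                (ch.key s.queried.length (I.map s.regs.scal) r)) = 1 := by
              refine (Finset.expect_congr rfl fun r _ => advRunE_exceeds ch Q q γ is _ ?_).trans
                (Fintype.expect_const _)
              simp [Config.addKey]; omega
            rw [h3]
            have h4 := expect_mem_unit fun r => ind Q (s.addKey d (I.map s.regs.scal)
                (ch.key s.queried.length (I.map s.regs.scal) r))
            have h5 := ind q s
            rw [abs_le]
            constructor <;> linarith [h4.1, h4.2, h5.1, h5.2]
          · simp only [h1, h2, and_false, if_false]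
            exact ih s h
      · have hc' : ∀ Q, ¬ (s.regs.bit c = true ∧ KeyAllowed l s (I.map s.regs.scal) ∧
          s.queried.length < Q) := fun Q h => hc ⟨h.1, h.2.1⟩
        simp only [if_neg (hc' _)]
        exact ih s h
    | chal c I₀ I₁ M₀ M₁ d d' =>
      simp only [advStepE]
      by_cases hc : s.regs.bit c = true ∧
        ChalAllowed l s (I₀.map s.regs.scal) (I₁.map s.regs.scal)
      · simp only [if_pos hc]
        rw [← Finset.expect_sub_distrib]
        exact (abs_expect_le _).trans
          (expect_mono_real fun r => ih (s.addChal d d' _ _ _) h)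
      · simp only [if_neg hc]
        exact ih s h

/-! ### The security experiment in terms of averages -/

def realMaster (ĝ : B.Ghat) (y_h α : ZMod B.p) (y_u : Fin l → ZMod B.p) : MasterKey B l :=
  { ĝ := ĝ, ĝα := ĝ ^ α, ĥ := ĝ ^ y_h, û := fun i => ĝ ^ y_u i }

def realParams (g : B.G) (ĝ : B.Ghat) (ν φ₁ φ₂ y_h : ZMod B.p) (y_u : Fin l → ZMod B.p)
    (y_w α : ZMod B.p) : PublicParams B l :=
  { g := ![g, g ^ ν, g ^ (-(φ₁ + ν * φ₂))]
    h := ![g ^ y_h, (g ^ y_h) ^ ν, (g ^ y_h) ^ (-(φ₁ + ν * φ₂))]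
    u := fun i => ![g ^ y_u i, (g ^ y_u i) ^ ν, (g ^ y_u i) ^ (-(φ₁ + ν * φ₂))]
    W := ![(ĝ ^ y_w) ^ φ₁, (ĝ ^ y_w) ^ φ₂, ĝ ^ y_w]
    Ω := B.e g ĝ ^ α }

variable (B l) in
/-- The average over the coins of `setup`. -/
noncomputable def setupE (f : MasterKey B l → PublicParams B l → ℝ) : ℝ :=
  𝔼 g : B.G, 𝔼 ĝ : B.Ghat, 𝔼 ν : ZMod B.p, 𝔼 φ₁ : ZMod B.p, 𝔼 φ₂ : ZMod B.p,
    𝔼 y_h : ZMod B.p, 𝔼 y_u : Fin l → ZMod B.p, 𝔼 y_w : ZMod B.p, 𝔼 α : ZMod B.p,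
    f (realMaster ĝ y_h α y_u) (realParams g ĝ ν φ₁ φ₂ y_h y_u y_w α)

theorem setupE_sub (f f' : MasterKey B l → PublicParams B l → ℝ) :
    setupE B l f - setupE B l f' = setupE B l fun mk pp => f mk pp - f' mk pp := by
  simp only [setupE, Finset.expect_sub_distrib]

theorem abs_setupE_le {f f' : MasterKey B l → PublicParams B l → ℝ}
    (h : ∀ mk pp, |f mk pp| ≤ f' mk pp) : |setupE B l f| ≤ setupE B l f' := by
  unfold setupE
  repeat refine (abs_expect_le _).trans (expect_mono_real fun _ => ?_)
  exact h _ _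

theorem represents_setup :
    Represents (setup B l) fun f => setupE B l fun mk pp => f (mk, pp) :=
  (Represents.unif _).bind fun _ => (Represents.unif _).bind fun _ =>
    (Represents.unif _).bind fun _ => (Represents.unif _).bind fun _ =>
    (Represents.unif _).bind fun _ => (Represents.unif _).bind fun _ =>
    (Represents.unif _).bind fun _ => (Represents.unif _).bind fun _ =>
    (Represents.unif _).bind fun _ => Represents.pure _

theorem experiment_eq_bind (A : List AdvInstr) : experiment B l A =
    (setup B l).bind fun x => (unif Bool).bind fun γ =>
      (advRun x.1 x.2 γ A x.2.init).bind fun s => PMF.pure (γ, s) := rfl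

theorem represents_experiment (A : List AdvInstr) :
    Represents (experiment B l A) fun f => setupE B l fun mk pp => 𝔼 γ : Bool,
      advRunE (realChallenger mk pp) A.length γ A (fun s => f (γ, s)) pp.init := by
  rw [experiment_eq_bind]
  have h : ∀ x : MasterKey B l × PublicParams B l, Represents ((unif Bool).bind fun γ =>
      (advRun x.1 x.2 γ A x.2.init).bind fun s => PMF.pure (γ, s)) fun f => 𝔼 γ : Bool,
      advRunE (realChallenger x.1 x.2) A.length γ A (fun s => f (γ, s)) x.2.init := fun x =>
    (Represents.unif Bool).bind fun γ => (represents_advRun x.1 x.2 γ A.length A x.2.init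
      (by simp [PublicParams.init])).bind fun s => Represents.pure _
  have h' := Represents.bind (represents_setup (B := B) (l := l)) h
  intro β F b
  exact h' β F b

theorem map_true_eq_zero_iff {α : Type} (μ : PMF α) (w : α → Bool) :
    ((μ.map w) true).toReal = 0 ↔ ∀ x ∈ μ.support, w x = false := by
  rw [ENNReal.toReal_eq_zero_iff, or_iff_left (PMF.apply_ne_top _ _),
    PMF.apply_eq_zero_iff, PMF.support_map]
  constructor
  · intro h x hx
    by_contra hw
    exact h ⟨x, hx, by simpa using hw⟩
  · rintro h ⟨x, hx, hw⟩
    rw [h x hx] at hw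
    cases hw

/-- A bound on the support becomes the vanishing of an average, the form in which it cancels the
error of `abs_advRunE_sub_le`. -/
theorem experiment_queried_le_iff (A : List AdvInstr) (n : ℕ) :
    (∀ x ∈ (experiment B l A).support, x.2.queried.length ≤ n) ↔
      (setupE B l fun mk pp => 𝔼 γ : Bool,
        advRunE (realChallenger mk pp) A.length γ A (exceeds n) pp.init) = 0 := by
  classical
  have h := (represents_experiment (B := B) (l := l) A).toReal_map
    (fun x => decide (n < x.2.queried.length)) true
  simp only [decide_eq_true_eq] at h
  have h2 := map_true_eq_zero_iff (experiment B l A) (fun x => decide (n < x.2.queried.length))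
  rw [h] at h2
  simp only [decide_eq_false_iff_not, not_lt] at h2
  rw [← h2]
  refine Eq.congr ?_ rfl
  congr!

theorem experiment_queried_le_length (A : List AdvInstr) :
    ∀ x ∈ (experiment B l A).support, x.2.queried.length ≤ A.length := by
  rw [experiment_queried_le_iff]
  simp [setupE, advRunE_exceeds_eq_zero, PublicParams.init]

/-- The advantage in terms of a challenger that gives out at most `q` keys. -/
theorem experiment_win_eq (A : List AdvInstr) (q : ℕ) (hqA : q ≤ A.length)
    (hq : ∀ x ∈ (experiment B l A).support, x.2.queried.length ≤ q) :
    (((experiment B l A).map fun x => decide (x.1 = x.2.regs.bit 0)) true).toReal =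
      setupE B l fun mk pp => (realChallenger mk pp).value q A := by
  have h := (represents_experiment (B := B) (l := l) A).toReal_map
    (fun x => decide (x.1 = x.2.regs.bit 0)) true
  simp only [decide_eq_true_eq] at h
  rw [h, ← sub_eq_zero, setupE_sub, ← abs_nonpos_iff]
  rw [experiment_queried_le_iff] at hq
  refine le_of_le_of_eq (abs_setupE_le (B := B) (l := l) fun mk pp => ?_) hq
  unfold Challenger.value
  rw [← Finset.expect_sub_distrib]
  refine (abs_expect_le (α := Bool) _).trans (expect_mono_real fun γ => ?_)
  exact abs_advRunE_sub_le _ hqA γ (guessed_mem_unit γ) A pp.init (Nat.zero_le _)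

end RealExperiment

/-! ### Blocks of statements: copying, sampling, writing -/

section Blocks

variable {B : BilinearGroup} {l : ℕ}

/-- The list of statements `S` leads from `m` to `m'` without coin tosses. -/
def Stmt.Runs (S : List (Stmt l B.p)) (m m' : Mem B l) : Prop := ∀ F, Stmt.denList S F m = F m'

/-- A block of assignments of exponents. -/
theorem Stmt.runs_assign {ι : Type} [DecidableEq ι] (φ : ι → ScalVar l)
    (hφ : Function.Injective φ)
    (st : ι → Stmt l B.p) (val : ι → ZMod B.p) (m : Mem B l)
    (hst : ∀ i (m' : Mem B l), m'.bit = m.bit → (∀ v, (∀ j, v ≠ φ j) → m'.scal v = m.scal v) →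
      ∀ F, (st i).den F m' = F (m'.setScal (φ i) (val i))) (L : List ι) :
    ∃ m', Stmt.Runs (L.map st) m m' ∧ m'.bit = m.bit ∧ m'.el = m.el ∧
      (∀ i ∈ L, m'.scal (φ i) = val i) ∧ ∀ v, (∀ j, v ≠ φ j) → m'.scal v = m.scal v := by
  have gen : ∀ m₁ : Mem B l, m₁.bit = m.bit → m₁.el = m.el →
      (∀ v, (∀ j, v ≠ φ j) → m₁.scal v = m.scal v) →
      ∃ m', Stmt.Runs (L.map st) m₁ m' ∧ m'.bit = m.bit ∧ m'.el = m.el ∧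
      (∀ i, m'.scal (φ i) = if i ∈ L then val i else m₁.scal (φ i)) ∧
      ∀ v, (∀ j, v ≠ φ j) → m'.scal v = m.scal v := by
    induction L with
    | nil => exact fun m₁ h1 h2 h3 => ⟨m₁, fun F => rfl, h1, h2, by simp, h3⟩
    | cons i L ih =>
      intro m₁ h1 h2 h3
      obtain ⟨m', r, b, e, s, u⟩ := ih (m₁.setScal (φ i) (val i)) h1 h2 (fun v hv => by
        simp [Mem.setScal, Function.update_of_ne (hv i), h3 v hv])
      refine ⟨m', fun F => ?_, b, e, fun j => ?_, u⟩
      · rw [List.map_cons, Stmt.denList, hst i m₁ h1 h3, r]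
      · rw [s j]
        by_cases hj : j = i
        · subst hj
          simp [Mem.setScal]
        · simp [Mem.setScal, Function.update_of_ne (hφ.ne hj), hj]
  obtain ⟨m', r, b, e, s, u⟩ := gen m rfl rfl fun _ _ => rfl
  exact ⟨m', r, b, e, fun i hi => by rw [s i, if_pos hi], u⟩

/-- Copy an identity out of the registers of the adversary, and pad it with zeros. -/
def copyId {p : ℕ} (φ : Fin l → ScalVar l) (I : List ℕ) : List (Stmt l p) :=
  (List.finRange l).map fun i : Fin l => match I[(i : ℕ)]? with
    | some a => .sel (φ i) .ok (.adv a) (.adv a)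
    | none => .zero (φ i)

theorem runs_copyId (φ : Fin l → ScalVar l) (hφ : Function.Injective φ)
    (hadv : ∀ i a, φ i ≠ .adv a) (I : List ℕ) (m : Mem B l) :
    ∃ m', Stmt.Runs (copyId φ I) m m' ∧ m'.bit = m.bit ∧ m'.el = m.el ∧
      (∀ i, m'.scal (φ i) = (I.map m.advState.scal).getD i 0) ∧
      ∀ v, (∀ j, v ≠ φ j) → m'.scal v = m.scal v := by
  obtain ⟨m', r, b, e, s, u⟩ := Stmt.runs_assign φ hφ (fun i : Fin l => match I[(i : ℕ)]? with
    | some a => .sel (φ i) .ok (.adv a) (.adv a)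
    | none => .zero (φ i)) (fun i => (I.map m.advState.scal).getD i 0) m (by
      intro i m' hb hs F
      rcases h : I[(i : ℕ)]? with _ | a
      · simp [Stmt.den, h]
      · simp [Stmt.den, h, hs _ fun j => (hadv j a).symm, Mem.advState]) (List.finRange l)
  exact ⟨m', r, b, e, fun i => s i (List.mem_finRange i), u⟩

/-! ### Sampling -/

open Classical in
/-- Set the exponents `φ v` for `v ∈ L`. -/
noncomputable def Mem.setOn {V : Type} (φ : V → ExpVar l) (L : List V) (x : V → ZMod B.p)
    (m : Mem B l) : Mem B l :=
  { m with scal := fun s => if h : ∃ v ∈ L, s = .exp (φ v) then x h.choose else m.scal s }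

theorem Mem.setOn_mem {V : Type} {φ : V → ExpVar l} (hφ : Function.Injective φ) {L : List V}
    (x : V → ZMod B.p) (m : Mem B l) {v : V} (hv : v ∈ L) :
    (m.setOn φ L x).scal (.exp (φ v)) = x v := by
  have h : ∃ w ∈ L, (.exp (φ v) : ScalVar l) = .exp (φ w) := ⟨v, hv, rfl⟩
  simp only [Mem.setOn, dif_pos h]
  exact congrArg x (hφ (ScalVar.exp.inj h.choose_spec.2)).symm

theorem Mem.setOn_not_mem {V : Type} {φ : V → ExpVar l} {L : List V}
    (x : V → ZMod B.p) (m : Mem B l) {s : ScalVar l} (hv : ∀ v ∈ L, s ≠ .exp (φ v)) :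
    (m.setOn φ L x).scal s = m.scal s := by
  simp only [Mem.setOn]
  rw [dif_neg]
  rintro ⟨v, h, h'⟩
  exact hv v h h'

/-- By `expect_update`, drawing coordinates one after the other amounts to drawing the whole vector
at once. The list must be free of repetitions, or a later draw would overwrite an earlier one. -/
theorem Stmt.denList_sample {V : Type} [Fintype V] [DecidableEq V] (φ : V → ExpVar l)
    (hφ : Function.Injective φ) (L : List V) (hL : L.Nodup) (F : Mem B l → ℝ) (m : Mem B l) :
    Stmt.denList (L.map fun v => .sample (φ v)) F m =
      𝔼 x : V → ZMod B.p, F (m.setOn φ L x) := by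
  induction L generalizing m with
  | nil =>
    have : ∀ x, m.setOn φ [] x = m := fun x => by
      ext1
      · rfl
      · funext s; exact Mem.setOn_not_mem x m (by simp)
      · rfl
    simp [this, Stmt.denList]
  | cons v L ih =>
    rw [List.nodup_cons] at hL
    rw [List.map_cons, Stmt.denList, ← expect_update v]
    simp only [Stmt.den, ih hL.2]
    refine Finset.expect_congr rfl fun a _ => Finset.expect_congr rfl fun x _ => congrArg F ?_
    ext1
    · rfl
    · funext s
      by_cases h : ∃ w ∈ L, s = .exp (φ w)
      · obtain ⟨w, hw, rfl⟩ := h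
        have hne : w ≠ v := fun h => hL.1 (h ▸ hw)
        rw [Mem.setOn_mem hφ _ _ hw, Mem.setOn_mem hφ _ _ (List.mem_cons_of_mem _ hw),
          Function.update_of_ne hne]
      · push Not at h
        rw [Mem.setOn_not_mem _ _ h]
        by_cases hs : s = .exp (φ v)
        · subst hs
          rw [Mem.setOn_mem hφ _ _ List.mem_cons_self]
          simp [Mem.setScal]
        · rw [Mem.setOn_not_mem _ _ (by simpa [hs] using h)]
          simp [Mem.setScal, Function.update_of_ne hs]
    · rfl

/-! ### Writing elements -/

def writes {p : ℕ} (k : GrpIdx) (d : ℕ) (c : BitExp l) : List (GrpExp l p) → List (Stmt l p)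
  | [] => []
  | G :: Gs => .el k d c G :: writes k (d + 1) c Gs

theorem State.writeEl_nil (σ : State B) (k : GrpIdx) (d : ℕ) : σ.writeEl k d [] = σ := by
  cases σ
  simp [State.writeEl]

theorem State.writeEl_cons (σ : State B) (k : GrpIdx) (d : ℕ) (x : B.El k) (xs : List (B.El k)) :
    σ.writeEl k d (x :: xs) = (σ.setEl k d x).writeEl k (d + 1) xs := by
  simp only [State.writeEl, State.setEl, State.mk.injEq, true_and]
  funext k' i
  by_cases hk : k' = k
  · subst hk
    simp only [Function.update_self]
    by_cases h : d ≤ i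
    · by_cases h' : d = i
      · subst h'; simp
      · have : i - d = (i - (d + 1)) + 1 := by omega
        simp [h, show d + 1 ≤ i by omega, this, Function.update_of_ne (Ne.symm h')]
    · simp [h, show ¬ d + 1 ≤ i by omega, Function.update_of_ne (show i ≠ d by omega)]
  · simp [Function.update_of_ne hk]

theorem Mem.advState_setAdv (m : Mem B l) (ρ : State B) : (m.setAdv ρ).advState = ρ := rfl

theorem Mem.setAdv_advState (m : Mem B l) : m.setAdv m.advState = m := by
  ext1
  · funext v; cases v <;> rfl
  · funext v; cases v <;> rfl
  · funext k v; cases v <;> rfl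

theorem Mem.setAdv_setAdv (m : Mem B l) (ρ ρ' : State B) :
    (m.setAdv ρ).setAdv ρ' = m.setAdv ρ' := by
  ext1
  · funext v; cases v <;> rfl
  · funext v; cases v <;> rfl
  · funext k v; cases v <;> rfl

/-- The condition is evaluated again before each element is written, so it must not depend on the
adversary's element registers, which change meanwhile. The formulas are safe, since they read only
base elements and exponents. -/
theorem runs_writes (k : GrpIdx) (d : ℕ) (c : BitExp l) (m : Mem B l)
    (hc : ∀ ρ : State B, ρ.bit = m.advState.bit → ρ.scal = m.advState.scal →
      c.eval (m.setAdv ρ) = c.eval m) (Gs : List (GrpExp l B.p)) :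
    Stmt.Runs (writes k d c Gs) m
      (m.setAdv (if c.eval m then m.advState.writeEl k d (Gs.map fun G => G.evalMem m)
        else m.advState)) := by
  induction Gs generalizing d m with
  | nil =>
    intro F
    simp [writes, Stmt.denList, State.writeEl_nil, Mem.setAdv_advState]
  | cons G Gs ih =>
    intro F
    simp only [writes, Stmt.denList, Stmt.den]
    by_cases h : c.eval m = true
    · simp only [h, if_true]
      rw [← Mem.setAdv_setEl]
      set m' := m.setAdv (m.advState.setEl k d (GrpExp.evalMem m G)) with hm'
      have h1 : c.eval m' = c.eval m := hc _ rfl rfl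
      rw [ih (d + 1) m' (fun ρ hb hs => by
        rw [hm', Mem.setAdv_setAdv, hc ρ hb hs]; exact h1.symm) F, h1, if_pos h]
      congr 1
      rw [hm', Mem.setAdv_setAdv, Mem.advState_setAdv, List.map_cons, State.writeEl_cons]
      rfl
    · simp only [h, if_false, Bool.false_eq_true]
      rw [← Mem.setAdv_setEl]
      have e : m.advState.setEl k d (m.el k (.adv d)) = m.advState := by
        simp only [State.setEl, Mem.advState, State.mk.injEq, true_and]
        funext k' i
        by_cases hk : k' = k
        · subst hk
          simp only [Function.update_self]
          exact congrFun (Function.update_eq_self d _) i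
        · simp [Function.update_of_ne hk]
      rw [e, Mem.setAdv_advState, ih (d + 1) m hc F]
      simp [h, Mem.setAdv_advState]

end Blocks

/-! ## Reductions

A reduction computes public parameters, private keys and the challenge ciphertext from the instance
of an assumption. -/

/-- The formulas of a reduction. If one of the elements `bad` is `1`, it outputs whether `test` is
`1`; otherwise its output says whether the guess of the adversary is correct. -/
structure Red (l p : ℕ) where
  g : Fin 3 → GrpExp l p
  h : Fin 3 → GrpExp l p
  u : Fin l → Fin 3 → GrpExp l p
  W : Fin 3 → GrpExp l p
  Ω : GrpExp l p
  key : Bool → CompIdx l → Fin 3 → GrpExp l p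
  C : GrpExp l p
  C₁ : Fin 3 → GrpExp l p
  C₂ : Fin 3 → GrpExp l p
  bad : List (GrpIdx × BaseVar)
  test : GrpIdx × BaseVar

/-- The values of the variables of exponent expressions. -/
def env {l : ℕ} {R : Type} [Zero R] (ω : SetupVar l → R) (x : KeyVar l → R) (I : List R)
    (lt eq : R) : ExpVar l → R
  | .setup v => ω v
  | .key v => x v
  | .ident i => I.getD i 0
  | .lt => lt
  | .eq => eq

/-! ### Translation of an adversary into a reduction -/

section Compile

variable {l p : ℕ}

/-- The order in which the components of a private key are handed over. -/
def Red.keyList (R : Red l p) (m : ℕ) : List (GrpExp l p) :=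
  List.ofFn (R.key false none) ++ List.ofFn (R.key false (some none)) ++
  (List.ofFn fun i : Fin l => List.ofFn fun j =>
    if m ≤ i then R.key false (some (some i)) j else []).flatten ++
  List.ofFn (R.key true none) ++ List.ofFn (R.key true (some none)) ++
  (List.ofFn fun i : Fin l => List.ofFn fun j =>
    if m ≤ i then R.key true (some (some i)) j else []).flatten

def Red.ppList (R : Red l p) : List (GrpExp l p) :=
  List.ofFn R.g ++ List.ofFn R.h ++ (List.ofFn fun i => List.ofFn (R.u i)).flatten

/-- There have been at least `j` keys. -/
def ge (j : ℕ) : BitExp l := if j = 0 then .const true else .var (.count j)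

def nonzero (m : ℕ) (φ : Fin l → ScalVar l) : BitExp l :=
  .all ((List.finRange l).map fun i : Fin l =>
    if (i : ℕ) < m then .not (.scalZero (φ i)) else .const true)

def agree (m : ℕ) (φ ψ : Fin l → ScalVar l) : BitExp l :=
  .all ((List.finRange l).map fun i : Fin l =>
    if (i : ℕ) < m then .scalEq (φ i) (ψ i) else .const true)

/-- Increase the number of keys by one if `ok` is set. -/
def counters : ℕ → List (Stmt l p)
  | 0 => []
  | j + 1 => .bit (.count (j + 1)) (.or (.var (.count (j + 1))) (.and (.var .ok) (ge j))) ::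
      counters j

def keyOk (q pos c m : ℕ) : BitExp l :=
  .all [.var (.adv c), .not (ge q), nonzero m (.slot pos),
    .not (.and (.var .done) (.or (agree m (.slot pos) (.chal false))
      (agree m (.slot pos) (.chal true))))]

/-- Positions and depths of the earlier key requests are known when the program is written, but
which of them were granted is known only at run time; hence the guard `got`. -/
def chalOk (hist : List (ℕ × ℕ)) (c m : ℕ) : BitExp l :=
  .all [.var (.adv c), .not (.var .done), nonzero m (.work false), nonzero m (.work true),
    .all (hist.map fun h => .not (.and (.var (.got h.1))
      (.or (agree h.2 (.slot h.1) (.work false)) (agree h.2 (.slot h.1) (.work true)))))]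

noncomputable def keyVars (l : ℕ) : List (KeyVar l) := Finset.univ.toList

noncomputable def setupVars (l : ℕ) : List (SetupVar l) := Finset.univ.toList

/-- A straight-line program cannot skip a refused request: everything is computed, and the bit `ok`
decides whether it takes effect. The number of keys is kept in unary. There are `q + 1` counters
because the indicator of key number `k ≤ q` compares the count with `k + 1`. -/
noncomputable def Red.keyCode (R : Red l p) (q k pos c : ℕ) (I : List ℕ) (d : ℕ) :
    List (Stmt l p) :=
  copyId (.slot pos) I ++ (copyId (fun i => .exp (.ident i)) I ++
    ([.bit .ok (keyOk q pos c I.length), .ofBit (.exp .lt) (.not (ge k)),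
      .ofBit (.exp .eq) (.and (ge k) (.not (ge (k + 1))))] ++
    ((keyVars l).map (fun v => .sample (.key v)) ++ (writes .right d (.var .ok)
      (R.keyList I.length) ++ ([.bit (.got pos) (.var .ok)] ++ counters (q + 1))))))

/-- Assign the variables `φ i` the values of `a i` if `c` is set, and of `b i` otherwise. -/
def selId (φ : Fin l → ScalVar l) (c : BitVar) (a b : Fin l → ScalVar l) : List (Stmt l p) :=
  (List.finRange l).map fun i => .sel (φ i) c (a i) (b i)

/-- The coins and indicators left over from key requests are cleared, because the ciphertext
formulas are evaluated with these variables equal to zero. -/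
noncomputable def Red.chalCode (R : Red l p) (hist : List (ℕ × ℕ)) (c : ℕ) (I₀ I₁ : List ℕ)
    (M₀ M₁ d d' : ℕ) : List (Stmt l p) :=
  copyId (.work false) I₀ ++ (copyId (.work true) I₁ ++ ([.bit .ok (chalOk hist c I₀.length)] ++
    (selId (.chal false) .ok (.work false) (.chal false) ++
    (selId (.chal true) .ok (.work true) (.chal true) ++
    (selId (fun i => .exp (.ident i)) .coin (.work true) (.work false) ++
    ((keyVars l).map (fun v => .zero (.exp (.key v))) ++ ([.zero (.exp .lt), .zero (.exp .eq)] ++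
    (writes .left d (.var .ok) (List.ofFn R.C₁ ++ List.ofFn R.C₂) ++
    [.elMsg d' (.var .ok) R.C M₁ M₀, .bit .done (.or (.var .done) (.var .ok))]))))))))

/-- Translate the program of an adversary; `hist` contains the positions and the depths of the
earlier key requests. -/
noncomputable def Red.compile (R : Red l p) (q k : ℕ) : List (ℕ × ℕ) → List AdvInstr →
    List (Stmt l p)
  | _, [] => []
  | hist, .loc i :: A => .loc i :: R.compile q k hist A
  | hist, .key c I d :: A => if I.length ≤ l then
      R.keyCode q k hist.length c I d ++ R.compile q k ((hist.length, I.length) :: hist) A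
      else R.compile q k hist A
  | hist, .chal c I₀ I₁ M₀ M₁ d d' :: A => if I₀.length ≤ l ∧ I₀.length = I₁.length then
      R.chalCode hist c I₀ I₁ M₀ M₁ d d' ++ R.compile q k hist A
      else R.compile q k hist A

end Compile

/-! ### The simulated challenger and its admissibility tests -/

section Simulation

variable {B : BilinearGroup} {l : ℕ}

/-- The challenger that a reduction simulates. -/
noncomputable def Red.chal (R : Red l B.p) (y : (k : GrpIdx) → BaseVar → B.El k) (k : ℕ)
    (ω : SetupVar l → ZMod B.p) : Challenger B l (KeyVar l → ZMod B.p) Unit where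
  pp :=
    { g := fun j => (R.g j).eval (y .left) (env ω 0 [] 0 0)
      h := fun j => (R.h j).eval (y .left) (env ω 0 [] 0 0)
      u := fun i j => (R.u i j).eval (y .left) (env ω 0 [] 0 0)
      W := fun j => (R.W j).eval (y .right) (env ω 0 [] 0 0)
      Ω := R.Ω.eval (y .target) (env ω 0 [] 0 0) }
  key n I x :=
    let v := env ω x I (if n < k then 1 else 0) (if n = k then 1 else 0)
    { K₁ := fun j => (R.key false none j).eval (y .right) v
      K₂ := fun j => (R.key false (some none) j).eval (y .right) v
      L := levelsAfter I.length fun i j => (R.key false (some (some i)) j).eval (y .right) v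
      R₁ := fun j => (R.key true none j).eval (y .right) v
      R₂ := fun j => (R.key true (some none) j).eval (y .right) v
      R₃ := levelsAfter I.length fun i j => (R.key true (some (some i)) j).eval (y .right) v }
  ct I M _ :=
    { C := R.C.eval (y .target) (env ω 0 I 0 0) * M
      C₁ := fun j => (R.C₁ j).eval (y .left) (env ω 0 I 0 0)
      C₂ := fun j => (R.C₂ j).eval (y .left) (env ω 0 I 0 0) }

theorem map_keyList (R : Red l B.p) (y : (k : GrpIdx) → BaseVar → B.El k) (k n : ℕ)
    (ω : SetupVar l → ZMod B.p) (I : ID B) (x : KeyVar l → ZMod B.p) :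
    (R.keyList I.length).map (fun G => G.eval (y .right)
      (env ω x I (if n < k then 1 else 0) (if n = k then 1 else 0))) =
      ((R.chal y k ω).key n I x).toList := by
  have h0 : ∀ v : ExpVar l → ZMod B.p,
      (GrpExp.eval (y .right) v ([] : GrpExp l B.p) : B.Ghat) = 1 := fun v => rfl
  have h1 : ∀ (i : Fin l) (j : Fin 3) (b : Bool) (v : ExpVar l → ZMod B.p),
      GrpExp.eval (y .right) v (if I.length ≤ i then R.key b (some (some i)) j else []) =
      levelsAfter I.length (fun i j => (R.key b (some (some i)) j).eval (y .right) v) i j := by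
    intro i j b v
    unfold levelsAfter
    split_ifs
    · rfl
    · exact h0 v
  simp only [Red.keyList, PrivateKey.toList, List.map_append, List.map_flatten, List.map_ofFn,
    Function.comp_def, Red.chal, h1]

theorem map_ppList (R : Red l B.p) (y : (k : GrpIdx) → BaseVar → B.El k) (k : ℕ)
    (ω : SetupVar l → ZMod B.p) :
    R.ppList.map (fun G => G.eval (y .left) (env ω 0 [] 0 0)) = (R.chal y k ω).pp.toList := by
  simp only [Red.ppList, PublicParams.toList, List.map_append, List.map_flatten, List.map_ofFn,
    Function.comp_def, Red.chal]

/-- Identities are compared after padding with zeros. The components of a valid identity are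
nonzero, so at a level of `I` beyond the end of `J` the padding disagrees with `I`, and no
comparison of lengths is needed. -/
theorem prefix_iff_getD {I J : ID B} (hI : ValidID l I) :
    I <+: J ↔ ∀ i : Fin l, (i : ℕ) < I.length → I.getD i 0 = J.getD i 0 := by
  constructor
  · rintro ⟨K, rfl⟩ i hi
    simp [List.getElem?_append_left hi]
  · intro h
    have hlen : I.length ≤ J.length := by
      by_contra! hl
      have := h ⟨J.length, hl.trans_le hI.1⟩ hl
      simp only [le_refl, List.getD_eq_default] at this
      rw [List.getD_eq_getElem _ _ hl] at this
      exact hI.2 _ (List.getElem_mem hl) this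
    rw [List.prefix_iff_eq_take]
    refine List.ext_getElem (by simp [hlen]) fun i h1 h2 => ?_
    have := h ⟨i, h1.trans_le hI.1⟩ h1
    rw [List.getD_eq_getElem _ _ h1, List.getD_eq_getElem _ _ (h1.trans_le hlen)] at this
    simpa using this

theorem nonzero_iff_getD {I : ID B} (hI : I.length ≤ l) :
    ValidID l I ↔ ∀ i : Fin l, (i : ℕ) < I.length → I.getD i 0 ≠ 0 := by
  constructor
  · rintro ⟨-, h⟩ i hi
    rw [List.getD_eq_getElem _ _ hi]
    exact h _ (List.getElem_mem hi)
  · refine fun h => ⟨hI, fun x hx => ?_⟩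
    obtain ⟨i, hi, rfl⟩ := List.mem_iff_getElem.mp hx
    have := h ⟨i, hi.trans_le hI⟩ hi
    rwa [List.getD_eq_getElem _ _ hi] at this

theorem eval_nonzero (m : Mem B l) (n : ℕ) (φ : Fin l → ScalVar l) :
    (nonzero n φ).eval m = true ↔ ∀ i : Fin l, (i : ℕ) < n → m.scal (φ i) ≠ 0 := by
  simp only [nonzero, BitExp.eval_all, List.all_map, List.all_eq_true, List.mem_finRange,
    forall_const, Function.comp_apply]
  refine forall_congr' fun i => ?_
  split_ifs with h <;> simp [h, BitExp.eval]

theorem eval_agree (m : Mem B l) (n : ℕ) (φ ψ : Fin l → ScalVar l) :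
    (agree n φ ψ).eval m = true ↔ ∀ i : Fin l, (i : ℕ) < n → m.scal (φ i) = m.scal (ψ i) := by
  simp only [agree, BitExp.eval_all, List.all_map, List.all_eq_true, List.mem_finRange,
    forall_const, Function.comp_apply]
  refine forall_congr' fun i => ?_
  split_ifs with h <;> simp [h, BitExp.eval]

/-- The counters are updated from the highest down, so each one still reads the old value of its
predecessor and the count grows by at most one. -/
theorem runs_counters (N : ℕ) (m : Mem B l) :
    ∃ m', Stmt.Runs (counters N) m m' ∧ m'.scal = m.scal ∧ m'.el = m.el ∧
      (∀ v, (∀ j, v ≠ .count j) → m'.bit v = m.bit v) ∧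
      ∀ j, m'.bit (.count j) = if 1 ≤ j ∧ j ≤ N then
        m.bit (.count j) || (m.bit .ok && (ge (j - 1) : BitExp l).eval m) else
        m.bit (.count j) := by
  induction N generalizing m with
  | zero =>
    refine ⟨m, fun F => rfl, rfl, rfl, fun _ _ => rfl, fun j => ?_⟩
    rw [if_neg (by omega)]
  | succ N ih =>
    set m₁ := m.setBit (.count (N + 1)) (m.bit (.count (N + 1)) || (m.bit .ok &&
      (ge N : BitExp l).eval m)) with hm₁
    have hb : ∀ v, v ≠ .count (N + 1) → m₁.bit v = m.bit v := fun v hv => by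
      simp [hm₁, Mem.setBit, Function.update_of_ne hv]
    obtain ⟨m', r, s, e, u, c⟩ := ih m₁
    refine ⟨m', fun F => ?_, s, e, fun v hv => by rw [u v hv, hb v (hv _)], fun j => ?_⟩
    · rw [counters, Stmt.denList, ← r F]
      simp [Stmt.den, BitExp.eval, hm₁]
    · rw [c j]
      by_cases h1 : j = N + 1
      · subst h1
        rw [if_neg (by omega), if_pos (by omega), hm₁]
        simp [Mem.setBit]
      · have h3 : m₁.bit (.count j) = m.bit (.count j) := hb _ (by simpa using h1)
        by_cases h2 : 1 ≤ j ∧ j ≤ N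
        · have h4 : (ge (j - 1) : BitExp l).eval m₁ = (ge (j - 1) : BitExp l).eval m := by
            unfold ge
            split_ifs
            · rfl
            · exact hb _ (by simp; omega)
          rw [if_pos h2, if_pos (by omega), h3, h4, hb .ok (by simp)]
        · rw [if_neg h2, if_neg (by omega), h3]

/-- A source may be its own target (the value is kept) but no other target, so the order of the
assignments does not matter. -/
theorem runs_selId (φ : Fin l → ScalVar l) (hφ : Function.Injective φ) (c : BitVar)
    (a b : Fin l → ScalVar l) (m : Mem B l)
    (h : ∀ i, (a i = φ i ∨ ∀ j, a i ≠ φ j) ∧ (b i = φ i ∨ ∀ j, b i ≠ φ j)) :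
    ∃ m', Stmt.Runs (selId φ c a b) m m' ∧ m'.bit = m.bit ∧ m'.el = m.el ∧
      (∀ i, m'.scal (φ i) = if m.bit c then m.scal (a i) else m.scal (b i)) ∧
      ∀ v, (∀ j, v ≠ φ j) → m'.scal v = m.scal v := by
  have gen : ∀ (L : List (Fin l)), L.Nodup → ∀ m₁ : Mem B l, m₁.bit = m.bit → m₁.el = m.el →
      (∀ v, (∀ j, v ≠ φ j) → m₁.scal v = m.scal v) →
      (∀ i ∈ L, m₁.scal (φ i) = m.scal (φ i)) →
      ∃ m', Stmt.Runs (L.map fun i => .sel (φ i) c (a i) (b i)) m₁ m' ∧ m'.bit = m.bit ∧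
        m'.el = m.el ∧
      (∀ i, m'.scal (φ i) = if i ∈ L then (if m.bit c then m.scal (a i) else m.scal (b i))
        else m₁.scal (φ i)) ∧
      ∀ v, (∀ j, v ≠ φ j) → m'.scal v = m.scal v := by
    intro L
    induction L with
    | nil => exact fun _ m₁ h1 h2 h3 _ => ⟨m₁, fun F => rfl, h1, h2, by simp, h3⟩
    | cons i L ih =>
      intro hL m₁ h1 h2 h3 h4
      rw [List.nodup_cons] at hL
      have ha : ∀ v, (v = φ i ∨ ∀ j, v ≠ φ j) → m₁.scal v = m.scal v := by
        rintro v (rfl | hv)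
        exacts [h4 i List.mem_cons_self, h3 v hv]
      obtain ⟨m', r, b', e, s, u⟩ := ih hL.2
        (m₁.setScal (φ i) (if m.bit c then m.scal (a i) else m.scal (b i))) h1 h2 (fun v hv => by
          simp [Mem.setScal, Function.update_of_ne (hv i), h3 v hv]) (fun j hj => by
          have : φ j ≠ φ i := hφ.ne fun h => hL.1 (h ▸ hj)
          simp [Mem.setScal, Function.update_of_ne this, h4 j (List.mem_cons_of_mem _ hj)])
      refine ⟨m', fun F => ?_, b', e, fun j => ?_, u⟩
      · rw [List.map_cons, Stmt.denList, ← r F]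
        simp only [Stmt.den, h1, ha _ (h i).1, ha _ (h i).2]
      · rw [s j]
        by_cases hj : j = i
        · subst hj
          simp [Mem.setScal, hL.1]
        · simp [Mem.setScal, Function.update_of_ne (hφ.ne hj), hj]
  obtain ⟨m', r, b', e, s, u⟩ := gen (List.finRange l) (List.nodup_finRange l) m rfl rfl
    (fun _ _ => rfl) fun _ _ => rfl
  exact ⟨m', r, b', e, fun i => by rw [s i, if_pos (List.mem_finRange i)], u⟩

end Simulation

/-! ### The simulation invariant and key requests -/

section Simulation

variable {B : BilinearGroup} {l : ℕ}

/-- The memory `m` of the reduction represents the configuration `s` of the experiment. -/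
structure Inv (y : (k : GrpIdx) → BaseVar → B.El k) (ω : SetupVar l → ZMod B.p) (γ : Bool)
    (N : ℕ) (hist : List (ℕ × ℕ)) (m : Mem B l) (s : Config B) : Prop where
  adv : m.advState = s.regs
  base : ∀ k v, m.el k (.base v) = y k v
  setup : ∀ v, m.scal (.exp (.setup v)) = ω v
  coin : m.bit .coin = γ
  count : ∀ j, 1 ≤ j → j ≤ N → m.bit (.count j) = decide (j ≤ s.queried.length)
  done : m.bit .done = s.challenge.isSome
  chal : ∀ c, s.challenge = some c → ∀ i : Fin l,
    m.scal (.chal false i) = c.1.getD i 0 ∧ m.scal (.chal true i) = c.2.getD i 0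
  valid : ∀ I ∈ s.queried, ValidID l I
  hist_lt : ∀ h ∈ hist, h.1 < hist.length
  got : ∀ h ∈ hist, m.bit (.got h.1) = true →
    ∃ I ∈ s.queried, I.length = h.2 ∧ ∀ i : Fin l, m.scal (.slot h.1 i) = I.getD i 0
  queried : ∀ I ∈ s.queried, ∃ h ∈ hist, m.bit (.got h.1) = true ∧ I.length = h.2 ∧
    ∀ i : Fin l, m.scal (.slot h.1 i) = I.getD i 0

variable {y : (k : GrpIdx) → BaseVar → B.El k} {ω : SetupVar l → ZMod B.p} {γ : Bool}
  {N : ℕ} {hist : List (ℕ × ℕ)} {m : Mem B l} {s : Config B}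

theorem Inv.loc (h : Inv y ω γ N hist m s) (σ : State B) :
    Inv y ω γ N hist (m.setAdv σ) { s with regs := σ } where
  adv := rfl
  base := h.base
  setup := h.setup
  coin := h.coin
  count := h.count
  done := h.done
  chal := h.chal
  valid := h.valid
  hist_lt := h.hist_lt
  got := h.got
  queried := h.queried

theorem Inv.eval_ge (h : Inv y ω γ N hist m s) {j : ℕ} (hj : j ≤ N) :
    (ge j : BitExp l).eval m = decide (j ≤ s.queried.length) := by
  unfold ge
  split_ifs with h0
  · subst h0; simp [BitExp.eval]
  · exact h.count j (by omega) hj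

/-- The invariant does not mention the variables that are used within a single step. -/
theorem Inv.of_eq (h : Inv y ω γ N hist m s) {m' : Mem B l} (hel : m'.el = m.el)
    (hb : ∀ v, v ≠ .ok → (∀ pos, v = .got pos → pos < hist.length) → m'.bit v = m.bit v)
    (hs : ∀ v : ScalVar l, (∀ i, v ≠ .exp (.ident i)) → (∀ i, v ≠ .exp (.key i)) → v ≠ .exp .lt →
      v ≠ .exp .eq → (∀ b i, v ≠ .work b i) → (∀ pos i, v = .slot pos i → pos < hist.length) →
      m'.scal v = m.scal v) :
    Inv y ω γ N hist m' s := by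
  have hgot : ∀ q ∈ hist, m'.bit (.got q.1) = m.bit (.got q.1) := fun q hq =>
    hb _ (by simp) (by simpa using h.hist_lt q hq)
  have hslot : ∀ q ∈ hist, ∀ i, m'.scal (.slot q.1 i) = m.scal (.slot q.1 i) := fun q hq i =>
    hs _ (by simp) (by simp) (by simp) (by simp) (by simp) (by
      rintro pos j hp
      have := h.hist_lt q hq
      simp only [ScalVar.slot.injEq] at hp
      omega)
  constructor
  · rw [← h.adv]
    simp only [Mem.advState, State.mk.injEq]
    refine ⟨funext fun i => hb _ (by simp) (by simp),
      funext fun i => hs _ (by simp) (by simp) (by simp) (by simp) (by simp) (by simp), ?_⟩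
    rw [hel]
  · rw [hel]; exact h.base
  · intro v
    rw [hs _ (by simp) (by simp) (by simp) (by simp) (by simp) (by simp)]
    exact h.setup v
  · rw [hb _ (by simp) (by simp)]; exact h.coin
  · intro j; rw [hb _ (by simp) (by simp)]; exact h.count j
  · rw [hb _ (by simp) (by simp)]; exact h.done
  · intro c hc i
    rw [hs _ (by simp) (by simp) (by simp) (by simp) (by simp) (by simp),
      hs _ (by simp) (by simp) (by simp) (by simp) (by simp) (by simp)]
    exact h.chal c hc i
  · exact h.valid
  · exact h.hist_lt
  · intro q hq
    simp only [hgot q hq, hslot q hq]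
    exact h.got q hq
  · intro I hI
    obtain ⟨q, hq, h1, h2⟩ := h.queried I hI
    exact ⟨q, hq, by rw [hgot q hq]; exact h1, by simpa only [hslot q hq] using h2⟩

theorem Inv.evalMem {k : GrpIdx} (G : GrpExp l B.p) (hbase : ∀ k v, m.el k (.base v) = y k v)
    {v : ExpVar l → ZMod B.p} (hv : ∀ w, m.scal (.exp w) = v w) :
    (G.evalMem m : B.El k) = G.eval (y k) v := by
  unfold GrpExp.evalMem
  rw [funext (hbase k), funext hv]

theorem Stmt.Runs.denList_append {S T : List (Stmt l B.p)} {m m' : Mem B l}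
    (h : Stmt.Runs S m m') (F : Mem B l → ℝ) :
    Stmt.denList (S ++ T) F m = Stmt.denList T F m' := by
  rw [Stmt.denList_append, h]

theorem bool_eq_decide {b : Bool} {P : Prop} [Decidable P] (h : b = true ↔ P) : b = decide P := by
  cases b <;> simp_all

theorem eval_keyOk {q pos c : ℕ} {I : List ℕ} (h : Inv y ω γ N hist m s) (hq : q ≤ N)
    (hI : I.length ≤ l)
    (hslot : ∀ i, m.scal (.slot pos i) = (I.map s.regs.scal).getD i 0) :
    (keyOk q pos c I.length).eval m = true ↔ s.regs.bit c = true ∧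
      KeyAllowed l s (I.map s.regs.scal) ∧ s.queried.length < q := by
  set J := I.map s.regs.scal with hJ
  have hl : J.length = I.length := by simp [hJ]
  have hc : m.bit (.adv c) = s.regs.bit c := by rw [← h.adv]; rfl
  have hval : (nonzero I.length (.slot pos)).eval m = true ↔ ValidID l J := by
    rw [eval_nonzero, nonzero_iff_getD (by rw [hl]; exact hI), hl]
    simp only [hslot]
  have hag : ∀ b i, (∀ (j : Fin l), m.scal (.chal b j) = List.getD i j 0) → ValidID l J →
      ((agree I.length (.slot pos) (.chal b)).eval m = true ↔ J <+: i) := by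
    intro b i hi hv
    rw [eval_agree, prefix_iff_getD hv, hl]
    simp only [hslot, hi]
  simp only [keyOk, BitExp.eval_all, List.all_cons, List.all_nil, Bool.and_true, BitExp.eval_not,
    BitExp.eval_and, BitExp.eval_or, BitExp.eval, Bool.and_eq_true, hc, h.eval_ge hq, h.done,
    KeyAllowed, hval, Bool.not_eq_true', Bool.and_eq_false_iff, Bool.or_eq_false_iff,
    decide_eq_false_iff_not, not_le]
  constructor
  · rintro ⟨h1, h2, h3, h4⟩
    refine ⟨h1, ⟨h3, fun c' hc' => ?_⟩, h2⟩
    rw [hc'] at h4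
    have h5 := h4.resolve_left (by simp)
    have h6 := fun i => h.chal c' hc' i
    rw [← hag false c'.1 (fun i => (h6 i).1) h3, ← hag true c'.2 (fun i => (h6 i).2) h3]
    simpa using h5
  · rintro ⟨h1, ⟨h3, h4⟩, h2⟩
    refine ⟨h1, h2, h3, ?_⟩
    rcases hch : s.challenge with _ | c'
    · simp
    · right
      have h5 := h4 c' hch
      have h6 := fun i => h.chal c' hch i
      rw [← hag false c'.1 (fun i => (h6 i).1) h3, ← hag true c'.2 (fun i => (h6 i).2) h3] at h5
      simpa using h5

/-- The continuation is compared only on memories that satisfy the invariant for the history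
extended by this request. The history grows even if the request is refused; then `got` stays unset
and the entry is inert. -/
theorem den_keyCode (R : Red l B.p) {q k c d : ℕ} {I : List ℕ} (hk : k ≤ q)
    (h : Inv y ω γ (q + 1) hist m s) (hI : I.length ≤ l) {F : Mem B l → ℝ} {f : Config B → ℝ}
    (hF : ∀ m' s', Inv y ω γ (q + 1) ((hist.length, I.length) :: hist) m' s' → F m' = f s') :
    Stmt.denList (R.keyCode q k hist.length c I d) F m =
      advStepE (R.chal y k ω) q γ (.key c I d) f s := by
  set pos := hist.length with hpos
  set J := I.map s.regs.scal with hJ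
  obtain ⟨m₁, r₁, b₁, e₁, s₁, u₁⟩ := runs_copyId (.slot pos) (fun i j h => by simpa using h)
    (by simp) I m
  obtain ⟨m₂, r₂, b₂, e₂, s₂, u₂⟩ := runs_copyId (fun i => .exp (.ident i))
    (fun i j h => by simpa using h) (by simp) I m₁
  have adv₁ : m₁.advState.scal = s.regs.scal := by
    funext i
    rw [← h.adv]
    exact u₁ _ (by simp)
  rw [adv₁] at s₂
  rw [h.adv] at s₁
  have h₂ : Inv y ω γ (q + 1) hist m₂ s := by
    refine h.of_eq (e₂.trans e₁) (fun v _ _ => by rw [b₂, b₁]) fun v hv1 _ _ _ _ hv => ?_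
    rw [u₂ v hv1, u₁ v fun j hj => (hv _ _ hj).ne rfl]
  have slot₂ : ∀ i, m₂.scal (.slot pos i) = J.getD i 0 := fun i => by
    rw [u₂ _ (by simp), s₁]
  set P := s.regs.bit c = true ∧ KeyAllowed l s J ∧ s.queried.length < q with hP
  classical
  have ok₂ : (keyOk q pos c I.length).eval m₂ = decide P :=
    bool_eq_decide (eval_keyOk h₂ (by omega) hI slot₂)
  set m₃ := m₂.setBit .ok (decide P) with hm₃
  have h₃ : Inv y ω γ (q + 1) hist m₃ s := h₂.of_eq rfl
    (fun v hv _ => by simp [hm₃, Mem.setBit, hv]) fun _ _ _ _ _ _ _ => rfl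
  set lt : ZMod B.p := if s.queried.length < k then 1 else 0 with hlt
  set eq : ZMod B.p := if s.queried.length = k then 1 else 0 with heq
  set m₄ := m₃.setScal (.exp .lt) lt with hm₄
  have h₄ : Inv y ω γ (q + 1) hist m₄ s := h₃.of_eq rfl (fun _ _ _ => rfl)
    fun v _ _ hv _ _ _ => by simp [hm₄, Mem.setScal, hv]
  set m₅ := m₄.setScal (.exp .eq) eq with hm₅
  have h₅ : Inv y ω γ (q + 1) hist m₅ s := h₄.of_eq rfl (fun _ _ _ => rfl)
    fun v _ _ _ hv _ _ => by simp [hm₅, Mem.setScal, hv]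
  have r₃ : Stmt.Runs [.bit .ok (keyOk q pos c I.length), .ofBit (.exp .lt) (.not (ge k)),
      .ofBit (.exp .eq) (.and (ge k) (.not (ge (k + 1))))] m₂ m₅ := by
    intro F
    simp only [Stmt.denList, Stmt.den, ok₂]
    rw [← hm₃, BitExp.eval_not, h₃.eval_ge (by omega)]
    rw [show (if (!decide (k ≤ s.queried.length)) = true then (1 : ZMod B.p) else 0) = lt by
      simp [hlt], ← hm₄, BitExp.eval_and, BitExp.eval_not, h₄.eval_ge (by omega),
      h₄.eval_ge (by omega)]
    rw [show (if (decide (k ≤ s.queried.length) && !decide (k + 1 ≤ s.queried.length)) = true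
      then (1 : ZMod B.p) else 0) = eq by simp [heq]; congr 1; simp; omega]
  -- The coins are sampled before it matters whether the request is granted. For each value of them
  -- the rest of the code is deterministic; after a refusal the result does not depend on them, and
  -- averaging over them has no effect.
  have step : ∀ x : KeyVar l → ZMod B.p,
      Stmt.denList (writes .right d (.var .ok) (R.keyList I.length) ++
        ([.bit (.got pos) (.var .ok)] ++ counters (q + 1))) F
        (m₅.setOn .key (keyVars l) x) =
      if P then f (s.addKey d J ((R.chal y k ω).key s.queried.length J x)) else f s := by
    intro x
    set m₆ := m₅.setOn .key (keyVars l) x with hm₆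
    have key₆ : ∀ v, m₆.scal (.exp (.key v)) = x v := fun v =>
      Mem.setOn_mem (φ := ExpVar.key) (fun _ _ h => by simpa using h) x m₅ (by simp [keyVars])
    have oth₆ : ∀ v : ScalVar l, (∀ w, v ≠ .exp (.key w)) → m₆.scal v = m₅.scal v := fun v hv =>
      Mem.setOn_not_mem x m₅ fun w _ => hv w
    have h₆ : Inv y ω γ (q + 1) hist m₆ s := h₅.of_eq rfl (fun _ _ _ => rfl)
      fun v _ hv _ _ _ _ => oth₆ v hv
    have env₆ : ∀ w, m₆.scal (.exp w) = env ω x J lt eq w := by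
      intro w
      cases w with
      | setup v => exact h₆.setup v
      | key v => exact key₆ v
      | ident i =>
        rw [oth₆ _ (by simp)]
        simp only [env, hm₅, hm₄, hm₃, Mem.setScal, Mem.setBit]
        rw [Function.update_of_ne (by simp), Function.update_of_ne (by simp), s₂]
      | lt =>
        rw [oth₆ _ (by simp)]
        simp [hm₅, hm₄, Mem.setScal, env]
      | eq =>
        rw [oth₆ _ (by simp)]
        simp [hm₅, Mem.setScal, env]
    have ok₆ : m₆.bit .ok = decide P := by
      simp [hm₆, Mem.setOn, hm₅, hm₄, hm₃, Mem.setScal, Mem.setBit]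
    have slot₆ : ∀ i, m₆.scal (.slot pos i) = J.getD i 0 := fun i => by
      rw [oth₆ _ (by simp), ← slot₂]
      simp [hm₅, hm₄, hm₃, Mem.setScal, Mem.setBit]
    have hw := runs_writes (B := B) .right d (.var .ok) m₆ (fun _ _ _ => rfl) (R.keyList I.length)
    rw [hw.denList_append]
    have hl : J.length = I.length := by simp [hJ]
    have hlist : (R.keyList I.length).map (fun G => (G.evalMem m₆ : B.Ghat)) =
        ((R.chal y k ω).key s.queried.length J x).toList := by
      rw [← map_keyList, hl]
      exact List.map_congr_left fun G _ => Inv.evalMem G h₆.base env₆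
    simp only [BitExp.eval, ok₆, hlist, h₆.adv]
    set s' : Config B := if P then s.addKey d J ((R.chal y k ω).key s.queried.length J x) else s
      with hs'
    have regs' : s'.regs = if P then s.regs.writeEl .right d
        ((R.chal y k ω).key s.queried.length J x).toList else s.regs := by
      rw [hs']; split_ifs <;> rfl
    have chal' : s'.challenge = s.challenge := by
      rw [hs']; split_ifs <;> rfl
    have quer' : s'.queried = if P then s.queried ++ [J] else s.queried := by
      rw [hs']; split_ifs <;> rfl
    rw [show (if decide P = true then s.regs.writeEl .right d
        ((R.chal y k ω).key s.queried.length J x).toList else s.regs) = s'.regs by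
      rw [regs']; simp]
    set m₇ := m₆.setAdv s'.regs with hm₇
    set m₈ := m₇.setBit (.got pos) (decide P) with hm₈
    obtain ⟨m₉, r₉, s₉, e₉, u₉, c₉⟩ := runs_counters (q + 1) m₈
    have r₈ : Stmt.Runs [.bit (.got pos) (.var .ok)] m₇ m₈ := by
      intro F
      simp only [Stmt.denList, Stmt.den, BitExp.eval]
      rw [show m₇.bit .ok = decide P from ok₆]
    rw [r₈.denList_append, r₉ F]
    have hgoal : (if P then f (s.addKey d J ((R.chal y k ω).key s.queried.length J x)) else f s) =
        f s' := by rw [hs']; split_ifs <;> rfl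
    rw [hgoal]
    apply hF
    have got₉ : ∀ pos', m₉.bit (.got pos') = if pos' = pos then decide P else m₆.bit (.got pos') := by
      intro pos'
      rw [u₉ _ (by simp), hm₈]
      by_cases hp : pos' = pos
      · subst hp; simp [Mem.setBit]
      · rw [if_neg hp]
        simp only [Mem.setBit]
        rw [Function.update_of_ne (by simpa using hp)]
        rfl
    have bit₉ : ∀ v, (∀ j, v ≠ .count j) → (∀ j, v ≠ .got j) → (∀ j, v ≠ .adv j) →
        m₉.bit v = m₆.bit v := by
      intro v h1 h2 h3
      rw [u₉ v h1, hm₈]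
      simp only [Mem.setBit]
      rw [Function.update_of_ne (h2 pos)]
      cases v <;> first | rfl | simp at h3
    have scal₉ : ∀ v, (∀ j, v ≠ .adv j) → m₉.scal v = m₆.scal v := by
      intro v h3
      rw [s₉]
      cases v <;> first | rfl | simp at h3
    have slot₉ : ∀ pos' i, m₉.scal (.slot pos' i) = m₆.scal (.slot pos' i) := fun pos' i =>
      scal₉ _ (by simp)
    have count₈ : ∀ j, m₈.bit (.count j) = m₆.bit (.count j) := fun j => by
      simp only [hm₈, Mem.setBit]
      rw [Function.update_of_ne (by simp)]
      rfl
    have hne : ∀ h' ∈ hist, h'.1 ≠ pos := fun h' hh => (h.hist_lt h' hh).ne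
    constructor
    · simp only [Mem.advState]
      have : m₇.advState = s'.regs := rfl
      rw [← this]
      simp only [Mem.advState, State.mk.injEq, s₉, e₉]
      exact ⟨funext fun i => by
        rw [u₉ _ (by simp), hm₈]
        simp only [Mem.setBit]
        rw [Function.update_of_ne (by simp)], rfl, rfl⟩
    · intro k' v
      rw [e₉]
      exact h₆.base k' v
    · intro v
      rw [scal₉ _ (by simp)]
      exact h₆.setup v
    · rw [bit₉ _ (by simp) (by simp) (by simp)]
      exact h₆.coin
    · intro j h1 h2
      rw [c₉ j, if_pos ⟨h1, h2⟩, count₈]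
      have hge : (ge (j - 1) : BitExp l).eval m₈ = decide (j - 1 ≤ s.queried.length) := by
        rw [← h₆.eval_ge (by omega)]
        unfold ge
        split_ifs
        · rfl
        · exact count₈ _
      have hok : m₈.bit .ok = decide P := by
        simp only [hm₈, Mem.setBit]
        rw [Function.update_of_ne (by simp)]
        exact ok₆
      rw [h₆.count j h1 h2, hge, hok, quer']
      by_cases hp : P
      · simp only [hp, decide_true, Bool.true_and, if_true, List.length_append,
          List.length_singleton]
        rw [← Bool.decide_or]
        congr 1
        simp; omega
      · simp [hp]
    · rw [bit₉ _ (by simp) (by simp) (by simp), chal']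
      exact h₆.done
    · intro c' hc' i
      rw [chal'] at hc'
      rw [scal₉ _ (by simp), scal₉ _ (by simp)]
      exact h₆.chal c' hc' i
    · intro I' hI'
      rw [quer'] at hI'
      by_cases hp : P
      · simp only [hp, if_true, List.mem_append, List.mem_singleton] at hI'
        rcases hI' with hI' | rfl
        · exact h.valid _ hI'
        · exact hp.2.1.1
      · simp only [hp, if_false] at hI'
        exact h.valid _ hI'
    · intro h' hh
      simp only [List.length_cons]
      rcases List.mem_cons.mp hh with rfl | hh
      · simp [hpos]
      · have := h.hist_lt h' hh
        omega
    · intro h' hh hg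
      rw [got₉] at hg
      simp only [slot₉]
      rcases List.mem_cons.mp hh with rfl | hh
      · simp only [if_true, decide_eq_true_eq] at hg
        refine ⟨J, ?_, hl, slot₆⟩
        rw [quer', if_pos hg]
        simp
      · rw [if_neg (hne h' hh)] at hg
        obtain ⟨I', hI', h1⟩ := h₆.got h' hh hg
        refine ⟨I', ?_, h1⟩
        rw [quer']
        split_ifs <;> simp [hI']
    · intro I' hI'
      have old : I' ∈ s.queried → ∃ h' ∈ (pos, I.length) :: hist, m₉.bit (.got h'.1) = true ∧
          I'.length = h'.2 ∧ ∀ i : Fin l, m₉.scal (.slot h'.1 i) = I'.getD i 0 := by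
        intro hI'
        obtain ⟨h', hh, h1, h2, h3⟩ := h₆.queried I' hI'
        refine ⟨h', List.mem_cons_of_mem _ hh, ?_, h2, fun i => ?_⟩
        · rw [got₉, if_neg (hne h' hh)]; exact h1
        · rw [slot₉]; exact h3 i
      rw [quer'] at hI'
      by_cases hp : P
      · simp only [hp, if_true, List.mem_append, List.mem_singleton] at hI'
        rcases hI' with hI' | rfl
        · exact old hI'
        · refine ⟨_, List.mem_cons_self, ?_, hl, fun i => ?_⟩
          · rw [got₉, if_pos rfl]; simp [hp]
          · rw [slot₉]; exact slot₆ i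
      · simp only [hp, if_false] at hI'
        exact old hI'
  unfold Red.keyCode
  rw [r₁.denList_append, r₂.denList_append, r₃.denList_append, Stmt.denList_append,
    Stmt.denList_sample ExpVar.key (fun _ _ h => by simpa using h) (keyVars l)
      (Finset.nodup_toList _)]
  simp only [step, advStepE]
  by_cases hp : P
  · simp only [if_pos hp]
    exact (if_pos hp).symm
  · simp only [if_neg hp, Fintype.expect_const]
    exact (if_neg hp).symm

end Simulation

/-! ### Simulation of the challenge and of whole runs -/

section Simulation

variable {B : BilinearGroup} {l : ℕ}
variable {y : (k : GrpIdx) → BaseVar → B.El k} {ω : SetupVar l → ZMod B.p} {γ : Bool}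
  {N : ℕ} {hist : List (ℕ × ℕ)} {m : Mem B l} {s : Config B}

theorem eval_chalOk {c : ℕ} {I₀ I₁ : List ℕ} (h : Inv y ω γ N hist m s)
    (hI : I₀.length ≤ l) (hlen : I₀.length = I₁.length)
    (h₀ : ∀ i, m.scal (.work false i) = (I₀.map s.regs.scal).getD i 0)
    (h₁ : ∀ i, m.scal (.work true i) = (I₁.map s.regs.scal).getD i 0) :
    (chalOk hist c I₀.length).eval m = true ↔ s.regs.bit c = true ∧
      ChalAllowed l s (I₀.map s.regs.scal) (I₁.map s.regs.scal) := by
  set J₀ := I₀.map s.regs.scal with hJ₀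
  set J₁ := I₁.map s.regs.scal with hJ₁
  have l₀ : J₀.length = I₀.length := by simp [hJ₀]
  have l₁ : J₁.length = I₁.length := by simp [hJ₁]
  have hc : m.bit (.adv c) = s.regs.bit c := by rw [← h.adv]; rfl
  have v₀ : (nonzero I₀.length (.work false)).eval m = true ↔ ValidID l J₀ := by
    rw [eval_nonzero, nonzero_iff_getD (by rw [l₀]; exact hI), l₀]
    simp only [h₀]
  have v₁ : (nonzero I₀.length (.work true)).eval m = true ↔ ValidID l J₁ := by
    rw [eval_nonzero, nonzero_iff_getD (by rw [l₁, ← hlen]; exact hI), l₁, hlen]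
    simp only [h₁]
  have hq : (∀ x ∈ hist, (BitExp.not (.and (.var (.got x.1)) (.or
      (agree x.2 (.slot x.1) (.work false)) (agree x.2 (.slot x.1) (.work true))))).eval m = true) ↔
      ∀ I ∈ s.queried, ¬ I <+: J₀ ∧ ¬ I <+: J₁ := by
    have hag : ∀ (x : ℕ × ℕ) (I : ID B), I ∈ s.queried → I.length = x.2 →
        (∀ i : Fin l, m.scal (.slot x.1 i) = I.getD i 0) →
        ((agree x.2 (.slot x.1) (.work false)).eval m = true ↔ I <+: J₀) ∧
        ((agree x.2 (.slot x.1) (.work true)).eval m = true ↔ I <+: J₁) := by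
      intro x I hI hx hs
      rw [eval_agree, eval_agree, prefix_iff_getD (h.valid I hI), prefix_iff_getD (h.valid I hI),
        hx]
      simp only [hs, h₀, h₁, and_self]
    simp only [BitExp.eval_not, BitExp.eval_and, BitExp.eval_or, BitExp.eval, Bool.not_eq_true',
      Bool.and_eq_false_iff, Bool.or_eq_false_iff]
    constructor
    · intro hh I hI
      obtain ⟨x, hx, g, hxl, hs⟩ := h.queried I hI
      have h1 := (hh x hx).resolve_left (by simp [g])
      rw [← (hag x I hI hxl hs).1, ← (hag x I hI hxl hs).2]
      simpa using h1
    · intro hh x hx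
      by_cases g : m.bit (.got x.1) = true
      · obtain ⟨I, hI, hxl, hs⟩ := h.got x hx g
        have h1 := hh I hI
        rw [← (hag x I hI hxl hs).1, ← (hag x I hI hxl hs).2] at h1
        right
        simpa using h1
      · left; simpa using g
  have hq' : (hist.all ((BitExp.eval m) ∘ fun x => BitExp.not (.and (.var (.got x.1)) (.or
      (agree x.2 (.slot x.1) (.work false)) (agree x.2 (.slot x.1) (.work true)))))) = true ↔
      ∀ I ∈ s.queried, ¬ I <+: J₀ ∧ ¬ I <+: J₁ := by
    rw [← hq, List.all_eq_true]
    rfl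
  have hd : (!m.bit .done) = true ↔ s.challenge = none := by
    rw [h.done]; simp
  simp only [chalOk, BitExp.eval_all, List.all_cons, List.all_nil, Bool.and_true, List.all_map,
    Bool.and_eq_true, v₀, v₁]
  rw [show (fun a : BitExp l => BitExp.eval m a) = BitExp.eval m from rfl, hq', BitExp.eval_not]
  simp only [BitExp.eval, hc, hd, ChalAllowed, l₀, l₁, hlen, true_and]

theorem den_chalCode (R : Red l B.p) {q k c d d' M₀ M₁ : ℕ} {I₀ I₁ : List ℕ}
    (h : Inv y ω γ N hist m s) (hI : I₀.length ≤ l)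
    (hlen : I₀.length = I₁.length) {F : Mem B l → ℝ} {f : Config B → ℝ}
    (hF : ∀ m' s', Inv y ω γ N hist m' s' → F m' = f s') :
    Stmt.denList (R.chalCode hist c I₀ I₁ M₀ M₁ d d') F m =
      advStepE (R.chal y k ω) q γ (.chal c I₀ I₁ M₀ M₁ d d') f s := by
  set J₀ := I₀.map s.regs.scal with hJ₀
  set J₁ := I₁.map s.regs.scal with hJ₁
  obtain ⟨m₁, r₁, b₁, e₁, s₁, u₁⟩ := runs_copyId (.work false) (fun i j h => by simpa using h)
    (by simp) I₀ m
  obtain ⟨m₂, r₂, b₂, e₂, s₂, u₂⟩ := runs_copyId (.work true) (fun i j h => by simpa using h)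
    (by simp) I₁ m₁
  have adv₁ : m₁.advState.scal = s.regs.scal := by
    funext i
    rw [← h.adv]
    exact u₁ _ (by simp)
  rw [adv₁] at s₂
  rw [h.adv] at s₁
  have h₂ : Inv y ω γ N hist m₂ s := by
    refine h.of_eq (e₂.trans e₁) (fun v _ _ => by rw [b₂, b₁]) fun v _ _ _ _ hv _ => ?_
    rw [u₂ v (hv true), u₁ v (hv false)]
  have w₀ : ∀ i, m₂.scal (.work false i) = J₀.getD i 0 := fun i => by
    rw [u₂ _ (by simp), s₁]
  set P := s.regs.bit c = true ∧ ChalAllowed l s J₀ J₁ with hP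
  classical
  have ok₂ : (chalOk hist c I₀.length).eval m₂ = decide P :=
    bool_eq_decide (eval_chalOk h₂ hI hlen w₀ s₂)
  set m₃ := m₂.setBit .ok (decide P) with hm₃
  have h₃ : Inv y ω γ N hist m₃ s := h₂.of_eq rfl
    (fun v hv _ => by simp [hm₃, Mem.setBit, hv]) fun _ _ _ _ _ _ _ => rfl
  have r₃ : Stmt.Runs [.bit .ok (chalOk hist c I₀.length)] m₂ m₃ := by
    intro F
    simp only [Stmt.denList, Stmt.den, ok₂]
    rfl
  have ok₃ : m₃.bit .ok = decide P := by simp [hm₃, Mem.setBit]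
  obtain ⟨m₄, r₄, b₄, e₄, s₄, u₄⟩ := runs_selId (.chal false) (fun i j h => by simpa using h) .ok
    (.work false) (.chal false) m₃ fun i => ⟨.inr (by simp), .inl rfl⟩
  obtain ⟨m₅, r₅, b₅, e₅, s₅, u₅⟩ := runs_selId (.chal true) (fun i j h => by simpa using h) .ok
    (.work true) (.chal true) m₄ fun i => ⟨.inr (by simp), .inl rfl⟩
  obtain ⟨m₆, r₆, b₆, e₆, s₆, u₆⟩ := runs_selId (fun i => .exp (.ident i))
    (fun i j h => by simpa using h) .coin (.work true) (.work false) m₅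
    fun i => ⟨.inr (by simp), .inr (by simp)⟩
  obtain ⟨m₇, r₇, b₇, e₇, s₇, u₇⟩ := Stmt.runs_assign (fun v : KeyVar l => .exp (.key v))
    (fun i j h => by simpa using h) (fun v => .zero (.exp (.key v))) (fun _ => 0) m₆
    (fun i m' _ _ F => rfl) (keyVars l)
  set m₈ := (m₇.setScal (.exp .lt) 0).setScal (.exp .eq) 0 with hm₈
  have r₈ : Stmt.Runs [.zero (.exp .lt), .zero (.exp .eq)] m₇ m₈ := fun F => rfl
  have bit₈ : m₈.bit = m₃.bit := by
    rw [show m₈.bit = m₇.bit from rfl, b₇, b₆, b₅, b₄]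
  have el₈ : m₈.el = m₃.el := by
    rw [show m₈.el = m₇.el from rfl, e₇, e₆, e₅, e₄]
  have scal₈ : ∀ v : ScalVar l, (∀ i, v ≠ .exp (.ident i)) → (∀ i, v ≠ .exp (.key i)) →
      v ≠ .exp .lt → v ≠ .exp .eq → (∀ b i, v ≠ .chal b i) → m₈.scal v = m₃.scal v := by
    intro v h1 h2 h3 h4 h5
    simp only [hm₈, Mem.setScal]
    rw [Function.update_of_ne h4, Function.update_of_ne h3, u₇ v h2, u₆ v h1, u₅ v (h5 true),
      u₄ v (h5 false)]
  have adv₈ : m₈.advState = s.regs := by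
    rw [← h₃.adv]
    simp only [Mem.advState, State.mk.injEq, bit₈, el₈]
    exact ⟨trivial, funext fun i => scal₈ _ (by simp) (by simp) (by simp) (by simp) (by simp),
      trivial⟩
  have base₈ : ∀ k v, m₈.el k (.base v) = y k v := by rw [el₈]; exact h₃.base
  have coin₃ : m₃.bit .coin = γ := h₃.coin
  have env₈ : ∀ w, m₈.scal (.exp w) = env ω 0 (if γ then J₁ else J₀) 0 0 w := by
    intro w
    cases w with
    | setup v =>
      rw [scal₈ _ (by simp) (by simp) (by simp) (by simp) (by simp)]
      exact h₃.setup v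
    | key v =>
      simp only [hm₈, Mem.setScal]
      rw [Function.update_of_ne (by simp), Function.update_of_ne (by simp)]
      exact s₇ v (by simp [keyVars])
    | ident i =>
      simp only [hm₈, Mem.setScal]
      rw [Function.update_of_ne (by simp), Function.update_of_ne (by simp), u₇ _ (by simp), s₆,
        b₅, b₄, coin₃, u₅ _ (by simp), u₄ _ (by simp), u₅ _ (by simp), u₄ _ (by simp)]
      rw [show m₃.scal = m₂.scal from rfl, s₂, w₀]
      cases γ <;> rfl
    | lt =>
      simp only [hm₈, Mem.setScal]
      rw [Function.update_of_ne (by simp)]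
      simp [env]
    | eq => simp [hm₈, Mem.setScal, env]
  have hw := runs_writes (B := B) .left d (.var .ok) m₈ (fun _ _ _ => rfl)
    (List.ofFn R.C₁ ++ List.ofFn R.C₂)
  set J := if γ then J₁ else J₀ with hJ
  set M := s.regs.el .target (if γ then M₁ else M₀) with hM
  set ct := (R.chal y k ω).ct J M () with hct
  have hlist : (List.ofFn R.C₁ ++ List.ofFn R.C₂).map (fun G => (G.evalMem m₈ : B.G)) =
      List.ofFn ct.C₁ ++ List.ofFn ct.C₂ := by
    rw [List.map_append, List.map_ofFn, List.map_ofFn]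
    congr 2
    · funext j; exact Inv.evalMem _ base₈ env₈
    · funext j; exact Inv.evalMem _ base₈ env₈
  have ok₈ : m₈.bit .ok = decide P := by rw [bit₈, ok₃]
  simp only [BitExp.eval, ok₈, hlist, adv₈] at hw
  set s' : Config B := if P then s.addChal d d' J₀ J₁ ct else s with hs'
  set m₉ := m₈.setAdv (if decide P = true then
    s.regs.writeEl .left d (List.ofFn ct.C₁ ++ List.ofFn ct.C₂) else s.regs) with hm₉
  set m₁₀ := m₉.setAdv s'.regs with hm₁₀
  set m₁₁ := m₁₀.setBit .done (m₃.bit .done || decide P) with hm₁₁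
  have r₁₀ : Stmt.Runs [.elMsg d' (.var .ok) R.C M₁ M₀, .bit .done (.or (.var .done) (.var .ok))]
      m₉ m₁₁ := by
    intro F
    have hC : (R.C.evalMem m₉ : B.GT) = R.C.eval (y .target) (env ω 0 J 0 0) :=
      Inv.evalMem R.C base₈ env₈
    have hco : m₉.bit .coin = γ := by
      rw [show m₉.bit .coin = m₈.bit .coin from rfl, bit₈, coin₃]
    have hok : m₉.bit .ok = decide P := ok₈
    simp only [Stmt.denList, Stmt.den, hC, hco, BitExp.eval, hok, BitExp.eval_or]
    have hst : m₉.setEl .target (.adv d') (if decide P = true then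
        R.C.eval (y .target) (env ω 0 J 0 0) * m₉.el .target (.adv (if γ = true then M₁ else M₀))
        else m₉.el .target (.adv d')) = m₁₀ := by
      rw [hm₁₀, hs', ← Mem.setAdv_setEl]
      congr 1
      by_cases hp : P
      · rw [if_pos hp]
        simp only [hp, decide_true, if_true]
        rw [hm₉]
        simp only [hp, decide_true, if_true]
        rw [Mem.advState_setAdv]
        simp only [Config.addChal]
        congr 1
      · rw [if_neg hp]
        simp only [hp, decide_false, Bool.false_eq_true, if_false]
        rw [hm₉]
        simp only [hp, decide_false, Bool.false_eq_true, if_false]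
        rw [Mem.advState_setAdv]
        simp only [State.setEl]
        rw [show (m₈.setAdv s.regs).el .target (.adv d') = s.regs.el .target d' from rfl,
          Function.update_eq_self, Function.update_eq_self]
    rw [hst, show m₁₀.bit .done = m₃.bit .done by
      rw [show m₁₀.bit .done = m₈.bit .done from rfl, bit₈],
      show m₁₀.bit .ok = decide P from ok₈]
  have chal' : s'.challenge = if P then some (J₀, J₁) else s.challenge := by
    rw [hs']; split_ifs <;> rfl
  have quer' : s'.queried = s.queried := by
    rw [hs']; split_ifs <;> rfl
  have bit₁₁ : ∀ v, v ≠ .done → (∀ j, v ≠ .adv j) → m₁₁.bit v = m₃.bit v := by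
    intro v h1 h2
    simp only [hm₁₁, Mem.setBit]
    rw [Function.update_of_ne h1, ← bit₈]
    cases v <;> first | rfl | simp at h2
  have scal₁₁ : ∀ v, (∀ j, v ≠ .adv j) → m₁₁.scal v = m₈.scal v := by
    intro v h2
    cases v <;> first | rfl | simp at h2
  have slot₁₁ : ∀ pos i, m₁₁.scal (.slot pos i) = m₃.scal (.slot pos i) := fun pos i => by
    rw [scal₁₁ _ (by simp), scal₈ _ (by simp) (by simp) (by simp) (by simp) (by simp)]
  have h₁₁ : Inv y ω γ N hist m₁₁ s' := by
    constructor
    · rw [← Mem.advState_setAdv m₉ s'.regs, ← hm₁₀]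
      simp only [Mem.advState, State.mk.injEq]
      refine ⟨funext fun i => ?_, rfl, rfl⟩
      simp only [hm₁₁, Mem.setBit]
      rw [Function.update_of_ne (by simp)]
    · exact base₈
    · intro v
      rw [scal₁₁ _ (by simp)]
      exact env₈ (.setup v)
    · rw [bit₁₁ _ (by simp) (by simp)]
      exact coin₃
    · intro j
      rw [bit₁₁ _ (by simp) (by simp), quer']
      exact h₃.count j
    · rw [hm₁₁, chal', h₃.done]
      simp only [Mem.setBit, Function.update_self]
      by_cases hp : P <;> simp [hp]
    · intro c' hc' i
      rw [scal₁₁ _ (by simp), scal₁₁ _ (by simp)]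
      simp only [hm₈, Mem.setScal]
      rw [Function.update_of_ne (by simp), Function.update_of_ne (by simp), u₇ _ (by simp),
        u₆ _ (by simp), Function.update_of_ne (by simp), Function.update_of_ne (by simp),
        u₇ _ (by simp), u₆ _ (by simp), s₅, u₅ _ (by simp), s₄, b₄, ok₃, u₄ _ (by simp),
        u₄ _ (by simp)]
      rw [chal'] at hc'
      by_cases hp : P
      · simp only [hp, if_true, decide_true, Option.some.injEq] at hc' ⊢
        subst hc'
        rw [show m₃.scal = m₂.scal from rfl, w₀, s₂]
        exact ⟨rfl, rfl⟩
      · simp only [hp, if_false, decide_false, Bool.false_eq_true] at hc' ⊢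
        exact h₃.chal c' hc' i
    · rw [quer']; exact h.valid
    · exact h.hist_lt
    · intro x hx
      rw [bit₁₁ _ (by simp) (by simp), quer']
      simp only [slot₁₁]
      exact h₃.got x hx
    · rw [quer']
      intro I hI
      obtain ⟨x, hx, h1⟩ := h₃.queried I hI
      refine ⟨x, hx, ?_⟩
      rw [bit₁₁ _ (by simp) (by simp)]
      simp only [slot₁₁]
      exact h1
  unfold Red.chalCode
  rw [r₁.denList_append, r₂.denList_append, r₃.denList_append, r₄.denList_append,
    r₅.denList_append, r₆.denList_append, r₇.denList_append, r₈.denList_append,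
    hw.denList_append, r₁₀, hF _ _ h₁₁, hs']
  simp only [advStepE]
  by_cases hp : P
  · rw [if_pos hp]
    refine Eq.trans ?_ (if_pos hp).symm
    -- A simulated ciphertext has no coins of its own; its randomness was sampled during setup. The
    -- average over `Unit` is trivial.
    exact (Fintype.expect_const _).symm
  · rw [if_neg hp]
    exact (if_neg hp).symm

/-- Requests dropped by the translation have too great a depth, or challenge identities of different
depths. The experiment would refuse them as well. -/
theorem den_compile (R : Red l B.p) {q k : ℕ} (hk : k ≤ q) (A : List AdvInstr)
    (h : Inv y ω γ (q + 1) hist m s) {F : Mem B l → ℝ} {f : Config B → ℝ}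
    (hF : ∀ hist m' s', Inv y ω γ (q + 1) hist m' s' → F m' = f s') :
    Stmt.denList (R.compile q k hist A) F m = advRunE (R.chal y k ω) q γ A f s := by
  induction A generalizing hist m s with
  | nil => exact hF _ _ _ h
  | cons i A ih =>
    simp only [advRunE]
    cases i with
    | loc i =>
      simp only [Red.compile, Stmt.denList, Stmt.den, advStepE, h.adv]
      exact stepE_congr i (fun σ => ih (h.loc σ)) _
    | key c I d =>
      simp only [Red.compile]
      split_ifs with hI
      · rw [Stmt.denList_append]
        exact den_keyCode R hk h hI fun m' s' h' => ih h'
      · rw [ih h]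
        refine (if_neg ?_).symm
        rintro ⟨-, h1, -⟩
        exact hI (by simpa using h1.1.1)
    | chal c I₀ I₁ M₀ M₁ d d' =>
      simp only [Red.compile]
      split_ifs with hI
      · rw [Stmt.denList_append]
        exact den_chalCode R h hI.1 hI.2 fun m' s' h' => ih h'
      · rw [ih h]
        refine (if_neg ?_).symm
        rintro ⟨-, h1⟩
        exact hI ⟨by simpa using h1.2.1.1, by simpa using h1.2.2.2.1⟩

end Simulation

/-! ### Correctness of the complete reduction -/

section Simulation

variable {l p : ℕ}

/-- All pairings of elements of the input. -/
def pairs : List (Fin 12 × Fin 12) :=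
  (List.finRange 12).flatMap fun i => (List.finRange 12).map fun j => (i, j)

theorem mem_pairs (x : Fin 12 × Fin 12) : x ∈ pairs := by
  simp [pairs]

def BitExp.xor (a b : BitExp l) : BitExp l := .or (.and a (.not b)) (.and (.not a) b)

/-- The output of a reduction. -/
def Red.out (R : Red l p) (pol : Bool) : BitExp l :=
  .or (.and (.any (R.bad.map fun x => .isOne x.1 x.2)) (.not (.isOne R.test.1 R.test.2)))
    (.and (.not (.any (R.bad.map fun x => .isOne x.1 x.2)))
      (if pol then .xor (.var .coin) (.var (.adv 0)) else .not (.xor (.var .coin) (.var (.adv 0)))))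

noncomputable def Red.stmts (R : Red l p) (q k : ℕ) (A : List AdvInstr) : List (Stmt l p) :=
  pairs.map (fun x => .pair x.1 x.2) ++ ((setupVars l).map (fun v => .sample (.setup v)) ++
    (writes .left 0 (.const true) R.ppList ++ (writes .right 0 (.const true) (List.ofFn R.W) ++
    (writes .target 0 (.const true) [R.Ω] ++ ([.flip .coin] ++ R.compile q k [] A)))))

/-- The program of a reduction. -/
noncomputable def Red.prog (R : Red l p) (L q k : ℕ) (pol : Bool) (A : List AdvInstr) :
    List Instr :=
  (R.stmts q k A).flatMap (Stmt.code L) ++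
    ((R.out pol).code L 0 ++ [.bitMux 0 0 (bitTemp L 0) (bitTemp L 0)])

variable {B : BilinearGroup}

/-- The elements that a reduction starts with. -/
def baseVal (σ : State B) : (k : GrpIdx) → BaseVar → B.El k
  | k, .inp i => σ.el k i
  | .target, .pair i j => B.e (σ.el .left i) (σ.el .right j)
  | .left, .pair _ _ => 1
  | .right, .pair _ _ => 1

/-- A state in which all registers but the first twelve of each group are blank. -/
structure State.IsInput (σ : State B) : Prop where
  bit : ∀ i, σ.bit i = false
  scal : ∀ i, σ.scal i = 0
  el : ∀ k i, 12 ≤ i → σ.el k i = 1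

open Classical in
noncomputable def Red.isBad (R : Red l B.p) (y : (k : GrpIdx) → BaseVar → B.El k) : Bool :=
  R.bad.any fun x => decide (y x.1 x.2 = 1)

theorem runs_pairs (L : List (Fin 12 × Fin 12)) (m : Mem B l) :
    ∃ m', Stmt.Runs (L.map fun x => .pair x.1 x.2) m m' ∧ m'.bit = m.bit ∧ m'.scal = m.scal ∧
      (∀ k v, (k = .target → ∀ i j, v ≠ .base (.pair i j)) → m'.el k v = m.el k v) ∧
      ∀ x : Fin 12 × Fin 12, m'.el .target (.base (.pair x.1 x.2)) = if x ∈ L then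
        B.e (m.el .left (.base (.inp x.1))) (m.el .right (.base (.inp x.2)))
        else m.el .target (.base (.pair x.1 x.2)) := by
  induction L generalizing m with
  | nil => exact ⟨m, fun F => rfl, rfl, rfl, fun _ _ _ => rfl, by simp⟩
  | cons z L ih =>
    obtain ⟨m', r, b, s, e, f⟩ := ih (m.setEl .target (.base (.pair z.1 z.2))
      (B.e (m.el .left (.base (.inp z.1))) (m.el .right (.base (.inp z.2)))))
    refine ⟨m', fun F => ?_, b, s, fun k v hv => ?_, fun x => ?_⟩
    · rw [List.map_cons, Stmt.denList, ← r F]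
      rfl
    · rw [e k v hv]
      simp only [Mem.setEl]
      by_cases hk : k = .target
      · subst hk
        rw [Function.update_self, Function.update_of_ne (hv rfl _ _)]
      · rw [Function.update_of_ne hk]
    · rw [f x]
      by_cases hx : x = z
      · subst hx
        simp [Mem.setEl]
      · have : (ElVar.base (.pair x.1 x.2)) ≠ .base (.pair z.1 z.2) := by
          intro h
          simp only [ElVar.base.injEq, BaseVar.pair.injEq] at h
          exact hx (Prod.ext h.1 h.2)
        simp [Mem.setEl, hx, Function.update_of_ne this]

theorem writes_true (k : GrpIdx) (d : ℕ) (m : Mem B l) (Gs : List (GrpExp l B.p)) :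
    Stmt.Runs (writes k d (.const true) Gs) m
      (m.setAdv (m.advState.writeEl k d (Gs.map fun G => G.evalMem m))) := by
  have := runs_writes (B := B) k d (.const true) m (fun _ _ _ => rfl) Gs
  simpa [BitExp.eval] using this

/-- The reduction simulates the challenger `R.chal`. -/
theorem Red.runE_prog (R : Red l B.p) {q k : ℕ} (hk : k ≤ q) (pol : Bool) (A : List AdvInstr)
    (σ : State B) (hσ : σ.IsInput) :
    runE (R.prog B.encLen q k pol A) (fun σ => if σ.bit 0 = false then 1 else 0) σ =
      if R.isBad (baseVal σ) then
        Set.indicator {x | x = 1} 1 (baseVal σ R.test.1 R.test.2)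
      else 𝔼 ω, if pol then (R.chal (baseVal σ) k ω).value q A
        else 1 - (R.chal (baseVal σ) k ω).value q A := by
  classical
  set y := baseVal σ with hy
  have hend : runE ((R.out pol).code B.encLen 0 ++ [.bitMux 0 0 (bitTemp B.encLen 0)
      (bitTemp B.encLen 0)]) (fun σ => if σ.bit 0 = false then (1 : ℝ) else 0) =
      fun ρ => (fun m : Mem B l => if (R.out pol).eval m = false then (1 : ℝ) else 0) (view l ρ) := by
    funext ρ
    obtain ⟨ρ', s, -, e, -⟩ := (R.out pol).steps_code 0 ρ
    rw [runE_append, s]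
    simp [runE, stepE, stepDet, State.setBit, e]
  rw [Red.prog, runE_append, hend, Stmt.runE_codeList (R.stmts q k A)
    (fun m : Mem B l => if (R.out pol).eval m = false then (1 : ℝ) else 0) σ]
  set m₀ := view l σ with hm₀
  obtain ⟨m₁, r₁, b₁, s₁, e₁, f₁⟩ := runs_pairs pairs m₀
  have hadv : ∀ i, 12 ≤ elAddr (.adv i) := fun i => by
    change 12 ≤ 12 + _; omega
  have adv₁ : m₁.advState = { bit := fun _ => false, scal := fun _ => 0, el := fun _ _ => 1 } := by
    simp only [Mem.advState, b₁, s₁, State.mk.injEq]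
    refine ⟨funext fun i => hσ.bit _, funext fun i => hσ.scal _, ?_⟩
    funext k i
    rw [e₁ k _ (by simp)]
    exact hσ.el k _ (hadv i)
  have base₁ : ∀ k v, m₁.el k (.base v) = y k v := by
    intro k v
    cases v with
    | inp i =>
      rw [e₁ k _ (by simp)]
      rfl
    | pair i j =>
      cases k with
      | target =>
        rw [f₁ (i, j), if_pos (mem_pairs _)]
        rfl
      | left =>
        rw [e₁ _ _ (by simp)]
        exact hσ.el _ _ (by simp only [elAddr]; omega)
      | right =>
        rw [e₁ _ _ (by simp)]
        exact hσ.el _ _ (by simp only [elAddr]; omega)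
  rw [Red.stmts, r₁.denList_append, Stmt.denList_append,
    Stmt.denList_sample ExpVar.setup (fun _ _ h => by simpa using h) (setupVars l)
      (Finset.nodup_toList _)]
  -- The indicator of output 0, as a function of the final configuration. On a bad input it ignores
  -- the run; otherwise it says whether the guess is right or, for the other polarity, whether it is
  -- wrong.
  set f : Bool → Config B → ℝ := fun γ s => if R.isBad y then
    Set.indicator {x | x = 1} 1 (y R.test.1 R.test.2) else if pol then guessed γ s
      else 1 - guessed γ s with hf
  have main : ∀ ω : SetupVar l → ZMod B.p,
      Stmt.denList (writes .left 0 (.const true) R.ppList ++ (writes .right 0 (.const true)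
        (List.ofFn R.W) ++ (writes .target 0 (.const true) [R.Ω] ++
        ([.flip .coin] ++ R.compile q k [] A))))
        (fun m : Mem B l => if (R.out pol).eval m = false then (1 : ℝ) else 0)
        (m₁.setOn .setup (setupVars l) ω) =
      𝔼 γ, advRunE (R.chal y k ω) q γ A (f γ) (R.chal y k ω).pp.init := by
    intro ω
    set m₂ := m₁.setOn .setup (setupVars l) ω with hm₂
    have set₂ : ∀ v, m₂.scal (.exp (.setup v)) = ω v := fun v =>
      Mem.setOn_mem (φ := ExpVar.setup) (fun _ _ h => by simpa using h) ω m₁ (by simp [setupVars])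
    have oth₂ : ∀ v : ScalVar l, (∀ w, v ≠ .exp (.setup w)) → m₂.scal v = 0 := fun v hv => by
      rw [hm₂, Mem.setOn_not_mem ω m₁ fun w _ => hv w, s₁]
      exact hσ.scal _
    have env₂ : ∀ w, m₂.scal (.exp w) = env ω 0 [] 0 0 w := by
      intro w
      cases w with
      | setup v => exact set₂ v
      | _ => rw [oth₂ _ (by simp)]; simp [env]
    have adv₂ : m₂.advState = m₁.advState := by
      simp only [Mem.advState, State.mk.injEq]
      refine ⟨rfl, funext fun i => ?_, rfl⟩
      rw [oth₂ _ (by simp), s₁]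
      exact (hσ.scal _).symm
    have bit₂ : ∀ v, m₂.bit v = false := fun v => by
      rw [show m₂.bit = m₁.bit from rfl, b₁]
      exact hσ.bit _
    have ev : ∀ {k' : GrpIdx} (G : GrpExp l B.p) (ρ : State B),
        (G.evalMem (m₂.setAdv ρ) : B.El k') = G.eval (y k') (env ω 0 [] 0 0) := fun G ρ =>
      Inv.evalMem (m := m₂.setAdv ρ) G base₁ env₂
    have ev' : ∀ {k' : GrpIdx} (G : GrpExp l B.p),
        (G.evalMem m₂ : B.El k') = G.eval (y k') (env ω 0 [] 0 0) := fun G =>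
      Inv.evalMem (m := m₂) G base₁ env₂
    rw [(writes_true .left 0 m₂ R.ppList).denList_append,
      (writes_true .right 0 _ (List.ofFn R.W)).denList_append,
      (writes_true .target 0 _ [R.Ω]).denList_append]
    simp only [Mem.setAdv_setAdv, Mem.advState_setAdv, ev, ev', map_ppList R y k, List.map_ofFn,
      adv₂, adv₁]
    rw [List.singleton_append, Stmt.denList]
    simp only [Stmt.den]
    refine Finset.expect_congr rfl fun γ _ => ?_
    refine den_compile R hk A (ω := ω) (γ := γ) (y := y) ?_ ?_
    · constructor
      · rfl
      · exact base₁
      · exact set₂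
      · simp [Mem.setBit]
      · intro j h1 _
        have : (m₂.setAdv (State.input (R.chal y k ω).pp.toList
          (List.ofFn (R.chal y k ω).pp.W) [(R.chal y k ω).pp.Ω])).bit (.count j) = false :=
          bit₂ _
        simp only [Mem.setBit, PublicParams.init, List.length_nil]
        rw [Function.update_of_ne (by simp)]
        refine (bit₂ (.count j)).trans ?_
        simp; omega
      · simp only [Mem.setBit, PublicParams.init]
        rw [Function.update_of_ne (by simp)]
        exact bit₂ .done
      · simp [PublicParams.init]
      · simp [PublicParams.init]
      · simp
      · simp
      · simp [PublicParams.init]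
    · intro hist m' s' h
      have hbad : ((R.bad.map fun x => (BitExp.isOne x.1 x.2 : BitExp l)).any
          fun a => a.eval m') = R.isBad y := by
        rw [List.any_map, Red.isBad]
        congr 1
        funext x
        simp only [Function.comp_apply, BitExp.eval, h.base]
      have hg : m'.bit (.adv 0) = s'.regs.bit 0 := by rw [← h.adv]; rfl
      simp only [Red.out, BitExp.eval_or, BitExp.eval_and, BitExp.eval_not, BitExp.eval_any, hbad,
        hf]
      by_cases hb : R.isBad y = true
      · simp only [hb, if_true, BitExp.eval, h.base, Bool.true_and, Bool.not_true, Bool.false_and,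
          Bool.or_false, Bool.not_eq_false', decide_eq_true_eq, Set.indicator, Set.mem_ofPred_eq,
          Pi.one_apply]
      · simp only [hb, if_false, Bool.false_eq_true] at hb ⊢
        simp only [Bool.false_and, Bool.false_or, Bool.not_false, Bool.true_and]
        cases pol <;> simp only [BitExp.eval_not, BitExp.xor, BitExp.eval_or, BitExp.eval_and,
          BitExp.eval, h.coin, hg, guessed, if_true, Bool.false_eq_true, if_false] <;>
          cases γ <;> cases s'.regs.bit 0 <;> simp
  simp only [main]
  by_cases hb : R.isBad y = true
  · simp only [hf, hb, if_true, advRunE_const, Fintype.expect_const]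
  · simp only [hf, hb, if_false, Bool.false_eq_true]
    refine Finset.expect_congr rfl fun ω _ => ?_
    cases pol
    · simp only [Bool.false_eq_true, if_false]
      -- Averages over runs are additive and fix constants, so the complementary indicator has the
      -- complementary average.
      rw [Challenger.value, ← Fintype.expect_const (ι := Bool) (1 : ℝ),
        ← Finset.expect_sub_distrib]
      refine Finset.expect_congr rfl fun γ _ => ?_
      rw [eq_sub_iff_add_eq, ← advRunE_add]
      simp [advRunE_const]
    · simp only [if_true]
      rfl

end Simulation

/-! ### The length of the programs -/

section Length

variable {l p : ℕ}

theorem BitExp.size_not (a : BitExp l) : (not a).size = a.size + 2 := rfl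
theorem BitExp.size_and (a b : BitExp l) : (and a b).size = a.size + b.size + 3 := rfl
theorem BitExp.size_or (a b : BitExp l) : (or a b).size = a.size + b.size + 5 := by
  simp only [or, size, size_not]; ring

theorem BitExp.size_all_le {L : List (BitExp l)} {s : ℕ} (h : ∀ a ∈ L, a.size ≤ s) :
    (all L).size ≤ L.length * (s + 3) + 1 := by
  induction L with
  | nil => simp [all, size]
  | cons a L ih =>
    have h1 := ih fun b hb => h b (List.mem_cons_of_mem _ hb)
    have h2 := h a List.mem_cons_self
    have h3 : (all (a :: L)).size = a.size + (all L).size + 3 := rfl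
    rw [h3, List.length_cons, Nat.succ_mul]
    omega

theorem BitExp.size_any_le {L : List (BitExp l)} {s : ℕ} (h : ∀ a ∈ L, a.size ≤ s) :
    (any L).size ≤ L.length * (s + 5) + 1 := by
  induction L with
  | nil => simp [any, size]
  | cons a L ih =>
    have h1 := ih fun b hb => h b (List.mem_cons_of_mem _ hb)
    have h2 := h a List.mem_cons_self
    have h3 : (any (a :: L)).size = a.size + (any L).size + 5 := size_or a (any L)
    rw [h3, List.length_cons, Nat.succ_mul]
    omega

theorem size_ge (j : ℕ) : (ge j : BitExp l).size = 1 := by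
  unfold ge; split_ifs <;> rfl

theorem size_nonzero_le (m : ℕ) (φ : Fin l → ScalVar l) : (nonzero m φ).size ≤ l * 7 + 1 := by
  refine (BitExp.size_all_le (s := 4) ?_).trans_eq (by simp)
  intro a ha
  obtain ⟨i, -, rfl⟩ := List.mem_map.mp ha
  split_ifs <;> simp [BitExp.size_not, BitExp.size]

theorem size_agree_le (m : ℕ) (φ ψ : Fin l → ScalVar l) : (agree m φ ψ).size ≤ l * 4 + 1 := by
  refine (BitExp.size_all_le (s := 1) ?_).trans_eq (by simp)
  intro a ha
  obtain ⟨i, -, rfl⟩ := List.mem_map.mp ha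
  split_ifs <;> simp [BitExp.size]

theorem size_keyOk_le (q pos c m : ℕ) : (keyOk q pos c m : BitExp l).size ≤ l * 15 + 40 := by
  have h1 := size_nonzero_le m (.slot pos : Fin l → ScalVar l)
  have h2 := size_agree_le m (.slot pos : Fin l → ScalVar l) (.chal false)
  have h3 := size_agree_le m (.slot pos : Fin l → ScalVar l) (.chal true)
  simp only [keyOk, BitExp.all, List.foldr, BitExp.size_and, BitExp.size_not, BitExp.size_or,
    BitExp.size, size_ge]
  omega

theorem size_chalOk_le (hist : List (ℕ × ℕ)) (c m : ℕ) :
    (chalOk hist c m : BitExp l).size ≤ l * 14 + 40 + hist.length * (l * 8 + 20) := by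
  have h1 := size_nonzero_le m (.work false : Fin l → ScalVar l)
  have h2 := size_nonzero_le m (.work true : Fin l → ScalVar l)
  have h3 : (BitExp.all (hist.map fun h => .not (.and (.var (.got h.1))
      (.or (agree h.2 (.slot h.1) (.work false)) (agree h.2 (.slot h.1) (.work true))))) :
        BitExp l).size ≤ hist.length * (l * 8 + 13 + 3) + 1 := by
    refine (BitExp.size_all_le (s := l * 8 + 13) ?_).trans_eq (by simp)
    intro a ha
    obtain ⟨h, -, rfl⟩ := List.mem_map.mp ha
    have h4 := size_agree_le h.2 (.slot h.1 : Fin l → ScalVar l) (.work false)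
    have h5 := size_agree_le h.2 (.slot h.1 : Fin l → ScalVar l) (.work true)
    simp only [BitExp.size_and, BitExp.size_not, BitExp.size_or, BitExp.size]
    omega
  have h6 : hist.length * (l * 8 + 13 + 3) ≤ hist.length * (l * 8 + 20) :=
    Nat.mul_le_mul_left _ (by omega)
  have h7 : (chalOk hist c m : BitExp l).size = 1 + ((1 + 2) + ((nonzero m (.work false) :
      BitExp l).size + ((nonzero m (.work true) : BitExp l).size + ((BitExp.all (hist.map fun h =>
      .not (.and (.var (.got h.1)) (.or (agree h.2 (.slot h.1) (.work false))
      (agree h.2 (.slot h.1) (.work true))))) : BitExp l).size + 1 + 3) + 3) + 3) + 3) + 3 := rfl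
  rw [h7]
  omega

theorem length_keyVars_le : (keyVars l).length ≤ 3 * l + 20 := by
  have h : keyVars l ⊆ [.delta, .rho, .r true, .r false, .eta true, .eta false,
      .c true none, .c true (some none), .c false none, .c false (some none)] ++
      ((List.finRange l).map (fun i => .c true (some (some i))) ++
      ((List.finRange l).map (fun i => .c false (some (some i))) ++
      (List.finRange l).map fun i => .a i)) := by
    intro v _
    rcases v with _ | _ | b | b | ⟨b, _ | _ | j⟩ | i <;> (try cases b) <;> simp
  refine ((Finset.nodup_toList _).subperm h).length_le.trans ?_
  simp only [List.length_append, List.length_map, List.length_finRange, List.length_cons,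
    List.length_nil]
  omega

theorem length_setupVars_le : (setupVars l).length ≤ 2 * l + 20 := by
  have h : setupVars l ⊆ [.nu, .phi1, .phi2, .yh, .alpha, .t, .s, .z, .xi, .zeta, .ah, .a0,
      .delta, .rho, .eta true, .eta false] ++
      ((List.finRange l).map (fun i => .yu i) ++ (List.finRange l).map fun i => .au i) := by
    intro v _
    rcases v with _ | _ | _ | _ | _ | _ | _ | _ | _ | _ | _ | _ | _ | _ | b | i | i <;>
      (try cases b) <;> simp
  refine ((Finset.nodup_toList _).subperm h).length_le.trans ?_
  simp only [List.length_append, List.length_map, List.length_finRange, List.length_cons,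
    List.length_nil]
  omega

/-- The total size of a list of statements. -/
def Stmt.total (L : ℕ) (S : List (Stmt l p)) : ℕ := (S.map (Stmt.size L)).sum

theorem Stmt.total_append (L : ℕ) (S T : List (Stmt l p)) :
    total L (S ++ T) = total L S + total L T := by
  simp [total]

theorem Stmt.total_cons (L : ℕ) (s : Stmt l p) (T : List (Stmt l p)) :
    total L (s :: T) = s.size L + total L T := by
  simp [total]

theorem Stmt.total_nil (L : ℕ) : total L ([] : List (Stmt l p)) = 0 := rfl

theorem Stmt.total_le (L : ℕ) {S : List (Stmt l p)} {s : ℕ} (h : ∀ x ∈ S, x.size L ≤ s) :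
    total L S ≤ S.length * s := by
  unfold total
  refine (List.sum_le_card_nsmul _ s ?_).trans_eq (by simp)
  simpa using h

theorem Stmt.length_flatMap_code (L : ℕ) (S : List (Stmt l p)) :
    (S.flatMap (code L)).length ≤ total L S := by
  induction S with
  | nil => simp [total]
  | cons s S ih =>
    have := length_code L s
    rw [List.flatMap_cons, List.length_append, total_cons]
    omega

theorem total_copyId (L : ℕ) (φ : Fin l → ScalVar l) (I : List ℕ) :
    Stmt.total L (copyId φ I : List (Stmt l p)) ≤ l := by
  refine (Stmt.total_le L (s := 1) ?_).trans_eq (by simp [copyId])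
  intro x hx
  obtain ⟨i, -, rfl⟩ := List.mem_map.mp hx
  split <;> exact le_rfl

theorem total_selId (L : ℕ) (φ : Fin l → ScalVar l) (c : BitVar) (a b : Fin l → ScalVar l) :
    Stmt.total L (selId φ c a b : List (Stmt l p)) ≤ l := by
  refine (Stmt.total_le L (s := 1) ?_).trans_eq (by simp [selId])
  intro x hx
  obtain ⟨i, -, rfl⟩ := List.mem_map.mp hx
  exact le_rfl

theorem total_counters (L N : ℕ) : Stmt.total L (counters N : List (Stmt l p)) = N * 12 := by
  induction N with
  | zero => rfl
  | succ N ih =>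
    rw [counters, Stmt.total_cons, ih]
    simp only [Stmt.size, BitExp.size_and, BitExp.size_or, BitExp.size, size_ge]
    ring

theorem total_writes (L : ℕ) (k : GrpIdx) (d : ℕ) (c : BitExp l) (hc : c.size = 1)
    {Gs : List (GrpExp l p)} {s : ℕ} (h : ∀ G ∈ Gs, G.size ≤ s) :
    Stmt.total L (writes k d c Gs) ≤ Gs.length * (s + 2) := by
  induction Gs generalizing d with
  | nil => simp [writes, Stmt.total]
  | cons G Gs ih =>
    have h1 := ih (d + 1) fun G' h' => h G' (List.mem_cons_of_mem _ h')
    have h2 := h G List.mem_cons_self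
    rw [writes, Stmt.total_cons, List.length_cons, Nat.succ_mul]
    simp only [Stmt.size, hc]
    omega

/-- All formulas of the reduction have size at most `s`. -/
structure Red.SizeLe (R : Red l p) (s : ℕ) : Prop where
  pos : 1 ≤ s
  g : ∀ i, (R.g i).size ≤ s
  h : ∀ i, (R.h i).size ≤ s
  u : ∀ i j, (R.u i j).size ≤ s
  W : ∀ i, (R.W i).size ≤ s
  Ω : R.Ω.size ≤ s
  key : ∀ b i j, (R.key b i j).size ≤ s
  C : R.C.size ≤ s
  C₁ : ∀ i, (R.C₁ i).size ≤ s
  C₂ : ∀ i, (R.C₂ i).size ≤ s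
  bad : R.bad.length ≤ s

variable {R : Red l p} {s : ℕ}

theorem length_flatten_ofFn {α : Type} (f : Fin l → Fin 3 → α) :
    (List.ofFn fun i => List.ofFn (f i)).flatten.length = l * 3 := by
  simp [List.length_flatten, List.map_ofFn, Function.comp_def]

theorem Red.SizeLe.total_keyList (h : R.SizeLe s) (L d m : ℕ) (k' : GrpIdx) (c : BitExp l)
    (hc : c.size = 1) :
    Stmt.total L (writes k' d c (R.keyList m)) ≤ (12 + l * 6) * (s + 2) := by
  refine (total_writes L k' d c hc (s := s) ?_).trans_eq ?_
  · intro G hG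
    have hn : GrpExp.size ([] : GrpExp l p) ≤ s := h.pos
    simp only [Red.keyList, List.mem_append, List.mem_ofFn, List.mem_flatten,
      exists_exists_eq_and] at hG
    rcases hG with ((((⟨i, rfl⟩ | ⟨i, rfl⟩) | ⟨i, j, rfl⟩) | ⟨i, rfl⟩) | ⟨i, rfl⟩) | ⟨i, j, rfl⟩
    any_goals exact h.key _ _ _
    all_goals
      split_ifs
      exacts [h.key _ _ _, hn]
  · congr 1
    simp only [Red.keyList, List.length_append, List.length_ofFn, length_flatten_ofFn]
    ring

theorem Red.SizeLe.total_keyCode (h : R.SizeLe s) (L q k pos c : ℕ) (I : List ℕ) (d : ℕ) :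
    Stmt.total L (R.keyCode q k pos c I d) ≤
      20 * l + 100 + (12 + l * 6) * (s + 2) + (q + 1) * 12 := by
  have h1 := total_copyId (p := p) L (.slot pos : Fin l → ScalVar l) I
  have h2 := total_copyId (p := p) L (fun i : Fin l => (.exp (.ident i) : ScalVar l)) I
  have h3 := size_keyOk_le (l := l) q pos c I.length
  have h4 : Stmt.total L ((keyVars l).map (fun v => (.sample (.key v) : Stmt l p))) ≤
      3 * l + 20 := by
    refine (Stmt.total_le L (s := 1) ?_).trans (by simpa using length_keyVars_le)
    intro x hx
    obtain ⟨i, -, rfl⟩ := List.mem_map.mp hx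
    exact le_rfl
  have h5 := h.total_keyList L d I.length .right (.var .ok) rfl
  unfold Red.keyCode
  simp only [Stmt.total_append, Stmt.total_cons, Stmt.total_nil, Stmt.size, BitExp.size_not,
    BitExp.size_and, BitExp.size, size_ge, total_counters]
  omega

theorem Red.SizeLe.total_chalCode (h : R.SizeLe s) (L : ℕ) (hist : List (ℕ × ℕ)) (c : ℕ)
    (I₀ I₁ : List ℕ) (M₀ M₁ d d' : ℕ) :
    Stmt.total L (R.chalCode hist c I₀ I₁ M₀ M₁ d d') ≤
      30 * l + 100 + 7 * (s + 2) + hist.length * (l * 8 + 20) := by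
  have h1 := total_copyId (p := p) L (.work false : Fin l → ScalVar l) I₀
  have h2 := total_copyId (p := p) L (.work true : Fin l → ScalVar l) I₁
  have h3 := size_chalOk_le (l := l) hist c I₀.length
  have h4 : Stmt.total L ((keyVars l).map (fun v => (.zero (.exp (.key v)) : Stmt l p))) ≤
      3 * l + 20 := by
    refine (Stmt.total_le L (s := 1) ?_).trans (by simpa using length_keyVars_le)
    intro x hx
    obtain ⟨i, -, rfl⟩ := List.mem_map.mp hx
    exact le_rfl
  have h5 := total_selId (p := p) L (.chal false : Fin l → ScalVar l) .ok (.work false)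
    (.chal false)
  have h6 := total_selId (p := p) L (.chal true : Fin l → ScalVar l) .ok (.work true)
    (.chal true)
  have h7 := total_selId (p := p) L (fun i : Fin l => (.exp (.ident i) : ScalVar l)) .coin
    (.work true) (.work false)
  have h8 : Stmt.total L (writes .left d (.var .ok) (List.ofFn R.C₁ ++ List.ofFn R.C₂)) ≤
      6 * (s + 2) := by
    refine (total_writes L .left d (.var .ok) rfl (s := s) ?_).trans_eq (by simp)
    intro G hG
    simp only [List.mem_append, List.mem_ofFn] at hG
    rcases hG with ⟨i, rfl⟩ | ⟨i, rfl⟩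
    exacts [h.C₁ i, h.C₂ i]
  have h9 := h.C
  unfold Red.chalCode
  simp only [Stmt.total_append, Stmt.total_cons, Stmt.total_nil, Stmt.size, BitExp.size_not,
    BitExp.size_or, BitExp.size]
  omega

/-- A bound for the number of steps that simulate one step of an adversary of length `a`. -/
def stepBound (L l s q a : ℕ) : ℕ :=
  50 * l + 200 + (19 + l * 6) * (s + 2) + (q + 1) * 12 + a * (l * 8 + 20) + (L + 1)

/-- The cost of a challenge grows with the history, which gains at most one entry per instruction.
The sum of the lengths of history and remaining program is bounded by `a` throughout. -/
theorem Red.SizeLe.total_compile (h : R.SizeLe s) (L q k : ℕ) (a : ℕ) (A : List AdvInstr)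
    (hist : List (ℕ × ℕ)) (ha : hist.length + A.length ≤ a) :
    Stmt.total L (R.compile q k hist A) ≤ A.length * stepBound L l s q a := by
  induction A generalizing hist with
  | nil => simp [Red.compile, Stmt.total]
  | cons i A ih =>
    simp only [List.length_cons] at ha
    have hs : (12 + l * 6) * (s + 2) ≤ (19 + l * 6) * (s + 2) := Nat.mul_le_mul_right _ (by omega)
    have hs' : 7 * (s + 2) ≤ (19 + l * 6) * (s + 2) := Nat.mul_le_mul_right _ (by omega)
    have hh : hist.length * (l * 8 + 20) ≤ a * (l * 8 + 20) := Nat.mul_le_mul_right _ (by omega)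
    rw [List.length_cons, Nat.succ_mul]
    cases i with
    | loc i =>
      have := ih hist (by omega)
      simp only [Red.compile, Stmt.total_cons, Stmt.size]
      unfold stepBound at *
      omega
    | key c I d =>
      simp only [Red.compile]
      split_ifs with hI
      · have h1 := ih ((hist.length, I.length) :: hist) (by simp; omega)
        have h2 := h.total_keyCode L q k hist.length c I d
        rw [Stmt.total_append]
        unfold stepBound at *
        omega
      · have h1 := ih hist (by omega)
        omega
    | chal c I₀ I₁ M₀ M₁ d d' =>
      have h1 := ih hist (by omega)
      simp only [Red.compile]
      split_ifs with hI
      · have h2 := h.total_chalCode L hist c I₀ I₁ M₀ M₁ d d'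
        rw [Stmt.total_append]
        unfold stepBound at *
        omega
      · omega

theorem Red.SizeLe.length_prog (h : R.SizeLe s) (L q k : ℕ) (pol : Bool) (A : List AdvInstr) :
    (R.prog L q k pol A).length ≤ 2 * l + 300 + (11 + l * 3) * (s + 2) + 14 * s +
      A.length * stepBound L l s q A.length := by
  have h1 : Stmt.total L (pairs.map (fun x => (.pair x.1 x.2 : Stmt l p))) ≤ 144 := by
    refine (Stmt.total_le L (s := 1) ?_).trans_eq (by simp [pairs])
    intro x hx
    obtain ⟨i, -, rfl⟩ := List.mem_map.mp hx
    exact le_rfl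
  have h2 : Stmt.total L ((setupVars l).map (fun v => (.sample (.setup v) : Stmt l p))) ≤
      2 * l + 20 := by
    refine (Stmt.total_le L (s := 1) ?_).trans (by simpa using length_setupVars_le)
    intro x hx
    obtain ⟨i, -, rfl⟩ := List.mem_map.mp hx
    exact le_rfl
  have h3 : Stmt.total L (writes .left 0 (.const true) R.ppList) ≤ (6 + l * 3) * (s + 2) := by
    refine (total_writes L .left 0 (.const true) rfl (s := s) ?_).trans_eq ?_
    · intro G hG
      simp only [Red.ppList, List.mem_append, List.mem_ofFn, List.mem_flatten,
        exists_exists_eq_and] at hG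
      rcases hG with (⟨i, rfl⟩ | ⟨i, rfl⟩) | ⟨i, j, rfl⟩
      · exact h.g i
      · exact h.h i
      · exact h.u _ _
    · congr 1
      simp only [Red.ppList, List.length_append, List.length_ofFn, length_flatten_ofFn]
  have h4 : Stmt.total L (writes .right 0 (.const true) (List.ofFn R.W)) ≤ 3 * (s + 2) := by
    refine (total_writes L .right 0 (.const true) rfl (s := s) ?_).trans_eq (by simp)
    intro G hG
    obtain ⟨i, rfl⟩ := List.mem_ofFn.mp hG
    exact h.W i
  have h5 : Stmt.total L (writes .target 0 (.const true) [R.Ω]) ≤ 1 * (s + 2) :=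
    total_writes L .target 0 (.const true) rfl (s := s) (by simpa using h.Ω)
  have h6 := h.total_compile L q k A.length A [] (by simp)
  have h7 : (R.out pol).size ≤ 14 * s + 60 := by
    have hb : (BitExp.any (R.bad.map fun x => (.isOne x.1 x.2 : BitExp l))).size ≤
        R.bad.length * 7 + 1 := by
      refine (BitExp.size_any_le (s := 2) ?_).trans_eq (by simp)
      intro a ha
      obtain ⟨x, -, rfl⟩ := List.mem_map.mp ha
      exact le_rfl
    have := h.bad
    cases pol <;> simp only [Red.out, BitExp.size_or, BitExp.size_and, BitExp.size_not, BitExp.xor,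
      BitExp.size, if_true, if_false, Bool.false_eq_true] <;> omega
  have h8 := Stmt.length_flatMap_code L (R.stmts q k A)
  have h9 : Stmt.total L ([.flip .coin] : List (Stmt l p)) = 1 := rfl
  rw [Red.stmts] at h8
  simp only [Stmt.total_append, h9] at h8
  rw [Red.prog, Red.stmts, List.length_append, List.length_append, BitExp.length_code]
  simp only [List.length_singleton]
  have h10 : (11 + l * 3) * (s + 2) = (6 + l * 3) * (s + 2) + 3 * (s + 2) + 1 * (s + 2) +
    1 * (s + 2) := by ring
  omega

end Length

/-! ### Polynomial bounds -/

namespace PolyBounded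

theorem mono {f g : ℕ → ℕ} (h : PolyBounded g) (hfg : ∀ n, f n ≤ g n) : PolyBounded f := by
  obtain ⟨P, hP⟩ := h
  exact ⟨P, fun n => (hfg n).trans (hP n)⟩

theorem const (c : ℕ) : PolyBounded fun _ => c := ⟨Polynomial.C c, by simp⟩

theorem add {f g : ℕ → ℕ} (hf : PolyBounded f) (hg : PolyBounded g) :
    PolyBounded fun n => f n + g n := by
  obtain ⟨P, hP⟩ := hf
  obtain ⟨Q, hQ⟩ := hg
  exact ⟨P + Q, fun n => by rw [Polynomial.eval_add]; exact Nat.add_le_add (hP n) (hQ n)⟩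

theorem mul {f g : ℕ → ℕ} (hf : PolyBounded f) (hg : PolyBounded g) :
    PolyBounded fun n => f n * g n := by
  obtain ⟨P, hP⟩ := hf
  obtain ⟨Q, hQ⟩ := hg
  exact ⟨P * Q, fun n => by rw [Polynomial.eval_mul]; exact Nat.mul_le_mul (hP n) (hQ n)⟩

end PolyBounded

theorem length_le_cost (A : List AdvInstr) : A.length ≤ (A.map AdvInstr.cost).sum := by
  induction A with
  | nil => simp
  | cons i A ih =>
    have : 1 ≤ i.cost := by cases i <;> simp [AdvInstr.cost, add_assoc]
    rw [List.map_cons, List.sum_cons, List.length_cons]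
    omega

/-- Reductions with formulas of linear size are efficient. -/
theorem isPPT_prog (Γ : BilinearGroupFamily) {l : ℕ → ℕ} (hl : PolyBounded l)
    {𝓐 : ℕ → List AdvInstr} (hA : IsPPTAdversary 𝓐)
    (R : (n : ℕ) → Red (l n) (Γ.grp n).p) (c : ℕ) (hR : ∀ n, (R n).SizeLe (c * (l n + 1)))
    (q k : ℕ → ℕ) (pol : ℕ → Bool) (hq : ∀ n, q n ≤ (𝓐 n).length) :
    IsPPT fun n => (R n).prog (Γ.grp n).encLen (q n) (k n) (pol n) (𝓐 n) := by
  have ha : PolyBounded fun n => (𝓐 n).length :=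
    PolyBounded.mono hA fun n => length_le_cost _
  have hs : PolyBounded fun n => c * (l n + 1) := (PolyBounded.const c).mul (hl.add (.const 1))
  have hq' := PolyBounded.mono ha hq
  have hstep : PolyBounded fun n =>
      stepBound (Γ.grp n).encLen (l n) (c * (l n + 1)) (q n) (𝓐 n).length := by
    unfold stepBound
    exact (((((PolyBounded.const 50).mul hl).add (.const 200)).add
      (((PolyBounded.const 19).add (hl.mul (.const 6))).mul (hs.add (.const 2)))).add
      ((hq'.add (.const 1)).mul (.const 12))).add
      (ha.mul ((hl.mul (.const 8)).add (.const 20))) |>.add (Γ.encLen_poly.add (.const 1))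
  refine PolyBounded.mono ?_ fun n => (hR n).length_prog _ (q n) (k n) (pol n) (𝓐 n)
  exact (((((PolyBounded.const 2).mul hl).add (.const 300)).add
    (((PolyBounded.const 11).add (hl.mul (.const 3))).mul (hs.add (.const 2)))).add
    ((PolyBounded.const 14).mul hs)).add (ha.mul hstep)

/-! ### Powers with exponents in `ℤ_p` -/

section Powers

variable {B : BilinearGroup} {k : GrpIdx}

theorem el_pow_card (x : B.El k) : x ^ B.p = 1 := by
  have := pow_card_eq_one (x := x)
  rwa [B.card_el] at this

/-- Exponents may be reduced modulo `p`, as the group has order `p`. The laws for exponents in `ZMod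
B.p` are read off from those for natural numbers through this lemma. -/
theorem el_pow_natCast (x : B.El k) (n : ℕ) : x ^ (n : ZMod B.p) = x ^ n := by
  change x ^ (n : ZMod B.p).val = x ^ n
  rw [ZMod.val_natCast]
  conv_rhs => rw [← Nat.mod_add_div n B.p, pow_add, pow_mul, el_pow_card, one_pow, mul_one]

theorem el_pow_add (x : B.El k) (a b : ZMod B.p) : x ^ (a + b) = x ^ a * x ^ b := by
  have : x ^ (a + b) = x ^ ((a.val + b.val : ℕ) : ZMod B.p) := by simp
  rw [this, el_pow_natCast, pow_add]
  rfl

theorem el_pow_mul (x : B.El k) (a b : ZMod B.p) : x ^ (a * b) = (x ^ a) ^ b := by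
  have : x ^ (a * b) = x ^ ((a.val * b.val : ℕ) : ZMod B.p) := by simp
  rw [this, el_pow_natCast, pow_mul]
  rfl

theorem el_pow_zero (x : B.El k) : x ^ (0 : ZMod B.p) = 1 := by
  have := el_pow_natCast x 0
  simpa using this

theorem el_pow_one (x : B.El k) : x ^ (1 : ZMod B.p) = x := by
  have := el_pow_natCast x 1
  simpa using this

theorem el_one_pow (a : ZMod B.p) : (1 : B.El k) ^ a = 1 := one_pow a.val

theorem el_pow_sum {ι : Type} (s : Finset ι) (x : B.El k) (f : ι → ZMod B.p) :
    x ^ (∑ i ∈ s, f i) = ∏ i ∈ s, x ^ f i := by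
  classical
  induction s using Finset.induction_on with
  | empty => simp [el_pow_zero]
  | insert i s hi ih => rw [Finset.sum_insert hi, Finset.prod_insert hi, el_pow_add, ih]

theorem el_pow_eq_one_iff {x : B.El k} (hx : orderOf x = B.p) (a : ZMod B.p) :
    x ^ a = 1 ↔ a = 0 := by
  constructor
  · intro h
    have h1 : x ^ a.val = 1 := h
    rw [← orderOf_dvd_iff_pow_eq_one, hx] at h1
    rw [← ZMod.natCast_zmod_val a]
    exact (ZMod.natCast_eq_zero_iff _ _).mpr h1
  · rintro rfl
    exact el_pow_zero x

theorem el_pow_injective {x : B.El k} (hx : orderOf x = B.p) :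
    Function.Injective fun a : ZMod B.p => x ^ a := by
  intro a b h
  simp only at h
  have : x ^ (a - b) = 1 := by
    have h1 : x ^ (a - b) * x ^ b = 1 * x ^ b := by rw [← el_pow_add, sub_add_cancel, h, one_mul]
    exact mul_right_cancel h1
  exact sub_eq_zero.mp ((el_pow_eq_one_iff hx _).mp this)

theorem el_pow_surjective {x : B.El k} (hx : orderOf x = B.p) (y : B.El k) :
    ∃ a : ZMod B.p, y = x ^ a := by
  have h := (Fintype.bijective_iff_injective_and_card (fun a : ZMod B.p => x ^ a)).mpr
    ⟨el_pow_injective hx, by rw [B.card_el, ZMod.card]⟩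
  obtain ⟨a, ha⟩ := h.2 y
  exact ⟨a, ha.symm⟩

theorem orderOf_el_pow {x : B.El k} (hx : orderOf x = B.p) {a : ZMod B.p} (ha : a ≠ 0) :
    orderOf (x ^ a) = B.p := by
  have hp := B.prime.out
  refine orderOf_eq_prime (el_pow_card _) ?_
  rw [Ne, el_pow_eq_one_iff hx]
  exact ha

theorem pairing_pow (g : B.G) (h : B.Ghat) (a b : ZMod B.p) :
    B.e (g ^ a) (h ^ b) = B.e g h ^ (a * b) :=
  B.bilinear g h a b

/-- Non-degeneracy is postulated for a single pair only. That pair consists of powers of `g` and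
`h`, so its pairing is a power of `B.e g h`, which therefore cannot be trivial. -/
theorem orderOf_pairing {g : B.G} {h : B.Ghat} (hg : orderOf g = B.p) (hh : orderOf h = B.p) :
    orderOf (B.e g h) = B.p := by
  have hp := B.prime.out
  obtain ⟨g', h', h0⟩ := B.nondegenerate
  obtain ⟨a, rfl⟩ := el_pow_surjective hg g'
  obtain ⟨b, rfl⟩ := el_pow_surjective hh h'
  rw [pairing_pow] at h0
  refine orderOf_eq_prime (el_pow_card _) fun h1 => ?_
  rw [h1, el_one_pow, orderOf_one] at h0
  exact hp.one_lt.ne h0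

end Powers

/-! ## Challengers in terms of exponents -/

/-- A challenger, in terms of exponents with respect to fixed generators. -/
structure ExpChal (l p : ℕ) where
  g : Fin 3 → ZMod p
  h : Fin 3 → ZMod p
  u : Fin l → Fin 3 → ZMod p
  W : Fin 3 → ZMod p
  Ω : ZMod p
  key : ℕ → List (ZMod p) → (KeyVar l → ZMod p) → Bool → CompIdx l → Fin 3 → ZMod p
  C : List (ZMod p) → ZMod p
  C₁ : List (ZMod p) → Fin 3 → ZMod p
  C₂ : List (ZMod p) → Fin 3 → ZMod p

section ExpChal

variable {B : BilinearGroup} {l : ℕ}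

/-- The private key for an identity of depth `m` with the given exponents. -/
def keyOf (ĝ : B.Ghat) (m : ℕ) (E : Bool → CompIdx l → Fin 3 → ZMod B.p) : PrivateKey B l where
  K₁ := fun j => ĝ ^ E false none j
  K₂ := fun j => ĝ ^ E false (some none) j
  L := levelsAfter m fun i j => ĝ ^ E false (some (some i)) j
  R₁ := fun j => ĝ ^ E true none j
  R₂ := fun j => ĝ ^ E true (some none) j
  R₃ := levelsAfter m fun i j => ĝ ^ E true (some (some i)) j

theorem keyOf_congr {ĝ : B.Ghat} {m : ℕ} {E E' : Bool → CompIdx l → Fin 3 → ZMod B.p}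
    (h : ∀ b j, (∀ i : Fin l, j = some (some i) → m ≤ i) → ∀ i, E b j i = E' b j i) :
    keyOf ĝ m E = keyOf ĝ m E' := by
  have h1 : ∀ b i, E b none i = E' b none i := fun b => h b none (by simp)
  have h2 : ∀ b i, E b (some none) i = E' b (some none) i := fun b => h b _ (by simp)
  have h3 : ∀ b, levelsAfter m (fun i j => ĝ ^ E b (some (some i)) j) =
      levelsAfter m (fun i j => ĝ ^ E' b (some (some i)) j) := by
    intro b
    funext i
    unfold levelsAfter
    split_ifs with hi
    · funext j
      dsimp only
      rw [h b (some (some i)) (by simpa using hi)]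
    · rfl
  simp only [keyOf, h1, h2, h3]

def ExpChal.toChal (E : ExpChal l B.p) (g : B.G) (ĝ : B.Ghat) :
    Challenger B l (KeyVar l → ZMod B.p) Unit where
  pp :=
    { g := fun j => g ^ E.g j
      h := fun j => g ^ E.h j
      u := fun i j => g ^ E.u i j
      W := fun j => ĝ ^ E.W j
      Ω := B.e g ĝ ^ E.Ω }
  key n I x := keyOf ĝ I.length (E.key n I x)
  ct I M _ :=
    { C := B.e g ĝ ^ E.C I * M
      C₁ := fun j => g ^ E.C₁ I j
      C₂ := fun j => g ^ E.C₂ I j }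

/-- Change the base of the exponents of elements of `𝔾`. -/
def ExpChal.scale {p : ℕ} (a : ZMod p) (E : ExpChal l p) : ExpChal l p where
  g := fun j => a * E.g j
  h := fun j => a * E.h j
  u := fun i j => a * E.u i j
  W := E.W
  Ω := a * E.Ω
  key := E.key
  C := fun I => a * E.C I
  C₁ := fun I j => a * E.C₁ I j
  C₂ := fun I j => a * E.C₂ I j

theorem pairing_pow_left (g : B.G) (ĝ : B.Ghat) (a : ZMod B.p) :
    B.e (g ^ a) ĝ = B.e g ĝ ^ a := by
  conv_lhs => rw [← el_pow_one ĝ, pairing_pow, mul_one]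

/-- In the reductions to LW1 and LW2 the generator of the scheme is not the `g` of the instance but
`g ^ b ^ 2` and `g ^ a`. -/
theorem ExpChal.toChal_scale (E : ExpChal l B.p) (a : ZMod B.p) (g : B.G) (ĝ : B.Ghat) :
    (E.scale a).toChal g ĝ = E.toChal (g ^ a) ĝ := by
  simp only [toChal, scale, el_pow_mul, pairing_pow_left]

/-- The challengers `E` and `E'` give answers with the same laws. -/
structure ExpChal.Equiv {p : ℕ} (q : ℕ) (E E' : ExpChal l p) : Prop where
  g : E.g = E'.g
  h : E.h = E'.h
  u : E.u = E'.u
  W : E.W = E'.W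
  Ω : E.Ω = E'.Ω
  key : ∀ n I, n < q → ∃ ψ : (KeyVar l → ZMod p) → KeyVar l → ZMod p, Function.Injective ψ ∧
    ∀ x b j, (∀ i : Fin l, j = some (some i) → I.length ≤ (i : ℕ)) →
      ∀ i, E.key n I x b j i = E'.key n I (ψ x) b j i
  C : ∀ I, E.C I = E'.C I
  C₁ : ∀ I, E.C₁ I = E'.C₁ I
  C₂ : ∀ I, E.C₂ I = E'.C₂ I

/-- An injective change of the coins of a key preserves their uniform law. The change may depend on
the identity and on the number of the key, because the coins are fresh for each key. -/
theorem ExpChal.Equiv.value {q : ℕ} {E E' : ExpChal l B.p} (h : E.Equiv q E') (g : B.G)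
    (ĝ : B.Ghat) (A : List AdvInstr) :
    (E.toChal g ĝ).value q A = (E'.toChal g ĝ).value q A := by
  refine Challenger.value_congr _ _ ?_ q ?_ ?_ A
  · simp only [toChal, h.g, h.h, h.u, h.W, h.Ω]
  · intro n I hn _ F
    obtain ⟨ψ, hψ, he⟩ := h.key n I hn
    rw [← expect_comp_injective hψ fun x => F ((E'.toChal g ĝ).key n I x)]
    refine Finset.expect_congr rfl fun x _ => congrArg F ?_
    exact keyOf_congr fun b j hj i => he x b j hj i
  · intro I M _ F
    simp only [toChal, h.C, h.C₁, h.C₂]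

/-! ### The exponents of a reduction -/

/-- The generators of the three groups. -/
def gens (g : B.G) (ĝ : B.Ghat) : (k : GrpIdx) → B.El k
  | .left => g
  | .right => ĝ
  | .target => B.e g ĝ

def GrpExp.expo {p : ℕ} (ε : BaseVar → ZMod p) (v : ExpVar l → ZMod p) (G : GrpExp l p) : ZMod p :=
  (G.map fun q => ε q.1 * q.2.eval v).sum

theorem GrpExp.eval_eq_pow {k : GrpIdx} {x : B.El k} {y : BaseVar → B.El k}
    {ε : BaseVar → ZMod B.p} (h : ∀ v, y v = x ^ ε v) (v : ExpVar l → ZMod B.p)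
    (G : GrpExp l B.p) : G.eval y v = x ^ G.expo ε v := by
  induction G with
  | nil => exact (el_pow_zero x).symm
  | cons q G ih =>
    unfold GrpExp.eval GrpExp.expo at *
    rw [List.map_cons, List.prod_cons, ih, List.map_cons, List.sum_cons, el_pow_add, h, el_pow_mul]

/-- The exponents of the answers of a reduction. -/
def Red.expChal {p : ℕ} (R : Red l p) (ε : GrpIdx → BaseVar → ZMod p) (k : ℕ)
    (ω : SetupVar l → ZMod p) : ExpChal l p where
  g := fun j => (R.g j).expo (ε .left) (env ω 0 [] 0 0)
  h := fun j => (R.h j).expo (ε .left) (env ω 0 [] 0 0)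
  u := fun i j => (R.u i j).expo (ε .left) (env ω 0 [] 0 0)
  W := fun j => (R.W j).expo (ε .right) (env ω 0 [] 0 0)
  Ω := R.Ω.expo (ε .target) (env ω 0 [] 0 0)
  key n I x b j i := (R.key b j i).expo (ε .right)
    (env ω x I (if n < k then 1 else 0) (if n = k then 1 else 0))
  C I := R.C.expo (ε .target) (env ω 0 I 0 0)
  C₁ I j := (R.C₁ j).expo (ε .left) (env ω 0 I 0 0)
  C₂ I j := (R.C₂ j).expo (ε .left) (env ω 0 I 0 0)

theorem Red.chal_eq (R : Red l B.p) {y : (k : GrpIdx) → BaseVar → B.El k}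
    {ε : GrpIdx → BaseVar → ZMod B.p} {g : B.G} {ĝ : B.Ghat}
    (h : ∀ k v, y k v = gens g ĝ k ^ ε k v) (k : ℕ) (ω : SetupVar l → ZMod B.p) :
    R.chal y k ω = (R.expChal ε k ω).toChal g ĝ := by
  have hl : ∀ (v : ExpVar l → ZMod B.p) (G : GrpExp l B.p),
      G.eval (y .left) v = g ^ G.expo (ε .left) v := fun v G => GrpExp.eval_eq_pow (h .left) v G
  have hr : ∀ (v : ExpVar l → ZMod B.p) (G : GrpExp l B.p),
      G.eval (y .right) v = ĝ ^ G.expo (ε .right) v := fun v G => GrpExp.eval_eq_pow (h .right) v G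
  have ht : ∀ (v : ExpVar l → ZMod B.p) (G : GrpExp l B.p),
      G.eval (y .target) v = B.e g ĝ ^ G.expo (ε .target) v := fun v G =>
    GrpExp.eval_eq_pow (h .target) v G
  unfold Red.chal ExpChal.toChal Red.expChal
  simp only [hl, hr, ht, keyOf]

/-- The exponents of the elements that a reduction starts with. -/
def baseExp {p : ℕ} (xs ys zs : List (ZMod p)) : GrpIdx → BaseVar → ZMod p
  | .left, .inp i => xs.getD i 0
  | .right, .inp i => ys.getD i 0
  | .target, .inp i => zs.getD i 0
  | .target, .pair i j => xs.getD i 0 * ys.getD j 0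
  | _, _ => 0

/-- The input of a reduction with the given exponents. -/
def inputOf (g : B.G) (ĝ : B.Ghat) (xs ys zs : List (ZMod B.p)) : State B :=
  State.input (xs.map fun a => g ^ a) (ys.map fun a => ĝ ^ a) (zs.map fun a => B.e g ĝ ^ a)

theorem State.input_el (xs : List B.G) (ys : List B.Ghat) (zs : List B.GT) (i : ℕ) :
    (State.input xs ys zs).el .left i = xs.getD i 1 ∧
    (State.input xs ys zs).el .right i = ys.getD i 1 ∧
    (State.input xs ys zs).el .target i = zs.getD i 1 := by
  simp [State.input, State.writeEl]

theorem inputOf_isInput (g : B.G) (ĝ : B.Ghat) {xs ys zs : List (ZMod B.p)} (hx : xs.length ≤ 12)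
    (hy : ys.length ≤ 12) (hz : zs.length ≤ 12) : (inputOf g ĝ xs ys zs).IsInput where
  bit _ := rfl
  scal _ := rfl
  el k i hi := by
    have h := State.input_el (xs.map fun a => g ^ a) (ys.map fun a => ĝ ^ a)
      (zs.map fun a => B.e g ĝ ^ a) i
    cases k
    · exact h.1.trans (List.getD_eq_default _ _ (by simp; omega))
    · exact h.2.1.trans (List.getD_eq_default _ _ (by simp; omega))
    · exact h.2.2.trans (List.getD_eq_default _ _ (by simp; omega))

theorem getD_map_pow {k : GrpIdx} (x : B.El k) (xs : List (ZMod B.p)) (i : ℕ) :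
    (xs.map fun a => x ^ a).getD i 1 = x ^ xs.getD i 0 := by
  rw [← el_pow_zero x, ← List.getD_map (f := fun a : ZMod B.p => x ^ a)]

theorem baseVal_inputOf (g : B.G) (ĝ : B.Ghat) (xs ys zs : List (ZMod B.p)) (k : GrpIdx)
    (v : BaseVar) :
    baseVal (inputOf g ĝ xs ys zs) k v = gens g ĝ k ^ baseExp xs ys zs k v := by
  have h := fun i => State.input_el (xs.map fun a => g ^ a) (ys.map fun a => ĝ ^ a)
      (zs.map fun a => B.e g ĝ ^ a) i
  have hl : ∀ i, (inputOf g ĝ xs ys zs).el .left i = g ^ xs.getD i 0 := fun i =>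
    (h i).1.trans (getD_map_pow _ _ _)
  have hr : ∀ i, (inputOf g ĝ xs ys zs).el .right i = ĝ ^ ys.getD i 0 := fun i =>
    (h i).2.1.trans (getD_map_pow _ _ _)
  have ht : ∀ i, (inputOf g ĝ xs ys zs).el .target i = B.e g ĝ ^ zs.getD i 0 := fun i =>
    (h i).2.2.trans (getD_map_pow _ _ _)
  cases k <;> cases v <;> simp only [baseVal, gens, baseExp, hl, hr, ht, el_pow_zero, pairing_pow]

open Classical in
/-- The probability that a reduction outputs `0`, if one of its inputs `bad` is `1`, or the test
element is `1`. -/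
theorem Red.runE_prog_inputOf (R : Red l B.p) {q k : ℕ} (hk : k ≤ q) (pol : Bool)
    (A : List AdvInstr) {g : B.G} {ĝ : B.Ghat} (hg : orderOf g = B.p) (hĝ : orderOf ĝ = B.p)
    {xs ys zs : List (ZMod B.p)} (hx : xs.length ≤ 12) (hy : ys.length ≤ 12)
    (hz : zs.length ≤ 12) :
    runE (R.prog B.encLen q k pol A) (fun σ => if σ.bit 0 = false then 1 else 0)
      (inputOf g ĝ xs ys zs) =
      if ∃ x ∈ R.bad, baseExp xs ys zs x.1 x.2 = 0 then
        if baseExp xs ys zs R.test.1 R.test.2 = 0 then 1 else 0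
      else 𝔼 ω, if pol then (((R.expChal (baseExp xs ys zs) k ω).toChal g ĝ).value q A)
        else 1 - (((R.expChal (baseExp xs ys zs) k ω).toChal g ĝ).value q A) := by
  have hone : ∀ k v, baseVal (inputOf g ĝ xs ys zs) k v = 1 ↔ baseExp xs ys zs k v = 0 := by
    intro k v
    rw [baseVal_inputOf]
    refine el_pow_eq_one_iff ?_ _
    cases k
    exacts [hg, hĝ, orderOf_pairing hg hĝ]
  rw [R.runE_prog hk pol A _ (inputOf_isInput g ĝ hx hy hz)]
  have h1 : R.isBad (baseVal (inputOf g ĝ xs ys zs)) = true ↔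
      ∃ x ∈ R.bad, baseExp xs ys zs x.1 x.2 = 0 := by
    simp only [Red.isBad, List.any_eq_true, decide_eq_true_eq, hone]
  simp only [h1, Red.chal_eq R (baseVal_inputOf g ĝ xs ys zs), Set.indicator, Set.mem_ofPred_eq,
    hone, Pi.one_apply]

end ExpChal

/-! ## More about averages -/

section Averages

variable {V W R : Type} [Fintype V] [DecidableEq V] [Fintype W] [DecidableEq W] [Fintype R]
  [Nonempty R]

/-- The coordinates of a random vector form a random vector. -/
theorem expect_restrict {ι : W → V} (hι : Function.Injective ι) (f : (W → R) → ℝ) :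
    𝔼 x : V → R, f (x ∘ ι) = 𝔼 y, f y := by
  classical
  have h1 : ∀ g : ({v // v ∈ Set.range ι} → R) → ℝ,
      𝔼 x : V → R, g (fun w => x w.1) = 𝔼 z, g z := by
    intro g
    rw [show 𝔼 x : V → R, g (fun w => x w.1)
        = 𝔼 q : ({v // v ∈ Set.range ι} → R) × ({v // ¬ v ∈ Set.range ι} → R), g q.1 from
      Fintype.expect_equiv (Equiv.piEquivPiSubtypeProd (· ∈ Set.range ι) fun _ => R) _ _
        fun x => rfl, expect_prod_type]
    simp only [Fintype.expect_const]
  refine (h1 fun z => f fun w => z ⟨ι w, Set.mem_range_self w⟩).trans ?_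
  exact Fintype.expect_equiv ((Equiv.ofInjective ι hι).arrowCongr (Equiv.refl R)).symm _ _
    fun z => rfl

/-- Some coordinates of a random vector are independent of the other ones. -/
theorem expect_split {ι : W → V} (hι : Function.Injective ι) (F : (W → R) → (V → R) → ℝ)
    (hF : ∀ y x x', (∀ v, v ∉ Set.range ι → x v = x' v) → F y x = F y x') :
    𝔼 x, F (x ∘ ι) x = 𝔼 y, 𝔼 x, F y x := by
  classical
  rw [← expect_merge (fun v => v ∈ Set.range ι), expect_swap (α := W → R)]
  refine Finset.expect_congr rfl fun x _ => ?_
  rw [← expect_restrict hι]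
  refine Finset.expect_congr rfl fun y _ => ?_
  have : (fun v => if v ∈ Set.range ι then y v else x v) ∘ ι = y ∘ ι := by
    funext w
    simp
  rw [this]
  exact hF _ _ _ fun v hv => by simp [hv]

theorem expect_split_one (v : V) (F : R → (V → R) → ℝ)
    (hF : ∀ a x b, F a (Function.update x v b) = F a x) :
    𝔼 x, F (x v) x = 𝔼 a, 𝔼 x, F a x := by
  rw [← expect_update v fun x => F (x v) x]
  simp only [Function.update_self, hF]

end Averages

/-! ### Independence from shifts, exceptional values -/

section Independence

variable {X S : Type} [Fintype X] [Nonempty X] [Fintype S] [Nonempty S]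

/-- Each `T s` preserves the uniform law and fixes `f`. Averaging over `s` therefore replaces `h` by
its mean along the orbits, which is the constant `c`, and leaves `f` alone. -/
theorem expect_mul_of_shift (T : S → X → X) (hT : ∀ s, Function.Injective (T s)) (f h : X → ℝ)
    (c : ℝ) (hf : ∀ s x, f (T s x) = f x) (hh : ∀ x, 𝔼 s, h (T s x) = c) :
    𝔼 x, f x * h x = (𝔼 x, f x) * 𝔼 x, h x := by
  have key : ∀ f : X → ℝ, (∀ s x, f (T s x) = f x) → 𝔼 x, f x * h x = (𝔼 x, f x) * c := by
    intro f hf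
    have h1 : ∀ s, 𝔼 x, f x * h x = 𝔼 x, f x * h (T s x) := by
      intro s
      rw [← expect_comp_injective (hT s)]
      simp only [hf]
    rw [← Fintype.expect_const (ι := S) (𝔼 x, f x * h x),
      Finset.expect_congr rfl fun s _ => h1 s, expect_swap, Finset.expect_mul]
    simp only [← Finset.mul_expect, hh]
  rw [key f hf]
  have := key (fun _ => 1) fun _ _ => rfl
  simp only [one_mul, Fintype.expect_const] at this
  rw [this]

theorem abs_expect_le_of_subsingleton {p : ℕ} [Fact p.Prime] {f : ZMod p → ℝ}
    (h : ∀ a, a ≠ 0 → f a = 0) (h0 : |f 0| ≤ 1) : |𝔼 a, f a| ≤ 1 / p := by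
  rw [Fintype.expect_eq_sum_div_card, Finset.sum_eq_single 0 (fun a _ ha => h a ha) (by simp),
    ZMod.card, abs_div, Nat.abs_cast]
  gcongr

/-- The average of a function that is constant off `0`. -/
theorem expect_ite_eq_zero {p : ℕ} [Fact p.Prime] (c V : ℝ) :
    𝔼 a : ZMod p, (if a = 0 then c else V) = (1 / p) * c + (1 - 1 / p) * V := by
  have hp : (p : ℝ) ≠ 0 := by
    have := (Fact.out : p.Prime).pos
    positivity
  have : ∀ a : ZMod p, (if a = 0 then c else V) = V + if a = 0 then c - V else 0 := by
    intro a; split_ifs <;> ring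
  simp only [this, Finset.expect_add_distrib, Fintype.expect_const]
  rw [Fintype.expect_eq_sum_div_card, Finset.sum_ite_eq', if_pos (Finset.mem_univ _), ZMod.card]
  field_simp
  ring

end Independence

/-! ### Replacing coins when only the laws of the answers matter -/

section Lazy

variable {B : BilinearGroup} {l : ℕ} {K C : Type} [Fintype K] [Nonempty K] [Fintype C] [Nonempty C]
  {X : Type} [Fintype X] [Nonempty X]

/-- Random coins of the private key number `k` and of the challenge ciphertext matter only through
the laws of these two, if these are independent. -/
theorem Challenger.expect_value_congr (ch ch' : X → Challenger B l K C) (k q : ℕ)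
    (hpp : ∀ x x', (ch x).pp = (ch' x').pp)
    (hkey : ∀ x x' n I r, n ≠ k → (ch x).key n I r = (ch' x').key n I r)
    (hj : ∀ J I M, ValidID l J → ValidID l I →
      ¬ J <+: I → ∀ r r' (F : PrivateKey B l → ℝ) (H : Ciphertext B → ℝ),
      𝔼 x, (F ((ch x).key k J r) * H ((ch x).ct I M r')) =
        (𝔼 x, F ((ch x).key k J r)) * 𝔼 x, H ((ch x).ct I M r'))
    (hj' : ∀ J I M, ValidID l J → ValidID l I →
      ¬ J <+: I → ∀ r r' (F : PrivateKey B l → ℝ) (H : Ciphertext B → ℝ),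
      𝔼 x, (F ((ch' x).key k J r) * H ((ch' x).ct I M r')) =
        (𝔼 x, F ((ch' x).key k J r)) * 𝔼 x, H ((ch' x).ct I M r'))
    (hk : k < q → ∀ I (F : PrivateKey B l → ℝ),
      𝔼 x, 𝔼 r, F ((ch x).key k I r) = 𝔼 x, 𝔼 r, F ((ch' x).key k I r))
    (hc : ∀ I M r (H : Ciphertext B → ℝ),
      𝔼 x, H ((ch x).ct I M r) = 𝔼 x, H ((ch' x).ct I M r))
    (A : List AdvInstr) :
    𝔼 x, (ch x).value q A = 𝔼 x, (ch' x).value q A := by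
  have x₀ : X := Classical.arbitrary X
  rw [value_lazy ch k q (fun x x' => (hpp x x₀).trans (hpp x' x₀).symm)
    (fun x x' n I r h => (hkey x x₀ n I r h).trans (hkey x' x₀ n I r h).symm) hj,
    value_lazy ch' k q (fun x x' => (hpp x₀ x).symm.trans (hpp x₀ x'))
    (fun x x' n I r h => (hkey x₀ x n I r h).symm.trans (hkey x₀ x' n I r h)) hj']
  refine value_congr (freshChallenger ch) (freshChallenger ch') (hpp _ _) q ?_ ?_ A
  · intro n I hn _ F
    simp only [freshChallenger, expect_prod_type]
    by_cases h : n = k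
    · subst h
      exact hk hn I F
    · obtain ⟨κ, hκ⟩ : ∃ κ : K → PrivateKey B l, ∀ x r, (ch x).key n I r = κ r ∧
          (ch' x).key n I r = κ r :=
        ⟨(ch' x₀).key n I, fun x r => ⟨hkey x x₀ n I r h,
          (hkey x₀ x n I r h).symm.trans (hkey x₀ x₀ n I r h)⟩⟩
      simp only [hκ]
  · intro I M _ H
    simp only [freshChallenger, expect_prod_type]
    rw [expect_swap, expect_swap (α := X)]
    exact Finset.expect_congr rfl fun r _ => hc I M r H

/-- Random coins of the challenge ciphertext matter only through its law. -/
theorem Challenger.expect_value_congr_ct (ch ch' : X → Challenger B l K C) (q : ℕ)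
    (hpp : ∀ x x', (ch x).pp = (ch' x').pp)
    (hkey : ∀ x x' n I r, (ch x).key n I r = (ch' x').key n I r)
    (hc : ∀ I M r (H : Ciphertext B → ℝ),
      𝔼 x, H ((ch x).ct I M r) = 𝔼 x, H ((ch' x).ct I M r))
    (A : List AdvInstr) :
    𝔼 x, (ch x).value q A = 𝔼 x, (ch' x).value q A := by
  have x₀ : X := Classical.arbitrary X
  obtain ⟨κ, hκ⟩ : ∃ κ : ℕ → ID B → K → PrivateKey B l, ∀ x n I r, (ch x).key n I r = κ n I r ∧
      (ch' x).key n I r = κ n I r :=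
    ⟨(ch' x₀).key, fun x n I r => ⟨hkey x x₀ n I r,
      (hkey x₀ x n I r).symm.trans (hkey x₀ x₀ n I r)⟩⟩
  -- No key depends on these coins, so any number may play the part of the distinguished key.
  refine expect_value_congr ch ch' 0 q hpp (fun x x' n I r _ => hkey x x' n I r) ?_ ?_ ?_ hc A
  · intro J I M _ _ _ r r' F H
    simp only [hκ, ← Finset.mul_expect, Fintype.expect_const]
  · intro J I M _ _ _ r r' F H
    simp only [hκ, ← Finset.mul_expect, Fintype.expect_const]
  · intro _ I F
    simp only [hκ]

end Lazy

/-! ## The games of the proof -/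

section Games

variable {l p : ℕ}

/-- The exponent of `h ∏ u_i ^ I_i`. -/
def idSum (h : ZMod p) (u : Fin l → ZMod p) (I : List (ZMod p)) : ZMod p :=
  h + ∑ i, u i * I.getD i 0

/-- The exponents of the components of a key. -/
def compVal (h one : ZMod p) (u : Fin l → ZMod p) (I : List (ZMod p)) : CompIdx l → ZMod p
  | none => idSum h u I
  | some none => one
  | some (some i) => u i

/-- A triple of a private key with payload `x`, semi-functional part `κ` and mask `c`. -/
def keyTriple (ω : SetupVar l → ZMod p) (x κ c : ZMod p) : Fin 3 → ZMod p :=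
  ![x - ω .nu * κ + ω .phi1 * c, κ + ω .phi2 * c, c]

/-- A triple of a ciphertext with payload `t` and semi-functional part `s`. -/
def ctTriple (ω : SetupVar l → ZMod p) (t s : ZMod p) : Fin 3 → ZMod p :=
  ![t, ω .nu * t + s, -(ω .phi1 * t + ω .phi2 * (ω .nu * t + s))]

def identExp (ω : SetupVar l → ZMod p) (I : List (ZMod p)) : ZMod p :=
  idSum (ω .yh) (fun i => ω (.yu i)) I

/-- A second copy of the identity exponent that does not enter the public parameters. In the games
it occurs only in semi-functional parts. -/
def auxExp (ω : SetupVar l → ZMod p) (I : List (ZMod p)) : ZMod p :=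
  idSum (ω .ah) (fun i => ω (.au i)) I

def keyPayload (ω : SetupVar l → ZMod p) (I : List (ZMod p)) (x : KeyVar l → ZMod p) (b : Bool)
    (j : CompIdx l) : ZMod p :=
  x (.r b) * compVal (ω .yh) 1 (fun i => ω (.yu i)) I j +
    if b = false ∧ j = none then ω .alpha else 0

/-- The exponents of a challenge ciphertext. -/
structure CtSpec (l p : ℕ) where
  c : (SetupVar l → ZMod p) → List (ZMod p) → ZMod p
  t₁ : (SetupVar l → ZMod p) → List (ZMod p) → ZMod p
  s₁ : (SetupVar l → ZMod p) → List (ZMod p) → ZMod p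
  t₂ : (SetupVar l → ZMod p) → List (ZMod p) → ZMod p
  s₂ : (SetupVar l → ZMod p) → List (ZMod p) → ZMod p

/-- The semi-functional parts of private keys. -/
abbrev KeySpec (l p : ℕ) : Type :=
  (SetupVar l → ZMod p) → ℕ → List (ZMod p) → (KeyVar l → ZMod p) → Bool → CompIdx l → ZMod p

/-- The answers of the challenger of a game. -/
def game (yw : ZMod p) (κ : KeySpec l p) (ct : CtSpec l p) (ω : SetupVar l → ZMod p) :
    ExpChal l p where
  g := ![1, ω .nu, -(ω .phi1 + ω .nu * ω .phi2)]
  h := ![ω .yh, ω .yh * ω .nu, ω .yh * -(ω .phi1 + ω .nu * ω .phi2)]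
  u i := ![ω (.yu i), ω (.yu i) * ω .nu, ω (.yu i) * -(ω .phi1 + ω .nu * ω .phi2)]
  W := ![yw * ω .phi1, yw * ω .phi2, yw]
  Ω := ω .alpha
  key n I x b j := keyTriple ω (keyPayload ω I x b j) (κ ω n I x b j) (x (.c b j))
  C := ct.c ω
  C₁ I := ctTriple ω (ct.t₁ ω I) (ct.s₁ ω I)
  C₂ I := ctTriple ω (ct.t₂ ω I) (ct.s₂ ω I)

/-- `δ` for the first part of a key, and `ρ δ` for the second one. -/
def partVal (δ ρ : ZMod p) (b : Bool) : ZMod p := if b then ρ * δ else δ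

/-- The semi-functional parts of a single key. -/
def semi (η : Bool → ZMod p) (δ ρ : ZMod p) (a : Fin l → ZMod p) (b : Bool) :
    CompIdx l → ZMod p
  | none => η b
  | some none => partVal δ ρ b
  | some (some i) => partVal δ ρ b * a i

/-- Semi-functional keys. -/
def semiKey (x : KeyVar l → ZMod p) : Bool → CompIdx l → ZMod p :=
  semi (fun b => x (.eta b)) (x .delta) (x .rho) fun i => x (.a i)

/-- The first `k` keys are semi-functional, and the semi-functional parts of the next one are given
by `κ`. -/
def hybrid (k : ℕ) (κ : (SetupVar l → ZMod p) → List (ZMod p) → Bool → CompIdx l → ZMod p) :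
    KeySpec l p :=
  fun ω n I x => if n < k then semiKey x else if n = k then κ ω I else 0

/-- The identity components of both halves of the key stand in the same ratio `a0` to the generator
components. Only this proportionality separates such a key from one with independent coins. -/
def nominalPart (ω : SetupVar l → ZMod p) (_ : List (ZMod p)) : Bool → CompIdx l → ZMod p :=
  semi (fun b => partVal (ω .delta) (ω .rho) b * ω .a0) (ω .delta) (ω .rho) fun i => ω (.au i)

/-- The same with the auxiliary exponent of the identity. -/
def correlatedPart (ω : SetupVar l → ZMod p) (I : List (ZMod p)) : Bool → CompIdx l → ZMod p :=
  semi (fun b => partVal (ω .delta) (ω .rho) b * auxExp ω I) (ω .delta) (ω .rho) fun i => ω (.au i)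

/-- The coins are those of the setup and not of the key, so that a reduction can embed its instance
in them. -/
def randomPart (ω : SetupVar l → ZMod p) (_ : List (ZMod p)) : Bool → CompIdx l → ZMod p :=
  semi (fun b => ω (.eta b)) (ω .delta) (ω .rho) fun i => ω (.au i)

def ctNormal : CtSpec l p where
  c ω _ := ω .alpha * ω .t
  t₁ ω _ := ω .t
  s₁ _ _ := 0
  t₂ ω I := ω .t * identExp ω I
  s₂ _ _ := 0

/-- The semi-functional part of the second triple depends on the identity through the auxiliary
exponents. This is the shape that the simulators for LW1 and LW2 produce without knowing `s`. -/
def ctCorrelated : CtSpec l p where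
  c ω _ := ω .alpha * ω .t
  t₁ ω _ := ω .t
  s₁ ω _ := ω .s
  t₂ ω I := ω .t * identExp ω I
  s₂ ω I := ω .s * auxExp ω I

def ctSemi : CtSpec l p where
  c ω _ := ω .alpha * ω .t
  t₁ ω _ := ω .t
  s₁ ω _ := ω .s
  t₂ ω I := ω .t * identExp ω I
  s₂ ω _ := ω .s * ω .z

/-- The part `s₂` is chosen so that the middle entry of the second triple is `z` itself. The
simulators for DBDH and the 3-party assumption can then write this entry without the product of `ν`
and the payload. -/
def ctUniform : CtSpec l p where
  c ω _ := ω .alpha * ω .t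
  t₁ ω _ := ω .t
  s₁ ω _ := ω .s
  t₂ ω I := ω .t * identExp ω I
  s₂ ω I := ω .z - ω .nu * (ω .t * identExp ω I)

def ctHidden : CtSpec l p where
  c ω _ := ω .alpha * ω .t + ω .xi
  t₁ ω _ := ω .t
  s₁ ω _ := ω .s
  t₂ ω I := ω .t * identExp ω I
  s₂ ω I := ω .z - ω .nu * (ω .t * identExp ω I)

def ctRandom : CtSpec l p where
  c ω _ := ω .alpha * ω .t + ω .xi
  t₁ ω _ := ω .t
  s₁ ω _ := ω .s
  t₂ ω I := ω .t * identExp ω I + ω .zeta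
  s₂ ω I := ω .z - ω .nu * (ω .t * identExp ω I + ω .zeta)

end Games

/-! ### Statistical hops of the challenge ciphertext -/

section GameValues

variable {B : BilinearGroup} {l : ℕ}

theorem expect_update_two {V R : Type} [Fintype V] [DecidableEq V] [Fintype R] [Nonempty R]
    (v w : V) (f : (V → R) → ℝ) :
    𝔼 x, 𝔼 a : R × R, f (Function.update (Function.update x v a.1) w a.2) = 𝔼 x, f x := by
  simp only [expect_prod_type]
  rw [expect_swap, ← expect_update w f,
    Finset.expect_congr rfl fun a _ => expect_swap (α := V → R) _, expect_swap]
  exact Finset.expect_congr rfl fun b _ => expect_update v fun x => f (Function.update x w b)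

/-- The probability that the adversary wins a game, for given generators. -/
noncomputable def gameValue (g : B.G) (ĝ : B.Ghat) (yw : ZMod B.p) (κ : KeySpec l B.p)
    (ct : CtSpec l B.p) (q : ℕ) (A : List AdvInstr) : ℝ :=
  𝔼 ω, ((game yw κ ct ω).toChal g ĝ).value q A

variable {g : B.G} {ĝ : B.Ghat} {yw : ZMod B.p} {q : ℕ} {A : List AdvInstr}

/-- The keys do not involve the setup coins through `κ`, so the exponent `ah` occurs in the
challenge ciphertext only. There it is a uniform summand of `auxExp`, which is thus as good as a
fresh `z` for the single challenge identity. -/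
theorem gameValue_correlated (κ : ℕ → List (ZMod B.p) → (KeyVar l → ZMod B.p) → Bool →
    CompIdx l → ZMod B.p) :
    gameValue g ĝ yw (fun _ => κ) ctCorrelated q A =
      gameValue g ĝ yw (fun _ => κ) ctSemi q A := by
  unfold gameValue
  rw [← expect_update .ah, ← expect_update .z, expect_swap, expect_swap (α := ZMod B.p)]
  refine Finset.expect_congr rfl fun ω _ => ?_
  refine Challenger.expect_value_congr_ct
    (fun a => (game yw (fun _ => κ) ctCorrelated (Function.update ω .ah a)).toChal g ĝ)
    (fun a => (game yw (fun _ => κ) ctSemi (Function.update ω .z a)).toChal g ĝ) q ?_ ?_ ?_ A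
  · intro a a'
    simp [ExpChal.toChal, game]
  · intro a a' n I r
    simp [ExpChal.toChal, game, keyTriple, keyPayload]
  · intro I M r H
    have h : ∀ a : ZMod B.p, H (((game yw (fun _ => κ) ctSemi (Function.update ω .z
        (a + ∑ i, ω (.au i) * I.getD i 0))).toChal g ĝ).ct I M r) =
        H (((game yw (fun _ => κ) ctCorrelated (Function.update ω .ah a)).toChal g ĝ).ct I M r) := by
      intro a
      congr 1
    simp only [← h]
    exact expect_comp_injective (add_left_injective _) fun a =>
      H (((game yw (fun _ => κ) ctSemi (Function.update ω .z a)).toChal g ĝ).ct I M r)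

/-- `xi` is a one-time pad on the message and `zeta` one on the identity exponent; neither occurs
elsewhere. The ciphertext has the law of one for a fixed identity and message, so the coin is
independent of the view. -/
theorem gameValue_random (hg : orderOf g = B.p) (hĝ : orderOf ĝ = B.p)
    (κ : ℕ → List (ZMod B.p) → (KeyVar l → ZMod B.p) → Bool → CompIdx l → ZMod B.p) :
    gameValue g ĝ yw (fun _ => κ) ctRandom q A = 1 / 2 := by
  unfold gameValue
  rw [← Fintype.expect_const (ι := SetupVar l → ZMod B.p) (1 / 2 : ℝ),
    ← expect_update_two .zeta .xi]
  refine Finset.expect_congr rfl fun ω _ => ?_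
  set ch : ZMod B.p × ZMod B.p → Challenger B l (KeyVar l → ZMod B.p) Unit := fun a =>
    (game yw (fun _ => κ) ctRandom
      (Function.update (Function.update ω .zeta a.1) .xi a.2)).toChal g ĝ with hch
  set ch' : ZMod B.p × ZMod B.p → Challenger B l (KeyVar l → ZMod B.p) Unit := fun a =>
    { ch a with ct := fun _ _ => (ch a).ct [] 1 } with hch'
  have h1 : 𝔼 a, (ch a).value q A = 𝔼 a, (ch' a).value q A := by
    refine Challenger.expect_value_congr_ct ch ch' q ?_ ?_ ?_ A
    · intro a a'
      simp [hch', hch, ExpChal.toChal, game]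
    · intro a a' n I r
      simp [hch', hch, ExpChal.toChal, game, keyTriple, keyPayload]
    · intro I M r H
      obtain ⟨m, rfl⟩ := el_pow_surjective (orderOf_pairing hg hĝ) M
      -- Shifting `zeta` by `d` replaces the empty identity by `I`, and shifting `xi` by the
      -- discrete logarithm `m` replaces the message 1 by the given one.
      set d := ω .t * identExp ω I - ω .t * identExp ω [] with hd
      have h : ∀ a, H ((ch' (a + (d, m))).ct I (B.e g ĝ ^ m) r) =
          H ((ch a).ct I (B.e g ĝ ^ m) r) := by
        intro a
        congr 1
        have h2 : ω .t * identExp ω [] + (a.1 + d) = ω .t * identExp ω I + a.1 := by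
          rw [hd]; ring
        simp only [identExp] at h2
        simp [hch', hch, ExpChal.toChal, game, ctRandom, el_pow_add, ctTriple, identExp, h2,
          mul_assoc]
      simp only [← h]
      exact expect_comp_injective (add_left_injective (d, m)) fun a =>
        H ((ch' a).ct I (B.e g ĝ ^ m) r)
  rw [h1]
  rw [Finset.expect_congr rfl fun a _ => (ch' a).value_eq_half (fun _ _ _ _ _ => rfl) q A,
    Fintype.expect_const]

/-- For `s ≠ 0` the map taking `z` to `s z + ν t ⟨I⟩`, with `⟨I⟩` the identity exponent, is a
bijection, and `z` occurs only in the ciphertext. The games differ only on `s = 0`, which has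
probability 1/p. -/
theorem abs_gameValue_uniform_sub_le (κ : ℕ → List (ZMod B.p) → (KeyVar l → ZMod B.p) → Bool →
    CompIdx l → ZMod B.p) :
    |gameValue g ĝ yw (fun _ => κ) ctSemi q A - gameValue g ĝ yw (fun _ => κ) ctUniform q A| ≤
      1 / B.p := by
  unfold gameValue
  rw [← expect_update .s, ← expect_update .s, ← Finset.expect_sub_distrib]
  refine abs_expect_le_of_subsingleton (fun s hs => ?_) ?_
  · rw [sub_eq_zero, ← expect_update .z, ← expect_update .z, expect_swap,
      expect_swap (α := ZMod B.p)]
    refine Finset.expect_congr rfl fun ω _ => ?_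
    refine Challenger.expect_value_congr_ct
      (fun z => (game yw (fun _ => κ) ctSemi
        (Function.update (Function.update ω .z z) .s s)).toChal g ĝ)
      (fun z => (game yw (fun _ => κ) ctUniform
        (Function.update (Function.update ω .z z) .s s)).toChal g ĝ) q ?_ ?_ ?_ A
    · intro a a'
      simp [ExpChal.toChal, game]
    · intro a a' n I r
      simp [ExpChal.toChal, game, keyTriple, keyPayload]
    · intro I M r H
      set d := ω .nu * (ω .t * identExp ω I) with hd
      rw [← expect_comp_injective (φ := fun z => s * z + d)
        (fun z z' h => mul_right_injective₀ hs (add_right_cancel h)) fun z =>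
        H (((game yw (fun _ => κ) ctUniform
          (Function.update (Function.update ω .z z) .s s)).toChal g ĝ).ct I M r)]
      refine Finset.expect_congr rfl fun z _ => ?_
      congr 1
      simp only [identExp] at hd
      simp [ExpChal.toChal, game, ctTriple, ctSemi, ctUniform, identExp, hd, add_comm]
  · have h1 := fun ct : CtSpec l B.p => expect_mem_unit fun ω : SetupVar l → ZMod B.p =>
      ((game yw (fun _ => κ) ct (Function.update ω .s 0)).toChal g ĝ).value_mem_unit q A
    have h2 := h1 ctSemi
    have h3 := h1 ctUniform
    rw [abs_le]
    constructor <;> linarith [h2.1, h2.2, h3.1, h3.2]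

end GameValues

/-! ## Hops without computational assumptions -/

section Averages

variable {l p : ℕ} [Fact p.Prime]

/-- The uniform summand `ah` makes `auxExp` at one identity uniform and independent of all level
exponents. -/
theorem expect_auxExp (I : List (ZMod p)) (v : SetupVar l) (hv : ∀ i, v ≠ .au i)
    (f : ZMod p → (Fin l → ZMod p) → ℝ) :
    𝔼 x : SetupVar l → ZMod p, f (auxExp x I) (fun i => x (.au i)) =
      𝔼 x : SetupVar l → ZMod p, f (x v) (fun i => x (.au i)) := by
  rw [← expect_update .ah, ← expect_update v, expect_swap, expect_swap (α := ZMod p)]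
  refine Finset.expect_congr rfl fun x _ => ?_
  rw [← expect_comp_injective (add_left_injective (∑ i, x (.au i) * I.getD i 0))
    fun a => f (Function.update x v a v) fun i => Function.update x v a (.au i)]
  refine Finset.expect_congr rfl fun a _ => ?_
  have : ∀ (b : ZMod p) i, Function.update x v b (.au i) = x (.au i) := fun b i =>
    Function.update_of_ne (hv i).symm _ _
  simp [auxExp, idSum, this]

/-- The statistical heart of the proof. A key for `J` shows `auxExp` at `J` and the exponents of the
levels after `J`. As `J` is not a prefix of `I`, they differ at a level of `J`, whose exponent the
key does not show separately. Moving this exponent against `ah` keeps all that the key shows and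
moves `auxExp` at `I` through all values. -/
theorem expect_auxExp_mul {B : BilinearGroup} {J I : ID B} (hJ : ValidID l J) (hp : ¬ J <+: I)
    (f : ZMod B.p → (Fin l → ZMod B.p) → ℝ)
    (hf : ∀ a u u', (∀ i : Fin l, J.length ≤ i → u i = u' i) → f a u = f a u')
    (h : ZMod B.p → ℝ) :
    𝔼 x : SetupVar l → ZMod B.p, f (auxExp x J) (fun i => x (.au i)) * h (auxExp x I) =
      (𝔼 x : SetupVar l → ZMod B.p, f (auxExp x J) (fun i => x (.au i))) *
        𝔼 x : SetupVar l → ZMod B.p, h (auxExp x I) := by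
  obtain ⟨i₀, h1, h2⟩ : ∃ i : Fin l, (i : ℕ) < J.length ∧ J.getD i 0 ≠ I.getD i 0 := by
    by_contra! hc
    exact hp ((prefix_iff_getD hJ).mpr hc)
  -- The correction of `ah` by `J.getD i₀ 0` is chosen so that `auxExp` at `J` is invariant; at `I`
  -- it changes by `s` times the difference of the components, which is nonzero.
  set T : ZMod B.p → (SetupVar l → ZMod B.p) → SetupVar l → ZMod B.p := fun s x =>
    x + s • (Pi.single (.au i₀) 1 - J.getD i₀ 0 • Pi.single .ah 1) with hT
  have h3 : ∀ s x (K : ID B), auxExp (T s x) K = auxExp x K + s * (K.getD i₀ 0 - J.getD i₀ 0) := by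
    intro s x K
    have : ∀ i : Fin l, T s x (.au i) = x (.au i) + if i = i₀ then s else 0 := by
      intro i
      by_cases hi : i = i₀
      · subst hi; simp [hT]
      · simp [hT, hi]
    simp only [auxExp, idSum, this, add_mul, Finset.sum_add_distrib, ite_mul, zero_mul,
      Finset.sum_ite_eq', Finset.mem_univ, if_true]
    simp [hT]
    ring
  refine expect_mul_of_shift T (fun s x y hxy => add_right_cancel hxy) _ _ (𝔼 a, h a) ?_ ?_
  · intro s x
    rw [h3, sub_self, mul_zero, add_zero]
    refine hf _ _ _ fun i hi => ?_
    have : i ≠ i₀ := by rintro rfl; omega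
    simp [hT, this]
  · intro x
    have h4 : I.getD i₀ 0 - J.getD i₀ 0 ≠ 0 := sub_ne_zero.mpr (Ne.symm h2)
    simp only [h3]
    exact expect_comp_injective (φ := fun s => auxExp x I + s * (I.getD i₀ 0 - J.getD i₀ 0))
      (fun s s' hs => mul_left_injective₀ h4 (add_left_cancel hs)) h

theorem expect_mul_coordinate (v : SetupVar l) (f : (SetupVar l → ZMod p) → ℝ)
    (hf : ∀ x a, f (Function.update x v a) = f x) (h : ZMod p → ℝ) :
    𝔼 x, f x * h (x v) = (𝔼 x, f x) * 𝔼 x : SetupVar l → ZMod p, h (x v) := by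
  have e : ∀ f : (SetupVar l → ZMod p) → ℝ, (∀ x a, f (Function.update x v a) = f x) →
      𝔼 x, f x * h (x v) = (𝔼 x, f x) * 𝔼 a, h a := by
    intro f hf
    rw [expect_split_one v (fun a x => f x * h a) fun a x b => by rw [hf], expect_swap]
    simp only [← Finset.mul_expect, Finset.expect_mul]
  rw [e f hf]
  congr 1
  simpa using (e (fun _ => 1) fun _ _ => rfl).symm

end Averages

/-! ### Statistical hops of the distinguished key -/

section Hops

variable {B : BilinearGroup} {l : ℕ} {g : B.G} {ĝ : B.Ghat} {yw : ZMod B.p} {q k : ℕ}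
  {A : List AdvInstr}

/-- The variables of the auxiliary exponents. -/
def IsAux : SetupVar l → Prop
  | .ah => True
  | .au _ => True
  | .a0 => True
  | .z => True
  | _ => False

instance : DecidablePred (IsAux (l := l)) := fun v => by
  cases v <;> unfold IsAux <;> infer_instance

theorem semi_congr (m : ℕ) {η : Bool → ZMod B.p} {δ ρ : ZMod B.p} {a a' : Fin l → ZMod B.p}
    (h : ∀ i : Fin l, m ≤ (i : ℕ) → a i = a' i) (b : Bool) (j : CompIdx l)
    (hj : ∀ i : Fin l, j = some (some i) → m ≤ (i : ℕ)) : semi η δ ρ a b j = semi η δ ρ a' b j := by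
  match j with
  | none => rfl
  | some none => rfl
  | some (some i) => simp [semi, h i (hj i rfl)]

/-- The auxiliary coins enter only key number `k` and the challenge. On the left the two answers are
independent by `expect_auxExp_mul`; on the right they use the different coordinates `a0` and `z`.
The separate laws agree by `expect_auxExp`, so `Challenger.expect_value_congr` applies. -/
theorem gameValue_hybrid_correlated :
    gameValue (l := l) g ĝ yw (hybrid k correlatedPart) ctCorrelated q A =
      gameValue (l := l) g ĝ yw (hybrid k nominalPart) ctSemi q A := by
  unfold gameValue
  rw [← expect_merge IsAux fun ω =>
      ((game yw (hybrid k correlatedPart) ctCorrelated ω).toChal g ĝ).value q A,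
    ← expect_merge IsAux fun ω =>
      ((game yw (hybrid k nominalPart) ctSemi ω).toChal g ĝ).value q A]
  refine Finset.expect_congr rfl fun ω _ => ?_
  set Φ : ID B → (KeyVar l → ZMod B.p) → ZMod B.p → (Fin l → ZMod B.p) → PrivateKey B l :=
    fun J r a u => keyOf ĝ J.length fun b j => keyTriple ω (keyPayload ω J r b j)
      (semi (fun b => partVal (ω .delta) (ω .rho) b * a) (ω .delta) (ω .rho) u b j) (r (.c b j))
    with hΦ
  set Ψ : ID B → B.GT → ZMod B.p → Ciphertext B := fun I M a =>
    { C := B.e g ĝ ^ (ω .alpha * ω .t) * M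
      C₁ := fun j => g ^ ctTriple ω (ω .t) (ω .s) j
      C₂ := fun j => g ^ ctTriple ω (ω .t * identExp ω I) (ω .s * a) j } with hΨ
  have hΦc : ∀ (J : ID B) r a u u', (∀ i : Fin l, J.length ≤ (i : ℕ) → u i = u' i) →
      Φ J r a u = Φ J r a u' := by
    intro J r a u u' h
    exact keyOf_congr fun b j hj i => by rw [semi_congr _ h b j hj]
  refine Challenger.expect_value_congr
    (fun x : SetupVar l → ZMod B.p => (game yw (hybrid k correlatedPart) ctCorrelated
      fun v => if IsAux v then x v else ω v).toChal g ĝ)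
    (fun x : SetupVar l → ZMod B.p => (game yw (hybrid k nominalPart) ctSemi
      fun v => if IsAux v then x v else ω v).toChal g ĝ) k q ?_ ?_ ?_ ?_ ?_ ?_ A
  · intro x x'
    simp [ExpChal.toChal, game, IsAux]
  · intro x x' n I r hn
    simp [ExpChal.toChal, game, IsAux, keyTriple, keyPayload, hybrid, hn]
  all_goals
    have k1 : ∀ (x : SetupVar l → ZMod B.p) J r, ((game yw (hybrid k correlatedPart) ctCorrelated
        fun v => if IsAux v then x v else ω v).toChal g ĝ).key k J r =
          Φ J r (auxExp x J) fun i => x (.au i) := by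
      intro x J r
      simp [ExpChal.toChal, game, IsAux, keyTriple, keyPayload, hybrid, correlatedPart, hΦ,
        auxExp]
    have k2 : ∀ (x : SetupVar l → ZMod B.p) J r, ((game yw (hybrid k nominalPart) ctSemi
        fun v => if IsAux v then x v else ω v).toChal g ĝ).key k J r =
          Φ J r (x .a0) fun i => x (.au i) := by
      intro x J r
      simp [ExpChal.toChal, game, IsAux, keyTriple, keyPayload, hybrid, nominalPart, hΦ]
    have c1 : ∀ (x : SetupVar l → ZMod B.p) I M r, ((game yw (hybrid k correlatedPart) ctCorrelated
        fun v => if IsAux v then x v else ω v).toChal g ĝ).ct I M r = Ψ I M (auxExp x I) := by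
      intro x I M r
      simp [ExpChal.toChal, game, IsAux, ctCorrelated, hΨ, auxExp, identExp, ctTriple]
    have c2 : ∀ (x : SetupVar l → ZMod B.p) I M r, ((game yw (hybrid k nominalPart) ctSemi
        fun v => if IsAux v then x v else ω v).toChal g ĝ).ct I M r = Ψ I M (x .z) := by
      intro x I M r
      simp [ExpChal.toChal, game, IsAux, ctSemi, hΨ, identExp, ctTriple]
  · intro J I M hJ _ hp r r' F H
    simp only [k1, c1]
    exact expect_auxExp_mul hJ hp (fun a u => F (Φ J r a u))
      (fun a u u' h => congrArg F (hΦc J r a u u' h)) fun a => H (Ψ I M a)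
  · intro J I M _ _ _ r r' F H
    simp only [k2, c2]
    exact expect_mul_coordinate .z (fun x => F (Φ J r (x .a0) fun i => x (.au i)))
      (fun x a => by simp) fun a => H (Ψ I M a)
  · intro _ J F
    simp only [k1, k2]
    rw [expect_swap, expect_swap (β := KeyVar l → ZMod B.p)]
    exact Finset.expect_congr rfl fun r _ =>
      expect_auxExp J .a0 (by simp) fun a u => F (Φ J r a u)
  · intro I M r H
    simp only [c1, c2]
    exact expect_auxExp I .z (by simp) fun a u => H (Ψ I M a)

/-- The variables of the special key. -/
def IsSpecial : SetupVar l → Prop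
  | .delta => True
  | .rho => True
  | .eta _ => True
  | .au _ => True
  | _ => False

instance : DecidablePred (IsSpecial (l := l)) := fun v => by
  cases v <;> unfold IsSpecial <;> infer_instance

def specialKeyVar : Bool ⊕ (Bool ⊕ Fin l) → KeyVar l
  | .inl b => .eta b
  | .inr (.inl true) => .delta
  | .inr (.inl false) => .rho
  | .inr (.inr i) => .a i

def specialSetupVar : Bool ⊕ (Bool ⊕ Fin l) → SetupVar l
  | .inl b => .eta b
  | .inr (.inl true) => .delta
  | .inr (.inl false) => .rho
  | .inr (.inr i) => .au i

theorem specialKeyVar_injective : Function.Injective (specialKeyVar (l := l)) := by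
  rintro (b | b | i) (b' | b' | i') <;> (try cases b) <;> (try cases b') <;>
    simp [specialKeyVar]

theorem specialSetupVar_injective : Function.Injective (specialSetupVar (l := l)) := by
  rintro (b | b | i) (b' | b' | i') <;> (try cases b) <;> (try cases b') <;>
    simp [specialSetupVar]

/-- In `ctSemi` the auxiliary level exponents no longer occur, so all coins of the special part
belong to key `k` alone. It is immaterial whether they are drawn at setup or with the key. -/
theorem gameValue_hybrid_random :
    gameValue (l := l) g ĝ yw (hybrid k randomPart) ctSemi q A =
      gameValue (l := l) g ĝ yw (hybrid (k + 1) 0) ctSemi q A := by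
  unfold gameValue
  rw [← expect_merge IsSpecial fun ω =>
      ((game yw (hybrid k randomPart) ctSemi ω).toChal g ĝ).value q A,
    ← expect_merge IsSpecial fun ω =>
      ((game yw (hybrid (k + 1) 0) ctSemi ω).toChal g ĝ).value q A]
  refine Finset.expect_congr rfl fun ω _ => ?_
  set Φ : ID B → (KeyVar l → ZMod B.p) → (Bool ⊕ (Bool ⊕ Fin l) → ZMod B.p) → PrivateKey B l :=
    fun J r y => keyOf ĝ J.length fun b j => keyTriple ω (keyPayload ω J r b j)
      (semi (fun b => y (.inl b)) (y (.inr (.inl true))) (y (.inr (.inl false)))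
        (fun i => y (.inr (.inr i))) b j) (r (.c b j))
    with hΦ
  refine Challenger.expect_value_congr
    (fun x : SetupVar l → ZMod B.p => (game yw (hybrid k randomPart) ctSemi
      fun v => if IsSpecial v then x v else ω v).toChal g ĝ)
    (fun x : SetupVar l → ZMod B.p => (game yw (hybrid (k + 1) 0) ctSemi
      fun v => if IsSpecial v then x v else ω v).toChal g ĝ) k q ?_ ?_ ?_ ?_ ?_ ?_ A
  · intro x x'
    simp [ExpChal.toChal, game, IsSpecial]
  · intro x x' n I r hn
    have : n < k ↔ n < k + 1 := by omega
    simp [ExpChal.toChal, game, IsSpecial, keyTriple, keyPayload, hybrid, hn, this]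
  all_goals
    have k1 : ∀ (x : SetupVar l → ZMod B.p) J r, ((game yw (hybrid k randomPart) ctSemi
        fun v => if IsSpecial v then x v else ω v).toChal g ĝ).key k J r =
          Φ J r (x ∘ specialSetupVar) := by
      intro x J r
      simp [ExpChal.toChal, game, IsSpecial, keyTriple, keyPayload, hybrid, randomPart, hΦ,
        specialSetupVar]
    have k2 : ∀ (x : SetupVar l → ZMod B.p) J r, ((game yw (hybrid (k + 1) 0) ctSemi
        fun v => if IsSpecial v then x v else ω v).toChal g ĝ).key k J r =
          Φ J r (r ∘ specialKeyVar) := by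
      intro x J r
      simp [ExpChal.toChal, game, IsSpecial, keyTriple, keyPayload, hybrid, semiKey, hΦ,
        specialKeyVar]
    obtain ⟨Ψ, c1, c2⟩ : ∃ Ψ : ID B → B.GT → Ciphertext B,
        (∀ (x : SetupVar l → ZMod B.p) I M r, ((game yw (hybrid k randomPart) ctSemi
          fun v => if IsSpecial v then x v else ω v).toChal g ĝ).ct I M r = Ψ I M) ∧
        ∀ (x : SetupVar l → ZMod B.p) I M r, ((game yw (hybrid (k + 1) 0) ctSemi
          fun v => if IsSpecial v then x v else ω v).toChal g ĝ).ct I M r = Ψ I M := by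
      refine ⟨fun I M => ((game yw 0 ctSemi ω).toChal g ĝ).ct I M (), ?_, ?_⟩ <;>
      · intro x I M r
        simp [ExpChal.toChal, game, IsSpecial, ctSemi, identExp, ctTriple]
  · intro J I M _ _ _ r r' F H
    simp only [c1, ← Finset.expect_mul, Fintype.expect_const]
  · intro J I M _ _ _ r r' F H
    simp only [c2, ← Finset.expect_mul, Fintype.expect_const]
  · intro _ J F
    simp only [k1, k2, Fintype.expect_const]
    -- On the left the special part comes from setup coordinates, on the right from coordinates of
    -- the key coins. The latter are disjoint from the coins of payload and masks, so they may be
    -- split off.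
    rw [expect_restrict specialSetupVar_injective fun y => 𝔼 r, F (Φ J r y),
      expect_split specialKeyVar_injective fun y r => F (Φ J r y)]
    intro y r r' h
    have : ∀ v : KeyVar l, (∀ w, specialKeyVar w ≠ v) → r v = r' v := fun v hv =>
      h v fun ⟨w, hw⟩ => hv w hw
    have h1 : ∀ b, r (.r b) = r' (.r b) := fun b => this _ (by
      rintro (b | b | i) <;> (try cases b) <;> simp [specialKeyVar])
    have h2 : ∀ b j, r (.c b j) = r' (.c b j) := fun b j => this _ (by
      rintro (b | b | i) <;> (try cases b) <;> simp [specialKeyVar])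
    simp only [hΦ, keyPayload, h1, h2]
  · intro I M r H
    simp only [c1, c2]

end Hops

/-! ## The real experiment as a game -/

/-- A surjective homomorphism maps a uniformly random element to a uniformly random element. -/
theorem expect_comp_surjective {X Y : Type} [Fintype X] [Nonempty X] [Fintype Y] [Nonempty Y]
    [AddGroup X] [AddGroup Y] (θ : X → Y) (hadd : ∀ x x', θ (x + x') = θ x + θ x')
    (hθ : Function.Surjective θ) (f : Y → ℝ) : 𝔼 x, f (θ x) = 𝔼 y, f y := by
  obtain ⟨σ, hσ⟩ := hθ.hasRightInverse
  have h : ∀ y, 𝔼 x, f (θ x) = 𝔼 x, f (θ x + y) := by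
    intro y
    rw [← expect_comp_injective (add_left_injective (σ y)) fun x => f (θ x)]
    simp only [hadd, hσ y]
  rw [← Fintype.expect_const (ι := Y) (𝔼 x, f (θ x)), Finset.expect_congr rfl fun y _ => h y,
    expect_swap, ← Fintype.expect_const (ι := X) (𝔼 y, f y)]
  exact Finset.expect_congr rfl fun x _ => expect_comp_injective (add_right_injective (θ x)) f

section Real

variable {B : BilinearGroup} {l : ℕ} {g : B.G} {ĝ : B.Ghat} {yw : ZMod B.p} {q : ℕ}
  {A : List AdvInstr}

theorem idProd_pow {k : GrpIdx} (x : B.El k) (h : ZMod B.p) (u : Fin l → ZMod B.p) (I : ID B) :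
    idProd (x ^ h) (fun i => x ^ u i) I = x ^ idSum h u I := by
  simp only [idProd, idSum, el_pow_add, el_pow_sum, el_pow_mul]

theorem pow_vec {k : GrpIdx} (x : B.El k) (a b c : ZMod B.p) :
    (fun j => x ^ (![a, b, c] : Fin 3 → ZMod B.p) j) = ![x ^ a, x ^ b, x ^ c] := by
  funext j
  fin_cases j <;> rfl

theorem pow_vec_level {k : GrpIdx} (x : B.El k) (a b c : Fin l → ZMod B.p) :
    (fun i j => x ^ (![a i, b i, c i] : Fin 3 → ZMod B.p) j) =
      fun i => ![x ^ a i, x ^ b i, x ^ c i] := by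
  funext i
  exact pow_vec x _ _ _

/-- The coins of `keyGen` in terms of the exponents of a private key. -/
def keyCoins (yw : ZMod B.p) (x : KeyVar l → ZMod B.p) : KeyCoins B l :=
  (x (.r false), yw⁻¹ * x (.c false none), yw⁻¹ * x (.c false (some none)),
    fun i => yw⁻¹ * x (.c false (some (some i))),
    x (.r true), yw⁻¹ * x (.c true none), yw⁻¹ * x (.c true (some none)),
    fun i => yw⁻¹ * x (.c true (some (some i))))

/-- The masks of `keyGen` are exponents of `W`, a power of ŵ; those of a game are exponents of ĝ.
The two differ by the factor `yw`, which must be invertible. -/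
theorem expect_keyCoins (hyw : yw ≠ 0) (f : KeyCoins B l → ℝ) :
    𝔼 x : KeyVar l → ZMod B.p, f (keyCoins yw x) = 𝔼 y, f y := by
  refine expect_comp_surjective _ (fun x x' => ?_) ?_ f
  · simp only [keyCoins, Pi.add_apply, mul_add]
    rfl
  · rintro ⟨r₁, c₁, c₂, c₃, r₂, c₄, c₅, c₆⟩
    refine ⟨fun
      | .r false => r₁
      | .r true => r₂
      | .c false none => yw * c₁
      | .c false (some none) => yw * c₂
      | .c false (some (some i)) => yw * c₃ i
      | .c true none => yw * c₄
      | .c true (some none) => yw * c₅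
      | .c true (some (some i)) => yw * c₆ i
      | _ => 0, ?_⟩
    simp [keyCoins, inv_mul_cancel_left₀ hyw]

/-- The challenger of the experiment for given exponents. -/
def realChal (g : B.G) (ĝ : B.Ghat) (yw : ZMod B.p) (ω : SetupVar l → ZMod B.p) :
    Challenger B l (KeyCoins B l) (ZMod B.p) :=
  realChallenger (realMaster ĝ (ω .yh) (ω .alpha) fun i => ω (.yu i))
    (realParams g ĝ (ω .nu) (ω .phi1) (ω .phi2) (ω .yh) (fun i => ω (.yu i)) yw (ω .alpha))

theorem realChal_key (hyw : yw ≠ 0) (ω : SetupVar l → ZMod B.p) (n : ℕ) (I : ID B)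
    (x : KeyVar l → ZMod B.p) :
    (realChal g ĝ yw ω).key n I (keyCoins yw x) =
      ((game yw (fun _ => 0) ctNormal ω).toChal g ĝ).key n I x := by
  have h1 : ∀ a c : ZMod B.p, yw * a * (yw⁻¹ * c) = a * c := by
    intro a c
    field_simp
  have h2 : ∀ c : ZMod B.p, yw * (yw⁻¹ * c) = c := by
    intro c
    field_simp
  simp [realChal, realChallenger, realMaster, realParams, keyCoins, ExpChal.toChal, game, keyOf,
    keyTriple, keyPayload, compVal, pow_vec, pow_vec_level, idProd_pow, h1, h2, ← el_pow_mul, ← el_pow_add]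
  simp [mul_comm, add_comm, add_left_comm]

theorem realChal_ct (ω : SetupVar l → ZMod B.p) (t : ZMod B.p) (I : ID B) (M : B.GT) :
    (realChal g ĝ yw ω).ct I M t =
      ((game yw (fun _ => 0) ctNormal (Function.update ω .t t)).toChal g ĝ).ct I M () := by
  have vec_congr {a a' b b' c c' : ZMod B.p} (ha : a = a') (hb : b = b') (hc : c = c') :
      (![g ^ a, g ^ b, g ^ c] : Fin 3 → B.G) = ![g ^ a', g ^ b', g ^ c'] := by rw [ha, hb, hc]
  have h1 : ∀ (a b c : ZMod B.p), (fun j => (![g ^ a, g ^ b, g ^ c] : Fin 3 → B.G) j ^ t) =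
      ![g ^ (a * t), g ^ (b * t), g ^ (c * t)] := by
    intro a b c
    funext j
    fin_cases j <;> exact (el_pow_mul _ _ _).symm
  have h2 : ∀ (a c : ZMod B.p), (fun j => idProd ((![g ^ ω .yh, g ^ (ω .yh * a), g ^ (ω .yh * c)] :
      Fin 3 → B.G) j) (fun i => (![g ^ ω (.yu i), g ^ (ω (.yu i) * a), g ^ (ω (.yu i) * c)] :
      Fin 3 → B.G) j) I ^ t) = ![g ^ (identExp ω I * t), g ^ (identExp ω I * a * t),
        g ^ (identExp ω I * c * t)] := by
    intro a c
    have : ∀ a, idSum (ω .yh * a) (fun i => ω (.yu i) * a) I = identExp ω I * a := by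
      intro a
      simp only [idSum, identExp, add_mul, Finset.sum_mul]
      congr 1
      exact Finset.sum_congr rfl fun i _ => by ring
    funext j
    fin_cases j
    · exact (congrArg (· ^ t) (idProd_pow g _ _ I)).trans (el_pow_mul _ _ _).symm
    all_goals
      refine (congrArg (· ^ t) (idProd_pow g _ _ I)).trans ?_
      rw [this]
      exact (el_pow_mul _ _ _).symm
  have h3 := h1 1 (ω .nu) (-(ω .phi1 + ω .nu * ω .phi2))
  rw [el_pow_one] at h3
  simp only [realChal, realChallenger, realParams, ExpChal.toChal, game, Ciphertext.mk.injEq,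
    ← el_pow_mul, h2, h3]
  refine ⟨?_, ?_, ?_⟩
  · simp [ctNormal]
  all_goals
    simp only [ctNormal, ctTriple, pow_vec, Function.update_self, ne_eq, reduceCtorEq,
      not_false_eq_true, Function.update_of_ne]
    have h5 : identExp (Function.update ω .t t) I = identExp ω I := by simp [identExp]
    refine vec_congr ?_ ?_ ?_ <;> (try rw [h5]) <;> ring

theorem realChal_pp (ω : SetupVar l → ZMod B.p) :
    (realChal g ĝ yw ω).pp = ((game yw (fun _ => 0) ctNormal ω).toChal g ĝ).pp := by
  simp [realChal, realChallenger, realParams, ExpChal.toChal, game, pow_vec, pow_vec_level,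
    el_pow_one, el_pow_mul]

/-- The game draws the encryption exponent `t` at setup, the experiment at the challenge. There is
only one challenge and no key involves `t`, so `Challenger.value_lazy` identifies the two. -/
theorem expect_value_realChal (hyw : yw ≠ 0) :
    𝔼 ω : SetupVar l → ZMod B.p, (realChal g ĝ yw ω).value q A =
      gameValue (l := l) g ĝ yw (fun _ => 0) ctNormal q A := by
  unfold gameValue
  rw [← expect_update .t fun ω => ((game yw (fun _ => 0) ctNormal ω).toChal g ĝ).value q A,
    expect_swap]
  refine Finset.expect_congr rfl fun ω _ => ?_
  set ch : ZMod B.p → Challenger B l (KeyVar l → ZMod B.p) Unit := fun t =>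
    (game yw (fun _ => 0) ctNormal (Function.update ω .t t)).toChal g ĝ with hch
  have hpp : ∀ t, (ch t).pp = (realChal g ĝ yw ω).pp := by
    intro t
    rw [realChal_pp]
    simp [hch, ExpChal.toChal, game]
  have hkey : ∀ t n I x, (ch t).key n I x = (realChal g ĝ yw ω).key n I (keyCoins yw x) := by
    intro t n I x
    rw [realChal_key hyw]
    simp [hch, ExpChal.toChal, game, keyTriple, keyPayload]
  change _ = 𝔼 t, (ch t).value q A
  rw [Challenger.value_lazy ch 0 q (fun t t' => (hpp t).trans (hpp t').symm)
    (fun t t' n I x _ => (hkey t n I x).trans (hkey t' n I x).symm)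
    (fun J I M _ _ _ x r F H => by simp only [hkey, ← Finset.mul_expect, Fintype.expect_const])]
  refine Challenger.value_congr (realChal g ĝ yw ω) (freshChallenger ch) (hpp _).symm q ?_ ?_ A
  · intro n I _ _ F
    simp only [freshChallenger, expect_prod_type, hkey, Fintype.expect_const]
    have h := expect_keyCoins hyw fun y => F ((realChal g ĝ yw ω).key n I y)
    simp only [expect_prod_type] at h
    exact h.symm
  · intro I M _ F
    simp only [freshChallenger, expect_prod_type, Fintype.expect_const, realChal_ct]
    simp [hch]

/-- The additional coordinates of `SetupVar` are ignored by `realChal`, and the others are exactly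
the coins of `setup` apart from the generators and `yw`. -/
theorem setupE_realChallenger :
    (setupE B l fun mk pp => (realChallenger mk pp).value q A) =
      𝔼 g : B.G, 𝔼 ĝ : B.Ghat, 𝔼 yw, 𝔼 ω : SetupVar l → ZMod B.p,
        (realChal g ĝ yw ω).value q A := by
  unfold setupE
  refine Finset.expect_congr rfl fun g _ => Finset.expect_congr rfl fun ĝ _ => ?_
  have h := fun yw : ZMod B.p => expect_comp_surjective (fun ω : SetupVar l → ZMod B.p =>
    (ω .nu, ω .phi1, ω .phi2, ω .yh, (fun i => ω (.yu i)), ω .alpha)) (fun x x' => rfl) (by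
      rintro ⟨ν, φ₁, φ₂, y, u, α⟩
      exact ⟨fun
        | .nu => ν
        | .phi1 => φ₁
        | .phi2 => φ₂
        | .yh => y
        | .yu i => u i
        | .alpha => α
        | _ => 0, rfl⟩) fun y => (realChallenger (realMaster ĝ y.2.2.2.1 y.2.2.2.2.2 y.2.2.2.2.1)
          (realParams g ĝ y.1 y.2.1 y.2.2.1 y.2.2.2.1 y.2.2.2.2.1 yw y.2.2.2.2.2)).value q A
  simp only [expect_prod_type] at h
  refine Eq.trans ?_ (Finset.expect_congr rfl fun yw _ => h yw).symm
  symm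
  iterate 5 refine (expect_swap _).trans (Finset.expect_congr rfl fun _ _ => ?_)
  rfl

end Real

/-! ## Formulas -/

namespace ScalExp

variable {l p : ℕ}

instance : Zero (ScalExp l p) := ⟨const 0⟩
instance : One (ScalExp l p) := ⟨const 1⟩
instance : Add (ScalExp l p) := ⟨add⟩
instance : Mul (ScalExp l p) := ⟨mul⟩
instance : Neg (ScalExp l p) := ⟨fun a => mul (const (-1)) a⟩
instance : Sub (ScalExp l p) := ⟨fun a b => a + -b⟩

variable (x : ExpVar l → ZMod p) (a b : ScalExp l p)

@[simp]
theorem eval_zero : (0 : ScalExp l p).eval x = 0 := rfl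
@[simp]
theorem eval_one : (1 : ScalExp l p).eval x = 1 := rfl
@[simp]
theorem eval_const (c : ZMod p) : (const c : ScalExp l p).eval x = c := rfl
@[simp]
theorem eval_var (v : ExpVar l) : (var v : ScalExp l p).eval x = x v := rfl
@[simp]
theorem eval_add : (a + b).eval x = a.eval x + b.eval x := rfl
@[simp]
theorem eval_mul : (a * b).eval x = a.eval x * b.eval x := rfl
@[simp]
theorem eval_neg : (-a).eval x = -a.eval x := neg_one_mul _
@[simp]
theorem eval_sub : (a - b).eval x = a.eval x - b.eval x := by
  rw [sub_eq_add_neg, ← eval_neg]; rfl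

@[simp]
theorem size_zero : (0 : ScalExp l p).size = 1 := rfl
@[simp]
theorem size_one : (1 : ScalExp l p).size = 1 := rfl
@[simp]
theorem size_const (c : ZMod p) : (const c : ScalExp l p).size = 1 := rfl
@[simp]
theorem size_var (v : ExpVar l) : (var v : ScalExp l p).size = 1 := rfl
@[simp]
theorem size_add : (a + b).size = a.size + b.size + 1 := rfl
@[simp]
theorem size_mul : (a * b).size = a.size + b.size + 1 := rfl
@[simp]
theorem size_neg : (-a).size = 1 + a.size + 1 := rfl
@[simp]
theorem size_sub : (a - b).size = a.size + (1 + b.size + 1) + 1 := rfl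

/-- The exponent of `h ∏ u_i ^ I_i` for the current identity. -/
def ident (h : ScalExp l p) (u : Fin l → ScalExp l p) : ScalExp l p :=
  (List.finRange l).foldr (fun i e => u i * var (.ident i) + e) h

theorem eval_ident (h : ScalExp l p) (u : Fin l → ScalExp l p) :
    (ident h u).eval x = h.eval x + ∑ i, (u i).eval x * x (.ident i) := by
  rw [Fin.sum_univ_def, ident]
  induction List.finRange l with
  | nil => simp
  | cons i L ih =>
    rw [List.foldr_cons, eval_add, ih, List.map_cons, List.sum_cons, eval_mul, eval_var]
    ring

theorem size_ident_le {h : ScalExp l p} {u : Fin l → ScalExp l p} (hh : h.size = 1)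
    (hu : ∀ i, (u i).size = 1) : (ident h u).size ≤ 1 + 4 * l := by
  have : ∀ L : List (Fin l), (L.foldr (fun i e => u i * var (.ident i) + e) h).size ≤
      1 + 4 * L.length := by
    intro L
    induction L with
    | nil => simp [hh]
    | cons i L ih =>
      rw [List.foldr_cons, size_add, size_mul, size_var, hu, List.length_cons]
      omega
  simpa [ident] using this (List.finRange l)

/-- The generator component is a parameter because LW1 and LW2 split the components into two
summands, only the second of which contains the generator: it gets 0 in one and 1 in the other. -/
def comp (h one : ScalExp l p) (u : Fin l → ScalExp l p) : CompIdx l → ScalExp l p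
  | none => ident h u
  | some none => one
  | some (some i) => u i

@[simp]
theorem eval_comp (h one : ScalExp l p) (u : Fin l → ScalExp l p) (j : CompIdx l)
    (ω : SetupVar l → ZMod p) (y : KeyVar l → ZMod p) (I : List (ZMod p)) (lt eq : ZMod p) :
    (comp h one u j).eval (env ω y I lt eq) = compVal (h.eval (env ω y I lt eq))
      (one.eval (env ω y I lt eq)) (fun i => (u i).eval (env ω y I lt eq)) I j := by
  match j with
  | none => exact eval_ident _ _ _
  | some none => rfl
  | some (some i) => rfl

theorem size_comp_le {h one : ScalExp l p} {u : Fin l → ScalExp l p} (hh : h.size = 1)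
    (ho : one.size = 1) (hu : ∀ i, (u i).size = 1) (j : CompIdx l) :
    (comp h one u j).size ≤ 1 + 4 * l := by
  match j with
  | none => exact size_ident_le hh hu
  | some none => simp only [comp, ho]; omega
  | some (some i) => simp only [comp, hu]; omega

abbrev sVar (v : SetupVar l) : ScalExp l p := var (.setup v)
abbrev kVar (v : KeyVar l) : ScalExp l p := var (.key v)

/-- The components of the auxiliary exponents. -/
abbrev auxComp (j : CompIdx l) : ScalExp l p := comp (sVar .ah) 1 (fun i => sVar (.au i)) j

theorem size_auxComp_le (j : CompIdx l) : (auxComp j : ScalExp l p).size ≤ 1 + 4 * l :=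
  size_comp_le rfl rfl (fun _ => rfl) j

abbrev identComp (one : ScalExp l p) (j : CompIdx l) : ScalExp l p :=
  comp (sVar .yh) one (fun i => sVar (.yu i)) j

theorem size_identComp_le {one : ScalExp l p} (h : one.size = 1) (j : CompIdx l) :
    (identComp one j).size ≤ 1 + 4 * l :=
  size_comp_le rfl h (fun _ => rfl) j

/-- The master exponent occurs only in the first component of a private key. -/
def master (b : Bool) (j : CompIdx l) : ScalExp l p :=
  if b = false ∧ j = none then sVar .alpha else 0

@[simp]
theorem eval_master (b : Bool) (j : CompIdx l) :
    (master b j : ScalExp l p).eval x = if b = false ∧ j = none then x (.setup .alpha) else 0 := by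
  unfold master; split_ifs <;> rfl

@[simp]
theorem size_master (b : Bool) (j : CompIdx l) : (master b j : ScalExp l p).size = 1 := by
  unfold master; split_ifs <;> rfl

/-- The semi-functional part of a private key. -/
def semi (η : Bool → ScalExp l p) (δ ρ : ScalExp l p) (a : Fin l → ScalExp l p) (b : Bool) :
    CompIdx l → ScalExp l p
  | none => η b
  | some none => if b then ρ * δ else δ
  | some (some i) => (if b then ρ * δ else δ) * a i

@[simp]
theorem eval_semi (η : Bool → ScalExp l p) (δ ρ : ScalExp l p) (a : Fin l → ScalExp l p)
    (b : Bool) (j : CompIdx l) : (semi η δ ρ a b j).eval x =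
      AHIBE.semi (fun b => (η b).eval x) (δ.eval x) (ρ.eval x) (fun i => (a i).eval x) b j := by
  match b, j with
  | _, none => rfl
  | true, some none => rfl
  | false, some none => rfl
  | true, some (some i) => rfl
  | false, some (some i) => rfl

theorem size_semi_le {η : Bool → ScalExp l p} {δ ρ : ScalExp l p} {a : Fin l → ScalExp l p}
    (b : Bool) (j : CompIdx l) {s : ℕ} (hη : (η b).size ≤ s) (hδ : δ.size = 1) (hρ : ρ.size ≤ s)
    (ha : ∀ i, (a i).size = 1) : (semi η δ ρ a b j).size ≤ s + 4 := by
  match b, j with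
  | _, none => simp only [semi]; omega
  | true, some none => simp only [semi, if_true, size_mul]; omega
  | false, some none => simp [semi, hδ]
  | true, some (some i) => simp only [semi, if_true, size_mul, ha]; omega
  | false, some (some i) => simp [semi, hδ, size_mul, ha]

/-- The semi-functional part with the coins of the current key. -/
abbrev semiKey (b : Bool) (j : CompIdx l) : ScalExp l p :=
  semi (fun b => kVar (.eta b)) (kVar .delta) (kVar .rho) (fun i => kVar (.a i)) b j

theorem size_semiKey_le (b : Bool) (j : CompIdx l) : (semiKey b j : ScalExp l p).size ≤ 5 :=
  size_semi_le b j (s := 1) le_rfl rfl le_rfl fun _ => rfl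

end ScalExp

namespace GrpExp

variable {l p : ℕ}

def smul (e : ScalExp l p) (G : GrpExp l p) : GrpExp l p := G.map fun q => (q.1, e * q.2)

variable (ε : BaseVar → ZMod p) (x : ExpVar l → ZMod p)

@[simp]
theorem expo_nil : expo ε x ([] : GrpExp l p) = 0 := rfl

@[simp]
theorem expo_cons (v : BaseVar) (e : ScalExp l p) (G : GrpExp l p) :
    expo ε x ((v, e) :: G) = ε v * e.eval x + expo ε x G := rfl

@[simp]
theorem expo_append (G H : GrpExp l p) : expo ε x (G ++ H) = expo ε x G + expo ε x H := by
  simp [expo]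

@[simp]
theorem expo_smul (e : ScalExp l p) (G : GrpExp l p) :
    expo ε x (smul e G) = e.eval x * expo ε x G := by
  induction G with
  | nil => simp [smul, expo]
  | cons q G ih =>
    have : smul e (q :: G) = (q.1, e * q.2) :: smul e G := rfl
    rw [this, expo_cons, ih, ScalExp.eval_mul]
    have h2 : expo ε x (q :: G) = ε q.1 * q.2.eval x + expo ε x G := rfl
    rw [h2]
    ring

@[simp]
theorem size_nil : size ([] : GrpExp l p) = 1 := rfl

@[simp]
theorem size_cons (q : BaseVar × ScalExp l p) (G : GrpExp l p) :
    size (q :: G) = q.2.size + 2 + size G := by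
  simp [size]; ring

theorem size_append (G H : GrpExp l p) : size (G ++ H) + 1 = size G + size H := by
  simp [size]; ring

@[simp]
theorem size_smul (e : ScalExp l p) (G : GrpExp l p) :
    size (smul e G) = size G + G.length * (e.size + 1) := by
  induction G with
  | nil => simp [smul]
  | cons q G ih =>
    have : smul e (q :: G) = (q.1, e * q.2) :: smul e G := rfl
    rw [this, size_cons, size_cons, ih, ScalExp.size_mul, List.length_cons]
    ring

theorem size_combination_le {e e' : ScalExp l p} {G G' : GrpExp l p} {s n m : ℕ}
    (he : e.size ≤ s) (he' : e'.size ≤ s) (hG : G.length ≤ n) (hG' : G'.length ≤ n)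
    (hm : size G ≤ m) (hm' : size G' ≤ m) :
    size (smul e G ++ smul e' G') ≤ 2 * m + 2 * n * (s + 1) := by
  have h1 := size_append (smul e G) (smul e' G')
  have h2 := Nat.mul_le_mul hG (Nat.succ_le_succ he)
  have h3 := Nat.mul_le_mul hG' (Nat.succ_le_succ he')
  rw [size_smul, size_smul] at h1
  simp only [Nat.succ_eq_add_one] at h2 h3
  nlinarith

end GrpExp

/-! ### Changes of the coins of a key -/

section KeySubst

variable {l p : ℕ} [Fact p.Prime]

/-- A change of the coins of a private key. -/
def keySubst (s : ZMod p) (d : Bool → ZMod p) (f : KeyVar l → (Bool → ZMod p) → ZMod p)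
    (x : KeyVar l → ZMod p) : KeyVar l → ZMod p
  | .r b => s * x (.r b) + d b
  | v => x v + f v fun b => x (.r b)

/-- The substitution is triangular: the values at `r` can be recovered first, and all shifts depend
on these only. -/
theorem keySubst_injective {s : ZMod p} (hs : s ≠ 0) (d : Bool → ZMod p)
    (f : KeyVar l → (Bool → ZMod p) → ZMod p) : Function.Injective (keySubst s d f) := by
  intro x y h
  have h1 : ∀ b, x (.r b) = y (.r b) := by
    intro b
    have := congrFun h (.r b)
    simp only [keySubst] at this
    exact mul_left_cancel₀ hs (add_right_cancel this)
  have h2 : (fun b => x (.r b)) = fun b => y (.r b) := funext h1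
  funext v
  have := congrFun h v
  cases v
  case r b => exact h1 b
  all_goals
    simp only [keySubst, h2] at this
    exact add_right_cancel this

variable (s : ZMod p) (d : Bool → ZMod p) (f : KeyVar l → (Bool → ZMod p) → ZMod p)
  (x : KeyVar l → ZMod p)

@[simp]
theorem keySubst_r (b : Bool) : keySubst s d f x (.r b) = s * x (.r b) + d b := rfl
@[simp]
theorem keySubst_delta : keySubst s d f x .delta = x .delta + f .delta fun b => x (.r b) := rfl
@[simp]
theorem keySubst_rho : keySubst s d f x .rho = x .rho + f .rho fun b => x (.r b) := rfl
@[simp]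
theorem keySubst_eta (b : Bool) :
    keySubst s d f x (.eta b) = x (.eta b) + f (.eta b) fun b => x (.r b) := rfl
@[simp]
theorem keySubst_c (b : Bool) (j : CompIdx l) :
    keySubst s d f x (.c b j) = x (.c b j) + f (.c b j) fun b => x (.r b) := rfl
@[simp]
theorem keySubst_a (i : Fin l) :
    keySubst s d f x (.a i) = x (.a i) + f (.a i) fun b => x (.r b) := rfl

/-- Linear combinations of the components. -/
theorem compVal_linear {h h₁ h₂ o o₁ o₂ : ZMod p} {u u₁ u₂ : Fin l → ZMod p} (s t : ZMod p)
    (hh : h = s * h₁ + t * h₂) (ho : o = s * o₁ + t * o₂) (hu : ∀ i, u i = s * u₁ i + t * u₂ i)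
    (I : List (ZMod p)) (j : CompIdx l) :
    compVal h o u I j = s * compVal h₁ o₁ u₁ I j + t * compVal h₂ o₂ u₂ I j := by
  match j with
  | none =>
    simp only [compVal, idSum, hh, hu, mul_add, Finset.mul_sum, add_mul, Finset.sum_add_distrib,
      mul_assoc]
    ring
  | some none => exact ho
  | some (some i) => exact hu i

end KeySubst

/-! ## The reduction to LW1 -/

section LW1

open ScalExp GrpExp BaseVar

variable {l p : ℕ}

/-- With ν = a + ν' and φ₁ = b + φ₁', `lw1P` is the public triple of the scheme's generator g^(b²)
and `lw1Q` that of g. With t = c + t', `lw1U` is the ciphertext triple over g^(b²), where the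
challenge stands for ab²c, and `lw1V` the one over g without semi-functional part. -/
def lw1P : Fin 3 → GrpExp l p :=
  ![[(inp 4, 1)],
    [(inp 3, 1), (inp 4, sVar .nu)],
    [(inp 5, -1), (inp 4, -(sVar .phi1 + sVar .phi2 * sVar .nu)), (inp 3, -sVar .phi2)]]

def lw1Q : Fin 3 → GrpExp l p :=
  ![[(inp 0, 1)],
    [(inp 1, 1), (inp 0, sVar .nu)],
    [(inp 2, -1), (inp 0, -(sVar .phi1 + sVar .phi2 * sVar .nu)), (inp 1, -sVar .phi2)]]

def lw1U : Fin 3 → GrpExp l p :=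
  ![[(inp 9, 1), (inp 4, sVar .t)],
    [(inp 11, 1), (inp 3, sVar .t), (inp 9, sVar .nu), (inp 4, sVar .nu * sVar .t)],
    [(inp 10, -1), (inp 5, -sVar .t), (inp 9, -(sVar .phi1 + sVar .phi2 * sVar .nu)),
      (inp 4, -((sVar .phi1 + sVar .phi2 * sVar .nu) * sVar .t)), (inp 11, -sVar .phi2),
      (inp 3, -(sVar .phi2 * sVar .t))]]

def lw1V : Fin 3 → GrpExp l p :=
  ![[(inp 6, 1), (inp 0, sVar .t)],
    [(inp 7, 1), (inp 6, sVar .nu), (inp 1, sVar .t), (inp 0, sVar .nu * sVar .t)],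
    [(inp 8, -1), (inp 2, -sVar .t), (inp 6, -(sVar .phi1 + sVar .phi2 * sVar .nu)),
      (inp 0, -((sVar .phi1 + sVar .phi2 * sVar .nu) * sVar .t)), (inp 7, -sVar .phi2),
      (inp 1, -(sVar .phi2 * sVar .t))]]

/-- The simulation for LW1. -/
def lw1Red (yw : ZMod p) : Red l p where
  g := lw1P
  h j := smul (sVar .yh) (lw1Q j) ++ smul (sVar .ah) (lw1P j)
  u i j := smul (sVar (.yu i)) (lw1Q j) ++ smul (sVar (.au i)) (lw1P j)
  W := ![[(inp 1, const yw), (inp 0, const yw * sVar .phi1)], [(inp 0, const yw * sVar .phi2)],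
    [(inp 0, const yw)]]
  Ω := [(pair 4 0, sVar .alpha)]
  key b j := ![
    [(inp 0, identComp 0 j * kVar (.r b) + master b j + sVar .phi1 * kVar (.c b j)),
      (inp 1, kVar (.c b j) - sVar .phi1 * (kVar (.r b) * auxComp j))],
    [(inp 0, sVar .phi2 * kVar (.c b j)), (inp 1, -(sVar .phi2 * (kVar (.r b) * auxComp j)))],
    [(inp 0, kVar (.c b j)), (inp 1, -(kVar (.r b) * auxComp j))]]
  C := [(pair 9 0, sVar .alpha), (pair 4 0, sVar .alpha * sVar .t)]
  C₁ := lw1U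
  C₂ j := smul (identComp 0 none) (lw1V j) ++ smul (auxComp none) (lw1U j)
  bad := [(.left, inp 2)]
  test := (.left, inp 11)

variable [Fact p.Prime]

/-- Identity exponents are split as y/b² + a'. Over g^(b²) the first summand uses only g and stays
free of the challenge; the second multiplies the challenge and becomes the auxiliary exponent. -/
def lw1Subst (a b c : ZMod p) (ω : SetupVar l → ZMod p) : SetupVar l → ZMod p
  | .nu => a + ω .nu
  | .phi1 => b + ω .phi1
  | .yh => ω .yh / b ^ 2 + ω .ah
  | .yu i => ω (.yu i) / b ^ 2 + ω (.au i)
  | .t => c + ω .t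
  | v => ω v

theorem lw1Subst_injective (a c : ZMod p) {b : ZMod p} (hb : b ≠ 0) :
    Function.Injective (lw1Subst (l := l) a b c) := by
  intro ω ω' h
  have h0 := fun v => congrFun h v
  have h1 : ω .ah = ω' .ah := h0 .ah
  have h2 : ∀ i, ω (.au i) = ω' (.au i) := fun i => h0 (.au i)
  funext v
  have h3 := h0 v
  cases v <;> first | exact h1 | exact h2 _ | simpa [lw1Subst, h1, h2, hb] using h3

/-- The excess of the challenge over ab²c, divided by b², becomes `s`. It vanishes for a true
instance and is uniform for a random one, and the second triple inherits it times `auxExp`. -/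
theorem lw1_equiv (yw a b c T : ZMod p) (hb : b ≠ 0) (k q : ℕ) (ω : SetupVar l → ZMod p) :
    ((lw1Red yw).expChal (baseExp [1, a, b, a * b ^ 2, b ^ 2, b ^ 3, c, a * c, b * c, b ^ 2 * c,
      b ^ 3 * c, T] [1, b] []) k ω).Equiv q ((game yw (fun _ => 0) ctCorrelated
        (Function.update (lw1Subst a b c ω) .s ((T - a * b ^ 2 * c) / b ^ 2))).scale (b ^ 2)) := by
  set ε := baseExp [1, a, b, a * b ^ 2, b ^ 2, b ^ 3, c, a * c, b * c, b ^ 2 * c,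
      b ^ 3 * c, T] [1, b] [] with hε
  set ω' := Function.update (lw1Subst a b c ω) .s ((T - a * b ^ 2 * c) / b ^ 2) with hω'
  set f : Fin 3 → ZMod p := ![1, ω' .nu, -(ω' .phi1 + ω' .phi2 * ω' .nu)] with hf
  have hP : ∀ I j, (lw1P j).expo (ε .left) (env ω 0 I 0 0) = b ^ 2 * f j := by
    intro I j
    fin_cases j <;> simp [lw1P, hω', lw1Subst, env, hε, baseExp, hf] <;> ring
  have hQ : ∀ I j, (lw1Q j).expo (ε .left) (env ω 0 I 0 0) = f j := by
    intro I j
    fin_cases j <;> simp [lw1Q, hω', lw1Subst, env, hε, baseExp, hf] <;> ring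
  have hU : ∀ I j, (lw1U j).expo (ε .left) (env ω 0 I 0 0) =
      b ^ 2 * ctTriple ω' (ω' .t) (ω' .s) j := by
    intro I j
    fin_cases j <;> simp [lw1U, hω', lw1Subst, env, hε, baseExp, ctTriple] <;> field_simp <;> ring
  have hV : ∀ I j, (lw1V j).expo (ε .left) (env ω 0 I 0 0) = ctTriple ω' (ω' .t) 0 j := by
    intro I j
    fin_cases j <;> simp [lw1V, hω', lw1Subst, env, hε, baseExp, ctTriple] <;> ring
  have hY : ∀ I j, compVal (ω' .yh) 1 (fun i => ω' (.yu i)) I j = (b ^ 2)⁻¹ *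
      compVal (ω .yh) 0 (fun i => ω (.yu i)) I j + 1 *
      compVal (ω .ah) 1 (fun i => ω (.au i)) I j := by
    intro I j
    refine compVal_linear _ _ ?_ ?_ (fun i => ?_) I j <;> simp [hω', lw1Subst] <;> ring
  have hF : ∀ I, b ^ 2 * identExp ω' I = compVal (ω .yh) 0 (fun i => ω (.yu i)) I none +
      b ^ 2 * compVal (ω .ah) 1 (fun i => ω (.au i)) I none := by
    intro I
    have := hY I none
    rw [show identExp ω' I = compVal (ω' .yh) 1 (fun i => ω' (.yu i)) I none from rfl, this]
    field_simp
  constructor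
  · funext j
    refine (hP [] j).trans (congrArg (b ^ 2 * ·) ?_)
    fin_cases j <;> simp [game, hf, mul_comm]
  · funext j
    simp only [Red.expChal, lw1Red, expo_append, expo_smul, hP, hQ]
    fin_cases j <;> simp [ExpChal.scale, game, hf, env, hω', lw1Subst] <;> field_simp
  · funext i j
    simp only [Red.expChal, lw1Red, expo_append, expo_smul, hP, hQ]
    fin_cases j <;> simp [ExpChal.scale, game, hf, env, hω', lw1Subst] <;> field_simp
  · funext j
    fin_cases j <;> simp [Red.expChal, lw1Red, ExpChal.scale, game, env, hω', lw1Subst, hε, baseExp]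
      <;> ring
  · simp [Red.expChal, lw1Red, ExpChal.scale, game, env, hω', lw1Subst, hε, baseExp]
  · intro n I _
    -- Scaling `r` by b² clears the denominator but leaves a multiple of b² in the payload, which
    -- the instance does not provide in 𝔾̂. Shifting the mask by -b r times the auxiliary component
    -- lets φ₁ = b + φ₁' cancel it.
    refine ⟨keySubst (b ^ 2) 0 fun v r => match v with
      | .c c j => - (b * r c * compVal (ω .ah) 1 (fun i => ω (.au i)) I j)
      | _ => 0, keySubst_injective (pow_ne_zero 2 hb) _ _, fun x c j _ i => ?_⟩
    have h1 := hY I j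
    simp only [hω', lw1Subst, ne_eq, reduceCtorEq, not_false_eq_true, Function.update_of_ne] at h1
    fin_cases i <;> simp [Red.expChal, lw1Red, ExpChal.scale, game, keyTriple, keyPayload, env, h1,
      hε, baseExp, hω', lw1Subst] <;> field_simp <;> ring
  · intro I
    simp [Red.expChal, lw1Red, ExpChal.scale, game, ctCorrelated, env, hω', lw1Subst, hε, baseExp]
    ring
  · intro I
    funext j
    exact hU I j
  · intro I
    funext j
    simp only [Red.expChal, lw1Red, expo_append, expo_smul, hU, hV]
    have h1 : ∀ I, auxExp ω' I = compVal (ω .ah) 1 (fun i => ω (.au i)) I none := fun I => by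
      simp [auxExp, hω', lw1Subst, compVal]
    have h2 := hF I
    rw [← h1] at h2
    have h3 : compVal (ω .yh) 0 (fun i => ω (.yu i)) I none = b ^ 2 * identExp ω' I -
      b ^ 2 * auxExp ω' I := by rw [h2]; ring
    simp only [eval_comp, eval_var, env, eval_zero, eval_one, ← h1, h3, ExpChal.scale, game,
      ctCorrelated]
    fin_cases j <;> simp [ctTriple] <;> ring

theorem lw1_size (yw : ZMod p) : (lw1Red yw : Red l p).SizeLe (200 * (l + 1)) := by
  have hP : ∀ j, (lw1P j : GrpExp l p).size ≤ 50 ∧ (lw1P j : GrpExp l p).length ≤ 6 := by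
    intro j
    fin_cases j <;> simp [lw1P]
  have hQ : ∀ j, (lw1Q j : GrpExp l p).size ≤ 50 ∧ (lw1Q j : GrpExp l p).length ≤ 6 := by
    intro j
    fin_cases j <;> simp [lw1Q]
  have hU : ∀ j, (lw1U j : GrpExp l p).size ≤ 50 ∧ (lw1U j : GrpExp l p).length ≤ 6 := by
    intro j
    fin_cases j <;> simp [lw1U]
  have hV : ∀ j, (lw1V j : GrpExp l p).size ≤ 50 ∧ (lw1V j : GrpExp l p).length ≤ 6 := by
    intro j
    fin_cases j <;> simp [lw1V]
  have hA := fun j => size_auxComp_le (p := p) (l := l) j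
  have hI := fun j => size_identComp_le (p := p) (l := l) (one := 0) rfl j
  constructor
  · omega
  · exact fun j => (hP j).1.trans (by omega)
  · exact fun j => (size_combination_le (s := 1) le_rfl le_rfl (hQ j).2 (hP j).2 (hQ j).1
      (hP j).1).trans (by omega)
  · exact fun i j => (size_combination_le (s := 1) le_rfl le_rfl (hQ j).2 (hP j).2 (hQ j).1
      (hP j).1).trans (by omega)
  · intro j
    fin_cases j <;> simp [lw1Red] <;> omega
  · simp [lw1Red]; omega
  · intro b i j
    have h1 := hA i
    have h2 := hI i
    fin_cases j <;> simp [lw1Red] <;> omega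
  · simp [lw1Red]; omega
  · exact fun j => (hU j).1.trans (by omega)
  · exact fun j => (size_combination_le (hI none) (hA none) (hV j).2 (hU j).2 (hV j).1
      (hU j).1).trans (by omega)
  · simp [lw1Red]; omega

end LW1

/-! ## The reduction to LW2 -/

section LW2

open ScalExp GrpExp BaseVar

variable {l p : ℕ}

/-- Here the scheme's generator is g^a and τ = a + φ₁', so the public triples over g^a and over g
(`lw2Q`) need neither b nor x. `lw2U` and `lw2V` are the ciphertext triples with t = bx + t', the
first one over g^a with s = -ax. -/
def lw2P : Fin 3 → GrpExp l p :=
  ![[(inp 1, 1)], [(inp 1, sVar .nu)], [(inp 2, -1), (inp 1, -sVar .phi1)]]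

def lw2Q : Fin 3 → GrpExp l p :=
  ![[(inp 0, 1)], [(inp 0, sVar .nu)], [(inp 1, -1), (inp 0, -sVar .phi1)]]

def lw2U : Fin 3 → GrpExp l p :=
  ![[(inp 4, 1), (inp 1, sVar .t)],
    [(inp 4, sVar .nu), (inp 1, sVar .nu * sVar .t), (inp 5, -1)],
    [(inp 2, -sVar .t), (inp 4, -sVar .phi1), (inp 1, -(sVar .phi1 * sVar .t)),
      (inp 5, sVar .phi2)]]

def lw2V : Fin 3 → GrpExp l p :=
  ![[(inp 3, 1), (inp 0, sVar .t)],
    [(inp 3, sVar .nu), (inp 0, sVar .nu * sVar .t)],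
    [(inp 4, -1), (inp 1, -sVar .t), (inp 3, -sVar .phi1), (inp 0, -(sVar .phi1 * sVar .t))]]

def levelFactor (b : Bool) : ScalExp l p := if b then sVar .rho else 1

@[simp]
theorem eval_levelFactor (b : Bool) (x : ExpVar l → ZMod p) :
    (levelFactor b : ScalExp l p).eval x = partVal 1 (x (.setup .rho)) b := by
  cases b <;> simp [levelFactor, partVal]

@[simp]
theorem size_levelFactor (b : Bool) : (levelFactor b : ScalExp l p).size = 1 := by
  cases b <;> rfl

/-- The factor of the auxiliary exponents in the special key. -/
def lw2Factor (b : Bool) (j : CompIdx l) : ScalExp l p :=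
  var .eq * (levelFactor b * auxComp j)

/-- The simulation for LW2. -/
def lw2Red (yw : ZMod p) : Red l p where
  g := lw2P
  h j := smul (sVar .yh) (lw2Q j) ++ smul (sVar .ah) (lw2P j)
  u i j := smul (sVar (.yu i)) (lw2Q j) ++ smul (sVar (.au i)) (lw2P j)
  W := ![[(inp 1, const yw), (inp 2, -(const yw * sVar .nu)),
      (inp 0, const yw * (sVar .phi1 - sVar .nu * sVar .phi2))],
    [(inp 2, const yw), (inp 0, const yw * sVar .phi2)], [(inp 0, const yw)]]
  Ω := [(pair 1 0, sVar .alpha)]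
  key b j := ![
    [(inp 1, auxComp j * kVar (.r b) + kVar (.c b j)),
      (inp 0, identComp 0 j * kVar (.r b) + master b j + sVar .phi1 * kVar (.c b j) -
        sVar .nu * (sVar .phi2 * kVar (.c b j) + var .lt * ScalExp.semiKey b j)),
      (inp 2, -(sVar .nu * kVar (.c b j))),
      (inp 3, (sVar .phi1 - sVar .nu * sVar .phi2) * lw2Factor b j -
        var .eq * (levelFactor b * identComp 0 j)),
      (inp 4, -(sVar .nu * lw2Factor b j))],
    [(inp 0, sVar .phi2 * kVar (.c b j) + var .lt * ScalExp.semiKey b j), (inp 2, kVar (.c b j)),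
      (inp 3, sVar .phi2 * lw2Factor b j), (inp 4, lw2Factor b j)],
    [(inp 0, kVar (.c b j)), (inp 3, lw2Factor b j)]]
  C := [(pair 4 0, sVar .alpha), (pair 1 0, sVar .alpha * sVar .t)]
  C₁ := lw2U
  C₂ j := smul (identComp 0 none) (lw2V j) ++ smul (auxComp none) (lw2U j)
  bad := [(.left, inp 1)]
  test := (.left, inp 0)

variable [Fact p.Prime]

/-- φ₂ hides b, and φ₁ is adjusted so that τ = φ₁ + νφ₂ does not contain it. In the last entry of
the ciphertext the term a²bx from τt then cancels against the one from φ₂s, which the instance does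
not contain in 𝔾. -/
def lw2Subst (a b x : ZMod p) (ω : SetupVar l → ZMod p) : SetupVar l → ZMod p
  | .phi1 => a - ω .nu * (b + ω .phi2) + ω .phi1
  | .phi2 => b + ω .phi2
  | .yh => ω .yh / a + ω .ah
  | .yu i => ω (.yu i) / a + ω (.au i)
  | .t => b * x + ω .t
  | v => ω v

theorem lw2Subst_injective {a : ZMod p} (ha : a ≠ 0) (b x : ZMod p) :
    Function.Injective (lw2Subst (l := l) a b x) := by
  intro ω ω' h
  have h0 := fun v => congrFun h v
  have h1 : ω .ah = ω' .ah := h0 .ah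
  have h2 : ∀ i, ω (.au i) = ω' (.au i) := fun i => h0 (.au i)
  have h3 : ω .nu = ω' .nu := h0 .nu
  have h4 : ω .phi2 = ω' .phi2 := add_left_cancel (h0 .phi2)
  funext v
  have h5 := h0 v
  cases v <;> first | exact h1 | exact h2 _ | exact h3 | exact h4 |
    simpa [lw2Subst, h1, h2, h3, h4, ha] using h5

theorem correlatedPart_eq (ω : SetupVar l → ZMod p) (I : List (ZMod p)) (b : Bool)
    (j : CompIdx l) : correlatedPart ω I b j =
      partVal (ω .delta) (ω .rho) b * compVal (ω .ah) 1 (fun i => ω (.au i)) I j := by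
  match j with
  | none => rfl
  | some none => exact (mul_one _).symm
  | some (some i) => rfl

theorem hybrid_apply (k : ℕ)
    (κ : (SetupVar l → ZMod p) → List (ZMod p) → Bool → CompIdx l → ZMod p)
    (ω : SetupVar l → ZMod p) (n : ℕ) (I : List (ZMod p)) (x : KeyVar l → ZMod p) (b : Bool)
    (j : CompIdx l) : hybrid k κ ω n I x b j = (if n < k then 1 else 0) * semiKey x b j +
      (if n = k then 1 else 0) * κ ω I b j := by
  unfold hybrid
  by_cases h1 : n < k
  · simp [h1, h1.ne]
  · by_cases h2 : n = k <;> simp [h1, h2]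

theorem semiKey_keySubst {f : KeyVar l → (Bool → ZMod p) → ZMod p}
    {x : KeyVar l → ZMod p} (hf : ∀ v, (∀ b j, v ≠ .c b j) → f v (fun b => x (.r b)) = 0)
    (s : ZMod p) (d : Bool → ZMod p) : semiKey (keySubst s d f x) = semiKey x := by
  unfold semiKey
  simp [hf]

/-- The challenge is used in key number `k` only. Its excess T - bc becomes the factor `delta` of
that key's semi-functional part: zero gives a normal key, a uniform value a correlated one. Earlier
keys are made semi-functional directly. -/
theorem lw2_equiv (yw b c x T : ZMod p) {a : ZMod p} (ha : a ≠ 0) (k q : ℕ)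
    (ω : SetupVar l → ZMod p) :
    ((lw2Red yw).expChal (baseExp [1, a, a ^ 2, b * x, a * b * x, a ^ 2 * x] [1, a, b, c, T] [])
      k ω).Equiv q ((game yw (hybrid k correlatedPart) ctCorrelated
        (Function.update (Function.update (lw2Subst a b x ω) .s (-(a * x))) .delta
          (T - b * c))).scale a) := by
  set ε := baseExp [1, a, a ^ 2, b * x, a * b * x, a ^ 2 * x] [1, a, b, c, T] [] with hε
  set ω' := Function.update (Function.update (lw2Subst a b x ω) .s (-(a * x))) .delta
    (T - b * c) with hω'
  set f : Fin 3 → ZMod p := ![1, ω' .nu, -(ω' .phi1 + ω' .phi2 * ω' .nu)] with hf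
  have hP : ∀ I j, (lw2P j).expo (ε .left) (env ω 0 I 0 0) = a * f j := by
    intro I j
    fin_cases j <;> simp [lw2P, hω', lw2Subst, env, hε, baseExp, hf] <;> ring
  have hQ : ∀ I j, (lw2Q j).expo (ε .left) (env ω 0 I 0 0) = f j := by
    intro I j
    fin_cases j <;> simp [lw2Q, hω', lw2Subst, env, hε, baseExp, hf] <;> ring
  have hU : ∀ I j, (lw2U j).expo (ε .left) (env ω 0 I 0 0) =
      a * ctTriple ω' (ω' .t) (ω' .s) j := by
    intro I j
    fin_cases j <;> simp [lw2U, hω', lw2Subst, env, hε, baseExp, ctTriple] <;> ring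
  have hV : ∀ I j, (lw2V j).expo (ε .left) (env ω 0 I 0 0) = ctTriple ω' (ω' .t) 0 j := by
    intro I j
    fin_cases j <;> simp [lw2V, hω', lw2Subst, env, hε, baseExp, ctTriple] <;> ring
  have hY : ∀ I j, compVal (ω' .yh) 1 (fun i => ω' (.yu i)) I j = a⁻¹ *
      compVal (ω .yh) 0 (fun i => ω (.yu i)) I j + 1 *
      compVal (ω .ah) 1 (fun i => ω (.au i)) I j := by
    intro I j
    refine compVal_linear _ _ ?_ ?_ (fun i => ?_) I j <;> simp [hω', lw2Subst] <;> ring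
  have hF : ∀ I, a * identExp ω' I = compVal (ω .yh) 0 (fun i => ω (.yu i)) I none +
      a * compVal (ω .ah) 1 (fun i => ω (.au i)) I none := by
    intro I
    have := hY I none
    rw [show identExp ω' I = compVal (ω' .yh) 1 (fun i => ω' (.yu i)) I none from rfl, this]
    field_simp
  constructor
  · funext j
    refine (hP [] j).trans (congrArg (a * ·) ?_)
    fin_cases j <;> simp [game, hf, mul_comm]
  · funext j
    simp only [Red.expChal, lw2Red, expo_append, expo_smul, hP, hQ]
    fin_cases j <;> simp [ExpChal.scale, game, hf, env, hω', lw2Subst] <;> field_simp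
  · funext i j
    simp only [Red.expChal, lw2Red, expo_append, expo_smul, hP, hQ]
    fin_cases j <;> simp [ExpChal.scale, game, hf, env, hω', lw2Subst] <;> field_simp
  · funext j
    fin_cases j <;> simp [Red.expChal, lw2Red, ExpChal.scale, game, env, hω', lw2Subst, hε, baseExp]
      <;> ring
  · simp [Red.expChal, lw2Red, ExpChal.scale, game, env, hω', lw2Subst, hε, baseExp]
  · intro n I _
    set A := compVal (ω .ah) 1 (fun i => ω (.au i)) I with hA
    set e : ZMod p := if n = k then 1 else 0 with he
    set f' : KeyVar l → (Bool → ZMod p) → ZMod p := fun v _ => match v with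
      | .c b j => e * (partVal 1 (ω .rho) b * A j) * c
      | _ => 0 with hf'
    -- In key `k` both `r` and the mask contain c. The unavailable products cancel: ac between the
    -- payload and φ₁ times the mask, bc between T - bc and φ₂ times the mask. For the other keys
    -- `e` is 0 and only the scaling by `a` remains.
    refine ⟨keySubst a (fun b => -(e * a * partVal 1 (ω .rho) b * c)) f',
      keySubst_injective ha _ _, fun y d j _ i => ?_⟩
    have h1 := hY I j
    rw [← hA] at h1
    have h3 : partVal (T - b * c) (ω .rho) d = partVal 1 (ω .rho) d * (T - b * c) := by
      cases d <;> simp [partVal]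
    have h4 : AHIBE.semi (fun b => y (.eta b)) (y .delta) (y .rho) (fun i => y (.a i)) d j =
        semiKey y d j := rfl
    have h5 : semiKey (keySubst a (fun b => -(e * a * partVal 1 (ω .rho) b * c)) f' y) d j =
        semiKey y d j := by
      rw [semiKey_keySubst]
      intro v hv
      cases v
      case c b j => exact absurd rfl (hv b j)
      all_goals rfl
    have h6 : correlatedPart ω' I d j = partVal 1 (ω .rho) d * (T - b * c) * A j := by
      rw [correlatedPart_eq, ← h3]
      simp [hω', lw2Subst, hA]
    obtain ⟨lt, hlt⟩ : ∃ lt : ZMod p, lt = if n < k then 1 else 0 := ⟨_, rfl⟩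
    have h7 := hybrid_apply k correlatedPart ω' n I
      (keySubst a (fun b => -(e * a * partVal 1 (ω .rho) b * c)) f' y) d j
    rw [h5, h6, ← he, ← hlt] at h7
    fin_cases i <;> simp [Red.expChal, lw2Red, lw2Factor, ExpChal.scale, game, keyTriple,
      keyPayload, env, h1, h4, h7, ← he, ← hA, ← hlt, hε, baseExp] <;>
      simp only [hω', hf', lw2Subst, ne_eq, reduceCtorEq, not_false_eq_true,
      Function.update_of_ne] <;> field_simp <;> ring
  · intro I
    simp [Red.expChal, lw2Red, ExpChal.scale, game, ctCorrelated, env, hω', lw2Subst, hε, baseExp]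
    ring
  · intro I
    funext j
    exact hU I j
  · intro I
    funext j
    simp only [Red.expChal, lw2Red, expo_append, expo_smul, hU, hV]
    have h1 : ∀ I, auxExp ω' I = compVal (ω .ah) 1 (fun i => ω (.au i)) I none := fun I => by
      simp [auxExp, hω', lw2Subst, compVal]
    have h2 := hF I
    rw [← h1] at h2
    have h3 : compVal (ω .yh) 0 (fun i => ω (.yu i)) I none = a * identExp ω' I -
      a * auxExp ω' I := by rw [h2]; ring
    simp only [eval_comp, eval_var, env, eval_zero, eval_one, ← h1, h3, ExpChal.scale, game,
      ctCorrelated]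
    fin_cases j <;> simp [ctTriple] <;> ring

theorem lw2_size (yw : ZMod p) : (lw2Red yw : Red l p).SizeLe (200 * (l + 1)) := by
  have hP : ∀ j, (lw2P j : GrpExp l p).size ≤ 50 ∧ (lw2P j : GrpExp l p).length ≤ 6 := by
    intro j
    fin_cases j <;> simp [lw2P]
  have hQ : ∀ j, (lw2Q j : GrpExp l p).size ≤ 50 ∧ (lw2Q j : GrpExp l p).length ≤ 6 := by
    intro j
    fin_cases j <;> simp [lw2Q]
  have hU : ∀ j, (lw2U j : GrpExp l p).size ≤ 50 ∧ (lw2U j : GrpExp l p).length ≤ 6 := by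
    intro j
    fin_cases j <;> simp [lw2U]
  have hV : ∀ j, (lw2V j : GrpExp l p).size ≤ 50 ∧ (lw2V j : GrpExp l p).length ≤ 6 := by
    intro j
    fin_cases j <;> simp [lw2V]
  have hA := fun j => size_auxComp_le (p := p) (l := l) j
  have hI := fun j => size_identComp_le (p := p) (l := l) (one := 0) rfl j
  have hS := fun b j => size_semiKey_le (p := p) (l := l) b j
  constructor
  · omega
  · exact fun j => (hP j).1.trans (by omega)
  · exact fun j => (size_combination_le (s := 1) le_rfl le_rfl (hQ j).2 (hP j).2 (hQ j).1
      (hP j).1).trans (by omega)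
  · exact fun i j => (size_combination_le (s := 1) le_rfl le_rfl (hQ j).2 (hP j).2 (hQ j).1
      (hP j).1).trans (by omega)
  · intro j
    fin_cases j <;> simp [lw2Red] <;> omega
  · simp [lw2Red]; omega
  · intro b i j
    have h1 := hA i
    have h2 := hI i
    have h3 := hS b i
    fin_cases j <;> simp [lw2Red, lw2Factor] <;> omega
  · simp [lw2Red]; omega
  · exact fun j => (hU j).1.trans (by omega)
  · exact fun j => (size_combination_le (hI none) (hA none) (hV j).2 (hU j).2 (hV j).1
      (hU j).1).trans (by omega)
  · simp [lw2Red]; omega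

end LW2

/-! ## The reduction to SXDH -/

section SXDH

open ScalExp GrpExp BaseVar

variable {l p : ℕ}

/-- A multiple of the generator. -/
abbrev clear (e : ScalExp l p) : GrpExp l p := [(inp 0, e)]

def ctTripleExp (t s : ScalExp l p) : Fin 3 → ScalExp l p :=
  ![t, sVar .nu * t + s, -(sVar .phi1 * t + sVar .phi2 * (sVar .nu * t + s))]

/-- `δ` for the first part of a key, and `ρ δ` for the second one. -/
def sxdhPart (b : Bool) : GrpExp l p :=
  if b then [(inp 2, sVar .delta), (inp 0, sVar .delta * sVar .rho)] else clear (sVar .delta)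

/-- With ρ = b + ρ' and a₀ = a + a₀', the identity component δρa₀ of the second half contains ab, in
whose place the challenge is put. The other components are linear in the known elements. -/
def sxdhSpecial (b : Bool) : CompIdx l → GrpExp l p
  | none => if b then [(inp 3, sVar .delta), (inp 2, sVar .delta * sVar .a0),
      (inp 1, sVar .delta * sVar .rho), (inp 0, sVar .delta * (sVar .rho * sVar .a0))]
      else [(inp 1, sVar .delta), (inp 0, sVar .delta * sVar .a0)]
  | some none => sxdhPart b
  | some (some i) => smul (sVar (.au i)) (sxdhPart b)

def sxdhSemi (b : Bool) (j : CompIdx l) : GrpExp l p :=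
  (inp 0, var .lt * ScalExp.semiKey b j) :: smul (var .eq) (sxdhSpecial b j)

/-- The simulation for SXDH. -/
def sxdhRed (yw : ZMod p) : Red l p where
  g j := clear (ctTripleExp 1 0 j)
  h j := clear (sVar .yh * ctTripleExp 1 0 j)
  u i j := clear (sVar (.yu i) * ctTripleExp 1 0 j)
  W := ![clear (const yw * sVar .phi1), clear (const yw * sVar .phi2), clear (const yw)]
  Ω := [(pair 0 0, sVar .alpha)]
  key b j := ![
    (inp 0, identComp 1 j * kVar (.r b) + master b j + sVar .phi1 * kVar (.c b j)) ::
      smul (-sVar .nu) (sxdhSemi b j),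
    (inp 0, sVar .phi2 * kVar (.c b j)) :: sxdhSemi b j,
    clear (kVar (.c b j))]
  C := [(pair 0 0, sVar .alpha * sVar .t)]
  C₁ j := clear (ctTripleExp (sVar .t) (sVar .s) j)
  C₂ j := clear (ctTripleExp (sVar .t * identComp 1 none) (sVar .s * sVar .z) j)
  bad := [(.right, inp 1)]
  test := (.right, inp 3)

variable [Fact p.Prime]

/-- Not injective, since the values at `eta` are determined by the others. That they become uniform
for a random challenge is shown separately, and only for `delta ≠ 0`. -/
def sxdhSubst (a b T : ZMod p) (ω : SetupVar l → ZMod p) : SetupVar l → ZMod p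
  | .rho => b + ω .rho
  | .a0 => a + ω .a0
  | .eta b' => if b' then ω .delta * (T + b * ω .a0 + ω .rho * a + ω .rho * ω .a0) else
      ω .delta * (a + ω .a0)
  | v => ω v

theorem eval_ctTripleExp (t s : ScalExp l p) (j : Fin 3) (ω : SetupVar l → ZMod p)
    (y : KeyVar l → ZMod p) (I : List (ZMod p)) (lt eq : ZMod p) :
    (ctTripleExp t s j).eval (env ω y I lt eq) =
      ctTriple ω (t.eval (env ω y I lt eq)) (s.eval (env ω y I lt eq)) j := by
  fin_cases j <;> simp [ctTripleExp, ctTriple, env]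

theorem sxdh_equiv (yw a b T : ZMod p) (k q : ℕ) (ω : SetupVar l → ZMod p) :
    ((sxdhRed yw).expChal (baseExp [1] [1, a, b, T] []) k ω).Equiv q
      (game yw (hybrid k randomPart) ctSemi (sxdhSubst a b T ω)) := by
  set ε := baseExp [1] [1, a, b, T] [] with hε
  have hS : ∀ I d (j : CompIdx l) (x : ExpVar l → ZMod p), (∀ v, x (.setup v) = ω v) →
      (sxdhSpecial d j).expo (ε .right) x = randomPart (sxdhSubst a b T ω) I d j := by
    intro I d j x hx
    match d, j with
    | false, none =>
      simp [sxdhSpecial, randomPart, semi, sxdhSubst, hε, baseExp, hx]; ring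
    | true, none =>
      simp [sxdhSpecial, randomPart, semi, sxdhSubst, hε, baseExp, hx]; ring
    | false, some none =>
      simp [sxdhSpecial, sxdhPart, randomPart, semi, sxdhSubst, hε, baseExp, hx, partVal]
    | true, some none =>
      simp [sxdhSpecial, sxdhPart, randomPart, semi, sxdhSubst, hε, baseExp, hx, partVal]; ring
    | false, some (some i) =>
      simp [sxdhSpecial, sxdhPart, randomPart, semi, sxdhSubst, hε, baseExp, hx, partVal]; ring
    | true, some (some i) =>
      simp [sxdhSpecial, sxdhPart, randomPart, semi, sxdhSubst, hε, baseExp, hx, partVal]; ring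
  constructor
  · funext j
    fin_cases j <;> simp [Red.expChal, sxdhRed, game, ctTripleExp, env, sxdhSubst, hε, baseExp,
      mul_comm, add_comm]
  · funext j
    fin_cases j <;> simp [Red.expChal, sxdhRed, game, ctTripleExp, env, sxdhSubst, hε, baseExp,
      mul_comm, add_comm]
  · funext i j
    fin_cases j <;> simp [Red.expChal, sxdhRed, game, ctTripleExp, env, sxdhSubst, hε, baseExp,
      mul_comm, add_comm]
  · funext j
    fin_cases j <;> simp [Red.expChal, sxdhRed, game, env, sxdhSubst, hε, baseExp]
  · simp [Red.expChal, sxdhRed, game, env, sxdhSubst, hε, baseExp]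
  · intro n I _
    refine ⟨id, Function.injective_id, fun y d j _ i => ?_⟩
    have h1 := hS I d j (env ω y I (if n < k then 1 else 0) (if n = k then 1 else 0)) fun v => rfl
    have h2 : (sxdhSemi d j).expo (ε .right)
        (env ω y I (if n < k then 1 else 0) (if n = k then 1 else 0)) =
        hybrid k randomPart (sxdhSubst a b T ω) n I y d j := by
      rw [hybrid_apply, ← h1, sxdhSemi, expo_cons, expo_smul, eval_mul, eval_semi]
      exact congrArg (· + _) (one_mul _)
    fin_cases i <;> simp [Red.expChal, sxdhRed, game, keyTriple, keyPayload, h2, env] <;>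
      simp [sxdhSubst, hε, baseExp] <;> ring
  · intro I
    simp [Red.expChal, sxdhRed, game, ctSemi, env, sxdhSubst, hε, baseExp]
  · intro I
    funext j
    simp only [Red.expChal, sxdhRed, expo_cons, expo_nil, eval_ctTripleExp]
    fin_cases j <;> simp [game, ctSemi, ctTriple, env, sxdhSubst, hε, baseExp]
  · intro I
    funext j
    simp only [Red.expChal, sxdhRed, expo_cons, expo_nil, eval_ctTripleExp]
    fin_cases j <;> simp [game, ctSemi, ctTriple, env, sxdhSubst, hε, baseExp, identExp, compVal]

theorem size_ctTripleExp_le (t s : ScalExp l p) (j : Fin 3) :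
    (ctTripleExp t s j).size ≤ 2 * t.size + s.size + 20 := by
  fin_cases j <;> simp [ctTripleExp] <;> omega

theorem sxdh_size (yw : ZMod p) : (sxdhRed yw : Red l p).SizeLe (200 * (l + 1)) := by
  have hI := fun j => size_identComp_le (p := p) (l := l) (one := 1) rfl j
  have hS := fun b j => size_semiKey_le (p := p) (l := l) b j
  have hT := fun t s j => size_ctTripleExp_le (p := p) (l := l) t s j
  have hP : ∀ b (j : CompIdx l), (sxdhSpecial b j : GrpExp l p).size ≤ 60 ∧
      (sxdhSpecial b j : GrpExp l p).length ≤ 4 := by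
    intro b j
    match b, j with
    | false, none => simp [sxdhSpecial]
    | true, none => simp [sxdhSpecial]
    | false, some none => simp [sxdhSpecial, sxdhPart]
    | true, some none => simp [sxdhSpecial, sxdhPart]
    | false, some (some i) => simp [sxdhSpecial, sxdhPart, smul]
    | true, some (some i) => simp [sxdhSpecial, sxdhPart, smul]
  have hL : ∀ (e : ScalExp l p) (G : GrpExp l p), (smul e G).length = G.length := fun e G => by
    simp [smul]
  have h10 := fun j => hT 1 0 j
  simp only [size_one, size_zero] at h10
  constructor
  · omega
  · intro j
    have := h10 j
    simp [sxdhRed]; omega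
  · intro j
    have := h10 j
    simp [sxdhRed]; omega
  · intro i j
    have := h10 j
    simp [sxdhRed]; omega
  · intro j
    fin_cases j <;> simp [sxdhRed] <;> omega
  · simp [sxdhRed]; omega
  · intro b i j
    have h1 := hI i
    have h2 := hS b i
    have h3 := hP b i
    fin_cases j <;> simp [sxdhRed, sxdhSemi, hL] <;> omega
  · simp [sxdhRed]; omega
  · intro j
    have := hT (sVar .t) (sVar .s) j
    simp at this
    simp [sxdhRed]; omega
  · intro j
    have := hT (sVar .t * identComp 1 none) (sVar .s * sVar .z) j
    have h1 := hI none
    simp at this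
    simp [sxdhRed]; omega
  · simp [sxdhRed]; omega

end SXDH

/-! ## The reduction to DBDH -/

section DBDH

open ScalExp GrpExp BaseVar

variable {l p : ℕ}

/-- The triple of the generator for `ν = a + ν'`. -/
def dbdhGen : Fin 3 → GrpExp l p :=
  ![clear 1, [(inp 1, 1), (inp 0, sVar .nu)],
    [(inp 0, -(sVar .phi1 + sVar .phi2 * sVar .nu)), (inp 1, -sVar .phi2)]]

/-- The triple of a ciphertext with payload `c + t` times `e`. -/
def dbdhTriple (e s : ScalExp l p) : Fin 3 → GrpExp l p :=
  ![[(inp 3, e), (inp 0, e * sVar .t)], clear s,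
    [(inp 3, -(sVar .phi1 * e)), (inp 0, -(sVar .phi1 * (e * sVar .t) + sVar .phi2 * s))]]

def dbdhSemi (b : Bool) (j : CompIdx l) : GrpExp l p :=
  [(inp 2, if b = false ∧ j = none then 1 else 0), (inp 0, ScalExp.semiKey b j)]

/-- The simulation for DBDH. -/
def dbdhRed (yw : ZMod p) : Red l p where
  g := dbdhGen
  h j := smul (sVar .yh) (dbdhGen j)
  u i j := smul (sVar (.yu i)) (dbdhGen j)
  W := ![clear (const yw * sVar .phi1), clear (const yw * sVar .phi2), clear (const yw)]
  Ω := [(pair 1 2, 1), (pair 0 0, sVar .alpha)]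
  key b j := ![
    (inp 0, identComp 1 j * kVar (.r b) + master b j + sVar .phi1 * kVar (.c b j)) ::
      (inp 1, -ScalExp.semiKey b j) :: smul (-sVar .nu) (dbdhSemi b j),
    (inp 0, sVar .phi2 * kVar (.c b j)) :: dbdhSemi b j,
    clear (kVar (.c b j))]
  C := [(inp 0, 1), (pair 1 2, sVar .t), (pair 3 0, sVar .alpha),
    (pair 0 0, sVar .alpha * sVar .t)]
  C₁ := dbdhTriple 1 (sVar .s)
  C₂ := dbdhTriple (identComp 1 none) (sVar .z)
  bad := [(.left, inp 1), (.left, inp 2), (.left, inp 3)]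
  test := (.target, inp 0)

variable [Fact p.Prime]

/-- The product αt contains abc. The value of `s` is shifted so that the middle entry νt + s of the
first triple is just the sampled `s`, and no ac is needed in 𝔾. -/
def dbdhSubst (a b c : ZMod p) (ω : SetupVar l → ZMod p) : SetupVar l → ZMod p
  | .nu => a + ω .nu
  | .alpha => a * b + ω .alpha
  | .t => c + ω .t
  | .s => ω .s - (a + ω .nu) * (c + ω .t)
  | v => ω v

theorem dbdhSubst_injective (a b c : ZMod p) :
    Function.Injective (dbdhSubst (l := l) a b c) := by
  intro ω ω' h
  have h0 := fun v => congrFun h v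
  have h1 : ω .nu = ω' .nu := add_left_cancel (h0 .nu)
  have h2 : ω .t = ω' .t := add_left_cancel (h0 .t)
  funext v
  have h3 := h0 v
  cases v <;> first | exact h1 | exact h2 | simpa [dbdhSubst, h1, h2] using h3

/-- The keys contain α = ab + α', but ab is not available in 𝔾̂. This is why all `q` keys must
already be semi-functional: their random parts, multiplied by -ν, absorb it. The excess of the
challenge over abc is the mask of the message. -/
theorem dbdh_equiv (yw a b c T : ZMod p) (q : ℕ) (ω : SetupVar l → ZMod p) :
    ((dbdhRed yw).expChal (baseExp [1, a, b, c] [1, a, b, c] [T]) q ω).Equiv q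
      (game yw (hybrid q 0) ctHidden
        (Function.update (dbdhSubst a b c ω) .xi (T - a * b * c))) := by
  set ε := baseExp [1, a, b, c] [1, a, b, c] [T] with hε
  set ω' := Function.update (dbdhSubst a b c ω) .xi (T - a * b * c) with hω'
  have hG : ∀ I j, (dbdhGen j).expo (ε .left) (env ω 0 I 0 0) =
      (![1, ω' .nu, -(ω' .phi1 + ω' .nu * ω' .phi2)] : Fin 3 → ZMod p) j := by
    intro I j
    fin_cases j <;> simp [dbdhGen, hω', dbdhSubst, env, hε, baseExp] <;> ring
  have hF : ∀ I, identExp ω' I = identExp ω I := fun I => by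
    simp [identExp, hω', dbdhSubst]
  constructor
  · funext j
    exact hG [] j
  · funext j
    simp only [Red.expChal, dbdhRed, expo_smul, hG]
    fin_cases j <;> simp [game, env, hω', dbdhSubst]
  · funext i j
    simp only [Red.expChal, dbdhRed, expo_smul, hG]
    fin_cases j <;> simp [game, env, hω', dbdhSubst]
  · funext j
    fin_cases j <;> simp [Red.expChal, dbdhRed, game, env, hω', dbdhSubst, hε, baseExp]
  · simp [Red.expChal, dbdhRed, game, env, hω', dbdhSubst, hε, baseExp]
  · intro n I hn
    set f : KeyVar l → (Bool → ZMod p) → ZMod p := fun v _ => match v with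
      | .eta false => b
      | _ => 0 with hf
    -- Adding b to the semi-functional part of the one component that carries α contributes -(a +
    -- ν')b, whose first term cancels ab.
    refine ⟨keySubst 1 0 f, keySubst_injective one_ne_zero _ _, fun y d j _ i => ?_⟩
    have h1 : semiKey (keySubst 1 0 f y) d j =
        semiKey y d j + if d = false ∧ j = none then b else 0 := by
      match d, j with
      | false, none => simp [semiKey, semi, hf]
      | true, none => simp [semiKey, semi, hf]
      | false, some none => simp [semiKey, semi, hf]
      | true, some none => simp [semiKey, semi, hf]
      | false, some (some i) => simp [semiKey, semi, hf]
      | true, some (some i) => simp [semiKey, semi, hf]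
    have h2 : AHIBE.semi (fun b => y (.eta b)) (y .delta) (y .rho) (fun i => y (.a i)) d j =
        semiKey y d j := rfl
    by_cases h3 : d = false ∧ j = none
    · rw [if_pos h3] at h1
      fin_cases i <;> simp [Red.expChal, dbdhRed, dbdhSemi, game, keyTriple, keyPayload, hybrid, hn,
        h1, h2, if_pos h3, env] <;> simp [hω', dbdhSubst, hε, baseExp, hf] <;> ring
    · rw [if_neg h3] at h1
      fin_cases i <;> simp [Red.expChal, dbdhRed, dbdhSemi, game, keyTriple, keyPayload, hybrid, hn,
        h1, h2, if_neg h3, env] <;> simp [hω', dbdhSubst, hε, baseExp, hf] <;> ring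
  · intro I
    simp [Red.expChal, dbdhRed, game, ctHidden, env, hω', dbdhSubst, hε, baseExp]
    ring
  · intro I
    funext j
    fin_cases j <;> simp [Red.expChal, dbdhRed, dbdhTriple, game, ctHidden, ctTriple, env, hω',
      dbdhSubst, hε, baseExp] <;> ring
  · intro I
    funext j
    have h1 : compVal (ω .yh) 1 (fun i => ω (.yu i)) I none = identExp ω I := rfl
    fin_cases j <;> simp [Red.expChal, dbdhRed, dbdhTriple, game, ctHidden, ctTriple, env, hF, h1]
      <;> simp [hω', dbdhSubst, hε, baseExp] <;> ring

theorem dbdh_size (yw : ZMod p) : (dbdhRed yw : Red l p).SizeLe (200 * (l + 1)) := by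
  have hI := fun j => size_identComp_le (p := p) (l := l) (one := 1) rfl j
  have hS := fun b j => size_semiKey_le (p := p) (l := l) b j
  have hG : ∀ j, (dbdhGen j : GrpExp l p).size ≤ 50 ∧ (dbdhGen j : GrpExp l p).length ≤ 6 := by
    intro j
    fin_cases j <;> simp [dbdhGen]
  have hT : ∀ (e s : ScalExp l p) j, (dbdhTriple e s j).size ≤ 2 * e.size + s.size + 30 := by
    intro e s j
    fin_cases j <;> simp [dbdhTriple] <;> omega
  have hO : ∀ P : Prop, [Decidable P] → (if P then 1 else 0 : ScalExp l p).size = 1 := by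
    intro P _
    split_ifs <;> rfl
  have hK : ∀ b (j : CompIdx l), (dbdhSemi b j : GrpExp l p).size ≤ 30 ∧
      (dbdhSemi b j : GrpExp l p).length ≤ 4 := by
    intro b j
    have := hS b j
    simp [dbdhSemi, hO]; omega
  constructor
  · omega
  · exact fun j => (hG j).1.trans (by omega)
  · intro j
    have := hG j
    simp [dbdhRed]; omega
  · intro i j
    have := hG j
    simp [dbdhRed]; omega
  · intro j
    fin_cases j <;> simp [dbdhRed] <;> omega
  · simp [dbdhRed]; omega
  · intro b i j
    have h1 := hI i
    have h2 := hS b i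
    have h3 := hK b i
    fin_cases j <;> simp [dbdhRed] <;> omega
  · simp [dbdhRed]; omega
  · intro j
    have := hT 1 (sVar .s) j
    simp at this
    simp [dbdhRed]; omega
  · intro j
    have := hT (identComp 1 none) (sVar .z) j
    have h1 := hI none
    simp at this
    simp [dbdhRed]; omega
  · simp [dbdhRed]; omega

end DBDH

/-! ## The reduction to the asymmetric 3-party Diffie-Hellman assumption -/

section A3DH

open ScalExp GrpExp BaseVar

variable {l p : ℕ}

/-- The triple of `g ^ (a b)`. -/
def a3dhGen : Fin 3 → GrpExp l p :=
  ![[(inp 4, 1)], [(inp 5, 1), (inp 4, sVar .nu)],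
    [(inp 4, -(sVar .phi1 + sVar .phi2 * sVar .nu)), (inp 5, -sVar .phi2)]]

def a3dhSemi (b : Bool) (j : CompIdx l) : GrpExp l p :=
  [(inp 2, if j = none then kVar (.r b) else 0), (inp 0, ScalExp.semiKey b j)]

/-- The simulation for the asymmetric 3-party Diffie-Hellman assumption. -/
def a3dhRed (yw : ZMod p) : Red l p where
  g := dbdhGen
  h j := smul (sVar .yh) (dbdhGen j) ++ smul 1 (a3dhGen j)
  u i j := smul (sVar (.yu i)) (dbdhGen j)
  W := ![clear (const yw * sVar .phi1), clear (const yw * sVar .phi2), clear (const yw)]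
  Ω := [(pair 0 0, sVar .alpha)]
  key b j := ![
    (inp 0, identComp 1 j * kVar (.r b) + master b j + sVar .phi1 * kVar (.c b j)) ::
      (inp 1, -ScalExp.semiKey b j) :: smul (-sVar .nu) (a3dhSemi b j),
    (inp 0, sVar .phi2 * kVar (.c b j)) :: a3dhSemi b j,
    clear (kVar (.c b j))]
  C := [(pair 3 0, sVar .alpha), (pair 0 0, sVar .alpha * sVar .t + sVar .xi)]
  C₁ := dbdhTriple 1 (sVar .s)
  C₂ := ![[(inp 6, 1), (inp 4, sVar .t), (inp 3, identComp 1 none),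
      (inp 0, identComp 1 none * sVar .t)], clear (sVar .z),
    [(inp 6, -sVar .phi1), (inp 4, -(sVar .phi1 * sVar .t)),
      (inp 3, -(sVar .phi1 * identComp 1 none)),
      (inp 0, -(sVar .phi1 * (identComp 1 none * sVar .t) + sVar .phi2 * sVar .z))]]
  bad := []
  test := (.left, inp 0)

variable [Fact p.Prime]

/-- Now ab is put into the exponent of h. The payload of the second ciphertext triple contains tab,
hence abc, where the challenge enters. The shift of `s` is the same as for DBDH. -/
def a3dhSubst (a b c : ZMod p) (ω : SetupVar l → ZMod p) : SetupVar l → ZMod p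
  | .nu => a + ω .nu
  | .yh => a * b + ω .yh
  | .t => c + ω .t
  | .s => ω .s - (a + ω .nu) * (c + ω .t)
  | v => ω v

theorem a3dhSubst_injective (a b c : ZMod p) :
    Function.Injective (a3dhSubst (l := l) a b c) := by
  intro ω ω' h
  have h0 := fun v => congrFun h v
  have h1 : ω .nu = ω' .nu := add_left_cancel (h0 .nu)
  have h2 : ω .t = ω' .t := add_left_cancel (h0 .t)
  funext v
  have h3 := h0 v
  cases v <;> first | exact h1 | exact h2 | simpa [a3dhSubst, h1, h2] using h3

theorem a3dh_equiv (yw a b c T : ZMod p) (q : ℕ) (ω : SetupVar l → ZMod p) :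
    ((a3dhRed yw).expChal (baseExp [1, a, b, c, a * b, a ^ 2 * b, T] [1, a, b] []) q ω).Equiv q
      (game yw (hybrid q 0) ctRandom
        (Function.update (a3dhSubst a b c ω) .zeta (T - a * b * c))) := by
  set ε := baseExp [1, a, b, c, a * b, a ^ 2 * b, T] [1, a, b] [] with hε
  set ω' := Function.update (a3dhSubst a b c ω) .zeta (T - a * b * c) with hω'
  set f : Fin 3 → ZMod p := ![1, ω' .nu, -(ω' .phi1 + ω' .nu * ω' .phi2)] with hf
  have hG : ∀ I j, (dbdhGen j).expo (ε .left) (env ω 0 I 0 0) = f j := by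
    intro I j
    fin_cases j <;> simp [dbdhGen, hω', a3dhSubst, env, hε, baseExp, hf] <;> ring
  have hH : ∀ I j, (a3dhGen j).expo (ε .left) (env ω 0 I 0 0) = a * b * f j := by
    intro I j
    fin_cases j <;> simp [a3dhGen, hω', a3dhSubst, env, hε, baseExp, hf] <;> ring
  have hY : ∀ I j, compVal (ω' .yh) 1 (fun i => ω' (.yu i)) I j =
      compVal (ω .yh) 1 (fun i => ω (.yu i)) I j + if j = none then a * b else 0 := by
    intro I j
    match j with
    | none => simp [compVal, idSum, hω', a3dhSubst]; ring
    | some none => simp [compVal]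
    | some (some i) => simp [compVal, hω', a3dhSubst]
  have hF : ∀ I, identExp ω' I = identExp ω I + a * b := fun I => hY I none
  constructor
  · funext j
    exact hG [] j
  · funext j
    simp only [Red.expChal, a3dhRed, expo_append, expo_smul, hG, hH]
    fin_cases j <;> simp [game, env, hω', a3dhSubst, hf] <;> ring
  · funext i j
    simp only [Red.expChal, a3dhRed, expo_smul, hG]
    fin_cases j <;> simp [game, env, hω', a3dhSubst, hf]
  · funext j
    fin_cases j <;> simp [Red.expChal, a3dhRed, game, env, hω', a3dhSubst, hε, baseExp]
  · simp [Red.expChal, a3dhRed, game, env, hω', a3dhSubst, hε, baseExp]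
  · intro n I hn
    set f' : KeyVar l → (Bool → ZMod p) → ZMod p := fun v r => match v with
      | .eta d => b * r d
      | _ => 0 with hf'
    -- The identity component of each half contains r ab; adding b r to its semi-functional part
    -- cancels this through the factor -ν with ν = a + ν'.
    refine ⟨keySubst 1 0 f', keySubst_injective one_ne_zero _ _, fun y d j _ i => ?_⟩
    have h1 : semiKey (keySubst 1 0 f' y) d j =
        semiKey y d j + if j = none then b * y (.r d) else 0 := by
      match d, j with
      | _, none => simp [semiKey, semi, hf']
      | true, some none => simp [semiKey, semi, hf']
      | false, some none => simp [semiKey, semi, hf']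
      | false, some (some i) => simp [semiKey, semi, hf']
      | true, some (some i) => simp [semiKey, semi, hf']
    have h2 : AHIBE.semi (fun b => y (.eta b)) (y .delta) (y .rho) (fun i => y (.a i)) d j =
        semiKey y d j := rfl
    have h4 := hY I j
    by_cases h3 : j = none
    · rw [if_pos h3] at h1 h4
      fin_cases i <;> simp [Red.expChal, a3dhRed, a3dhSemi, game, keyTriple, keyPayload, hybrid, hn,
        h1, h2, h4, if_pos h3, env] <;> simp [hω', a3dhSubst, hε, baseExp, hf'] <;> ring
    · rw [if_neg h3] at h1 h4
      fin_cases i <;> simp [Red.expChal, a3dhRed, a3dhSemi, game, keyTriple, keyPayload, hybrid, hn,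
        h1, h2, h4, if_neg h3, env] <;> simp [hω', a3dhSubst, hε, baseExp, hf'] <;> ring
  · intro I
    simp [Red.expChal, a3dhRed, game, ctRandom, env, hω', a3dhSubst, hε, baseExp]
    ring
  · intro I
    funext j
    fin_cases j <;> simp [Red.expChal, a3dhRed, dbdhTriple, game, ctRandom, ctTriple, env, hω',
      a3dhSubst, hε, baseExp] <;> ring
  · intro I
    funext j
    have h1 : compVal (ω .yh) 1 (fun i => ω (.yu i)) I none = identExp ω I := rfl
    fin_cases j <;> simp [Red.expChal, a3dhRed, game, ctRandom, ctTriple, env, hF, h1]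
      <;> simp [hω', a3dhSubst, hε, baseExp] <;> ring

theorem a3dh_size (yw : ZMod p) : (a3dhRed yw : Red l p).SizeLe (200 * (l + 1)) := by
  have hI := fun j => size_identComp_le (p := p) (l := l) (one := 1) rfl j
  have hS := fun b j => size_semiKey_le (p := p) (l := l) b j
  have hG : ∀ j, (dbdhGen j : GrpExp l p).size ≤ 50 ∧ (dbdhGen j : GrpExp l p).length ≤ 6 := by
    intro j
    fin_cases j <;> simp [dbdhGen]
  have hH : ∀ j, (a3dhGen j : GrpExp l p).size ≤ 50 ∧ (a3dhGen j : GrpExp l p).length ≤ 6 := by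
    intro j
    fin_cases j <;> simp [a3dhGen]
  have hO : ∀ (j : CompIdx l) (b : Bool),
      (if j = none then kVar (.r b) else 0 : ScalExp l p).size = 1 := by
    intro j b
    split_ifs <;> rfl
  have hK : ∀ b (j : CompIdx l), (a3dhSemi b j : GrpExp l p).size ≤ 30 ∧
      (a3dhSemi b j : GrpExp l p).length ≤ 4 := by
    intro b j
    have := hS b j
    simp [a3dhSemi, hO]; omega
  constructor
  · omega
  · exact fun j => (hG j).1.trans (by omega)
  · exact fun j => (size_combination_le (s := 1) le_rfl le_rfl (hG j).2 (hH j).2 (hG j).1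
      (hH j).1).trans (by omega)
  · intro i j
    have := hG j
    simp [a3dhRed]; omega
  · intro j
    fin_cases j <;> simp [a3dhRed] <;> omega
  · simp [a3dhRed]; omega
  · intro b i j
    have h1 := hI i
    have h2 := hS b i
    have h3 := hK b i
    fin_cases j <;> simp [a3dhRed] <;> omega
  · simp [a3dhRed]; omega
  · intro j
    fin_cases j <;> simp [a3dhRed, dbdhTriple] <;> omega
  · intro j
    have h1 := hI none
    fin_cases j <;> simp [a3dhRed] <;> omega
  · simp [a3dhRed]

end A3DH

/-! ## The advantages of the reductions -/

/-- The probability that the output of an algorithm agrees with `pol`, if it is `true` with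
probability `x`. -/
def polarize (pol : Bool) (x : ℝ) : ℝ := if pol then x else 1 - x

theorem expect_polarize {X : Type} [Fintype X] [Nonempty X] (pol : Bool) (f : X → ℝ) :
    𝔼 x, polarize pol (f x) = polarize pol (𝔼 x, f x) := by
  cases pol
  · simp [polarize, Finset.expect_sub_distrib]
  · rfl

/-- The hardwired sign does more than remove the absolute value: it makes the gap between two games
point in the same direction as the gain from degenerate instances, so that the two add up. -/
theorem exists_polarize_sub (x y : ℝ) : ∃ pol, polarize pol x - polarize pol y = |x - y| := by
  rcases le_total x y with h | h
  · exact ⟨false, by rw [abs_of_nonpos (sub_nonpos.mpr h)]; simp [polarize]⟩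
  · exact ⟨true, by rw [abs_of_nonneg (sub_nonneg.mpr h)]; simp [polarize]⟩

/-- The form in which a random challenge is used: the instance permutes the setup coins, and its
challenge replaces one coordinate by an injective function of a uniform exponent. -/
theorem expect_update_comp {V R : Type} [Fintype V] [DecidableEq V] [Fintype R] [Nonempty R]
    (v : V) (f : (V → R) → ℝ) {σ : R → (V → R) → V → R} (hσ : ∀ d, Function.Injective (σ d))
    {φ : R → R} (hφ : Function.Injective φ) :
    𝔼 d, 𝔼 x, f (Function.update (σ d x) v (φ d)) = 𝔼 x, f x := by
  rw [← expect_update v f, ← expect_comp_injective hφ fun a => 𝔼 x, f (Function.update x v a)]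
  exact Finset.expect_congr rfl fun d _ =>
    expect_comp_injective (hσ d) fun x => f (Function.update x v (φ d))

/-! ### Random generators -/

section Generators

variable {B : BilinearGroup}

theorem represents_randGen (k : GrpIdx) :
    Represents (randGen B k) fun f => 𝔼 g : B.Generator k, f g.1 :=
  (Represents.unif _).bind fun _ => Represents.pure _

theorem expect_generator_pow {k : GrpIdx} {a : ZMod B.p} (ha : a ≠ 0) (f : B.El k → ℝ) :
    𝔼 g : B.Generator k, f (g.1 ^ a) = 𝔼 g : B.Generator k, f g.1 := by
  refine expect_comp_injective (α := B.Generator k)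
    (φ := fun g => ⟨g.1 ^ a, orderOf_el_pow g.2 ha⟩) (fun g g' h => ?_) fun g => f g.1
  have h1 : g.1 ^ a = g'.1 ^ a := congrArg Subtype.val h
  have h2 := congrArg (fun x : B.El k => x ^ a⁻¹) h1
  simp only [← el_pow_mul, mul_inv_cancel₀ ha, el_pow_one] at h2
  exact Subtype.ext h2

/-- The average over the generators of a function that is constant off an exceptional value. -/
theorem expect_generators_ite {e : ZMod B.p → ZMod B.p} (he : ∀ a, a ≠ 0 → e a ≠ 0) (pol : Bool)
    (K : ℝ) (f : B.El .left → B.El .right → ℝ) :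
    𝔼 g : B.Generator .left, 𝔼 ĝ : B.Generator .right, 𝔼 a : ZMod B.p,
      (if a = 0 then K else polarize pol (f (g.1 ^ e a) ĝ.1)) =
      (1 / B.p) * K + (1 - 1 / B.p) * polarize pol
        (𝔼 g : B.Generator .left, 𝔼 ĝ : B.Generator .right, f g.1 ĝ.1) := by
  rw [← expect_ite_eq_zero]
  rw [Finset.expect_congr rfl fun g _ => expect_swap (α := B.Generator .right) _, expect_swap]
  refine Finset.expect_congr rfl fun a _ => ?_
  split_ifs with h
  · simp only [Fintype.expect_const]
  · simp only [expect_polarize]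
    exact congrArg _ (expect_generator_pow (he a h) fun g => 𝔼 ĝ : B.Generator .right, f g ĝ.1)

variable {l : ℕ}

/-- The probability that the adversary wins a game, for random generators. -/
noncomputable def meanValue (yw : ZMod B.p) (κ : KeySpec l B.p) (ct : CtSpec l B.p) (q : ℕ)
    (A : List AdvInstr) : ℝ :=
  𝔼 g : B.Generator .left, 𝔼 ĝ : B.Generator .right,
    gameValue (B := B) g.1 ĝ.1 yw κ ct q A

end Generators

/-! ### Output probabilities of the reduction to LW1 -/

section Advantages

variable {B : BilinearGroup} {l : ℕ} {yw : ZMod B.p} {q k : ℕ} {A : List AdvInstr} {pol : Bool}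

theorem probZero_LW1 (P : List Instr) (β : Bool) : probZero (LW1 B β) P =
    𝔼 g : B.Generator .left, 𝔼 ĝ : B.Generator .right, 𝔼 a, 𝔼 b, 𝔼 c, 𝔼 d,
      runE P (fun σ => if σ.bit 0 = false then 1 else 0) (inputOf g.1 ĝ.1
        [1, a, b, a * b ^ 2, b ^ 2, b ^ 3, c, a * c, b * c, b ^ 2 * c, b ^ 3 * c,
          if β then d else a * b ^ 2 * c] [1, b] []) := by
  refine (probZero_eq (μ := LW1 B β) ((represents_randGen _).bind fun g => (represents_randGen _).bind fun ĝ =>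
    (Represents.unif _).bind fun a => (Represents.unif _).bind fun b =>
    (Represents.unif _).bind fun c => (Represents.unif _).bind fun d => Represents.pure _) P).trans ?_
  cases β <;> simp [inputOf, el_pow_one]

theorem probZero_LW2 (P : List Instr) (β : Bool) : probZero (LW2 B β) P =
    𝔼 g : B.Generator .left, 𝔼 ĝ : B.Generator .right, 𝔼 a, 𝔼 b, 𝔼 c, 𝔼 x, 𝔼 d,
      runE P (fun σ => if σ.bit 0 = false then 1 else 0) (inputOf g.1 ĝ.1
        [1, a, a ^ 2, b * x, a * b * x, a ^ 2 * x] [1, a, b, c, if β then d else b * c] []) := by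
  refine (probZero_eq (μ := LW2 B β) ((represents_randGen _).bind fun g => (represents_randGen _).bind fun ĝ =>
    (Represents.unif _).bind fun a => (Represents.unif _).bind fun b =>
    (Represents.unif _).bind fun c => (Represents.unif _).bind fun x =>
    (Represents.unif _).bind fun d => Represents.pure _) P).trans ?_
  cases β <;> simp [inputOf, el_pow_one]

theorem probZero_SXDH (P : List Instr) (β : Bool) : probZero (SXDH B β) P =
    𝔼 g : B.Generator .left, 𝔼 ĝ : B.Generator .right, 𝔼 a, 𝔼 b, 𝔼 c,
      runE P (fun σ => if σ.bit 0 = false then 1 else 0) (inputOf g.1 ĝ.1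
        [1] [1, a, b, if β then c else a * b] []) := by
  refine (probZero_eq (μ := SXDH B β) ((represents_randGen _).bind fun g => (represents_randGen _).bind fun ĝ =>
    (Represents.unif _).bind fun a => (Represents.unif _).bind fun b =>
    (Represents.unif _).bind fun c => Represents.pure _) P).trans ?_
  cases β <;> simp [inputOf, el_pow_one]

theorem probZero_DBDH (P : List Instr) (β : Bool) : probZero (DBDH B β) P =
    𝔼 g : B.Generator .left, 𝔼 ĝ : B.Generator .right, 𝔼 a, 𝔼 b, 𝔼 c, 𝔼 d,
      runE P (fun σ => if σ.bit 0 = false then 1 else 0) (inputOf g.1 ĝ.1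
        [1, a, b, c] [1, a, b, c] [if β then d else a * b * c]) := by
  refine (probZero_eq (μ := DBDH B β) ((represents_randGen _).bind fun g => (represents_randGen _).bind fun ĝ =>
    (Represents.unif _).bind fun a => (Represents.unif _).bind fun b =>
    (Represents.unif _).bind fun c => (Represents.unif _).bind fun d => Represents.pure _) P).trans ?_
  cases β <;> simp [inputOf, el_pow_one]

theorem probZero_A3DH (P : List Instr) (β : Bool) : probZero (A3DH B β) P =
    𝔼 g : B.Generator .left, 𝔼 ĝ : B.Generator .right, 𝔼 a, 𝔼 b, 𝔼 c, 𝔼 d,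
      runE P (fun σ => if σ.bit 0 = false then 1 else 0) (inputOf g.1 ĝ.1
        [1, a, b, c, a * b, a ^ 2 * b, if β then d else a * b * c] [1, a, b] []) := by
  refine (probZero_eq (μ := A3DH B β) ((represents_randGen _).bind fun g => (represents_randGen _).bind fun ĝ =>
    (Represents.unif _).bind fun a => (Represents.unif _).bind fun b =>
    (Represents.unif _).bind fun c => (Represents.unif _).bind fun d => Represents.pure _) P).trans ?_
  cases β <;> simp [inputOf, el_pow_one]

theorem expect_value_lw1 {g : B.G} {ĝ : B.Ghat} (a c : ZMod B.p) {b : ZMod B.p} (hb : b ≠ 0)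
    (β : Bool) :
    𝔼 d, 𝔼 ω, (((lw1Red (l := l) yw).expChal (baseExp [1, a, b, a * b ^ 2, b ^ 2, b ^ 3, c, a * c,
      b * c, b ^ 2 * c, b ^ 3 * c, if β then d else a * b ^ 2 * c] [1, b] []) k ω).toChal
        g ĝ).value q A =
      gameValue (l := l) (g ^ b ^ 2) ĝ yw (fun _ => 0) (if β then ctCorrelated else ctNormal) q
        A := by
  simp only [(lw1_equiv yw a b c _ hb k q _).value, ExpChal.toChal_scale]
  cases β
  · have h : ∀ ω : SetupVar l → ZMod B.p, game yw (fun _ => 0) ctCorrelated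
        (Function.update (lw1Subst a b c ω) .s 0) =
        game yw (fun _ => 0) ctNormal (lw1Subst a b c ω) := by
      intro ω
      simp [game, ctCorrelated, ctNormal, identExp, keyTriple, keyPayload, ctTriple]
    simp only [Bool.false_eq_true, if_false, sub_self, zero_div, h, Fintype.expect_const]
    exact expect_comp_injective (lw1Subst_injective a c hb) fun ω =>
      ((game yw (fun _ => 0) ctNormal ω).toChal (g ^ b ^ 2) ĝ).value q A
  · exact expect_update_comp .s (fun ω => ((game yw (fun _ => 0) ctCorrelated ω).toChal
      (g ^ b ^ 2) ĝ).value q A) (fun _ => lw1Subst_injective a c hb) fun d d' h =>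
        sub_left_injective ((div_left_inj' (pow_ne_zero 2 hb)).mp h)

/-- For b = 0, which has probability 1/p, the simulation breaks down, but ab²c = 0: the test for a
trivial challenge always succeeds on a true instance and with probability 1/p on a random one. For b
≠ 0 the generator g^(b²) is again uniform among generators. -/
theorem probZero_lw1Red (hk : k ≤ q) (β : Bool) :
    probZero (LW1 B β) ((lw1Red (l := l) yw).prog B.encLen q k pol A) =
      (1 / B.p) * (if β then 1 / (B.p : ℝ) else 1) + (1 - 1 / B.p) * polarize pol
        (meanValue (l := l) yw (fun _ => 0) (if β then ctCorrelated else ctNormal) q A) := by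
  rw [probZero_LW1]
  refine Eq.trans ?_ (expect_generators_ite (e := fun b => b ^ 2) (fun b hb => pow_ne_zero 2 hb)
    pol _ fun g ĝ => gameValue (B := B) g ĝ yw (fun _ => 0) (if β then ctCorrelated else ctNormal)
    q A)
  refine Finset.expect_congr rfl fun g _ => Finset.expect_congr rfl fun ĝ _ => ?_
  rw [expect_swap]
  refine Finset.expect_congr rfl fun b _ => ?_
  have h := fun a c d => (lw1Red (l := l) yw).runE_prog_inputOf hk pol A g.2 ĝ.2
    (xs := [1, a, b, a * b ^ 2, b ^ 2, b ^ 3, c, a * c, b * c, b ^ 2 * c, b ^ 3 * c,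
      if β then d else a * b ^ 2 * c]) (ys := [1, b]) (zs := []) (by simp) (by simp) (by simp)
  have hbad : ∀ a c d, (∃ x ∈ (lw1Red (l := l) yw).bad, baseExp [1, a, b, a * b ^ 2, b ^ 2, b ^ 3,
      c, a * c, b * c, b ^ 2 * c, b ^ 3 * c, if β then d else a * b ^ 2 * c] [1, b] [] x.1 x.2 = 0)
      ↔ b = 0 := by
    intro a c d
    simp [lw1Red, baseExp]
  have htest : ∀ a c d, baseExp [1, a, b, a * b ^ 2, b ^ 2, b ^ 3,
      c, a * c, b * c, b ^ 2 * c, b ^ 3 * c, if β then d else a * b ^ 2 * c] [1, b] []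
      (lw1Red (l := l) yw).test.1 (lw1Red (l := l) yw).test.2 =
      if β then d else a * b ^ 2 * c := fun a c d => rfl
  simp only [h, hbad, htest]
  by_cases hb : b = 0
  · simp only [if_pos hb]
    cases β
    · simp [hb]
    · simp
  · simp only [if_neg hb]
    have h1 := fun a c => expect_value_lw1 (l := l) (yw := yw) (q := q) (k := k) (A := A)
      (g := g.1) (ĝ := ĝ.1) a c hb β
    change 𝔼 a, 𝔼 c, 𝔼 d, 𝔼 ω, polarize pol _ = _
    simp only [expect_polarize, h1, Fintype.expect_const]

end Advantages

/-! ### Output probabilities of the reductions to LW2 and SXDH -/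

section Advantages

variable {B : BilinearGroup} {l : ℕ} {yw : ZMod B.p} {q k : ℕ} {A : List AdvInstr} {pol : Bool}

theorem expect_update_update {V R : Type} [Fintype V] [DecidableEq V] [Fintype R] [Nonempty R]
    (v w : V) (f : (V → R) → ℝ) :
    𝔼 a, 𝔼 b, 𝔼 x, f (Function.update (Function.update x v a) w b) = 𝔼 x, f x := by
  rw [expect_swap, ← expect_update w f]
  exact Finset.expect_congr rfl fun b _ => expect_update v fun x => f (Function.update x w b)

theorem expect_value_lw2 {g : B.G} {ĝ : B.Ghat} {a : ZMod B.p} (ha : a ≠ 0) (b c : ZMod B.p)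
    (β : Bool) :
    𝔼 x, 𝔼 d, 𝔼 ω, (((lw2Red (l := l) yw).expChal (baseExp
      [1, a, a ^ 2, b * x, a * b * x, a ^ 2 * x] [1, a, b, c, if β then d else b * c] []) k
        ω).toChal g ĝ).value q A =
      gameValue (l := l) (g ^ a) ĝ yw (hybrid k (if β then correlatedPart else 0)) ctCorrelated q
        A := by
  simp only [(lw2_equiv yw b c _ _ ha k q _).value, ExpChal.toChal_scale]
  have hs : Function.Injective fun x => -(a * x) := fun x y h =>
    mul_right_injective₀ ha (neg_injective h)
  cases β
  · have h : ∀ x (ω : SetupVar l → ZMod B.p), game yw (hybrid k correlatedPart) ctCorrelated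
        (Function.update (Function.update (lw2Subst a b x ω) .s (-(a * x))) .delta 0) =
        game yw (hybrid k 0) ctCorrelated
          (Function.update (lw2Subst a b x ω) .s (-(a * x))) := by
      intro x ω
      have h0 : ∀ (ω : SetupVar l → ZMod B.p) I, correlatedPart
          (Function.update ω .delta 0) I = 0 := by
        intro ω I
        funext d j
        rw [correlatedPart_eq]
        cases d <;> simp [partVal]
      have h1 : ∀ ω : SetupVar l → ZMod B.p, hybrid k correlatedPart
          (Function.update ω .delta 0) = hybrid k 0 ω := by
        intro ω
        unfold hybrid
        simp only [h0]
        rfl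
      unfold game
      rw [h1]
      rfl
    simp only [Bool.false_eq_true, if_false, sub_self, h, Fintype.expect_const]
    exact expect_update_comp .s (fun ω => ((game yw (hybrid k 0) ctCorrelated ω).toChal
      (g ^ a) ĝ).value q A) (fun x => lw2Subst_injective ha b x) hs
  · simp only [if_true]
    set f : (SetupVar l → ZMod B.p) → ℝ := fun ω =>
      ((game yw (hybrid k correlatedPart) ctCorrelated ω).toChal (g ^ a) ĝ).value q A
    have h1 : ∀ x d, 𝔼 ω, f (Function.update (Function.update (lw2Subst a b x ω) .s (-(a * x)))
        .delta (d - b * c)) = 𝔼 ω, f (Function.update (Function.update ω .s (-(a * x)))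
        .delta (d - b * c)) := fun x d =>
      expect_comp_injective (lw2Subst_injective ha b x) fun ω =>
        f (Function.update (Function.update ω .s (-(a * x))) .delta (d - b * c))
    change 𝔼 x, 𝔼 d, 𝔼 ω, f _ = 𝔼 ω, f ω
    simp only [h1]
    rw [expect_comp_injective hs fun x => 𝔼 d, 𝔼 ω, f (Function.update (Function.update ω .s x)
        .delta (d - b * c)), ← expect_update_update .s .delta f]
    exact Finset.expect_congr rfl fun x _ => expect_comp_injective
      (sub_left_injective (b := b * c)) fun d =>
        𝔼 ω, f (Function.update (Function.update ω .s x) .delta d)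

/-- For a = 0 nothing is gained: the test element is the generator, which is never trivial, so both
cases contribute zero. The factor that is lost here is available in the final estimate. -/
theorem probZero_lw2Red (hk : k ≤ q) (β : Bool) :
    probZero (LW2 B β) ((lw2Red (l := l) yw).prog B.encLen q k pol A) =
      (1 - 1 / B.p) * polarize pol (meanValue (l := l) yw
        (hybrid k (if β then correlatedPart else 0)) ctCorrelated q A) := by
  rw [probZero_LW2]
  refine Eq.trans ?_ ((expect_generators_ite (e := id) (fun b hb => hb) pol 0 fun g ĝ =>
    gameValue (B := B) g ĝ yw (hybrid k (if β then correlatedPart else 0)) ctCorrelated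
      q A).trans (by rw [mul_zero, zero_add]; rfl))
  refine Finset.expect_congr rfl fun g _ => Finset.expect_congr rfl fun ĝ _ => ?_
  refine Finset.expect_congr rfl fun a _ => ?_
  have h := fun b c x d => (lw2Red (l := l) yw).runE_prog_inputOf hk pol A g.2 ĝ.2
    (xs := [1, a, a ^ 2, b * x, a * b * x, a ^ 2 * x])
    (ys := [1, a, b, c, if β then d else b * c]) (zs := []) (by simp) (by simp) (by simp)
  have hbad : ∀ b c x d, (∃ y ∈ (lw2Red (l := l) yw).bad, baseExp
      [1, a, a ^ 2, b * x, a * b * x, a ^ 2 * x] [1, a, b, c, if β then d else b * c] []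
      y.1 y.2 = 0) ↔ a = 0 := by
    intro b c x d
    simp [lw2Red, baseExp]
  have htest : ∀ b c x d, baseExp
      [1, a, a ^ 2, b * x, a * b * x, a ^ 2 * x] [1, a, b, c, if β then d else b * c] []
      (lw2Red (l := l) yw).test.1 (lw2Red (l := l) yw).test.2 = 1 := fun b c x d => rfl
  simp only [h, hbad, htest]
  by_cases ha : a = 0
  · simp [ha]
  · simp only [if_neg ha]
    have h1 := fun b c => expect_value_lw2 (l := l) (yw := yw) (q := q) (k := k) (A := A)
      (g := g.1) (ĝ := ĝ.1) ha b c β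
    change 𝔼 b, 𝔼 c, 𝔼 x, 𝔼 d, 𝔼 ω, polarize pol _ = _
    simp only [expect_polarize, h1, Fintype.expect_const]
    rfl

/-- The coins of the game with an instance of SXDH that differs by `θ` from a Diffie-Hellman
triple. -/
def sxdhCoins {p : ℕ} (θ : ZMod p) (ω : SetupVar l → ZMod p) : SetupVar l → ZMod p
  | .eta b => if b then ω .delta * (θ + ω .rho * ω .a0) else ω .delta * ω .a0
  | v => ω v

def sxdhShift {p : ℕ} (a b : ZMod p) (ω : SetupVar l → ZMod p) : SetupVar l → ZMod p
  | .rho => b + ω .rho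
  | .a0 => a + ω .a0
  | v => ω v

theorem sxdhShift_injective {p : ℕ} (a b : ZMod p) :
    Function.Injective (sxdhShift (l := l) a b) := by
  intro ω ω' h
  funext v
  have h0 := congrFun h v
  cases v <;> first | exact add_left_cancel h0 | exact h0

theorem sxdhSubst_eq {p : ℕ} [Fact p.Prime] (a b T : ZMod p) (ω : SetupVar l → ZMod p) :
    sxdhSubst a b T ω = sxdhCoins (T - a * b) (sxdhShift a b ω) := by
  funext v
  cases v
  case eta d =>
    cases d
    · rfl
    · change ω .delta * _ = ω .delta * (T - a * b + (b + ω .rho) * (a + ω .a0))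
      ring
  all_goals rfl

/-- The value of the game for an instance of SXDH. -/
noncomputable def sxdhValue (l : ℕ) (yw : ZMod B.p) (k q : ℕ) (A : List AdvInstr) (β : Bool)
    (g : B.G) (ĝ : B.Ghat) : ℝ :=
  𝔼 θ, 𝔼 ω : SetupVar l → ZMod B.p, ((game yw (hybrid k randomPart) ctSemi
    (sxdhCoins (if β then θ else 0) ω)).toChal g ĝ).value q A

/-- The simulation would work for a = 0 too. The test is made there only for its gain, which pays
for the error of `abs_sxdhValue_true_sub_le`. -/
theorem probZero_sxdhRed (hk : k ≤ q) (β : Bool) :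
    probZero (SXDH B β) ((sxdhRed (l := l) yw).prog B.encLen q k pol A) =
      (1 / B.p) * (if β then 1 / (B.p : ℝ) else 1) + (1 - 1 / B.p) * polarize pol
        (𝔼 g : B.Generator .left, 𝔼 ĝ : B.Generator .right,
          sxdhValue (B := B) l yw k q A β g.1 ĝ.1) := by
  rw [probZero_SXDH]
  refine Eq.trans ?_ (expect_generators_ite (e := fun _ => 1) (fun b hb => one_ne_zero) pol _
    fun g ĝ => sxdhValue (B := B) l yw k q A β g ĝ)
  refine Finset.expect_congr rfl fun g _ => Finset.expect_congr rfl fun ĝ _ => ?_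
  refine Finset.expect_congr rfl fun a _ => ?_
  have h := fun b c => (sxdhRed (l := l) yw).runE_prog_inputOf hk pol A g.2 ĝ.2
    (xs := [1]) (ys := [1, a, b, if β then c else a * b]) (zs := []) (by simp) (by simp) (by simp)
  have hbad : ∀ b c, (∃ y ∈ (sxdhRed (l := l) yw).bad, baseExp
      [1] [1, a, b, if β then c else a * b] [] y.1 y.2 = 0) ↔ a = 0 := by
    intro b c
    simp [sxdhRed, baseExp]
  have htest : ∀ b c, baseExp [1] [1, a, b, if β then c else a * b] []
      (sxdhRed (l := l) yw).test.1 (sxdhRed (l := l) yw).test.2 = if β then c else a * b :=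
    fun b c => rfl
  simp only [h, hbad, htest]
  by_cases ha : a = 0
  · simp only [if_pos ha]
    cases β
    · simp [ha]
    · simp
  · simp only [if_neg ha, el_pow_one]
    have h1 : ∀ b, 𝔼 c, 𝔼 ω, (((sxdhRed (l := l) yw).expChal
        (baseExp [1] [1, a, b, if β then c else a * b] []) k ω).toChal g.1 ĝ.1).value q A =
        sxdhValue (B := B) l yw k q A β g.1 ĝ.1 := by
      intro b
      have h2 := fun T => expect_comp_injective (sxdhShift_injective (l := l) a b) fun ω =>
        ((game yw (hybrid k randomPart) ctSemi (sxdhCoins (T - a * b) ω)).toChal g.1 ĝ.1).value q A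
      simp only [(sxdh_equiv yw a b _ k q _).value, sxdhSubst_eq, h2]
      cases β
      · simp [sxdhValue]
      · exact expect_comp_injective (sub_left_injective (b := a * b)) fun θ =>
          𝔼 ω, ((game yw (hybrid k randomPart) ctSemi (sxdhCoins θ ω)).toChal g.1 ĝ.1).value q A
    change 𝔼 b, 𝔼 c, 𝔼 ω, polarize pol _ = _
    simp only [expect_polarize, h1, Fintype.expect_const]

theorem sxdhValue_false (g : B.G) (ĝ : B.Ghat) :
    sxdhValue l yw k q A false g ĝ =
      gameValue (l := l) g ĝ yw (hybrid k nominalPart) ctSemi q A := by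
  unfold sxdhValue gameValue
  simp only [Bool.false_eq_true, if_false, Fintype.expect_const]
  refine Finset.expect_congr rfl fun ω _ => ?_
  have h : randomPart (sxdhCoins 0 ω) = nominalPart ω := by
    funext I b j
    match b, j with
    | false, none => simp [randomPart, nominalPart, semi, sxdhCoins, partVal]
    | true, none => simp [randomPart, nominalPart, semi, sxdhCoins, partVal]; ring
    | _, some none => rfl
    | _, some (some i) => rfl
  have h1 : hybrid k randomPart (sxdhCoins 0 ω) = hybrid k nominalPart ω := by
    unfold hybrid
    rw [h]
  unfold game
  rw [h1]
  rfl

/-- For `δ ≠ 0`, the exponents of the special key are uniform. -/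
def sxdhUntie {p : ℕ} (δ : ZMod p) (y : (SetupVar l → ZMod p) × ZMod p) :
    (SetupVar l → ZMod p) × ZMod p :=
  (fun v => match v with
    | .a0 => y.1 (.eta false)
    | .eta b => if b then δ * (y.2 + y.1 .rho * y.1 .a0) else δ * y.1 .a0
    | v => y.1 v, y.1 (.eta true))

theorem sxdhUntie_injective {p : ℕ} [Fact p.Prime] {δ : ZMod p} (hδ : δ ≠ 0) :
    Function.Injective (sxdhUntie (l := l) δ) := by
  intro y y' h
  have h0 := fun v => congrFun (congrArg Prod.fst h) v
  have e0 : y.1 (.eta true) = y'.1 (.eta true) := congrArg Prod.snd h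
  have e1 : y.1 (.eta false) = y'.1 (.eta false) := h0 .a0
  have e2 : y.1 .a0 = y'.1 .a0 := mul_left_cancel₀ hδ (h0 (.eta false))
  have e3 : y.1 .rho = y'.1 .rho := h0 .rho
  have e4 : y.2 + y.1 .rho * y.1 .a0 = y'.2 + y'.1 .rho * y'.1 .a0 :=
    mul_left_cancel₀ hδ (h0 (.eta true))
  rw [e2, e3] at e4
  refine Prod.ext (funext fun v => ?_) (add_right_cancel e4)
  have h5 := h0 v
  cases v
  case a0 => exact e2
  case eta b =>
    cases b
    exacts [e1, e0]
  all_goals exact h5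

/-- For `δ ≠ 0` the pair `δ a0`, `δ (θ + ρ a0)` is a bijective function of `a0` and `θ`. Since `f`
ignores `a0`, this coordinate can store the old value of `eta false`, which makes the replacement a
permutation of all coins. -/
theorem expect_sxdhCoins {p : ℕ} [Fact p.Prime] {δ : ZMod p} (hδ : δ ≠ 0)
    (f : (SetupVar l → ZMod p) → ℝ) (hf : ∀ x a, f (Function.update x .a0 a) = f x) :
    𝔼 ω, 𝔼 θ, f (sxdhCoins θ (Function.update ω .delta δ)) =
      𝔼 ω, f (Function.update ω .delta δ) := by
  have h : 𝔼 ω, f (Function.update ω .delta δ) =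
      𝔼 y : (SetupVar l → ZMod p) × ZMod p, f (Function.update y.1 .delta δ) := by
    rw [expect_prod_type]
    simp only [Fintype.expect_const]
  rw [h, ← expect_prod_type fun y : (SetupVar l → ZMod p) × ZMod p =>
    f (sxdhCoins y.2 (Function.update y.1 .delta δ)),
    ← expect_comp_injective (sxdhUntie_injective hδ) fun y => f (Function.update y.1 .delta δ)]
  refine Finset.expect_congr rfl fun y _ => ?_
  rw [← hf _ (y.1 (.eta false))]
  congr 1
  funext v
  cases v <;> simp [sxdhUntie, sxdhCoins]

/-- The games agree for each nonzero value of `delta`, and `delta = 0` has probability 1/p. -/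
theorem abs_sxdhValue_true_sub_le (g : B.G) (ĝ : B.Ghat) :
    |sxdhValue l yw k q A true g ĝ -
      gameValue (l := l) g ĝ yw (hybrid k randomPart) ctSemi q A| ≤ 1 / B.p := by
  obtain ⟨f, hf⟩ : ∃ f : (SetupVar l → ZMod B.p) → ℝ, ∀ ω, f ω =
    ((game yw (hybrid k randomPart) ctSemi ω).toChal g ĝ).value q A := ⟨_, fun _ => rfl⟩
  have hf0 : ∀ x a, f (Function.update x .a0 a) = f x := fun x a => by
    rw [hf, hf]
    rfl
  have h1 : sxdhValue l yw k q A true g ĝ = 𝔼 δ, 𝔼 ω, 𝔼 θ,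
      f (sxdhCoins θ (Function.update ω .delta δ)) := by
    rw [expect_update .delta fun ω => 𝔼 θ, f (sxdhCoins θ ω), expect_swap]
    simp only [sxdhValue, hf, if_true]
  have h2 : gameValue (l := l) g ĝ yw (hybrid k randomPart) ctSemi q A =
      𝔼 δ, 𝔼 ω, f (Function.update ω .delta δ) := by
    rw [expect_update .delta f]
    simp only [gameValue, hf]
  rw [h1, h2, ← Finset.expect_sub_distrib]
  refine abs_expect_le_of_subsingleton (fun δ hδ => ?_) ?_
  · rw [sub_eq_zero, expect_sxdhCoins hδ f hf0]
  · have hu : ∀ ω, f ω ∈ Set.Icc (0 : ℝ) 1 := fun ω => by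
      rw [hf]
      exact Challenger.value_mem_unit _ _ _
    have h3 := expect_mem_unit fun ω => expect_mem_unit fun θ =>
      hu (sxdhCoins θ (Function.update ω .delta 0))
    have h4 := expect_mem_unit fun ω => hu (Function.update ω .delta 0)
    rw [abs_le]
    constructor <;> linarith [h3.1, h3.2, h4.1, h4.2]

end Advantages

/-! ### Output probabilities of the reductions to DBDH and A3DH -/

section Advantages

variable {B : BilinearGroup} {l : ℕ} {yw : ZMod B.p} {q : ℕ} {A : List AdvInstr} {pol : Bool}

theorem expect_ite_three {p : ℕ} [Fact p.Prime] (c V : ℝ) :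
    𝔼 x : ZMod p, 𝔼 y : ZMod p, 𝔼 z : ZMod p, (if x = 0 ∨ y = 0 ∨ z = 0 then c else V) =
      (1 - (1 - 1 / (p : ℝ)) ^ 3) * c + (1 - 1 / (p : ℝ)) ^ 3 * V := by
  have h : ∀ x y z : ZMod p, (if x = 0 ∨ y = 0 ∨ z = 0 then c else V) =
      if x = 0 then c else if y = 0 then c else if z = 0 then c else V := by
    intro x y z
    split_ifs <;> tauto
  have h1 : ∀ (x : ZMod p) (f : ZMod p → ℝ),
      𝔼 y, (if x = 0 then c else f y) = if x = 0 then c else 𝔼 y, f y := by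
    intro x f
    split_ifs
    · exact Fintype.expect_const c
    · rfl
  simp only [h, h1, expect_ite_eq_zero]
  ring

theorem expect_value_dbdh {g : B.G} {ĝ : B.Ghat} (a b c : ZMod B.p) (β : Bool) :
    𝔼 d, 𝔼 ω, (((dbdhRed (l := l) yw).expChal (baseExp [1, a, b, c] [1, a, b, c]
      [if β then d else a * b * c]) q ω).toChal g ĝ).value q A =
      gameValue (l := l) g ĝ yw (hybrid q 0) (if β then ctHidden else ctUniform) q A := by
  simp only [(dbdh_equiv yw a b c _ q _).value]
  cases β
  · have h : ∀ ω : SetupVar l → ZMod B.p, game yw (hybrid q 0) ctHidden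
        (Function.update (dbdhSubst a b c ω) .xi 0) =
        game yw (hybrid q 0) ctUniform (dbdhSubst a b c ω) := by
      intro ω
      have h1 : hybrid q 0 (Function.update (dbdhSubst a b c ω) .xi 0) =
        hybrid q 0 (dbdhSubst a b c ω) := rfl
      simp [game, ctHidden, ctUniform, identExp, keyTriple, keyPayload, ctTriple, h1]
    simp only [Bool.false_eq_true, if_false, sub_self, h, Fintype.expect_const]
    exact expect_comp_injective (dbdhSubst_injective a b c) fun ω =>
      ((game yw (hybrid q 0) ctUniform ω).toChal g ĝ).value q A
  · simp only [if_true]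
    exact expect_update_comp .xi (fun ω => ((game yw (hybrid q 0) ctHidden ω).toChal
      g ĝ).value q A) (σ := fun _ => dbdhSubst a b c)
        (fun _ => dbdhSubst_injective a b c) (φ := fun d => d - a * b * c) sub_left_injective

/-- The test is made if any of a, b, c is 0, although the simulation does not need it. The three
exponents match the three degeneracies of the setup (trivial g, ĝ or ŵ), whose probability has the
same form. -/
theorem probZero_dbdhRed (β : Bool) :
    probZero (DBDH B β) ((dbdhRed (l := l) yw).prog B.encLen q q pol A) =
      (1 - (1 - 1 / (B.p : ℝ)) ^ 3) * (if β then 1 / (B.p : ℝ) else 1) +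
        (1 - 1 / (B.p : ℝ)) ^ 3 * polarize pol
        (meanValue (l := l) yw (hybrid q 0) (if β then ctHidden else ctUniform) q A) := by
  rw [probZero_DBDH]
  have key : ∀ (g : B.Generator .left) (ĝ : B.Generator .right), 𝔼 a, 𝔼 b, 𝔼 c, 𝔼 d,
      runE ((dbdhRed (l := l) yw).prog B.encLen q q pol A)
        (fun σ => if σ.bit 0 = false then 1 else 0) (inputOf g.1 ĝ.1
        [1, a, b, c] [1, a, b, c] [if β then d else a * b * c]) =
      (1 - (1 - 1 / (B.p : ℝ)) ^ 3) * (if β then 1 / (B.p : ℝ) else 1) +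
        (1 - 1 / (B.p : ℝ)) ^ 3 * polarize pol (gameValue (B := B) (l := l) g.1 ĝ.1 yw (hybrid q 0)
          (if β then ctHidden else ctUniform) q A) := by
    intro g ĝ
    rw [← expect_ite_three]
    refine Finset.expect_congr rfl fun a _ => Finset.expect_congr rfl fun b _ =>
      Finset.expect_congr rfl fun c _ => ?_
    have h := fun d => (dbdhRed (l := l) yw).runE_prog_inputOf le_rfl pol A g.2 ĝ.2 (q := q)
      (xs := [1, a, b, c]) (ys := [1, a, b, c]) (zs := [if β then d else a * b * c])
      (by simp) (by simp) (by simp)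
    have hbad : ∀ d, (∃ y ∈ (dbdhRed (l := l) yw).bad, baseExp [1, a, b, c] [1, a, b, c]
        [if β then d else a * b * c] y.1 y.2 = 0) ↔ a = 0 ∨ b = 0 ∨ c = 0 := by
      intro d
      simp [dbdhRed, baseExp]
    have htest : ∀ d, baseExp [1, a, b, c] [1, a, b, c] [if β then d else a * b * c]
        (dbdhRed (l := l) yw).test.1 (dbdhRed (l := l) yw).test.2 =
        if β then d else a * b * c := fun d => rfl
    simp only [h, hbad, htest]
    by_cases h0 : a = 0 ∨ b = 0 ∨ c = 0
    · simp only [if_pos h0]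
      cases β
      · have : a * b * c = 0 := by
          simp only [mul_eq_zero]
          tauto
        simp [this]
      · simp
    · simp only [if_neg h0]
      have h1 := expect_value_dbdh (l := l) (yw := yw) (q := q) (A := A)
        (g := g.1) (ĝ := ĝ.1) a b c β
      change 𝔼 d, 𝔼 ω, polarize pol _ = _
      simp only [expect_polarize, h1]
  simp only [key, Finset.expect_add_distrib, Fintype.expect_const, ← Finset.mul_expect,
    expect_polarize]
  rfl

theorem expect_value_a3dh {g : B.G} {ĝ : B.Ghat} (a b c : ZMod B.p) (β : Bool) :
    𝔼 d, 𝔼 ω, (((a3dhRed (l := l) yw).expChal (baseExp [1, a, b, c, a * b, a ^ 2 * b,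
      if β then d else a * b * c] [1, a, b] []) q ω).toChal g ĝ).value q A =
      gameValue (l := l) g ĝ yw (hybrid q 0) (if β then ctRandom else ctHidden) q A := by
  simp only [(a3dh_equiv yw a b c _ q _).value]
  cases β
  · have h : ∀ ω : SetupVar l → ZMod B.p, game yw (hybrid q 0) ctRandom
        (Function.update (a3dhSubst a b c ω) .zeta 0) =
        game yw (hybrid q 0) ctHidden (a3dhSubst a b c ω) := by
      intro ω
      have h1 : hybrid q 0 (Function.update (a3dhSubst a b c ω) .zeta 0) =
        hybrid q 0 (a3dhSubst a b c ω) := rfl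
      simp [game, ctHidden, ctRandom, identExp, keyTriple, keyPayload, ctTriple, h1]
    simp only [Bool.false_eq_true, if_false, sub_self, h, Fintype.expect_const]
    exact expect_comp_injective (a3dhSubst_injective a b c) fun ω =>
      ((game yw (hybrid q 0) ctHidden ω).toChal g ĝ).value q A
  · simp only [if_true]
    exact expect_update_comp .zeta (fun ω => ((game yw (hybrid q 0) ctRandom ω).toChal
      g ĝ).value q A) (σ := fun _ => a3dhSubst a b c)
        (fun _ => a3dhSubst_injective a b c) (φ := fun d => d - a * b * c) sub_left_injective

theorem probZero_a3dhRed (β : Bool) :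
    probZero (A3DH B β) ((a3dhRed (l := l) yw).prog B.encLen q q pol A) = polarize pol
        (meanValue (l := l) yw (hybrid q 0) (if β then ctRandom else ctHidden) q A) := by
  rw [probZero_A3DH]
  have key : ∀ (g : B.Generator .left) (ĝ : B.Generator .right), 𝔼 a, 𝔼 b, 𝔼 c, 𝔼 d,
      runE ((a3dhRed (l := l) yw).prog B.encLen q q pol A)
        (fun σ => if σ.bit 0 = false then 1 else 0) (inputOf g.1 ĝ.1
        [1, a, b, c, a * b, a ^ 2 * b, if β then d else a * b * c] [1, a, b] []) =
      polarize pol (gameValue (B := B) (l := l) g.1 ĝ.1 yw (hybrid q 0)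
          (if β then ctRandom else ctHidden) q A) := by
    intro g ĝ
    have h := fun a b c d : ZMod B.p => (a3dhRed (l := l) yw).runE_prog_inputOf le_rfl pol A g.2 ĝ.2 (q := q)
      (xs := [1, a, b, c, a * b, a ^ 2 * b, if β then d else a * b * c]) (ys := [1, a, b])
      (zs := []) (by simp) (by simp) (by simp)
    have hbad : ∀ a b c d : ZMod B.p, ¬ (∃ y ∈ (a3dhRed (l := l) yw).bad, baseExp [1, a, b, c, a * b,
        a ^ 2 * b, if β then d else a * b * c] [1, a, b] [] y.1 y.2 = 0) := by
      intro a b c d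
      simp [a3dhRed]
    simp only [h, if_neg (hbad _ _ _ _)]
    have h1 := fun a b c => expect_value_a3dh (l := l) (yw := yw) (q := q) (A := A)
      (g := g.1) (ĝ := ĝ.1) a b c β
    change 𝔼 a, 𝔼 b, 𝔼 c, 𝔼 d, 𝔼 ω, polarize pol _ = _
    simp only [expect_polarize, h1, Fintype.expect_const]
  simp only [key, expect_polarize]
  rfl

theorem meanValue_random (κ : ℕ → List (ZMod B.p) → (KeyVar l → ZMod B.p) → Bool →
    CompIdx l → ZMod B.p) : meanValue yw (fun _ => κ) ctRandom q A = 1 / 2 := by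
  have h := fun (g : B.Generator .left) (ĝ : B.Generator .right) =>
    gameValue_random (B := B) (yw := yw) (q := q) (A := A) g.2 ĝ.2 κ
  simp only [meanValue, h, Fintype.expect_const]

end Advantages

/-! ### Advantages of the reductions and the hybrid sum -/

section Hops

variable {B : BilinearGroup} {l : ℕ} {yw : ZMod B.p} {q k : ℕ} {A : List AdvInstr}

/-- The advantage of a program in distinguishing the two cases of an assumption. -/
noncomputable def progAdv (B : BilinearGroup) (X : (B : BilinearGroup) → Bool → PMF (State B))
    (P : List Instr) : ℝ :=
  |probZero (X B false) P - probZero (X B true) P|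

theorem inv_order_pos (B : BilinearGroup) : (0 : ℝ) < 1 / B.p :=
  one_div_pos.mpr (Nat.cast_pos.mpr B.prime.out.pos)

theorem inv_order_le (B : BilinearGroup) : 1 / (B.p : ℝ) ≤ 1 / 2 :=
  one_div_le_one_div_of_le two_pos (by exact_mod_cast B.prime.out.two_le)

theorem hybrid_zero_zero {p : ℕ} : (hybrid 0 0 : KeySpec l p) = fun _ => 0 := by
  funext ω n I x
  simp [hybrid]

theorem hybrid_zero {p : ℕ} (k : ℕ) : (hybrid k 0 : KeySpec l p) =
    fun _ n _ x => if n < k then semiKey x else 0 := by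
  funext ω n I x
  unfold hybrid
  split_ifs <;> rfl

theorem meanValue_correlated (k : ℕ) : meanValue (l := l) yw (hybrid k 0) ctCorrelated q A =
    meanValue (l := l) yw (hybrid k 0) ctSemi q A := by
  rw [hybrid_zero]
  exact Finset.expect_congr rfl fun _ _ => Finset.expect_congr rfl fun _ _ =>
    gameValue_correlated fun n _ x => if n < k then semiKey x else 0

theorem abs_meanValue_uniform_sub_le (k : ℕ) :
    |meanValue (l := l) yw (hybrid k 0) ctSemi q A -
      meanValue (l := l) yw (hybrid k 0) ctUniform q A| ≤ 1 / B.p := by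
  rw [hybrid_zero]
  simp only [meanValue, ← Finset.expect_sub_distrib]
  exact (abs_expect_le _).trans (expect_le_of_le fun g => (abs_expect_le _).trans
    (expect_le_of_le fun ĝ =>
      abs_gameValue_uniform_sub_le fun n _ x => if n < k then semiKey x else 0))

/-- The summand `(1 - 1/p) * (1/p)` comes from the instances with b = 0. It will pay for the hop
from `ctSemi` to `ctUniform`. -/
theorem exists_pol_lw1 (yw : ZMod B.p) (q : ℕ) (A : List AdvInstr) :
    ∃ pol, progAdv B LW1 ((lw1Red (l := l) yw).prog B.encLen q 0 pol A) =
      (1 - 1 / B.p) * (1 / B.p) + (1 - 1 / B.p) * |meanValue (l := l) yw (fun _ => 0) ctNormal q A -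
        meanValue (l := l) yw (hybrid 0 0) ctSemi q A| := by
  rw [← meanValue_correlated, hybrid_zero_zero]
  obtain ⟨pol, hpol⟩ := exists_polarize_sub (meanValue (l := l) yw (fun _ => 0) ctNormal q A)
    (meanValue (l := l) yw (fun _ => 0) ctCorrelated q A)
  refine ⟨pol, ?_⟩
  have h1 := inv_order_pos B
  have h2 := inv_order_le B
  have h3 := abs_nonneg (meanValue (l := l) yw (fun _ => 0) ctNormal q A -
    meanValue (l := l) yw (fun _ => 0) ctCorrelated q A)
  rw [← hpol] at h3 ⊢
  rw [progAdv, probZero_lw1Red (Nat.zero_le _), probZero_lw1Red (Nat.zero_le _)]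
  simp only [Bool.false_eq_true, if_false, if_true]
  rw [abs_of_nonneg]
  · ring
  · nlinarith

theorem exists_pol_lw2 (yw : ZMod B.p) (hk : k ≤ q) (A : List AdvInstr) :
    ∃ pol, progAdv B LW2 ((lw2Red (l := l) yw).prog B.encLen q k pol A) =
      (1 - 1 / B.p) * |meanValue (l := l) yw (hybrid k 0) ctSemi q A -
        meanValue (l := l) yw (hybrid k nominalPart) ctSemi q A| := by
  obtain ⟨pol, hpol⟩ := exists_polarize_sub (meanValue (l := l) yw (hybrid k 0) ctSemi q A)
    (meanValue (l := l) yw (hybrid k nominalPart) ctSemi q A)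
  refine ⟨pol, ?_⟩
  have h2 := inv_order_le B
  have h4 : meanValue (l := l) yw (hybrid k correlatedPart) ctCorrelated q A =
      meanValue (l := l) yw (hybrid k nominalPart) ctSemi q A :=
    Finset.expect_congr rfl fun _ _ => Finset.expect_congr rfl fun _ _ =>
      gameValue_hybrid_correlated
  rw [progAdv, probZero_lw2Red hk, probZero_lw2Red hk]
  simp only [Bool.false_eq_true, if_false, if_true, meanValue_correlated, h4]
  rw [← mul_sub, hpol, abs_mul, abs_abs, abs_of_nonneg (by linarith)]

theorem exists_pol_sxdh (yw : ZMod B.p) (hk : k ≤ q) (A : List AdvInstr) :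
    ∃ pol, (1 - 1 / B.p) * |meanValue (l := l) yw (hybrid k nominalPart) ctSemi q A -
        meanValue (l := l) yw (hybrid (k + 1) 0) ctSemi q A| ≤
      progAdv B SXDH ((sxdhRed (l := l) yw).prog B.encLen q k pol A) := by
  set x := meanValue (l := l) yw (hybrid k nominalPart) ctSemi q A with hx
  set y := 𝔼 g : B.Generator .left, 𝔼 ĝ : B.Generator .right,
    sxdhValue (B := B) l yw k q A true g.1 ĝ.1 with hy
  obtain ⟨pol, hpol⟩ := exists_polarize_sub x y
  refine ⟨pol, ?_⟩
  have h1 := inv_order_pos B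
  have h2 := inv_order_le B
  have h3 : |y - meanValue (l := l) yw (hybrid (k + 1) 0) ctSemi q A| ≤ 1 / B.p := by
    rw [hy, meanValue]
    simp only [← Finset.expect_sub_distrib, ← gameValue_hybrid_random]
    exact (abs_expect_le _).trans (expect_le_of_le fun g => (abs_expect_le _).trans
      (expect_le_of_le fun ĝ => abs_sxdhValue_true_sub_le _ _))
  have h4 : 𝔼 g : B.Generator .left, 𝔼 ĝ : B.Generator .right,
      sxdhValue (B := B) l yw k q A false g.1 ĝ.1 = x :=
    Finset.expect_congr rfl fun _ _ => Finset.expect_congr rfl fun _ _ => sxdhValue_false _ _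
  have h5 := abs_sub_le x y (meanValue (l := l) yw (hybrid (k + 1) 0) ctSemi q A)
  rw [progAdv, probZero_sxdhRed hk, probZero_sxdhRed hk]
  simp only [if_true, h4, ← hy]
  refine le_trans ?_ (le_abs_self _)
  simp only [Bool.false_eq_true, if_false]
  have h6 := abs_nonneg (x - y)
  rw [← hpol] at h5 h6
  -- The distance from `y` to the next hybrid, at most 1/p, is weighted with 1 - 1/p and so is
  -- covered exactly by the gain `(1/p) * (1 - 1/p)` from a = 0.
  nlinarith

theorem exists_pol_dbdh (yw : ZMod B.p) (q : ℕ) (A : List AdvInstr) :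
    ∃ pol, (1 - (1 - 1 / (B.p : ℝ)) ^ 3) * (1 - 1 / B.p) + (1 - 1 / (B.p : ℝ)) ^ 3 *
        |meanValue (l := l) yw (hybrid q 0) ctUniform q A -
          meanValue (l := l) yw (hybrid q 0) ctHidden q A| ≤
      progAdv B DBDH ((dbdhRed (l := l) yw).prog B.encLen q q pol A) := by
  obtain ⟨pol, hpol⟩ := exists_polarize_sub (meanValue (l := l) yw (hybrid q 0) ctUniform q A)
    (meanValue (l := l) yw (hybrid q 0) ctHidden q A)
  refine ⟨pol, ?_⟩
  rw [progAdv, probZero_dbdhRed, probZero_dbdhRed, ← hpol]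
  refine le_trans (le_of_eq ?_) (le_abs_self _)
  simp only [Bool.false_eq_true, if_false, if_true]
  ring

theorem exists_pol_a3dh (yw : ZMod B.p) (q : ℕ) (A : List AdvInstr) :
    ∃ pol, |meanValue (l := l) yw (hybrid q 0) ctHidden q A - 1 / 2| ≤
      progAdv B A3DH ((a3dhRed (l := l) yw).prog B.encLen q q pol A) := by
  refine ⟨true, ?_⟩
  have h : meanValue (l := l) yw (hybrid q 0) ctRandom q A = 1 / 2 := by
    rw [hybrid_zero]
    exact meanValue_random _
  rw [progAdv, probZero_a3dhRed, probZero_a3dhRed]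
  simp [polarize, h]

/-! ### From the experiment to random generators -/

/-- A uniform element is a uniform power of a generator: trivial for exponent 0, and otherwise a
uniform generator. -/
theorem expect_el (k : GrpIdx) (f : B.El k → ℝ) :
    𝔼 g, f g = (1 / B.p) * f 1 + (1 - 1 / B.p) * 𝔼 g : B.Generator k, f g.1 := by
  have h1 : ∀ g : B.Generator k, 𝔼 x, f x = 𝔼 a : ZMod B.p, f (g.1 ^ a) := fun g =>
    (Fintype.expect_bijective (fun a : ZMod B.p => g.1 ^ a)
      ⟨el_pow_injective g.2, fun y => (el_pow_surjective g.2 y).imp fun _ h => h.symm⟩ _ _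
      fun _ => rfl).symm
  rw [← Fintype.expect_const (ι := B.Generator k) (𝔼 x, f x),
    Finset.expect_congr rfl fun g _ => h1 g, expect_swap, ← expect_ite_eq_zero]
  refine Finset.expect_congr rfl fun a _ => ?_
  split_ifs with ha
  · simp [ha, el_pow_zero]
  · exact expect_generator_pow ha f

theorem abs_expect_el_le {k : GrpIdx} {f : B.El k → ℝ} {c : ℝ} (h : |f 1| ≤ c) :
    |𝔼 g, f g| ≤ (1 / B.p) * c + (1 - 1 / B.p) * |𝔼 g : B.Generator k, f g.1| := by
  have h1 := inv_order_pos B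
  have h2 := inv_order_le B
  rw [expect_el]
  refine (abs_add_le _ _).trans (add_le_add ?_ ?_)
  · rw [abs_mul, abs_of_pos h1]
    exact mul_le_mul_of_nonneg_left h h1.le
  · rw [abs_mul, abs_of_nonneg (by linarith)]

theorem abs_expect_expect_le {X : Type} [Fintype X] [Nonempty X] {f : X → ℝ} {c : ℝ}
    (h : ∀ x, |f x| ≤ c) : |𝔼 x, f x| ≤ c :=
  (abs_expect_le f).trans (expect_le_of_le h)

/-- The games need generators g, ĝ and a nonzero exponent of ŵ, which the setup picks with
probability `(1 - 1/p)^3`. In the remaining cases the bias is at most 1/2. -/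
theorem exists_yw (q : ℕ) (A : List AdvInstr) : ∃ yw : ZMod B.p,
    |(setupE B l fun mk pp => (realChallenger mk pp).value q A) - 1 / 2| ≤
      (1 - (1 - 1 / (B.p : ℝ)) ^ 3) / 2 + (1 - 1 / (B.p : ℝ)) ^ 3 *
        |meanValue (l := l) yw (fun _ => 0) ctNormal q A - 1 / 2| := by
  have h1 := inv_order_pos B
  have h2 := inv_order_le B
  set F : B.G → B.Ghat → ZMod B.p → ℝ := fun g ĝ yw =>
    (𝔼 ω : SetupVar l → ZMod B.p, (realChal g ĝ yw ω).value q A) - 1 / 2 with hF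
  have hF1 : ∀ g ĝ yw, |F g ĝ yw| ≤ 1 / 2 := by
    intro g ĝ yw
    have := expect_mem_unit fun ω : SetupVar l → ZMod B.p =>
      (realChal g ĝ yw ω).value_mem_unit q A
    rw [abs_le]
    constructor <;> simp only [hF] <;> linarith [this.1, this.2]
  set M : ZMod B.p → ℝ := fun yw => 𝔼 g : B.Generator .left, 𝔼 ĝ : B.Generator .right,
    F g.1 ĝ.1 yw with hM
  have hM1 : ∀ yw, yw ≠ 0 → M yw = meanValue (l := l) yw (fun _ => 0) ctNormal q A - 1 / 2 := by
    intro yw hyw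
    simp only [hM, hF, expect_value_realChal hyw, Finset.expect_sub_distrib, Fintype.expect_const]
    rfl
  -- The nonzero exponent with the largest bias is fixed, because the reductions may contain it as a
  -- constant.
  obtain ⟨yw, hyw, hmax⟩ := Finset.exists_max_image (univ.filter fun y : ZMod B.p => y ≠ 0)
    (fun y => |M y|) ⟨1, by simp⟩
  simp only [mem_filter, mem_univ, true_and] at hyw hmax
  refine ⟨yw, ?_⟩
  rw [← hM1 yw hyw, setupE_realChallenger]
  have e1 : (𝔼 g : B.G, 𝔼 ĝ : B.Ghat, 𝔼 yw, 𝔼 ω : SetupVar l → ZMod B.p,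
      (realChal g ĝ yw ω).value q A) - 1 / 2 = 𝔼 g : B.G, 𝔼 ĝ : B.Ghat, 𝔼 yw, F g ĝ yw := by
    simp only [hF, Finset.expect_sub_distrib, Fintype.expect_const]
  have e2 : |𝔼 yw, M yw| ≤ (1 / B.p) * (1 / 2) + (1 - 1 / B.p) * |M yw| := by
    rw [← expect_ite_eq_zero]
    refine (abs_expect_le _).trans (expect_mono_real fun y => ?_)
    split_ifs with hy
    · exact abs_expect_expect_le fun g => abs_expect_expect_le fun ĝ => hF1 _ _ _
    · exact hmax y hy
  have e3 : |𝔼 g : B.Generator .left, 𝔼 ĝ : B.Ghat, 𝔼 yw, F g.1 ĝ yw| ≤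
      (1 / B.p) * (1 / 2) + (1 - 1 / B.p) * |𝔼 yw, M yw| := by
    rw [expect_swap]
    refine (abs_expect_el_le (k := .right) (c := 1 / 2)
      (abs_expect_expect_le fun g => abs_expect_expect_le fun yw => hF1 _ _ _)).trans_eq ?_
    congr 3
    rw [Finset.expect_congr rfl fun ĝ _ => expect_swap _, expect_swap]
    exact Finset.expect_congr rfl fun yw _ => expect_swap _
  have e4 := abs_expect_el_le (k := .left) (B := B) (f := fun g => 𝔼 ĝ : B.Ghat, 𝔼 yw, F g ĝ yw)
    (c := 1 / 2) (abs_expect_expect_le fun g => abs_expect_expect_le fun yw => hF1 _ _ _)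
  rw [e1]
  set v : ℝ := 1 - 1 / B.p with hv
  have hr : 1 / (B.p : ℝ) = 1 - v := by rw [hv]; ring
  rw [hr] at e2 e3 e4
  have hv0 : 0 ≤ v := by rw [hv]; linarith
  have e5 := mul_le_mul_of_nonneg_left (e3.trans (add_le_add_right
    (mul_le_mul_of_nonneg_left e2 hv0) _)) hv0
  refine (e4.trans (add_le_add_right e5 _)).trans_eq ?_
  ring

/-- The bound for a single value of the security parameter. -/
theorem exists_reductions (A : List AdvInstr) (hqA : q ≤ A.length)
    (hq : ∀ x ∈ (experiment B l A).support, x.2.queried.length ≤ q) :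
    ∃ (yw : ZMod B.p) (k₂ k₃ : ℕ) (pol₁ pol₂ pol₃ pol₄ pol₅ : Bool),
      |(((experiment B l A).map fun x => decide (x.1 = x.2.regs.bit 0)) true).toReal - 1 / 2| ≤
        progAdv B LW1 ((lw1Red (l := l) yw).prog B.encLen q 0 pol₁ A)
          + q * (progAdv B LW2 ((lw2Red (l := l) yw).prog B.encLen q k₂ pol₂ A)
            + progAdv B SXDH ((sxdhRed (l := l) yw).prog B.encLen q k₃ pol₃ A))
          + progAdv B DBDH ((dbdhRed (l := l) yw).prog B.encLen q q pol₄ A)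
          + progAdv B A3DH ((a3dhRed (l := l) yw).prog B.encLen q q pol₅ A) := by
  rw [experiment_win_eq A q hqA hq]
  obtain ⟨yw, hyw⟩ := exists_yw (B := B) (l := l) q A
  set N := meanValue (l := l) yw (fun _ => 0) ctNormal q A
  set S : ℕ → ℝ := fun k => meanValue (l := l) yw (hybrid k 0) ctSemi q A with hS
  set H : ℕ → ℝ := fun k => meanValue (l := l) yw (hybrid k nominalPart) ctSemi q A with hH
  set U := meanValue (l := l) yw (hybrid q 0) ctUniform q A
  set V := meanValue (l := l) yw (hybrid q 0) ctHidden q A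
  -- The best index is fixed, where a uniform reduction would guess one. It is sought among `q + 1`
  -- indices so that it exists for `q = 0` as well.
  have hmax : ∀ f : ℕ → ℝ, ∃ k ≤ q, ∑ i ∈ range q, f i ≤ q * f k := by
    intro f
    obtain ⟨k, hk, hf⟩ := Finset.exists_max_image (range (q + 1)) f ⟨0, by simp⟩
    refine ⟨k, Nat.lt_succ_iff.mp (mem_range.mp hk), ?_⟩
    refine (Finset.sum_le_card_nsmul _ _ (f k) fun i hi => hf i ?_).trans_eq (by simp)
    exact mem_range.mpr ((mem_range.mp hi).trans (Nat.lt_succ_self q))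
  obtain ⟨k₂, hk₂, h₂⟩ := hmax fun k => |S k - H k|
  obtain ⟨k₃, hk₃, h₃⟩ := hmax fun k => |H k - S (k + 1)|
  obtain ⟨pol₁, hp₁⟩ := exists_pol_lw1 (l := l) yw q A
  obtain ⟨pol₂, hp₂⟩ := exists_pol_lw2 (l := l) yw hk₂ A
  obtain ⟨pol₃, hp₃⟩ := exists_pol_sxdh (l := l) yw hk₃ A
  obtain ⟨pol₄, hp₄⟩ := exists_pol_dbdh (l := l) yw q A
  obtain ⟨pol₅, hp₅⟩ := exists_pol_a3dh (l := l) yw q A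
  refine ⟨yw, k₂, k₃, pol₁, pol₂, pol₃, pol₄, pol₅, hyw.trans ?_⟩
  have hu : |S q - U| ≤ 1 / B.p := abs_meanValue_uniform_sub_le q
  have hsum : |S 0 - S q| ≤ ∑ i ∈ range q, |S i - H i| + ∑ i ∈ range q, |H i - S (i + 1)| := by
    rw [← Finset.sum_add_distrib, abs_sub_comm, ← Finset.sum_range_sub S q]
    refine (Finset.abs_sum_le_sum_abs _ _).trans (Finset.sum_le_sum fun i _ => ?_)
    rw [abs_sub_comm]
    exact abs_sub_le _ _ _
  have hN : |N - 1 / 2| ≤ |N - S 0| + |S 0 - S q| + |S q - U| + |U - V| + |V - 1 / 2| := by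
    have t1 := abs_sub_le N (S 0) (1 / 2)
    have t2 := abs_sub_le (S 0) (S q) (1 / 2)
    have t3 := abs_sub_le (S q) U (1 / 2)
    have t4 := abs_sub_le U V (1 / 2)
    linarith
  have h1 := inv_order_pos B
  have h2 := inv_order_le B
  set v : ℝ := 1 - 1 / B.p with hv
  have hr : 1 / (B.p : ℝ) = 1 - v := by rw [hv]; ring
  rw [hr] at hu h1 h2 hp₁
  have hv0 : 0 ≤ v := by linarith
  have hw0 : 0 ≤ v ^ 3 := by positivity
  have hwv : v ^ 3 ≤ v := by
    have : v ^ 2 ≤ 1 := by nlinarith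
    nlinarith
  have hw1 : v ^ 3 ≤ 1 := by linarith
  have hq0 : (0 : ℝ) ≤ q := Nat.cast_nonneg q
  change progAdv B LW1 _ = v * (1 - v) + v * |N - S 0| at hp₁
  change progAdv B LW2 _ = v * |S k₂ - H k₂| at hp₂
  change v * |H k₃ - S (k₃ + 1)| ≤ _ at hp₃
  have m1 : v ^ 3 * |N - S 0| ≤ v * |N - S 0| := mul_le_mul_of_nonneg_right hwv (abs_nonneg _)
  have m2 : v ^ 3 * |S 0 - S q| ≤ q * (v * |S k₂ - H k₂| + v * |H k₃ - S (k₃ + 1)|) :=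
    calc v ^ 3 * |S 0 - S q| ≤ v * (q * |S k₂ - H k₂| + q * |H k₃ - S (k₃ + 1)|) :=
          mul_le_mul hwv (hsum.trans (add_le_add h₂ h₃)) (abs_nonneg _) hv0
      _ = _ := by ring
  -- The statistical error 1/p is paid by the surplus of the reduction to LW1.
  have m3 : v ^ 3 * |S q - U| ≤ v * (1 - v) := mul_le_mul hwv hu (abs_nonneg _) hv0
  have m4 : v ^ 3 * |V - 1 / 2| ≤ |V - 1 / 2| := mul_le_of_le_one_left (abs_nonneg _) hw1
  -- The degenerate setups are paid by the surplus of the reduction to DBDH; this uses `v ≥ 1/2`,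
  -- that is `p ≥ 2`.
  have m5 : (1 - v ^ 3) / 2 ≤ (1 - v ^ 3) * v := by nlinarith
  have m6 := mul_le_mul_of_nonneg_left hN hw0
  have m7 := mul_le_mul_of_nonneg_left (add_le_add hp₂.ge hp₃) hq0
  linarith

end Hops

end AHIBE

/-! ### Families of reductions and negligible functions -/

namespace AHIBE

theorem exists_adversaries (Γ : BilinearGroupFamily) {l : ℕ → ℕ} (hl : PolyBounded l)
    {𝓐 : ℕ → List AdvInstr} (hA : IsPPTAdversary 𝓐) {q : ℕ → ℕ} (hq : QueryBound Γ l 𝓐 q) :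
    ∃ 𝓑₁ 𝓑₂ 𝓑₃ 𝓑₄ 𝓑₅ : ℕ → List Instr,
      IsPPT 𝓑₁ ∧ IsPPT 𝓑₂ ∧ IsPPT 𝓑₃ ∧ IsPPT 𝓑₄ ∧ IsPPT 𝓑₅ ∧
      ∀ n : ℕ, schemeAdv Γ l 𝓐 n ≤ assumptionAdv Γ LW1 𝓑₁ n
        + q n * (assumptionAdv Γ LW2 𝓑₂ n + assumptionAdv Γ SXDH 𝓑₃ n)
        + assumptionAdv Γ DBDH 𝓑₄ n + assumptionAdv Γ A3DH 𝓑₅ n := by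
  -- The given `q` may grow arbitrarily fast, but the programs contain about `q` counters. Capping
  -- it by the length of the adversary keeps them polynomial and still bounds the number of keys.
  have hqA : ∀ n, min (q n) (𝓐 n).length ≤ (𝓐 n).length := fun n => min_le_right _ _
  choose yw k₂ k₃ pol₁ pol₂ pol₃ pol₄ pol₅ h using fun n =>
    exists_reductions (B := Γ.grp n) (l := l n) (𝓐 n) (hqA n) fun x hx =>
      le_min (hq n x hx) (experiment_queried_le_length _ x hx)
  refine ⟨_, _, _, _, _, isPPT_prog Γ hl hA (fun n => lw1Red (yw n)) 200 (fun n => lw1_size _) _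
      (fun _ => 0) pol₁ hqA,
    isPPT_prog Γ hl hA (fun n => lw2Red (yw n)) 200 (fun n => lw2_size _) _ k₂ pol₂ hqA,
    isPPT_prog Γ hl hA (fun n => sxdhRed (yw n)) 200 (fun n => sxdh_size _) _ k₃ pol₃ hqA,
    isPPT_prog Γ hl hA (fun n => dbdhRed (yw n)) 200 (fun n => dbdh_size _) _
      (fun n => min (q n) (𝓐 n).length) pol₄ hqA,
    isPPT_prog Γ hl hA (fun n => a3dhRed (yw n)) 200 (fun n => a3dh_size _) _
      (fun n => min (q n) (𝓐 n).length) pol₅ hqA, fun n => (h n).trans ?_⟩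
  have h1 : ((min (q n) (𝓐 n).length : ℕ) : ℝ) ≤ q n := Nat.cast_le.mpr (min_le_left _ _)
  have h2 := add_nonneg
    (abs_nonneg (probZero (LW2 (Γ.grp n) false) ((lw2Red (l := l n) (yw n)).prog (Γ.grp n).encLen
      (min (q n) (𝓐 n).length) (k₂ n) (pol₂ n) (𝓐 n)) - probZero (LW2 (Γ.grp n) true)
      ((lw2Red (l := l n) (yw n)).prog (Γ.grp n).encLen (min (q n) (𝓐 n).length) (k₂ n) (pol₂ n)
      (𝓐 n))))
    (abs_nonneg (probZero (SXDH (Γ.grp n) false) ((sxdhRed (l := l n) (yw n)).prog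
      (Γ.grp n).encLen (min (q n) (𝓐 n).length) (k₃ n) (pol₃ n) (𝓐 n)) - probZero
      (SXDH (Γ.grp n) true) ((sxdhRed (l := l n) (yw n)).prog (Γ.grp n).encLen
      (min (q n) (𝓐 n).length) (k₃ n) (pol₃ n) (𝓐 n))))
  have h3 := mul_le_mul_of_nonneg_right h1 h2
  unfold progAdv assumptionAdv
  linarith

theorem Negligible.add {f g : ℕ → ℝ} (hf : Negligible f) (hg : Negligible g) :
    Negligible fun n => f n + g n :=
  Asymptotics.SuperpolynomialDecay.add hf hg

theorem Negligible.polyBounded_mul {f : ℕ → ℝ} (hf : Negligible f) {q : ℕ → ℕ}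
    (hq : PolyBounded q) : Negligible fun n => q n * f n := by
  obtain ⟨P, hP⟩ := hq
  refine Asymptotics.SuperpolynomialDecay.trans_abs_le
    (Asymptotics.SuperpolynomialDecay.polynomial_mul hf (P.map (Nat.castRingHom ℝ))) fun n => ?_
  rw [abs_mul, abs_mul, Polynomial.eval_natCast_map, Nat.abs_cast]
  refine mul_le_mul_of_nonneg_right ?_ (abs_nonneg _)
  simpa using hP n

end AHIBE

theorem theorem1 (Γ : AHIBE.BilinearGroupFamily) (l : ℕ → ℕ) (hl : AHIBE.PolyBounded l) :
    (∀ 𝓐 : ℕ → List AHIBE.AdvInstr, AHIBE.IsPPTAdversary 𝓐 →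
      ∀ q : ℕ → ℕ, AHIBE.QueryBound Γ l 𝓐 q →
        ∃ 𝓑₁ 𝓑₂ 𝓑₃ 𝓑₄ 𝓑₅ : ℕ → List AHIBE.Instr,
          AHIBE.IsPPT 𝓑₁ ∧ AHIBE.IsPPT 𝓑₂ ∧ AHIBE.IsPPT 𝓑₃ ∧ AHIBE.IsPPT 𝓑₄ ∧
            AHIBE.IsPPT 𝓑₅ ∧
          ∀ n : ℕ, AHIBE.schemeAdv Γ l 𝓐 n ≤
            AHIBE.assumptionAdv Γ AHIBE.LW1 𝓑₁ n
              + q n * (AHIBE.assumptionAdv Γ AHIBE.LW2 𝓑₂ n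
                + AHIBE.assumptionAdv Γ AHIBE.SXDH 𝓑₃ n)
              + AHIBE.assumptionAdv Γ AHIBE.DBDH 𝓑₄ n
              + AHIBE.assumptionAdv Γ AHIBE.A3DH 𝓑₅ n) ∧
    (AHIBE.Holds Γ AHIBE.LW1 → AHIBE.Holds Γ AHIBE.LW2 → AHIBE.Holds Γ AHIBE.SXDH →
      AHIBE.Holds Γ AHIBE.DBDH → AHIBE.Holds Γ AHIBE.A3DH → AHIBE.FullySecure Γ l) := by
  have key := fun (𝓐 : ℕ → List AHIBE.AdvInstr) (hA : AHIBE.IsPPTAdversary 𝓐) (q : ℕ → ℕ)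
    (hq : AHIBE.QueryBound Γ l 𝓐 q) => AHIBE.exists_adversaries Γ hl hA hq
  refine ⟨key, fun h₁ h₂ h₃ h₄ h₅ 𝓐 hA => ?_⟩
  -- The number of instructions is a polynomial query bound that every PPT adversary has.
  obtain ⟨𝓑₁, 𝓑₂, 𝓑₃, 𝓑₄, 𝓑₅, p₁, p₂, p₃, p₄, p₅, h⟩ := key 𝓐 hA (fun n => (𝓐 n).length)
    fun n => AHIBE.experiment_queried_le_length (𝓐 n)
  have hlen : AHIBE.PolyBounded fun n => (𝓐 n).length :=
    AHIBE.PolyBounded.mono hA fun n => AHIBE.length_le_cost _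
  refine Asymptotics.SuperpolynomialDecay.trans_abs_le ((((h₁ 𝓑₁ p₁).add
    (((h₂ 𝓑₂ p₂).add (h₃ 𝓑₃ p₃)).polyBounded_mul hlen)).add (h₄ 𝓑₄ p₄)).add (h₅ 𝓑₅ p₅))
    fun n => ?_
  refine le_trans ?_ ((h n).trans (le_abs_self _))
  rw [AHIBE.schemeAdv, abs_abs]
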